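/- Let $G$ be a finite group. The quantum double $\mathsf{D}(G)$ is the algebra with basis $gh^*$ ($g,h\in G$), unit $\sum_h e h^*$ and product $(g_1h_1^*)(g_2h_2^*)=\delta_{g_2^{-1}h_1g_2,\,h_2}\,g_1g_2h_2^*$; it is a Hilbert space in which the $gh^*=|g,h^*\rangle$ are orthonormal. Let $Z(h)$ be the centralizer of $h$ and $\widehat{Z(h)}$ the set of isomorphism classes of its irreducible complex representations. A *Fourier basis* of $\mathbb{C}[H]$ is an orthonormal basis $b_{\rho,i,j}$ ($\rho\in\widehat H$, $1\le i,j\le d_\rho=\dim\rho$) such that for all $\rho,j$ the span of $\{b_{\rho,i,j}\}_i$ is a subrepresentation of the left regular representation isomorphic to $\rho$; the Fourier transform (QFT) of $H$ for this basis takes $\sum c_{\rho ij}b_{\rho,i,j}$ to $\sum c_{\rho ij}|\rho,i,j\rangle$. Given transversals $T_h$ (one element from each left coset of $Z(h)$ in $G$) and Fourier bases $b^{(h)}$ of $\mathbb{C}[Z(h)]$, $h\in G$, put $|h^*,\rho,j,t,i\rangle=\sum_{z\in Z(h)}b^{(h)}_{\rho,i,j}(z)\,|tz,h^*\rangle$ for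 $t\in T_h$, and let $V_{h,\rho,j}$ be the span of these vectors over all $t,i$. The QFT over $\mathsf{D}(G)$ is the transformation from the basis $|g,h^*\rangle$ to the basis $|h^*,\rho,j,t,i\rangle$. **1. Decomposition.** For every finite group $G$, every $\mathbb{C}[Z(h)]$ has a Fourier basis. For every choice of transversals and Fourier bases, the vectors $|h^*,\rho,j,t,i\rangle$ form an orthonormal basis of $\mathsf{D}(G)$, the decomposition $$\mathsf{D}(G)=\bigoplus_{h\in G}\ \bigoplus_{\rho\in\widehat{Z(h)}}\ \bigoplus_{j=1}^{d_\rho}V_{h,\rho,j}$$ is orthogonal, and each $V_{h,\rho,j}$ is an irreducible subspace of the left regular representation of $\mathsf{D}(G)$, isomorphic to $\mathrm{Ind}_{Z(h)}^G\rho=\mathbb{C}[G]\otimes_{\mathbb{C}[Z(h)]}\rho$ with the action $gh'^*\,(x\otimes w)=\delta_{x^{-1}h'x,\,h}\;gx\otimes w$. **2. Efficient Fourier transforms.** Let $(G_x)_{x\in\iota}$ be a family of finite groups. Suppose that each $G_x$ has a name (a bit string) and that its elements are encoded by distinct bit strings of a common length $\ell_x$, where the names and the encodings have length at most $\operatorname{polylog}|G_x|$.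 Fix for all $x$ and $h\in G_x$ a transversal $T_h$ of $Z(h)$, a Fourier basis of $\mathbb{C}[Z(h)]$, and injective encodings of its labels $\rho,i,j$ by $\ell_x$ bits each. "Efficiently" means: a classical program (a multi-stack machine with step count, one and the same for the whole family) computes from the given data and a precision parameter $k$ (in unary), in time polynomial in $\log|G_x|$ and $k$, the description of a quantum circuit over NOT, CNOT, Toffoli, Hadamard and $T=\mathrm{diag}(1,e^{i\pi/4})$ that carries out the transformation to within $2^{-k}$ in operator norm, with work qubits that start and end in $|0\rangle$. (Throughout, one may instead ask for exact circuits.) Then: (a) *Sufficiency.* Suppose that products in $G_x$ can be computed in time $\operatorname{polylog}|G_x|$, that given $h$ one can efficiently carry out the QFT over $Z(h)$, and that given $h$ and $g$ one can in time $\operatorname{polylog}|G_x|$ write $g=tz$ with $t\in T_h$, $z\in Z(h)$. Then, given the name of $G_x$ and $\ell_x$ in unary, one can efficiently carry out the QFT over $\mathsf{D}(G_x)$, with respect to the same transversals, Fourier bases and encodings. (b) *Necessity.* If, given the name of $G_x$ and $\ell_x$ in unary, one can efficiently carry out the QFT over $\mathsf{D}(G_x)$, then, given $h$, one can efficiently carry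 out the QFT over $Z(h)$, with respect to Fourier bases of the $\mathbb{C}[Z(h)]$ which are the given ones for all $h$ with $1\in T_h$. -/

import Mathlib

set_option linter.unusedSectionVars false

universe u v

/-! ## The quantum double of a finite group -/

section QuantumDouble

/-- The underlying Hilbert space of the quantum double `D(G)`: it has the orthonormal basis
`g h^*`, `g, h ∈ G`; the coordinate of `a` at `g h^*` is `a (g, h)`. -/
def QuantumDouble (G : Type u) : Type u := EuclideanSpace ℂ (G × G)

namespace QuantumDouble

variable {G : Type u}

noncomputable instance [Fintype G] : NormedAddCommGroup (QuantumDouble G) :=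
  inferInstanceAs (NormedAddCommGroup (EuclideanSpace ℂ (G × G)))

noncomputable instance [Fintype G] : InnerProductSpace ℂ (QuantumDouble G) :=
  inferInstanceAs (InnerProductSpace ℂ (EuclideanSpace ℂ (G × G)))

instance : CoeFun (QuantumDouble G) (fun _ => G × G → ℂ) := ⟨fun a => WithLp.ofLp a⟩

/-- The element of `D(G)` with given coordinates. -/
def mk (f : G × G → ℂ) : QuantumDouble G := WithLp.toLp 2 f

@[simp] theorem mk_apply (f : G × G → ℂ) (p : G × G) : (mk f) p = f p := rfl

theorem ext' {a b : QuantumDouble G} (h : ∀ p, a p = b p) : a = b :=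
  WithLp.ofLp_injective 2 (funext h)

open scoped Classical in
/-- The basis element `g h^*` of `D(G)`. -/
noncomputable def ket (g h : G) : QuantumDouble G := mk fun p => if p = (g, h) then 1 else 0

variable [Group G] [Fintype G]

@[simp] theorem add_apply (a b : QuantumDouble G) (p : G × G) : (a + b) p = a p + b p := rfl
@[simp] theorem zero_apply (p : G × G) : (0 : QuantumDouble G) p = 0 := rfl
@[simp] theorem smul_apply (c : ℂ) (a : QuantumDouble G) (p : G × G) : (c • a) p = c * a p := rfl

/-- The bilinear extension of `(g₁ h₁^*) (g₂ h₂^*) = δ_{g₂⁻¹ h₁ g₂, h₂} g₁ g₂ h₂^*`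
(see `QuantumDouble.ket_mul_ket`). -/
noncomputable instance : Mul (QuantumDouble G) :=
  ⟨fun a b => mk fun p => ∑ k : G, a (p.1 * k⁻¹, k * p.2 * k⁻¹) * b (k, p.2)⟩

open scoped Classical in
/-- The unit `∑ h, e h^*`. -/
noncomputable instance : One (QuantumDouble G) := ⟨mk fun p => if p.1 = 1 then 1 else 0⟩

theorem mul_apply (a b : QuantumDouble G) (p : G × G) :
    (a * b) p = ∑ k : G, a (p.1 * k⁻¹, k * p.2 * k⁻¹) * b (k, p.2) := rfl

open scoped Classical in
theorem one_apply (p : G × G) : (1 : QuantumDouble G) p = if p.1 = 1 then 1 else 0 := rfl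

noncomputable instance : Ring (QuantumDouble G) :=
  { (inferInstance : AddCommGroup (QuantumDouble G)), (inferInstance : Mul (QuantumDouble G)),
    (inferInstance : One (QuantumDouble G)) with
    left_distrib := fun a b c => ext' fun p => by
      simp [mul_apply, mul_add, Finset.sum_add_distrib]
    right_distrib := fun a b c => ext' fun p => by
      simp [mul_apply, add_mul, Finset.sum_add_distrib]
    zero_mul := fun a => ext' fun p => by simp [mul_apply]
    mul_zero := fun a => ext' fun p => by simp [mul_apply]
    one_mul := fun a => ext' fun p => by
      classical
      simp [mul_apply, one_apply, mul_inv_eq_one]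
    mul_one := fun a => ext' fun p => by
      classical
      simp [mul_apply, one_apply]
    mul_assoc := fun a b c => ext' fun p => by
      simp only [mul_apply, Finset.sum_mul, Finset.mul_sum]
      conv_rhs => rw [Finset.sum_comm]
      refine Finset.sum_congr rfl fun k _ => ?_
      refine (Fintype.sum_equiv (Equiv.mulRight k⁻¹) _ _ fun l => ?_).symm
      simp [mul_assoc] }

noncomputable instance : Algebra ℂ (QuantumDouble G) :=
  Algebra.ofModule
    (fun c a b => ext' fun p => by simp [mul_apply, Finset.mul_sum, mul_assoc])
    (fun c a b => ext' fun p => by simp [mul_apply, Finset.mul_sum, mul_left_comm])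

open scoped Classical in
theorem ket_mul_ket (g₁ h₁ g₂ h₂ : G) :
    ket g₁ h₁ * ket g₂ h₂ = if g₂⁻¹ * h₁ * g₂ = h₂ then ket (g₁ * g₂) h₂ else 0 := by
  refine ext' fun p => ?_
  obtain ⟨x, y⟩ := p
  rw [mul_apply, Finset.sum_eq_single g₂]
  · by_cases hy : y = h₂
    · subst hy
      by_cases hc : g₂⁻¹ * h₁ * g₂ = y
      · have : g₂ * y * g₂⁻¹ = h₁ := by rw [← hc]; group
        simp [ket, hc, this, mul_inv_eq_iff_eq_mul]
      · have : g₂ * y * g₂⁻¹ ≠ h₁ := fun h => hc (by rw [← h]; group)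
        simp [ket, hc, this]
    · simp only [ket, mk_apply, Prod.mk.injEq, hy, and_false, if_false, mul_zero]
      split_ifs <;> simp [hy]
  · intro k _ hk
    simp [ket, hk]
  · simp

end QuantumDouble

end QuantumDouble

/-! ## Irreducible representations and Fourier bases of a finite group -/

section Fourier

/-- The centralizer `Z(h)`. -/
abbrev Zc {G : Type u} [Group G] (h : G) : Subgroup G := Subgroup.centralizer {h}

noncomputable instance {G : Type u} [Group G] [Fintype G] (h : G) : Fintype (Zc h) :=
  Fintype.ofFinite _

/-- An irreducible complex representation of `H`, on a coordinate space. -/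
structure Irrep (H : Type u) [Group H] where
  dim : ℕ
  rep : Representation ℂ H (Fin dim → ℂ)
  irreducible : rep.IsIrreducible

/-- Isomorphism of irreducible representations. -/
instance Irrep.setoid (H : Type u) [Group H] : Setoid (Irrep H) where
  r a b := Nonempty (Representation.Equiv a.rep b.rep)
  iseqv :=
    { refl := fun a => ⟨Representation.Equiv.refl a.rep⟩
      symm := fun ⟨e⟩ => ⟨e.symm⟩
      trans := fun ⟨e⟩ ⟨f⟩ => ⟨e.trans f⟩ }

/-- `Ĥ`: the isomorphism classes of irreducible complex representations of `H`. -/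
def IrrepClass (H : Type u) [Group H] : Type u := Quotient (Irrep.setoid H)

variable {H : Type u} [Group H]

/-- The dimension `d_ρ`. -/
noncomputable def IrrepClass.dim (ρ : IrrepClass H) : ℕ := (Quotient.out ρ).dim

/-- A representation in the class `ρ`. -/
noncomputable def IrrepClass.rep (ρ : IrrepClass H) : Representation ℂ H (Fin ρ.dim → ℂ) :=
  (Quotient.out ρ).rep

/-- The labels `(ρ, i, j)` with `ρ ∈ Ĥ` and `1 ≤ i, j ≤ d_ρ`. -/
abbrev FourierIndex (H : Type u) [Group H] : Type u :=
  (ρ : IrrepClass H) × Fin ρ.dim × Fin ρ.dim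

/-- A Fourier basis of the group algebra `ℂ[H]` (with its orthonormal basis `H` and the left
regular action `(z • w) y = w (z⁻¹ y)`): an orthonormal basis `b_{ρ,i,j}` of `ℂ[H]` such that,
for all `ρ` and `j`, the span of `{b_{ρ,i,j} | i}` is an irreducible subspace isomorphic to `ρ`.
The associated Fourier transform of `H` takes a vector to its coordinates in this basis. -/
structure FourierBasis (H : Type u) [Group H] [Fintype H] where
  vec : FourierIndex H → EuclideanSpace ℂ H
  orthonormal : Orthonormal ℂ vec
  span_eq_top : Submodule.span ℂ (Set.range vec) = ⊤
  isotypic : ∀ (ρ : IrrepClass H) (j : Fin ρ.dim),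
    ∃ ψ : (Fin ρ.dim → ℂ) →ₗ[ℂ] EuclideanSpace ℂ H,
      Function.Injective ψ ∧
      LinearMap.range ψ = Submodule.span ℂ (Set.range fun i => vec ⟨ρ, i, j⟩) ∧
      ∀ (z : H) (w : Fin ρ.dim → ℂ) (y : H), ψ (ρ.rep z w) y = ψ w (z⁻¹ * y)

variable {G : Type u} [Group G] [Fintype G]

/-- The labels `(h, t, ρ, i, j)` with `h ∈ G`, `t ∈ T_h`, `ρ` an irreducible representation of
`Z(h)` and `1 ≤ i, j ≤ d_ρ`. -/
abbrev DoubleIndex (T : G → Set G) : Type u := (h : G) × T h × FourierIndex (Zc h)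

/-- The vectors `|h^*, ρ, j, t, i⟩ = ∑_{z ∈ Z(h)} b_{ρ,i,j}(z) (t z) h^*` of `D(G)`, for
transversals `T_h` of `Z(h)` in `G` and Fourier bases `b` of `ℂ[Z(h)]`, `h ∈ G`. -/
noncomputable def doubleBasis (T : G → Set G) (B : ∀ h : G, FourierBasis (Zc h))
    (a : DoubleIndex T) : QuantumDouble G :=
  ∑ z : Zc a.1, (B a.1).vec a.2.2 z • QuantumDouble.ket ((a.2.1 : G) * z) a.1

/-- The subspace `V_{h,ρ,j}` of `D(G)`: the span of the `|h^*, ρ, j, t, i⟩` over all `t, i`. -/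
noncomputable def doubleBlock (T : G → Set G) (B : ∀ h : G, FourierBasis (Zc h))
    (h : G) (ρ : IrrepClass (Zc h)) (j : Fin ρ.dim) : Submodule ℂ (QuantumDouble G) :=
  Submodule.span ℂ (Set.range fun ti : T h × Fin ρ.dim => doubleBasis T B ⟨h, ti.1, ρ, ti.2, j⟩)

/-- The element `x ⊗ w` of `Ind_{Z(h)}^G ρ = ℂ[G] ⊗_{ℂ[Z(h)]} ρ`; the group acts by
`g (x ⊗ w) = g x ⊗ w` (see `indTensor_action`) and `x z ⊗ w = x ⊗ ρ(z) w`
(see `indTensor_mul`). Mathlib's tensors carry the inverse of the group element. -/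
noncomputable def indTensor {h : G} (ρ : IrrepClass (Zc h)) (x : G) (w : Fin ρ.dim → ℂ) :
    Representation.IndV (Zc h).subtype ρ.rep :=
  Representation.IndV.mk (Zc h).subtype ρ.rep x⁻¹ w

theorem indTensor_action {h : G} (ρ : IrrepClass (Zc h)) (g x : G) (w : Fin ρ.dim → ℂ) :
    Representation.ind (Zc h).subtype ρ.rep g (indTensor ρ x w) = indTensor ρ (g * x) w := by
  simp [indTensor]

theorem indTensor_mul {h : G} (ρ : IrrepClass (Zc h)) (x : G) (z : Zc h)
    (w : Fin ρ.dim → ℂ) :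
    indTensor ρ (x * z) w = indTensor ρ x (ρ.rep z w) := by
  rw [indTensor, indTensor]
  refine (Representation.Coinvariants.mk_self_apply
    (Representation.tprod ((Representation.leftRegular ℂ G).comp (Zc h).subtype) ρ.rep) z
      _).symm.trans ?_
  simp [Representation.IndV.mk]

end Fourier

/-! ## Quantum circuits -/

section Circuits

/-- The gates NOT, CNOT, Toffoli, Hadamard and `T = diag(1, e^{iπ/4})`, acting on wires numbered
by natural numbers; a gate acts on distinct wires, the last one being the target. -/
inductive Gate : Type
  | not (i : ℕ) : Gate
  | cnot (a i : ℕ) (h : a ≠ i) : Gate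
  | toffoli (a b i : ℕ) (hab : a ≠ b) (ha : a ≠ i) (hb : b ≠ i) : Gate
  | hadamard (i : ℕ) : Gate
  | tgate (i : ℕ) : Gate

/-- A quantum circuit: the gates in the order in which they are applied. -/
abbrev Circuit : Type := List Gate

/-- The description of a wire: its number in unary, followed by an end mark. -/
def wireCode (i : ℕ) : List Bool := List.replicate i true ++ [false]

/-- The description of a gate by a bit string. -/
def Gate.code : Gate → List Bool
  | .not i => [false, false, false] ++ wireCode i
  | .cnot a i _ => [false, false, true] ++ wireCode a ++ wireCode i
  | .toffoli a b i _ _ _ => [false, true, false] ++ wireCode a ++ wireCode b ++ wireCode i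
  | .hadamard i => [false, true, true] ++ wireCode i
  | .tgate i => [true, false, false] ++ wireCode i

/-- The description of a circuit by a bit string. Its length bounds the number of gates and all
the wires used. -/
def Circuit.code (C : Circuit) : List Bool := C.flatMap Gate.code

/-- A computational basis state of the wires. -/
abbrev BasisState : Type := ℕ → Bool

/-- The basis state that holds the bits of `l` on the first wires and `0` on all others. -/
def BasisState.ofBits (l : List Bool) : BasisState := fun i => l.getD i false

/-- State vectors: finite superpositions of basis states. A circuit acts on finitely many wires,
and the other wires (all in state `0` in our use) are idle. -/
abbrev QState : Type := BasisState →₀ ℂ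

/-- The Hilbert space norm (`ℓ²`) of a finite superposition. -/
noncomputable def l2norm {β : Type*} (v : β →₀ ℂ) : ℝ := Real.sqrt (v.sum fun _ a => ‖a‖ ^ 2)

/-- The action of a gate on a basis state. -/
noncomputable def Gate.onBasis : Gate → BasisState → QState
  | .not i, s => Finsupp.single (Function.update s i (!(s i))) 1
  | .cnot a i _, s => Finsupp.single (Function.update s i (xor (s i) (s a))) 1
  | .toffoli a b i _ _ _, s => Finsupp.single (Function.update s i (xor (s i) (s a && s b))) 1
  | .hadamard i, s =>
      Finsupp.single (Function.update s i false) (1 / (Real.sqrt 2 : ℂ)) +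
      Finsupp.single (Function.update s i true)
        ((if s i = true then -1 else 1) / (Real.sqrt 2 : ℂ))
  | .tgate i, s =>
      Finsupp.single s (if s i = true then Complex.exp (Complex.I * Real.pi / 4) else 1)

/-- The linear action of a gate. -/
noncomputable def Gate.apply (g : Gate) : QState →ₗ[ℂ] QState :=
  Finsupp.linearCombination ℂ g.onBasis

/-- The linear action of a circuit. -/
noncomputable def Circuit.apply (C : Circuit) (v : QState) : QState :=
  C.foldl (fun w g => g.apply w) v

/-- The state `∑ a, v(a) |inp a⟩` that represents the vector `v`. -/
noncomputable def loadState {α : Type*} [Fintype α] (inp : α → BasisState)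
    (v : EuclideanSpace ℂ α) : QState :=
  ∑ a, Finsupp.single (inp a) (v a)

/-- The circuit `C` carries out, to within `ε` in operator norm, the transformation to the basis
`b`: it takes the vector `∑ y, c_y b_y`, which is given to it in the form
`∑ y, ∑ a, c_y b_y(a) |inp a⟩`, to `∑ y, c_y |out y⟩`. All wires outside the output registers
have to be returned in state `0`. -/
def Circuit.CarriesOut {α β : Type*} [Fintype α] (C : Circuit) (inp : α → BasisState)
    (b : β → EuclideanSpace ℂ α) (out : β → BasisState) (ε : ℝ) : Prop :=
  ∀ c : β →₀ ℂ,
    l2norm (C.apply (loadState inp (Finsupp.linearCombination ℂ b c)) - Finsupp.mapDomain out c)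
      ≤ ε * l2norm c

end Circuits

/-! ## Classical algorithms with a step count -/

section Programs

/-- Programs over finitely many registers, each of which holds a bit string used as a stack. -/
inductive Prog : Type
  | skip : Prog
  /-- push the bit `b` on register `r` -/
  | push (r : ℕ) (b : Bool) : Prog
  /-- drop the top bit of register `r` (no effect if it is empty) -/
  | pop (r : ℕ) : Prog
  | seq (p q : Prog) : Prog
  /-- run `p` if the top bit of register `r` is `1`, and `q` otherwise -/
  | branch (r : ℕ) (p q : Prog) : Prog
  /-- run `p` as long as register `r` is not empty -/
  | loop (r : ℕ) (p : Prog) : Prog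

/-- `Prog.Exec p σ n τ`: started on the registers `σ`, the program `p` halts after exactly `n`
steps with the registers `τ`. Each stack operation and each test counts as one step. -/
inductive Prog.Exec : Prog → (ℕ → List Bool) → ℕ → (ℕ → List Bool) → Prop
  | skip (σ : ℕ → List Bool) : Prog.Exec .skip σ 1 σ
  | push (σ : ℕ → List Bool) (r : ℕ) (b : Bool) :
      Prog.Exec (.push r b) σ 1 (Function.update σ r (b :: σ r))
  | pop (σ : ℕ → List Bool) (r : ℕ) :
      Prog.Exec (.pop r) σ 1 (Function.update σ r (σ r).tail)
  | seq {p q : Prog} {σ τ υ : ℕ → List Bool} {m n : ℕ} :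
      Prog.Exec p σ m τ → Prog.Exec q τ n υ → Prog.Exec (.seq p q) σ (m + n) υ
  | branch_true {r : ℕ} {p q : Prog} {σ τ : ℕ → List Bool} {n : ℕ} :
      (σ r).head? = some true → Prog.Exec p σ n τ → Prog.Exec (.branch r p q) σ (n + 1) τ
  | branch_false {r : ℕ} {p q : Prog} {σ τ : ℕ → List Bool} {n : ℕ} :
      (σ r).head? ≠ some true → Prog.Exec q σ n τ → Prog.Exec (.branch r p q) σ (n + 1) τ
  | loop_done {r : ℕ} {p : Prog} {σ : ℕ → List Bool} :
      σ r = [] → Prog.Exec (.loop r p) σ 1 σ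
  | loop_step {r : ℕ} {p : Prog} {σ τ υ : ℕ → List Bool} {m n : ℕ} :
      σ r ≠ [] → Prog.Exec p σ m τ → Prog.Exec (.loop r p) τ n υ →
      Prog.Exec (.loop r p) σ (m + n + 1) υ

/-- Started with the strings `inp` in the first registers and all other registers empty, `p`
halts within `t` steps with the strings `out` in the first registers. -/
def Prog.Computes (p : Prog) (t : ℕ) (inp out : List (List Bool)) : Prop :=
  ∃ (n : ℕ) (τ : ℕ → List Bool), n ≤ t ∧ p.Exec (fun r => inp.getD r []) n τ ∧
    ∀ r < out.length, τ r = out.getD r []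

/-- The number `k` in unary. -/
def unary (k : ℕ) : List Bool := List.replicate k true

end Programs

/-! ## Efficient computation in families of finite groups -/

section Efficiency

/-- The bound `(log |G| + k + 2) ^ c`: polylogarithmic in `|G|` and polynomial in the precision
parameter `k`. -/
def polylog (G : Type v) [Fintype G] (k c : ℕ) : ℕ := (Nat.log 2 (Fintype.card G) + k + 2) ^ c

/-- A representation of the groups `G x`, `x ∈ ι`, and of their elements by bit strings of length
polylogarithmic in the order: `name x` is the string by which an algorithm is told which group it
works in, and the elements of `G x` are encoded by distinct strings of the length `len x`. -/
structure GroupEncoding {ι : Type u} (G : ι → Type v) [∀ x, Fintype (G x)] where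
  name : ι → List Bool
  len : ι → ℕ
  enc : ∀ x, G x → List Bool
  length_enc : ∀ x g, (enc x g).length = len x
  enc_injective : ∀ x, Function.Injective (enc x)
  short : ∃ c, ∀ x, (name x).length ≤ polylog (G x) 0 c ∧ len x ≤ polylog (G x) 0 c

/-- Encodings by bit strings of length `ℓ` of the labels `ρ`, `i` and `j` of the vectors of a
Fourier basis of `ℂ[H]`. -/
structure FourierCode (H : Type u) [Group H] (ℓ : ℕ) where
  irr : IrrepClass H → List Bool
  row : ∀ ρ : IrrepClass H, Fin ρ.dim → List Bool
  col : ∀ ρ : IrrepClass H, Fin ρ.dim → List Bool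
  length_irr : ∀ ρ, (irr ρ).length = ℓ
  length_row : ∀ ρ i, (row ρ i).length = ℓ
  length_col : ∀ ρ j, (col ρ j).length = ℓ
  irr_injective : Function.Injective irr
  row_injective : ∀ ρ, Function.Injective (row ρ)
  col_injective : ∀ ρ, Function.Injective (col ρ)

variable {ι : Type u} {G : ι → Type v} [∀ x, Group (G x)] [∀ x, Fintype (G x)]

/-- Products of group elements can be computed in time `polylog |G|`. -/
def EfficientMul (E : GroupEncoding G) : Prop :=
  ∃ (p : Prog) (c : ℕ), ∀ (x : ι) (g h : G x),
    p.Computes (polylog (G x) 0 c) [E.name x, E.enc x g, E.enc x h] [E.enc x (g * h)]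

/-- Given `h` and `g`, one can in time `polylog |G|` express `g = t z` with `t ∈ T_h` and
`z ∈ Z(h)`. -/
def EfficientFactorization (E : GroupEncoding G) (T : ∀ x, G x → Set (G x)) : Prop :=
  ∃ (p : Prog) (c : ℕ), ∀ (x : ι) (h : G x) (t : T x h) (z : Zc h),
    p.Computes (polylog (G x) 0 c) [E.name x, E.enc x h, E.enc x ((t : G x) * z)]
      [E.enc x t, E.enc x z]

/-- Uniformly efficient Fourier transforms over the centralizers: given `h` and a precision
parameter `k`, one can compute in time polynomial in `log |G|` and `k` a quantum circuit that
carries out the Fourier transform of `Z(h)`, `|z⟩ ↦ ∑ ⟨b_{ρ,i,j}, z⟩ |ρ, i, j⟩`, to within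
`δ k`. -/
def EfficientCentralizerQFT (E : GroupEncoding G) (B : ∀ x (h : G x), FourierBasis (Zc h))
    (L : ∀ x (h : G x), FourierCode (Zc h) (E.len x)) (δ : ℕ → ℝ) : Prop :=
  ∃ (C : ∀ x, G x → ℕ → Circuit) (p : Prog) (c : ℕ), ∀ (x : ι) (h : G x) (k : ℕ),
    p.Computes (polylog (G x) k c) [E.name x, E.enc x h, unary k] [(C x h k).code] ∧
    (C x h k).CarriesOut
      (fun z : Zc h => BasisState.ofBits (E.enc x z))
      (B x h).vec
      (fun a => BasisState.ofBits
        ((L x h).irr a.1 ++ (L x h).row a.1 a.2.1 ++ (L x h).col a.1 a.2.2))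
      (δ k)

/-- An efficient Fourier transform over `D(G)`: given the group, the length of the encodings and
a precision parameter `k`, one can compute in time polynomial in `log |G|` and `k` a quantum
circuit that carries out the transformation from the basis `|g, h^*⟩` of `D(G)` to the basis
`|h^*, ρ, j, t, i⟩` to within `δ k`. -/
def EfficientDoubleQFT (E : GroupEncoding G) (T : ∀ x, G x → Set (G x))
    (B : ∀ x (h : G x), FourierBasis (Zc h))
    (L : ∀ x (h : G x), FourierCode (Zc h) (E.len x)) (δ : ℕ → ℝ) : Prop :=
  ∃ (C : ι → ℕ → Circuit) (p : Prog) (c : ℕ), ∀ (x : ι) (k : ℕ),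
    p.Computes (polylog (G x) k c) [E.name x, unary (E.len x), unary k] [(C x k).code] ∧
    (C x k).CarriesOut
      (fun gh : G x × G x => BasisState.ofBits (E.enc x gh.1 ++ E.enc x gh.2))
      (doubleBasis (T x) (B x))
      (fun a : DoubleIndex (T x) => BasisState.ofBits
        (E.enc x a.1 ++ (L x a.1).irr a.2.2.1 ++ (L x a.1).col a.2.2.1 a.2.2.2.2 ++
          E.enc x a.2.1 ++ (L x a.1).row a.2.2.1 a.2.2.2.1))
      (δ k)

end Efficiency

-- Decomposition. For `x` in `G`, `cosetMap h x` embeds `ℂ[Z(h)]` isometrically in `D(G)`, onto the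
-- span of the kets `g h^*` with `g` in the coset `x Z(h)`. As every `g` is uniquely `t z`, the
-- images for different pairs `(h, t)` are orthogonal and together fill `D(G)`, so orthonormal bases
-- of the `ℂ[Z(h)]` glue to one of `D(G)`. A ket either annihilates such an image or carries it to
-- the image of another coset, and which of the two happens depends on the coset only
-- (`ket_mul_cosetMap`). Hence a copy of `ρ` in `ℂ[Z(h)]` spreads to a copy of the induced
-- representation. It is simple: a suitable ket isolates one coset component of a nonzero vector and
-- brings it to the coset of `1`, where irreducibility of `ρ` takes over. Fourier bases exist by the
-- theorem of Peter and Weyl (`FourierBasis.nonempty`).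
--
-- Sufficiency. The circuit replaces `|g, h⟩` by `|h, t, z⟩` with `g = t z`; multiplication serves
-- to erase `g`. It remains to transform `z`, but the circuit for this depends on `h`, which is
-- itself in superposition. So its description is computed coherently and then interpreted. Programs
-- are compiled into reversible circuits (`Layout.circ_exec`), a fixed circuit applies whatever gate
-- is displayed on certain wires (`Panel.Ok.step_apply`), and reading and applying alternate until
-- the description is used up (`Layout.steps_spec`, `interpret_spec`). On the block of a pair `(h,
-- t)` this acts as the circuit for `Z(h)`. Different blocks keep disjoint supports, so the error
-- does not grow (`l2norm_block_le`, `doubleCirc_defect`).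
--
-- Necessity. Exactly one `t` in `T_h` lies in `Z(h)`. With `h` adjoined, the left translates by `t`
-- of the Fourier basis vectors become basis vectors of `D(G)` in the block `(h, t)`, so the
-- transform `U` over `D(G)` carries out a Fourier transform of `Z(h)`, except that `h` and `t`
-- remain in registers. The element `h` is known. For `t` no algorithm is given, but `|h, h⟩` lies
-- in the same block: a second use of `U`, on `|h, h⟩`, exhibits `t`, which is then subtracted from
-- the first result, and the inverse of `U` restores `|h, h⟩`. Three uses of `U` triple the error,
-- which two more bits of precision compensate (`centralizerCirc_defect`). The basis is the given
-- one when `t = 1`.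
--
-- Uniformity. That all these circuits can be written down in polynomial time follows from a
-- calculus of computable strings, numbers and circuits (`PS`, `PN`, `PC`), closed under
-- concatenation, loops, calls of programs and inversion of circuits.
--
-- Registers on which a circuit does not act are treated by adding bit patterns to basis states
-- (`qtrans`, `translates`) in place of tensor products.

universe w

/-! ## Existence of Fourier bases -/

section FourierExistence

variable {H : Type u} [Group H] [Fintype H]

/-- The left regular action on `ℂ[H]`, by isometries. -/
noncomputable def leftTranslate (z : H) : EuclideanSpace ℂ H ≃ₗᵢ[ℂ] EuclideanSpace ℂ H :=
  LinearIsometryEquiv.piLpCongrLeft 2 ℂ ℂ (Equiv.mulLeft z)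

@[simp] theorem leftTranslate_apply (z : H) (f : EuclideanSpace ℂ H) (y : H) :
    leftTranslate z f y = f (z⁻¹ * y) := by
  simp [leftTranslate, LinearIsometryEquiv.piLpCongrLeft_apply, Equiv.piCongrLeft']

theorem leftTranslate_mul (a b : H) (f : EuclideanSpace ℂ H) :
    leftTranslate (a * b) f = leftTranslate a (leftTranslate b f) := by
  ext y; simp [mul_assoc]

@[simp] theorem leftTranslate_one (f : EuclideanSpace ℂ H) : leftTranslate (1 : H) f = f := by
  ext y; simp

theorem inner_leftTranslate_inv (z : H) (f g : EuclideanSpace ℂ H) :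
    inner ℂ (leftTranslate z⁻¹ f) g = inner ℂ f (leftTranslate z g) := by
  rw [← (leftTranslate z).inner_map_map (leftTranslate z⁻¹ f) g, ← leftTranslate_mul]
  simp

theorem Representation.IsIrreducible.submodule_eq_bot_or_top {V : Type*} [AddCommGroup V] [Module ℂ V]
    {ρ : Representation ℂ H V} (hρ : ρ.IsIrreducible) (N : Submodule ℂ V)
    (hN : ∀ z, ∀ v ∈ N, ρ z v ∈ N) : N = ⊥ ∨ N = ⊤ := by
  rcases IsSimpleOrder.eq_bot_or_eq_top (⟨N, hN⟩ : Subrepresentation ρ) with h | h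
  · exact Or.inl (congrArg Subrepresentation.toSubmodule h)
  · exact Or.inr (congrArg Subrepresentation.toSubmodule h)

theorem Representation.IsIrreducible.exists_ne_zero {V : Type*} [AddCommGroup V] [Module ℂ V]
    {ρ : Representation ℂ H V} (hρ : ρ.IsIrreducible) : ∃ v : V, v ≠ 0 := by
  by_contra! h
  refine (bot_ne_top (α := Subrepresentation ρ)) (Subrepresentation.toSubmodule_injective ?_)
  refine le_antisymm bot_le fun v _ => ?_
  rw [h v]
  exact Submodule.zero_mem _

theorem IrrepClass.irreducible (ρ : IrrepClass H) : ρ.rep.IsIrreducible :=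
  (Quotient.out ρ).irreducible

/-- The matrix coefficients of `ρ` with respect to a linear form. -/
noncomputable def coeffMap {V : Type*} [AddCommGroup V] [Module ℂ V] (ρ : Representation ℂ H V)
    (l : V →ₗ[ℂ] ℂ) : V →ₗ[ℂ] EuclideanSpace ℂ H where
  toFun w := WithLp.toLp 2 fun y => l (ρ y⁻¹ w)
  map_add' a b := by ext; simp
  map_smul' a b := by ext; simp

theorem coeffMap_rep {V : Type*} [AddCommGroup V] [Module ℂ V] (ρ : Representation ℂ H V)
    (l : V →ₗ[ℂ] ℂ) (z : H) (w : V) : coeffMap ρ l (ρ z w) = leftTranslate z (coeffMap ρ l w) := by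
  ext y
  simp [coeffMap, map_mul]

theorem injective_of_irreducible {V : Type*} [AddCommGroup V] [Module ℂ V]
    {ρ : Representation ℂ H V} (hρ : ρ.IsIrreducible) (ψ : V →ₗ[ℂ] EuclideanSpace ℂ H)
    (hψ : ∀ z w, ψ (ρ z w) = leftTranslate z (ψ w)) (hne : ψ ≠ 0) : Function.Injective ψ := by
  rw [← LinearMap.ker_eq_bot]
  refine (Representation.IsIrreducible.submodule_eq_bot_or_top hρ (LinearMap.ker ψ) fun z v hv => ?_).resolve_right fun h =>
    hne (LinearMap.ker_eq_top.1 h)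
  rw [LinearMap.mem_ker] at hv ⊢
  rw [hψ, hv, map_zero]

/-- The coefficients with respect to a coordinate that is not zero on some vector give the
embedding. The inner product of `ℂ[H]` then plays the part of an invariant inner product on `ρ`, so
none has to be constructed; the `v i` are preimages of an orthonormal basis of the range. -/
theorem IrrepClass.exists_embedding (ρ : IrrepClass H) :
    ∃ (ψ : (Fin ρ.dim → ℂ) →ₗ[ℂ] EuclideanSpace ℂ H) (v : Fin ρ.dim → Fin ρ.dim → ℂ),
      Function.Injective ψ ∧ (∀ z w, ψ (ρ.rep z w) = leftTranslate z (ψ w)) ∧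
      Orthonormal ℂ (fun i => ψ (v i)) ∧
      Submodule.span ℂ (Set.range fun i => ψ (v i)) = LinearMap.range ψ := by
  obtain ⟨w, hw⟩ := Representation.IsIrreducible.exists_ne_zero ρ.irreducible
  obtain ⟨i, hi⟩ := Function.ne_iff.1 hw
  have hinj := injective_of_irreducible ρ.irreducible (coeffMap ρ.rep (LinearMap.proj i))
    (coeffMap_rep _ _) (fun h => hi (by
      have := congrArg (fun f : EuclideanSpace ℂ H => f 1) (LinearMap.congr_fun h w)
      simpa [coeffMap] using this))
  set ψ := coeffMap ρ.rep (LinearMap.proj i) with hψ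
  have hdim : Module.finrank ℂ (LinearMap.range ψ) = ρ.dim := by
    rw [LinearMap.finrank_range_of_inj hinj]; simp
  let e : OrthonormalBasis (Fin ρ.dim) ℂ (LinearMap.range ψ) :=
    (stdOrthonormalBasis ℂ (LinearMap.range ψ)).reindex (finCongr hdim)
  have hv : ∀ i, ∃ v, ψ v = e i := fun i => (e i).2
  choose v hv using hv
  refine ⟨ψ, v, hinj, coeffMap_rep _ _, ?_, ?_⟩
  · simp only [hv]
    exact e.orthonormal.comp_linearIsometry (LinearMap.range ψ).subtypeₗᵢ
  · have h1 : Submodule.span ℂ (Set.range e) = ⊤ := by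
      rw [← OrthonormalBasis.coe_toBasis]; exact e.toBasis.span_eq
    have h2 := congrArg (Submodule.map (LinearMap.range ψ).subtype) h1
    rw [Submodule.map_span, Submodule.map_top, Submodule.range_subtype, ← Set.range_comp] at h2
    rw [← h2]
    congr 2
    funext i
    exact hv i

/-- The averaged operator of Schur's lemma. -/
noncomputable def averageMap {V W : Type*} [AddCommGroup V] [Module ℂ V] [AddCommGroup W]
    [Module ℂ W] (σ : Representation ℂ H W) (ψ : V →ₗ[ℂ] EuclideanSpace ℂ H)
    (e : EuclideanSpace ℂ H) (u : W) : V →ₗ[ℂ] W where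
  toFun w := ∑ y : H, inner ℂ e (leftTranslate y (ψ w)) • σ y⁻¹ u
  map_add' a b := by simp [add_smul, Finset.sum_add_distrib]
  map_smul' a b := by simp [mul_smul, Finset.smul_sum]

/-- The substitution `y ↦ y * z` in the sum moves the action of `z` from the argument to the value.
-/
theorem averageMap_rep {V W : Type*} [AddCommGroup V] [Module ℂ V] [AddCommGroup W]
    [Module ℂ W] (ρ : Representation ℂ H V) (σ : Representation ℂ H W)
    (ψ : V →ₗ[ℂ] EuclideanSpace ℂ H) (hψ : ∀ z w, ψ (ρ z w) = leftTranslate z (ψ w))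
    (e : EuclideanSpace ℂ H) (u : W) (z : H) (w : V) :
    averageMap σ ψ e u (ρ z w) = σ z (averageMap σ ψ e u w) := by
  simp only [averageMap, LinearMap.coe_mk, AddHom.coe_mk, map_sum, map_smul, hψ, ← leftTranslate_mul]
  refine Fintype.sum_equiv (Equiv.mulRight z) _ _ fun y => ?_
  rw [← Module.End.mul_apply, ← map_mul]
  simp

/-- Correlations of two matrix coefficients are matrix entries of an intertwiner. This is how
Schur's lemma yields the orthogonality relations. -/
theorem inner_averageMap {V W : Type*} [AddCommGroup V] [Module ℂ V] [AddCommGroup W]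
    [Module ℂ W] (σ : Representation ℂ H W)
    (ψ : V →ₗ[ℂ] EuclideanSpace ℂ H) (φ : W →ₗ[ℂ] EuclideanSpace ℂ H)
    (hφ : ∀ z w, φ (σ z w) = leftTranslate z (φ w))
    (e f : EuclideanSpace ℂ H) (u : W) (w : V) :
    inner ℂ f (φ (averageMap σ ψ e u w)) =
      ∑ y : H, inner ℂ e (leftTranslate y (ψ w)) * inner ℂ f (leftTranslate y⁻¹ (φ u)) := by
  simp only [averageMap, LinearMap.coe_mk, AddHom.coe_mk, map_sum, map_smul, hφ, inner_sum,
    inner_smul_right]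

/-- Peter and Weyl: the basis consists of the matrix coefficients, scaled by the square root of `d_ρ
/ |H|`. Schur's lemma makes them orthonormal. An irreducible subspace orthogonal to all of them
cannot exist, because its vectors are themselves matrix coefficients. -/
theorem FourierBasis.nonempty (H : Type u) [Group H] [Fintype H] : Nonempty (FourierBasis H) := by
  classical
  choose ψ v hinj hψ hon hspan using fun ρ : IrrepClass H => ρ.exists_embedding
  have hcard : (0 : ℝ) < Fintype.card H := by exact_mod_cast Fintype.card_pos
  have hdim : ∀ ρ : IrrepClass H, 0 < ρ.dim := fun ρ => by
    obtain ⟨w, hw⟩ := Representation.IsIrreducible.exists_ne_zero ρ.irreducible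
    obtain ⟨i, -⟩ := Function.ne_iff.1 hw
    exact i.pos
  have hne : ∀ ρ σ : IrrepClass H, ρ ≠ σ → ∀ A : (Fin ρ.dim → ℂ) →ₗ[ℂ] (Fin σ.dim → ℂ),
      (∀ z w, A (ρ.rep z w) = σ.rep z (A w)) → A = 0 := by
    intro ρ σ hρσ A hA
    have := ρ.irreducible
    have := σ.irreducible
    rcases Representation.IsIrreducible.bijective_or_eq_zero
      (A.intertwiningMap_of_isIntertwiningMap ρ.rep σ.rep hA) with h | h
    · refine absurd ?_ hρσ
      rw [← Quotient.out_eq ρ, ← Quotient.out_eq σ]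
      exact Quotient.sound ⟨Representation.IntertwiningMap.ofBijective _ h⟩
    · exact congrArg Representation.IntertwiningMap.toLinearMap h
  have hsc : ∀ ρ : IrrepClass H, ∀ A : (Fin ρ.dim → ℂ) →ₗ[ℂ] (Fin ρ.dim → ℂ),
      (∀ z w, A (ρ.rep z w) = ρ.rep z (A w)) → ∃ c : ℂ, ∀ w, A w = c • w := by
    intro ρ A hA
    have := ρ.irreducible
    obtain ⟨c, hc⟩ :=
      (Representation.IsIrreducible.algebraMap_intertwiningMap_bijective_of_isAlgClosed
        (ρ := ρ.rep)).2 (A.intertwiningMap_of_isIntertwiningMap ρ.rep ρ.rep hA)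
    refine ⟨c, fun w => ?_⟩
    have := congrArg (fun f : Representation.IntertwiningMap ρ.rep ρ.rep => f w) hc
    simpa [Algebra.algebraMap_eq_smul_one] using this.symm
  have hschur : ∀ (ρ : IrrepClass H) (i j i' j' : Fin ρ.dim),
      ∑ y : H, inner ℂ (ψ ρ (v ρ i)) (leftTranslate y (ψ ρ (v ρ j))) *
        inner ℂ (ψ ρ (v ρ j')) (leftTranslate y⁻¹ (ψ ρ (v ρ i'))) =
      if i = i' ∧ j = j' then (Fintype.card H : ℂ) / ρ.dim else 0 := by
    intro ρ i j i' j'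
    obtain ⟨c, hc⟩ := hsc ρ (averageMap ρ.rep (ψ ρ) (ψ ρ (v ρ i)) (v ρ i'))
      (averageMap_rep _ _ _ (hψ ρ) _ _)
    have key : ∀ j j', ∑ y : H, inner ℂ (ψ ρ (v ρ i)) (leftTranslate y (ψ ρ (v ρ j))) *
        inner ℂ (ψ ρ (v ρ j')) (leftTranslate y⁻¹ (ψ ρ (v ρ i'))) = if j = j' then c else 0 := by
      intro j j'
      rw [← inner_averageMap ρ.rep (ψ ρ) (ψ ρ) (hψ ρ), hc, map_smul, inner_smul_right,
        orthonormal_iff_ite.1 (hon ρ)]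
      simp [eq_comm]
    -- The scalar of Schur's lemma is found from a trace: in the sum over `j = j'`, the expansion in
    -- the orthonormal basis `ψ (v j)` collapses each summand to one inner product, in which the two
    -- translations cancel.
    have htr : (ρ.dim : ℂ) * c = if i = i' then (Fintype.card H : ℂ) else 0 := by
      have h1 : (ρ.dim : ℂ) * c = ∑ j, ∑ y : H, inner ℂ (ψ ρ (v ρ i))
          (leftTranslate y (ψ ρ (v ρ j))) *
          inner ℂ (ψ ρ (v ρ j)) (leftTranslate y⁻¹ (ψ ρ (v ρ i'))) := by
        simp [key]
      rw [h1, Finset.sum_comm]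
      have h2 : ∀ y : H, ∑ j, inner ℂ (ψ ρ (v ρ i)) (leftTranslate y (ψ ρ (v ρ j))) *
          inner ℂ (ψ ρ (v ρ j)) (leftTranslate y⁻¹ (ψ ρ (v ρ i'))) = if i = i' then 1 else 0 := by
        intro y
        have hmem : leftTranslate y⁻¹ (ψ ρ (v ρ i')) ∈
            Submodule.span ℂ (Set.range fun i => ψ ρ (v ρ i)) := by
          rw [hspan, ← hψ]; exact LinearMap.mem_range_self _ _
        obtain ⟨a, ha⟩ := (Submodule.mem_span_range_iff_exists_fun ℂ).1 hmem
        have hcoef : ∀ j, inner ℂ (ψ ρ (v ρ j)) (leftTranslate y⁻¹ (ψ ρ (v ρ i'))) = a j := by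
          intro j
          rw [← ha, (hon ρ).inner_right_fintype]
        simp only [hcoef]
        have h3 : ∑ j, inner ℂ (ψ ρ (v ρ i)) (leftTranslate y (ψ ρ (v ρ j))) * a j =
            inner ℂ (ψ ρ (v ρ i)) (leftTranslate y (∑ j, a j • ψ ρ (v ρ j))) := by
          simp [mul_comm]
        rw [h3, ha, ← leftTranslate_mul, mul_inv_cancel, leftTranslate_one,
          orthonormal_iff_ite.1 (hon ρ)]
      simp only [h2]
      split_ifs <;> simp
    have hd : (ρ.dim : ℂ) ≠ 0 := by exact_mod_cast (hdim ρ).ne'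
    rw [key]
    by_cases h : i = i'
    · simp only [h, if_true, true_and] at htr ⊢
      rw [← htr, mul_div_cancel_left₀ _ hd]
    · simp only [h, if_false, false_and] at htr ⊢
      simp [(mul_eq_zero.1 htr).resolve_left hd]
  -- The constant in the orthogonality relations is `|H| / d_ρ`; this factor normalises it.
  let s : IrrepClass H → ℂ := fun ρ => ((Real.sqrt (ρ.dim / Fintype.card H) : ℝ) : ℂ)
  have hs : ∀ ρ, s ρ * s ρ = ρ.dim / Fintype.card H := fun ρ => by
    simp only [s]
    rw [← Complex.ofReal_mul, Real.mul_self_sqrt (by positivity)]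
    push_cast; rfl
  have hs0 : ∀ ρ, s ρ ≠ 0 := fun ρ h => by
    have := hs ρ
    rw [h, zero_mul] at this
    have h1 : (ρ.dim : ℂ) ≠ 0 := by exact_mod_cast (hdim ρ).ne'
    have h2 : (Fintype.card H : ℂ) ≠ 0 := by exact_mod_cast hcard.ne'
    exact div_ne_zero h1 h2 this.symm
  let lin : (ρ : IrrepClass H) → Fin ρ.dim → (Fin ρ.dim → ℂ) →ₗ[ℂ] ℂ := fun ρ j =>
    (innerₛₗ ℂ (ψ ρ (v ρ j))).comp (ψ ρ)
  let vec : FourierIndex H → EuclideanSpace ℂ H := fun a =>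
    s a.1 • coeffMap a.1.rep (lin a.1 a.2.2) (v a.1 a.2.1)
  have hvec : ∀ a y, vec a y =
      s a.1 * inner ℂ (ψ a.1 (v a.1 a.2.2)) (leftTranslate y⁻¹ (ψ a.1 (v a.1 a.2.1))) := by
    intro a y
    simp [vec, lin, coeffMap, hψ]
  have hinner : ∀ a b, inner ℂ (vec a) (vec b) = s a.1 * s b.1 * ∑ y : H,
      inner ℂ (ψ a.1 (v a.1 a.2.1)) (leftTranslate y (ψ a.1 (v a.1 a.2.2))) *
        inner ℂ (ψ b.1 (v b.1 b.2.2)) (leftTranslate y⁻¹ (ψ b.1 (v b.1 b.2.1))) := by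
    intro a b
    rw [PiLp.inner_apply, Finset.mul_sum]
    refine Finset.sum_congr rfl fun y _ => ?_
    rw [hvec, hvec, RCLike.inner_apply, map_mul, inner_conj_symm, inner_leftTranslate_inv]
    simp only [s, Complex.conj_ofReal]
    ring
  have horth : Orthonormal ℂ vec := by
    rw [orthonormal_iff_ite]
    rintro ⟨ρ, i, j⟩ ⟨σ, i', j'⟩
    rw [hinner]
    by_cases h : ρ = σ
    · subst h
      dsimp only
      rw [hschur, hs]
      have h1 : (ρ.dim : ℂ) ≠ 0 := by exact_mod_cast (hdim ρ).ne'
      have h2 : (Fintype.card H : ℂ) ≠ 0 := by exact_mod_cast hcard.ne'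
      by_cases h3 : i = i' ∧ j = j'
      · obtain ⟨rfl, rfl⟩ := h3
        simp only [and_self, if_true]
        field_simp
      · rw [if_neg h3, if_neg, mul_zero]
        intro h4
        exact h3 (by simpa using h4)
    · rw [if_neg (fun h' => h (congrArg Sigma.fst h'))]
      dsimp only
      rw [← inner_averageMap σ.rep (ψ ρ) (ψ σ) (hψ σ),
        hne ρ σ h _ (averageMap_rep _ _ _ (hψ ρ) _ _)]
      simp
  have hmem : ∀ (ρ : IrrepClass H) (l : (Fin ρ.dim → ℂ) →ₗ[ℂ] ℂ) (w : Fin ρ.dim → ℂ),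
      coeffMap ρ.rep l w ∈ Submodule.span ℂ (Set.range vec) := by
    intro ρ l w
    have hvb : LinearIndependent ℂ (v ρ) :=
      LinearIndependent.of_comp (ψ ρ) (hon ρ).linearIndependent
    have hvs : Submodule.span ℂ (Set.range (v ρ)) = ⊤ :=
      hvb.span_eq_top_of_card_eq_finrank' (by simp)
    -- The `v ρ j` form a basis of the representation space and `lin ρ j` is the dual basis, so
    -- coefficients with respect to arbitrary linear forms are covered.
    have hl : l = ∑ j, l (v ρ j) • lin ρ j := by
      refine LinearMap.ext_on hvs ?_
      rintro _ ⟨k, rfl⟩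
      simp [lin, orthonormal_iff_ite.1 (hon ρ)]
    obtain ⟨a, rfl⟩ : ∃ a : Fin ρ.dim → ℂ, ∑ i, a i • v ρ i = w :=
      (Submodule.mem_span_range_iff_exists_fun ℂ).1 (hvs ▸ Submodule.mem_top)
    have hexp : coeffMap ρ.rep l (∑ i, a i • v ρ i) =
        ∑ i, ∑ j, (a i * l (v ρ j) * (s ρ)⁻¹) • vec ⟨ρ, i, j⟩ := by
      conv_lhs => rw [hl]
      ext y
      simp only [coeffMap, vec, LinearMap.coe_mk, AddHom.coe_mk, map_sum, map_smul,
        LinearMap.sum_apply, LinearMap.smul_apply, smul_eq_mul, WithLp.ofLp_sum, WithLp.ofLp_smul,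
        Finset.sum_apply, Pi.smul_apply, Finset.mul_sum]
      refine Finset.sum_congr rfl fun i _ => Finset.sum_congr rfl fun j _ => ?_
      field_simp [hs0 ρ]
    rw [hexp]
    exact Submodule.sum_mem _ fun i _ => Submodule.sum_mem _ fun j _ =>
      Submodule.smul_mem _ _ (Submodule.subset_span ⟨_, rfl⟩)
  refine ⟨⟨vec, horth, ?_, ?_⟩⟩
  · set S := Submodule.span ℂ (Set.range vec) with hS
    have hSinv : ∀ z, ∀ f ∈ S, leftTranslate z f ∈ S := by
      intro z f hf
      induction hf using Submodule.span_induction with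
      | mem f hf =>
        obtain ⟨a, rfl⟩ := hf
        simp only [vec, map_smul, ← coeffMap_rep]
        exact Submodule.smul_mem _ _ (hmem _ _ _)
      | zero => simp
      | add f g _ _ h1 h2 => rw [map_add]; exact S.add_mem h1 h2
      | smul c f _ h => rw [map_smul]; exact S.smul_mem c h
    by_contra hne'
    have hperp : Sᗮ ≠ ⊥ := fun h => hne' ((Submodule.orthogonal_eq_bot_iff).1 h)
    -- A nonzero invariant subspace of the complement of least dimension is irreducible. It is
    -- transported to a coordinate space because `Irrep` lives there.
    let good : Submodule ℂ (EuclideanSpace ℂ H) → Prop := fun U =>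
      U ≠ ⊥ ∧ U ≤ Sᗮ ∧ ∀ z, ∀ f ∈ U, leftTranslate z f ∈ U
    have hgood : ∃ n, ∃ U, good U ∧ Module.finrank ℂ U = n := by
      refine ⟨_, Sᗮ, ⟨hperp, le_rfl, fun z f hf => ?_⟩, rfl⟩
      rw [Submodule.mem_orthogonal] at hf ⊢
      intro g hg
      rw [← inner_leftTranslate_inv]
      exact hf _ (hSinv _ _ hg)
    obtain ⟨U, hU, hUn⟩ := Nat.find_spec hgood
    have hmin : ∀ U', good U' → U' ≤ U → U' = U := fun U' h1 h2 =>
      Submodule.eq_of_le_of_finrank_le h2 (hUn ▸ Nat.find_min' hgood ⟨U', h1, rfl⟩)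
    let d := Module.finrank ℂ U
    let e : (Fin d → ℂ) ≃ₗ[ℂ] U := (Module.finBasis ℂ U).equivFun.symm
    let ρU : Representation ℂ H U :=
      { toFun := fun z => ((leftTranslate z).toLinearEquiv.toLinearMap).restrict (hU.2.2 z)
        map_one' := by ext f y; simp
        map_mul' := fun a b => by ext f y; simp [mul_assoc] }
    let ρ0 : Representation ℂ H (Fin d → ℂ) :=
      { toFun := fun z => e.symm.toLinearMap ∘ₗ ρU z ∘ₗ e.toLinearMap
        map_one' := by ext; simp
        map_mul' := fun a b => by ext; simp }
    have hρ0 : ∀ z w, e (ρ0 z w) = ρU z (e w) := fun z w => by simp [ρ0]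
    have hirr : ρ0.IsIrreducible := by
      refine { exists_pair_ne := ⟨⊥, ⊤, fun h => hU.1 ?_⟩, eq_bot_or_eq_top := fun N => ?_ }
      · have h' := congrArg Subrepresentation.toSubmodule h
        rw [Submodule.eq_bot_iff]
        intro f hf
        have : e.symm ⟨f, hf⟩ ∈ (⊤ : Submodule ℂ (Fin d → ℂ)) := Submodule.mem_top
        have h2 : e.symm ⟨f, hf⟩ = 0 := by
          have h3 : (⊥ : Submodule ℂ (Fin d → ℂ)) = ⊤ := h'
          rw [← h3] at this
          exact (Submodule.mem_bot ℂ).1 this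
        simpa using congrArg Subtype.val ((LinearEquiv.map_eq_zero_iff e.symm).1 h2)
      · by_cases hN : N.toSubmodule = ⊥
        · exact Or.inl (Subrepresentation.toSubmodule_injective hN)
        · right
          have h1 := hmin (N.toSubmodule.map (U.subtype ∘ₗ e.toLinearMap)) ⟨?_, ?_, ?_⟩ ?_
          · refine Subrepresentation.toSubmodule_injective (eq_top_iff.2 fun w _ => ?_)
            have h2 : (e w : EuclideanSpace ℂ H) ∈
                N.toSubmodule.map (U.subtype ∘ₗ e.toLinearMap) := by
              rw [h1]; exact (e w).2
            obtain ⟨w', hw', h3⟩ := h2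
            have : w' = w := e.injective (Subtype.ext h3)
            exact this ▸ hw'
          · intro h
            apply hN
            rw [Submodule.eq_bot_iff] at h ⊢
            intro w hw
            have := h _ (Submodule.mem_map_of_mem hw)
            exact e.map_eq_zero_iff.1 (Subtype.ext this)
          · rintro _ ⟨w, -, rfl⟩
            exact hU.2.1 (e w).2
          · rintro z _ ⟨w, hw, rfl⟩
            refine ⟨ρ0 z w, N.apply_mem_toSubmodule z hw, ?_⟩
            simp only [LinearMap.comp_apply, LinearEquiv.coe_coe, hρ0]
            rfl
          · rintro _ ⟨w, -, rfl⟩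
            exact (e w).2
    let I : Irrep H := ⟨d, ρ0, hirr⟩
    let ρ : IrrepClass H := Quotient.mk _ I
    have hρ : Nonempty (Representation.Equiv ρ.rep ρ0) := Quotient.mk_out (s := Irrep.setoid H) I
    obtain ⟨E⟩ := hρ
    obtain ⟨w, hw⟩ := Representation.IsIrreducible.exists_ne_zero ρ.irreducible
    let χ : (Fin ρ.dim → ℂ) →ₗ[ℂ] EuclideanSpace ℂ H :=
      U.subtype ∘ₗ e.toLinearMap ∘ₗ E.toLinearEquiv.toLinearMap
    have hχ : ∀ z w, χ (ρ.rep z w) = leftTranslate z (χ w) := by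
      intro z w
      have h1 : E.toLinearEquiv (ρ.rep z w) = ρ0 z (E.toLinearEquiv w) :=
        E.toIntertwiningMap.isIntertwining _ _ z w
      change (e (E.toLinearEquiv (ρ.rep z w)) : EuclideanSpace ℂ H) = _
      rw [h1, hρ0]
      rfl
    -- Since `f y = (y⁻¹ f) 1`, an equivariant map is recovered from its value at `1`: its vectors
    -- are coefficients, hence lie in the span `S` as well as in its orthogonal complement.
    have h1 : χ w = coeffMap ρ.rep
        (LinearMap.comp (EuclideanSpace.proj (1 : H)).toLinearMap χ) w := by
      ext y
      simp [coeffMap, hχ]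
    have h2 : χ w ∈ S := h1 ▸ hmem _ _ _
    have h3 : χ w ∈ Sᗮ := hU.2.1 (e _).2
    have h4 : χ w = 0 := by
      have := Submodule.inner_right_of_mem_orthogonal h2 h3
      exact inner_self_eq_zero.1 this
    refine hw (E.toLinearEquiv.map_eq_zero_iff.1 (e.map_eq_zero_iff.1 (Subtype.ext h4)))
  · intro ρ j
    refine ⟨s ρ • coeffMap ρ.rep (lin ρ j), ?_, ?_, ?_⟩
    · refine injective_of_irreducible ρ.irreducible _ (fun z w => by simp [coeffMap_rep]) fun h => ?_
      have := LinearMap.congr_fun h (v ρ j)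
      exact horth.ne_zero ⟨ρ, j, j⟩ this
    · have hvs : Submodule.span ℂ (Set.range (v ρ)) = ⊤ :=
        (LinearIndependent.of_comp (ψ ρ) (hon ρ).linearIndependent).span_eq_top_of_card_eq_finrank'
          (by simp)
      rw [LinearMap.range_eq_map, ← hvs, Submodule.map_span, ← Set.range_comp]
      rfl
    · intro z w y
      simp [coeffMap_rep]

end FourierExistence

/-! ## The decomposition of the regular representation of `D(G)` -/

section Decomposition

variable {G : Type u} [Group G] [Fintype G]

open scoped Classical in
theorem QuantumDouble.inner_ket (g h g' h' : G) :
    inner ℂ (QuantumDouble.ket g h) (QuantumDouble.ket g' h') =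
      if g = g' ∧ h = h' then (1 : ℂ) else 0 := by
  have h1 : inner ℂ (QuantumDouble.ket g h) (QuantumDouble.ket g' h') =
      ∑ p : G × G, inner ℂ (QuantumDouble.ket g h p) (QuantumDouble.ket g' h' p) :=
    PiLp.inner_apply (𝕜 := ℂ) (ι := G × G) (f := fun _ => ℂ) _ _
  rw [h1, Finset.sum_eq_single (g, h)]
  · simp [QuantumDouble.ket]
  · intro p _ hp
    simp [QuantumDouble.ket, hp]
  · simp

theorem QuantumDouble.eq_sum_ket (a : QuantumDouble G) :
    a = ∑ p : G × G, a p • QuantumDouble.ket p.1 p.2 := by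
  classical
  refine QuantumDouble.ext' fun q => ?_
  have h1 : ∀ (s : Finset (G × G)) (f : G × G → QuantumDouble G), (∑ p ∈ s, f p) q = ∑ p ∈ s, f p q := by
    intro s f
    induction s using Finset.induction_on with
    | empty => simp
    | insert b s hb ih => rw [Finset.sum_insert hb, Finset.sum_insert hb, QuantumDouble.add_apply, ih]
  rw [h1]
  simp [QuantumDouble.ket]

/-- The embedding of `ℂ[Z(h)]` in `D(G)` as the span of the `(t z) h^*`. -/
noncomputable def cosetMap (h t : G) : EuclideanSpace ℂ (Zc h) →ₗ[ℂ] QuantumDouble G where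
  toFun u := ∑ z : Zc h, u z • QuantumDouble.ket (t * z) h
  map_add' a b := by simp [add_smul, Finset.sum_add_distrib]
  map_smul' a b := by simp [mul_smul, Finset.smul_sum]

theorem cosetMap_def (h t : G) (u : EuclideanSpace ℂ (Zc h)) :
    cosetMap h t u = ∑ z : Zc h, u z • QuantumDouble.ket (t * z) h := rfl

theorem doubleBasis_eq_cosetMap (T : G → Set G) (B : ∀ h : G, FourierBasis (Zc h))
    (a : DoubleIndex T) : doubleBasis T B a = cosetMap a.1 a.2.1 ((B a.1).vec a.2.2) := rfl

theorem inner_cosetMap_self (h t : G) (u u' : EuclideanSpace ℂ (Zc h)) :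
    inner ℂ (cosetMap h t u) (cosetMap h t u') = inner ℂ u u' := by
  classical
  simp only [cosetMap_def, sum_inner, inner_sum, inner_smul_left, inner_smul_right,
    QuantumDouble.inner_ket, PiLp.inner_apply, RCLike.inner_apply]
  refine Finset.sum_congr rfl fun z _ => ?_
  rw [Finset.sum_eq_single z]
  · simp [mul_comm]
  · intro z' _ hz
    rw [if_neg (fun e => hz (by simpa using e.1)), mul_zero]
  · simp

/-- The factorization `g = t z` is unique, so kets from different blocks never coincide. -/
theorem inner_cosetMap_of_ne {T : G → Set G}
    (hT : ∀ h, Subgroup.IsComplement (T h) (Zc h : Set G)) {h h' : G} (t : T h) (t' : T h')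
    (hne : (⟨h, t⟩ : (h : G) × T h) ≠ ⟨h', t'⟩)
    (u : EuclideanSpace ℂ (Zc h)) (u' : EuclideanSpace ℂ (Zc h')) :
    inner ℂ (cosetMap h t u) (cosetMap h' t' u') = 0 := by
  classical
  simp only [cosetMap_def, sum_inner, inner_sum, inner_smul_left, inner_smul_right,
    QuantumDouble.inner_ket]
  refine Finset.sum_eq_zero fun z _ => ?_
  rw [Finset.sum_eq_zero fun z' _ => ?_, mul_zero]
  rw [if_neg, mul_zero]
  rintro ⟨h1, rfl⟩
  have h2 := (hT h).1 (a₁ := (t, z')) (a₂ := (t', z)) h1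
  have h3 : t = t' := (Prod.ext_iff.1 h2).1
  exact hne (by rw [h3])

/-- The elements of `Z(h)` commute with `h`, so the condition under which a product of kets survives
is the same for all `x z` in a coset. -/
theorem ket_mul_cosetMap (h g h' x : G) (u : EuclideanSpace ℂ (Zc h)) :
    (x⁻¹ * h' * x = h → QuantumDouble.ket g h' * cosetMap h x u = cosetMap h (g * x) u) ∧
    (x⁻¹ * h' * x ≠ h → QuantumDouble.ket g h' * cosetMap h x u = 0) := by
  have key : ∀ z : Zc h, (x * z : G)⁻¹ * h' * (x * z) = h ↔ x⁻¹ * h' * x = h := by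
    intro z
    have hz : h * (z : G) = z * h := Subgroup.mem_centralizer_singleton_iff.1 z.2 |>.symm
    constructor
    · intro e
      have : x⁻¹ * h' * x = z * ((x * z : G)⁻¹ * h' * (x * z)) * (z : G)⁻¹ := by group
      rw [this, e, ← hz]; group
    · intro e
      have : (x * z : G)⁻¹ * h' * (x * z) = (z : G)⁻¹ * (x⁻¹ * h' * x) * z := by group
      rw [this, e, mul_assoc, hz]; group
  simp only [cosetMap_def, Finset.mul_sum, mul_smul_comm, QuantumDouble.ket_mul_ket]
  constructor
  · intro e
    exact Finset.sum_congr rfl fun z _ => by rw [if_pos ((key z).2 e), mul_assoc]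
  · intro e
    exact Finset.sum_eq_zero fun z _ => by rw [if_neg (fun h1 => e ((key z).1 h1)), smul_zero]

/-- The relation `x z ⊗ w = x ⊗ ρ(z) w` of the induced representation, as seen inside `D(G)`; it
makes `indMap` well defined. -/
theorem cosetMap_mul {h : G} (x : G) (z : Zc h) (u : EuclideanSpace ℂ (Zc h)) :
    cosetMap h (x * z) u = cosetMap h x (leftTranslate z u) := by
  simp only [cosetMap_def, leftTranslate_apply]
  refine Fintype.sum_equiv (Equiv.mulLeft z) _ _ fun y => ?_
  simp [mul_assoc]

theorem doubleBasis_orthonormal {T : G → Set G} (hT : ∀ h, Subgroup.IsComplement (T h) (Zc h : Set G))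
    (B : ∀ h : G, FourierBasis (Zc h)) : Orthonormal ℂ (doubleBasis T B) := by
  classical
  rw [orthonormal_iff_ite]
  rintro ⟨h, t, a⟩ ⟨h', t', a'⟩
  simp only [doubleBasis_eq_cosetMap]
  by_cases hne : (⟨h, t⟩ : (h : G) × T h) = ⟨h', t'⟩
  · cases hne
    rw [inner_cosetMap_self, orthonormal_iff_ite.1 (B h).orthonormal]
    simp
  · rw [inner_cosetMap_of_ne hT t t' hne, if_neg]
    rintro h1
    cases h1
    exact hne rfl

/-- A ket `(t z) h^*` is the image of the point mass at `z`, which the Fourier basis of `ℂ[Z(h)]`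
spans. -/
theorem doubleBasis_span {T : G → Set G} (hT : ∀ h, Subgroup.IsComplement (T h) (Zc h : Set G))
    (B : ∀ h : G, FourierBasis (Zc h)) : Submodule.span ℂ (Set.range (doubleBasis T B)) = ⊤ := by
  classical
  rw [eq_top_iff]
  rintro a -
  rw [QuantumDouble.eq_sum_ket a]
  refine Submodule.sum_mem _ fun p _ => Submodule.smul_mem _ _ ?_
  obtain ⟨⟨t, z⟩, htz⟩ := (hT p.2).2 p.1
  have h1 : QuantumDouble.ket p.1 p.2 = cosetMap p.2 t (EuclideanSpace.single (z : Zc p.2) 1) := by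
    refine Eq.symm ((Finset.sum_eq_single (z : Zc p.2) ?_ ?_).trans ?_)
    · intro z' _ hz; simp [hz]
    · simp
    · have htz' : (t : G) * ((z : Zc p.2) : G) = p.1 := htz
      simp [htz']
  rw [h1]
  have h2 : EuclideanSpace.single (z : Zc p.2) (1 : ℂ) ∈
      Submodule.span ℂ (Set.range (B p.2).vec) := (B p.2).span_eq_top ▸ Submodule.mem_top
  have h3 := Submodule.mem_map_of_mem (f := cosetMap p.2 (t : G)) h2
  rw [Submodule.map_span] at h3
  refine Submodule.span_mono ?_ h3
  rintro _ ⟨_, ⟨a, rfl⟩, rfl⟩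
  exact ⟨⟨p.2, t, a⟩, rfl⟩

theorem doubleBlock_orthogonal {T : G → Set G} (hT : ∀ h, Subgroup.IsComplement (T h) (Zc h : Set G))
    (B : ∀ h : G, FourierBasis (Zc h)) :
    OrthogonalFamily ℂ
      (fun a : (h : G) × (ρ : IrrepClass (Zc h)) × Fin ρ.dim =>
        doubleBlock T B a.1 a.2.1 a.2.2)
      (fun a => (doubleBlock T B a.1 a.2.1 a.2.2).subtypeₗᵢ) := by
  refine OrthogonalFamily.of_pairwise fun a b hab => ?_
  refine Submodule.isOrtho_span.2 ?_
  rintro _ ⟨⟨t, i⟩, rfl⟩ _ ⟨⟨t', i'⟩, rfl⟩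
  refine (doubleBasis_orthonormal hT B).2 fun h => hab ?_
  obtain ⟨h, ρ, j⟩ := a
  obtain ⟨h', ρ', j'⟩ := b
  cases h
  rfl

theorem iSup_doubleBlock {T : G → Set G} (hT : ∀ h, Subgroup.IsComplement (T h) (Zc h : Set G))
    (B : ∀ h : G, FourierBasis (Zc h)) :
    (⨆ a : (h : G) × (ρ : IrrepClass (Zc h)) × Fin ρ.dim,
      doubleBlock T B a.1 a.2.1 a.2.2) = ⊤ := by
  rw [eq_top_iff, ← doubleBasis_span hT B, Submodule.span_le]
  rintro _ ⟨⟨h, t, ρ, i, j⟩, rfl⟩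
  exact Submodule.mem_iSup_of_mem (p := fun a : (h : G) × (ρ : IrrepClass (Zc h)) × Fin ρ.dim =>
    doubleBlock T B a.1 a.2.1 a.2.2) ⟨h, ρ, j⟩ (Submodule.subset_span ⟨(t, i), rfl⟩)

/-- The map `x ⊗ w ↦ ∑ z, ψ(w)(z) (x z) h^*` from the induced representation to `D(G)`. -/
noncomputable def indMap {h : G} {ρ : IrrepClass (Zc h)}
    (ψ : (Fin ρ.dim → ℂ) →ₗ[ℂ] EuclideanSpace ℂ (Zc h))
    (hψ : ∀ z w, ψ (ρ.rep z w) = leftTranslate z (ψ w)) :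
    Representation.IndV (Zc h).subtype ρ.rep →ₗ[ℂ] QuantumDouble G :=
  Representation.Coinvariants.lift _
    (TensorProduct.lift <| (Finsupp.lift _ _ _ fun x : G => cosetMap h x⁻¹ ∘ₗ ψ) ∘ₗ
      (MonoidAlgebra.coeffLinearEquiv ℂ).toLinearMap)
    fun z => by
      ext x w
      simp [hψ, ← cosetMap_mul]

theorem indMap_indTensor {h : G} {ρ : IrrepClass (Zc h)}
    (ψ : (Fin ρ.dim → ℂ) →ₗ[ℂ] EuclideanSpace ℂ (Zc h))
    (hψ : ∀ z w, ψ (ρ.rep z w) = leftTranslate z (ψ w)) (x : G) (w : Fin ρ.dim → ℂ) :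
    indMap ψ hψ (indTensor ρ x w) = cosetMap h x (ψ w) := by
  simp [indMap, indTensor]

open scoped Classical in
/-- Every element of the induced representation is a sum `∑ t, t ⊗ w_t` over a transversal. -/
theorem exists_sum_indTensor {T : G → Set G} (hT : ∀ h, Subgroup.IsComplement (T h) (Zc h : Set G)) {h : G} (ρ : IrrepClass (Zc h))
    (a : Representation.IndV (Zc h).subtype ρ.rep) :
    ∃ w : T h → Fin ρ.dim → ℂ, a = ∑ t : T h, indTensor ρ t (w t) := by
  classical
  let σ : (T h → Fin ρ.dim → ℂ) →ₗ[ℂ] Representation.IndV (Zc h).subtype ρ.rep :=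
    ∑ t : T h, (Representation.IndV.mk (Zc h).subtype ρ.rep (t : G)⁻¹) ∘ₗ LinearMap.proj t
  have hσ : ∀ w, σ w = ∑ t : T h, indTensor ρ t (w t) := fun w => by
    simp [σ, indTensor]
  have hr : LinearMap.range σ = ⊤ := by
    -- A map out of the induced representation is determined by its values on tensors, so it
    -- suffices that the projection modulo the range kills these.
    have : (LinearMap.range σ).mkQ = 0 := by
      apply Representation.IndV.hom_ext
      intro x
      refine LinearMap.ext fun w => ?_
      obtain ⟨⟨t, z⟩, htz⟩ := (hT h).2 x⁻¹
      have hmem : Representation.IndV.mk (Zc h).subtype ρ.rep x w ∈ LinearMap.range σ := by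
        refine ⟨Pi.single (M := fun _ : T h => Fin ρ.dim → ℂ) t (ρ.rep z w), ?_⟩
        rw [hσ, Finset.sum_eq_single t]
        · rw [Pi.single_eq_same, ← indTensor_mul, indTensor]
          have htz' : (t : G) * (z : G) = x⁻¹ := htz
          rw [htz', inv_inv]
        · intro t' _ ht'
          rw [Pi.single_eq_of_ne ht']
          simp [indTensor]
        · simp
      exact (Submodule.Quotient.mk_eq_zero _).2 hmem
    rw [← Submodule.ker_mkQ (LinearMap.range σ), this, LinearMap.ker_zero]
  obtain ⟨w, hw⟩ : a ∈ LinearMap.range σ := hr ▸ Submodule.mem_top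
  exact ⟨w, by rw [← hw, hσ]⟩

-- Coset components are recovered by inner products; a sum that vanishes has vanishing components,
-- whence the injectivity of `indMap`.
open scoped Classical in
theorem inner_cosetMap_sum {T : G → Set G} (hT : ∀ h, Subgroup.IsComplement (T h) (Zc h : Set G)) {h : G} {ρ : IrrepClass (Zc h)}
    (ψ : (Fin ρ.dim → ℂ) →ₗ[ℂ] EuclideanSpace ℂ (Zc h)) (w : T h → Fin ρ.dim → ℂ) (t : T h) :
    inner ℂ (cosetMap h t (ψ (w t))) (∑ s : T h, cosetMap h s (ψ (w s))) =
      inner ℂ (ψ (w t)) (ψ (w t)) := by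
  classical
  rw [inner_sum, Finset.sum_eq_single t]
  · rw [inner_cosetMap_self]
  · intro s _ hs
    exact inner_cosetMap_of_ne hT t s (fun e => hs (by cases e; rfl)) _ _
  · simp

/-- `indMap` for the embedding `ψ` of `ρ` provided by the Fourier basis is the isomorphism with the
induced representation. For simplicity, a nonzero vector of a submodule has a nonzero component over
some coset. One ket moves this component to the coset of `1` and kills the rest; irreducibility of
`ρ` then gives everything over that coset, and kets distribute it to the other cosets. -/
theorem doubleBlock_irreducible {T : G → Set G} (hT : ∀ h, Subgroup.IsComplement (T h) (Zc h : Set G))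
    (B : ∀ h : G, FourierBasis (Zc h)) (h : G) (ρ : IrrepClass (Zc h)) (j : Fin ρ.dim) :
    (∃ W : Submodule (QuantumDouble G) (QuantumDouble G),
      (W : Set (QuantumDouble G)) = doubleBlock T B h ρ j ∧
      IsSimpleModule (QuantumDouble G) W) ∧
    ∃ φ : Representation.IndV (Zc h).subtype ρ.rep ≃ₗ[ℂ] doubleBlock T B h ρ j,
      ∀ (g h' x : G) (w : Fin ρ.dim → ℂ),
        (x⁻¹ * h' * x = h →
          QuantumDouble.ket g h' * (φ (indTensor ρ x w) : QuantumDouble G) =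
            φ (indTensor ρ (g * x) w)) ∧
        (x⁻¹ * h' * x ≠ h →
          QuantumDouble.ket g h' * (φ (indTensor ρ x w) : QuantumDouble G) = 0) := by
  classical
  obtain ⟨ψ, hinj, hran, hact⟩ := (B h).isotypic ρ j
  have hψ : ∀ z w, ψ (ρ.rep z w) = leftTranslate z (ψ w) := fun z w => by
    ext y; rw [hact, leftTranslate_apply]
  have hsum : ∀ w : T h → Fin ρ.dim → ℂ, indMap ψ hψ (∑ t : T h, indTensor ρ t (w t)) =
      ∑ t : T h, cosetMap h t (ψ (w t)) := fun w => by
    rw [map_sum]; simp only [indMap_indTensor]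
  have hθ : Function.Injective (indMap ψ hψ) := by
    rw [injective_iff_map_eq_zero]
    intro a ha
    obtain ⟨w, rfl⟩ := exists_sum_indTensor hT ρ a
    rw [hsum] at ha
    have : ∀ t, w t = 0 := fun t => by
      have h1 := inner_cosetMap_sum hT ψ w t
      rw [ha, inner_zero_right] at h1
      exact hinj (by rw [inner_self_eq_zero.1 h1.symm, map_zero])
    simp [this, indTensor]
  have hle : ∀ x w, cosetMap h x (ψ w) ∈ doubleBlock T B h ρ j := by
    intro x w
    obtain ⟨⟨t, z⟩, htz⟩ := (hT h).2 x
    have htz' : (t : G) * ((z : Zc h) : G) = x := htz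
    rw [← htz', cosetMap_mul, ← hψ]
    have h1 : ψ (ρ.rep z w) ∈ Submodule.span ℂ (Set.range fun i => (B h).vec ⟨ρ, i, j⟩) :=
      hran ▸ LinearMap.mem_range_self _ _
    have h3 := Submodule.mem_map_of_mem (f := cosetMap h (t : G)) h1
    rw [Submodule.map_span] at h3
    refine Submodule.span_mono ?_ h3
    rintro _ ⟨_, ⟨i, rfl⟩, rfl⟩
    exact ⟨(t, i), rfl⟩
  have hrange : LinearMap.range (indMap ψ hψ) = doubleBlock T B h ρ j := by
    refine le_antisymm ?_ ?_
    · rintro _ ⟨a, rfl⟩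
      obtain ⟨w, rfl⟩ := exists_sum_indTensor hT ρ a
      rw [hsum]
      exact Submodule.sum_mem _ fun t _ => hle _ _
    · rw [doubleBlock, Submodule.span_le]
      rintro _ ⟨⟨t, i⟩, rfl⟩
      have h1 : (B h).vec ⟨ρ, i, j⟩ ∈ LinearMap.range ψ :=
        hran ▸ Submodule.subset_span ⟨i, rfl⟩
      obtain ⟨w, hw⟩ := h1
      exact ⟨indTensor ρ t w, by rw [indMap_indTensor, hw]; rfl⟩
  constructor
  · let W : Submodule (QuantumDouble G) (QuantumDouble G) :=
      { carrier := doubleBlock T B h ρ j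
        add_mem' := fun ha hb => Submodule.add_mem _ ha hb
        zero_mem' := Submodule.zero_mem _
        smul_mem' := by
          intro a x hx
          rw [SetLike.mem_coe, ← hrange] at hx
          obtain ⟨b, rfl⟩ := hx
          obtain ⟨w, rfl⟩ := exists_sum_indTensor hT ρ b
          rw [hsum, smul_eq_mul, QuantumDouble.eq_sum_ket a, Finset.sum_mul]
          refine Submodule.sum_mem _ fun p _ => ?_
          rw [Finset.mul_sum]
          refine Submodule.sum_mem _ fun t _ => ?_
          rw [smul_mul_assoc]
          refine Submodule.smul_mem _ _ ?_
          by_cases hc : (t : G)⁻¹ * p.2 * t = h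
          · rw [(ket_mul_cosetMap h p.1 p.2 t _).1 hc]
            exact hle _ _
          · rw [(ket_mul_cosetMap h p.1 p.2 t _).2 hc]
            exact Submodule.zero_mem _ }
    refine ⟨W, rfl, ?_⟩
    have hWmem : ∀ x w, cosetMap h x (ψ w) ∈ W := hle
    rw [isSimpleModule_iff_isAtom]
    obtain ⟨w₀, hw₀⟩ := Representation.IsIrreducible.exists_ne_zero ρ.irreducible
    constructor
    · intro hbot
      have h1 := hWmem 1 w₀
      rw [hbot, Submodule.mem_bot] at h1
      have h2 := inner_cosetMap_self h 1 (ψ w₀) (ψ w₀)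
      rw [h1, inner_zero_left] at h2
      exact hw₀ (hinj (by rw [inner_self_eq_zero.1 h2.symm, map_zero]))
    · intro N hN
      by_contra hNbot
      refine hN.not_ge ?_
      obtain ⟨n, hn, hn0⟩ := Submodule.exists_mem_ne_zero_of_ne_bot hNbot
      have hnW : n ∈ doubleBlock T B h ρ j := hN.le hn
      rw [← hrange] at hnW
      obtain ⟨b, rfl⟩ := hnW
      obtain ⟨w, rfl⟩ := exists_sum_indTensor hT ρ b
      rw [hsum] at hn hn0
      obtain ⟨t, ht⟩ : ∃ t, w t ≠ 0 := by
        by_contra! hw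
        exact hn0 (by simp [hw])
      have hcomp : cosetMap h 1 (ψ (w t)) ∈ N := by
        -- For `h' = t h t⁻¹` the condition `s⁻¹ h' s = h` says that `t⁻¹ s` is in `Z(h)`, so only
        -- the coset of `t` survives, and the factor `t⁻¹` carries it to the coset of `1`.
        have h1 := N.smul_mem (QuantumDouble.ket (t : G)⁻¹ ((t : G) * h * (t : G)⁻¹)) hn
        rw [smul_eq_mul, Finset.mul_sum, Finset.sum_eq_single t] at h1
        · rwa [(ket_mul_cosetMap h _ _ (t : G) _).1 (by group), inv_mul_cancel] at h1
        · intro s _ hs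
          refine (ket_mul_cosetMap h _ _ (s : G) _).2 fun e => hs ?_
          have hz : (t : G)⁻¹ * s ∈ Zc h := by
            rw [Subgroup.mem_centralizer_singleton_iff]
            have : (t : G) * h * (t : G)⁻¹ * s = s * h := by
              calc (t : G) * h * (t : G)⁻¹ * s =
                  s * ((s : G)⁻¹ * (t * h * (t : G)⁻¹) * s) := by group
                _ = s * h := by rw [e]
            calc (t : G)⁻¹ * s * h = (t : G)⁻¹ * (s * h) := by group
              _ = (t : G)⁻¹ * ((t : G) * h * (t : G)⁻¹ * s) := by rw [this]
              _ = h * ((t : G)⁻¹ * s) := by group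
          have h2 := (hT h).1 (a₁ := (t, ⟨_, hz⟩)) (a₂ := (s, 1)) (by simp)
          exact (Prod.ext_iff.1 h2).1.symm
        · simp
      -- The vectors of `ρ` whose copy over the coset of `1` belongs to `N`.
      let P : Submodule ℂ (Fin ρ.dim → ℂ) :=
        (N.restrictScalars ℂ).comap (cosetMap h 1 ∘ₗ ψ)
      have hP : P = ⊤ := by
        refine (Representation.IsIrreducible.submodule_eq_bot_or_top ρ.irreducible P ?_).resolve_left ?_
        · intro z v hv
          have h1 := N.smul_mem (QuantumDouble.ket (z : G) h) (show cosetMap h 1 (ψ v) ∈ N from hv)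
          rw [smul_eq_mul, (ket_mul_cosetMap h _ _ 1 _).1 (by simp), mul_one] at h1
          change cosetMap h 1 (ψ (ρ.rep z v)) ∈ N
          rw [hψ, ← cosetMap_mul, one_mul]
          exact h1
        · intro hbot
          have h1 : w t ∈ P := hcomp
          rw [hbot, Submodule.mem_bot] at h1
          exact ht h1
      have hall : ∀ x v, cosetMap h x (ψ v) ∈ N := by
        intro x v
        have h1 : v ∈ P := hP ▸ Submodule.mem_top
        have h2 := N.smul_mem (QuantumDouble.ket x h) (show cosetMap h 1 (ψ v) ∈ N from h1)
        rwa [smul_eq_mul, (ket_mul_cosetMap h _ _ 1 _).1 (by simp), mul_one] at h2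
      intro x hx
      have hx' : x ∈ doubleBlock T B h ρ j := hx
      rw [← hrange] at hx'
      obtain ⟨b, rfl⟩ := hx'
      obtain ⟨w', rfl⟩ := exists_sum_indTensor hT ρ b
      rw [hsum]
      exact Submodule.sum_mem _ fun t _ => hall _ _
  · refine ⟨(LinearEquiv.ofInjective _ hθ).trans (LinearEquiv.ofEq _ _ hrange), ?_⟩
    intro g h' x w
    have hφ : ∀ x w, (((LinearEquiv.ofInjective _ hθ).trans (LinearEquiv.ofEq _ _ hrange))
        (indTensor ρ x w) : QuantumDouble G) = cosetMap h x (ψ w) := fun x w =>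
      indMap_indTensor ψ hψ x w
    rw [hφ, hφ]
    exact ket_mul_cosetMap h g h' x (ψ w)

end Decomposition

/-! ## The Hilbert space of finite superpositions -/

section FiniteSuperpositions

variable {β : Type*}

/-- The inner product of finite superpositions. -/
noncomputable def braket (u v : β →₀ ℂ) : ℂ := u.sum fun s a => star a * v s

theorem braket_eq_sum (u v : β →₀ ℂ) (S : Finset β) (hS : u.support ⊆ S) :
    braket u v = ∑ s ∈ S, star (u s) * v s :=
  Finsupp.sum_of_support_subset _ hS _ (by simp)

theorem braket_add_left (u u' v : β →₀ ℂ) : braket (u + u') v = braket u v + braket u' v := by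
  classical
  exact Finsupp.sum_add_index' (by simp) (by simp [add_mul])

theorem braket_smul_left (c : ℂ) (u v : β →₀ ℂ) : braket (c • u) v = star c * braket u v := by
  rw [braket, Finsupp.sum_smul_index' (by simp), braket, Finsupp.mul_sum]
  simp [mul_assoc]

theorem braket_conj (u v : β →₀ ℂ) : star (braket v u) = braket u v := by
  classical
  rw [braket_eq_sum u v (u.support ∪ v.support) Finset.subset_union_left,
    braket_eq_sum v u (u.support ∪ v.support) Finset.subset_union_right]
  simp [mul_comm]

theorem braket_add_right (u v v' : β →₀ ℂ) : braket u (v + v') = braket u v + braket u v' := by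
  rw [← braket_conj, braket_add_left, star_add, braket_conj, braket_conj]

theorem braket_smul_right (c : ℂ) (u v : β →₀ ℂ) : braket u (c • v) = c * braket u v := by
  rw [← braket_conj, braket_smul_left, star_mul, braket_conj, star_star, mul_comm]

theorem braket_zero_left (v : β →₀ ℂ) : braket 0 v = 0 := by simp [braket]

theorem braket_zero_right (v : β →₀ ℂ) : braket v 0 = 0 := by simp [braket]

open scoped Classical in
theorem braket_single (s t : β) (a b : ℂ) :
    braket (Finsupp.single s a) (Finsupp.single t b) = if s = t then star a * b else 0 := by
  rw [braket, Finsupp.sum_single_index (by simp), Finsupp.single_apply]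
  split_ifs with h1 h2 h2
  · rfl
  · exact absurd h1.symm h2
  · exact absurd h2.symm h1
  · simp

theorem l2norm_sq (v : β →₀ ℂ) : l2norm v ^ 2 = v.sum fun _ a => ‖a‖ ^ 2 :=
  Real.sq_sqrt (Finset.sum_nonneg fun _ _ => by positivity)

theorem braket_self (v : β →₀ ℂ) : braket v v = ((l2norm v ^ 2 : ℝ) : ℂ) := by
  rw [l2norm_sq, braket, Finsupp.sum, Finsupp.sum, Complex.ofReal_sum]
  refine Finset.sum_congr rfl fun s _ => ?_
  have := Complex.conj_mul' (v s)
  push_cast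
  exact this

theorem l2norm_nonneg (v : β →₀ ℂ) : 0 ≤ l2norm v := Real.sqrt_nonneg _

theorem l2norm_eq (v : β →₀ ℂ) : l2norm v = Real.sqrt (braket v v).re := by
  rw [braket_self, Complex.ofReal_re, Real.sqrt_sq (l2norm_nonneg v)]

/-- The inner product space structure. -/
@[reducible] noncomputable def braketCore : InnerProductSpace.Core ℂ (β →₀ ℂ) where
  inner := braket
  conj_inner_symm u v := braket_conj u v
  re_inner_nonneg v := by
    rw [braket_self]
    exact sq_nonneg (l2norm v)
  add_left := braket_add_left
  smul_left u v c := braket_smul_left c u v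
  definite v h := by
    change braket v v = 0 at h
    rw [braket_self] at h
    have h1 : l2norm v ^ 2 = 0 := by exact_mod_cast h
    rw [l2norm_sq, Finsupp.sum, Finset.sum_eq_zero_iff_of_nonneg (fun _ _ => by positivity)] at h1
    ext s
    by_cases hs : s ∈ v.support
    · simpa using h1 s hs
    · simpa using hs

/-- The triangle inequality comes from the norm that `braketCore` induces. -/
theorem l2norm_add_le (u v : β →₀ ℂ) : l2norm (u + v) ≤ l2norm u + l2norm v := by
  let _ := (braketCore (β := β)).toNormedAddCommGroup
  have h : ∀ w : β →₀ ℂ, ‖w‖ = l2norm w := fun w => (l2norm_eq w).symm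
  rw [← h, ← h, ← h]
  exact norm_add_le u v

theorem l2norm_sub_le (u v w : β →₀ ℂ) : l2norm (u - w) ≤ l2norm (u - v) + l2norm (v - w) := by
  have := l2norm_add_le (u - v) (v - w)
  rwa [sub_add_sub_cancel] at this

theorem l2norm_smul (c : ℂ) (v : β →₀ ℂ) : l2norm (c • v) = ‖c‖ * l2norm v := by
  rw [l2norm_eq, l2norm_eq, braket_smul_left, braket_smul_right, ← mul_assoc]
  have : star c * c = ((‖c‖ ^ 2 : ℝ) : ℂ) := by
    rw [Complex.ofReal_pow]; exact Complex.conj_mul' c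
  rw [this, Complex.re_ofReal_mul, Real.sqrt_mul (by positivity), Real.sqrt_sq (norm_nonneg c)]

theorem l2norm_sub_comm (u v : β →₀ ℂ) : l2norm (u - v) = l2norm (v - u) := by
  rw [← neg_sub, ← neg_one_smul ℂ, l2norm_smul]; simp

/-- Linear maps that take the basis to an orthonormal family are isometries. -/
theorem l2norm_map_of_orthonormal {γ : Type*} (f : (β →₀ ℂ) →ₗ[ℂ] (γ →₀ ℂ))
    (hf : ∀ s t, braket (f (Finsupp.single s 1)) (f (Finsupp.single t 1)) =
      braket (Finsupp.single s 1) (Finsupp.single t (1 : ℂ))) (v : β →₀ ℂ) :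
    l2norm (f v) = l2norm v := by
  classical
  have key : ∀ u v, braket (f u) (f v) = braket u v := by
    intro u v
    induction u using Finsupp.induction_linear with
    | zero => simp [braket_zero_left]
    | add u u' h h' => rw [map_add, braket_add_left, braket_add_left, h, h']
    | single s a =>
      induction v using Finsupp.induction_linear with
      | zero => simp [braket_zero_right]
      | add u u' h h' => rw [map_add, braket_add_right, braket_add_right, h, h']
      | single t b =>
        have h1 : ∀ (s : β) (a : ℂ), Finsupp.single s a = a • Finsupp.single s 1 := by simp
        rw [h1 s a, h1 t b, map_smul, map_smul, braket_smul_left, braket_smul_right,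
          braket_smul_left, braket_smul_right, hf]
  rw [l2norm_eq, l2norm_eq, key]

theorem l2norm_mapDomain {γ : Type*} (f : β → γ) (hf : Function.Injective f) (v : β →₀ ℂ) :
    l2norm (Finsupp.mapDomain f v) = l2norm v := by
  classical
  refine l2norm_map_of_orthonormal (Finsupp.lmapDomain ℂ ℂ f) (fun s t => ?_) v
  simp [Finsupp.lmapDomain_apply, Finsupp.mapDomain_single, braket_single, hf.eq_iff]

/-- The theorem of Pythagoras for superpositions with disjoint supports. -/
theorem l2norm_sq_sum {κ : Type*} (S : Finset κ) (v : κ → β →₀ ℂ)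
    (hv : ∀ a b, a ≠ b → Disjoint (v a).support (v b).support) :
    l2norm (∑ a ∈ S, v a) ^ 2 = ∑ a ∈ S, l2norm (v a) ^ 2 := by
  classical
  simp only [l2norm_sq]
  induction S using Finset.induction_on with
  | empty => simp
  | insert a S ha ih =>
    rw [Finset.sum_insert ha, Finset.sum_insert ha, ← ih, Finsupp.sum_add_index_of_disjoint]
    refine Finset.disjoint_of_subset_right Finsupp.support_finsetSum ?_
    rw [Finset.disjoint_biUnion_right]
    intro b hb
    exact hv a b (fun e => ha (e ▸ hb))

end FiniteSuperpositions

/-! ## Gates without side conditions -/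

section RawGates

open scoped symmDiff

/-- A gate whose wires need not be distinct. -/
inductive Raw : Type
  | not (i : ℕ) : Raw
  | cnot (a i : ℕ) : Raw
  | tof (a b i : ℕ) : Raw
  | had (i : ℕ) : Raw
  | tg (i : ℕ) : Raw

namespace Raw

def code : Raw → List Bool
  | .not i => [false, false, false] ++ wireCode i
  | .cnot a i => [false, false, true] ++ wireCode a ++ wireCode i
  | .tof a b i => [false, true, false] ++ wireCode a ++ wireCode b ++ wireCode i
  | .had i => [false, true, true] ++ wireCode i
  | .tg i => [true, false, false] ++ wireCode i

def Valid : Raw → Prop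
  | .not _ => True
  | .cnot a i => a ≠ i
  | .tof a b i => a ≠ b ∧ a ≠ i ∧ b ≠ i
  | .had _ => True
  | .tg _ => True

/-- The wires of the gate satisfy `P`. -/
def On (P : ℕ → Prop) : Raw → Prop
  | .not i => P i
  | .cnot a i => P a ∧ P i
  | .tof a b i => P a ∧ P b ∧ P i
  | .had i => P i
  | .tg i => P i

/-- The classical gates: they take basis states to basis states. -/
def Cl : Raw → Prop
  | .had _ => False
  | .tg _ => False
  | _ => True

noncomputable def onBasis : Raw → BasisState → QState
  | .not i, s => Finsupp.single (Function.update s i (!(s i))) 1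
  | .cnot a i, s => Finsupp.single (Function.update s i (xor (s i) (s a))) 1
  | .tof a b i, s => Finsupp.single (Function.update s i (xor (s i) (s a && s b))) 1
  | .had i, s =>
      Finsupp.single (Function.update s i false) (1 / (Real.sqrt 2 : ℂ)) +
      Finsupp.single (Function.update s i true)
        ((if s i = true then -1 else 1) / (Real.sqrt 2 : ℂ))
  | .tg i, s =>
      Finsupp.single s (if s i = true then Complex.exp (Complex.I * Real.pi / 4) else 1)

noncomputable def apply (g : Raw) : QState →ₗ[ℂ] QState :=
  Finsupp.linearCombination ℂ g.onBasis

/-- The action of a classical gate on basis states. -/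
def act : Raw → BasisState → BasisState
  | .not i, s => Function.update s i (!(s i))
  | .cnot a i, s => Function.update s i (xor (s i) (s a))
  | .tof a b i, s => Function.update s i (xor (s i) (s a && s b))
  | .had _, s => s
  | .tg _, s => s

/-- The inverse of a gate. -/
def inv : Raw → List Raw
  -- The gate `T` has order 8, so its inverse is available within the gate set; the other gates are
  -- involutions.
  | .tg i => List.replicate 7 (.tg i)
  | g => [g]

@[simp] theorem apply_single (g : Raw) (s : BasisState) (c : ℂ) :
    g.apply (Finsupp.single s c) = c • g.onBasis s := by
  simp [apply]

end Raw

def Gate.toRaw : Gate → Raw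
  | .not i => .not i
  | .cnot a i _ => .cnot a i
  | .toffoli a b i _ _ _ => .tof a b i
  | .hadamard i => .had i
  | .tgate i => .tg i

theorem Gate.toRaw_code (g : Gate) : g.toRaw.code = g.code := by cases g <;> rfl

theorem Gate.toRaw_valid (g : Gate) : g.toRaw.Valid := by
  cases g <;> simp_all [Gate.toRaw, Raw.Valid]

theorem Gate.toRaw_apply (g : Gate) : g.toRaw.apply = g.apply := by
  have : g.toRaw.onBasis = g.onBasis := by
    funext s
    cases g <;> rfl
  rw [Raw.apply, Gate.apply, this]

theorem Raw.Valid.exists_gate {g : Raw} (h : g.Valid) : ∃ g' : Gate, g'.toRaw = g := by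
  cases g with
  | not i => exact ⟨.not i, rfl⟩
  | cnot a i => exact ⟨.cnot a i h, rfl⟩
  | tof a b i => exact ⟨.toffoli a b i h.1 h.2.1 h.2.2, rfl⟩
  | had i => exact ⟨.hadamard i, rfl⟩
  | tg i => exact ⟨.tgate i, rfl⟩

/-- The code of a list of raw gates. -/
def rcode (C : List Raw) : List Bool := C.flatMap Raw.code

/-- The action of a list of raw gates. -/
noncomputable def rapply : List Raw → QState →ₗ[ℂ] QState
  | [] => LinearMap.id
  | g :: C => rapply C ∘ₗ g.apply

def ract : List Raw → BasisState → BasisState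
  | [], s => s
  | g :: C, s => ract C (g.act s)

/-- The inverse circuit. -/
def rinv : List Raw → List Raw
  | [] => []
  | g :: C => rinv C ++ g.inv

@[simp] theorem rapply_nil (v : QState) : rapply [] v = v := rfl
@[simp] theorem rapply_cons (g : Raw) (C : List Raw) (v : QState) :
    rapply (g :: C) v = rapply C (g.apply v) := rfl
@[simp] theorem ract_nil (s : BasisState) : ract [] s = s := rfl
@[simp] theorem ract_cons (g : Raw) (C : List Raw) (s : BasisState) :
    ract (g :: C) s = ract C (g.act s) := rfl

@[simp] theorem rapply_append (C D : List Raw) (v : QState) :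
    rapply (C ++ D) v = rapply D (rapply C v) := by
  induction C generalizing v with
  | nil => rfl
  | cons g C ih => simp [ih]

@[simp] theorem ract_append (C D : List Raw) (s : BasisState) :
    ract (C ++ D) s = ract D (ract C s) := by
  induction C generalizing s with
  | nil => rfl
  | cons g C ih => simp [ih]

@[simp] theorem rcode_nil : rcode [] = [] := rfl
@[simp] theorem rcode_cons (g : Raw) (C : List Raw) : rcode (g :: C) = g.code ++ rcode C := rfl
@[simp] theorem rcode_append (C D : List Raw) : rcode (C ++ D) = rcode C ++ rcode D := by
  simp [rcode]

theorem rcode_flatMap {α : Type*} (L : List α) (f : α → List Raw) :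
    rcode (L.flatMap f) = L.flatMap fun a => rcode (f a) := by
  simp [rcode, List.flatMap_assoc]

theorem Circuit.apply_eq (C : Circuit) (v : QState) : C.apply v = rapply (C.map Gate.toRaw) v := by
  induction C generalizing v with
  | nil => rfl
  | cons g C ih =>
    rw [List.map_cons, rapply_cons, ← ih, Gate.toRaw_apply]
    rfl

theorem Circuit.code_eq (C : Circuit) : C.code = rcode (C.map Gate.toRaw) := by
  simp [Circuit.code, rcode, List.flatMap_map, Gate.toRaw_code]

theorem Circuit.map_toRaw_valid (C : Circuit) : ∀ g ∈ C.map Gate.toRaw, g.Valid := by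
  intro g hg
  obtain ⟨g', -, rfl⟩ := List.mem_map.1 hg
  exact g'.toRaw_valid

theorem exists_circuit (C : List Raw) (hC : ∀ g ∈ C, g.Valid) :
    ∃ D : Circuit, D.map Gate.toRaw = C := by
  induction C with
  | nil => exact ⟨[], rfl⟩
  | cons g C ih =>
    obtain ⟨D, hD⟩ := ih fun g' hg => hC g' (List.mem_cons_of_mem _ hg)
    obtain ⟨g', hg'⟩ := (hC g List.mem_cons_self).exists_gate
    exact ⟨g' :: D, by simp [hD, hg']⟩

/-! ### Unitarity -/

theorem update_eq_update_iff (s t : BasisState) (i : ℕ) (a b : Bool) :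
    Function.update s i a = Function.update t i b ↔ a = b ∧ ∀ j, j ≠ i → s j = t j := by
  constructor
  · intro h
    refine ⟨by simpa using congrFun h i, fun j hj => ?_⟩
    simpa [hj] using congrFun h j
  · rintro ⟨rfl, h⟩
    funext j
    by_cases hj : j = i
    · subst hj; simp
    · simp [hj, h j hj]

theorem Raw.act_injective {g : Raw} (hg : g.Valid) : Function.Injective g.act := by
  have key : Function.LeftInverse g.act g.act := by
    intro s
    funext j
    cases g with
    | not i => by_cases hj : j = i <;> simp [Raw.act, hj]
    | cnot a i =>
      have ha : a ≠ i := hg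
      by_cases hj : j = i <;> simp [Raw.act, hj, ha]
    | tof a b i =>
      obtain ⟨-, ha, hb⟩ : a ≠ b ∧ a ≠ i ∧ b ≠ i := hg
      by_cases hj : j = i <;> simp [Raw.act, hj, ha, hb]
    | had i => rfl
    | tg i => rfl
  exact key.injective

theorem Raw.Cl.onBasis {g : Raw} (hg : g.Cl) (s : BasisState) :
    g.onBasis s = Finsupp.single (g.act s) 1 := by
  cases g <;> first | rfl | exact hg.elim

theorem sqrt_two_mul_self : ((Real.sqrt 2 : ℝ) : ℂ) * ((Real.sqrt 2 : ℝ) : ℂ) = 2 := by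
  rw [← Complex.ofReal_mul, Real.mul_self_sqrt (by norm_num)]
  norm_num

theorem sqrt_two_ne_zero : ((Real.sqrt 2 : ℝ) : ℂ) ≠ 0 := by
  intro h
  have := sqrt_two_mul_self
  rw [h] at this
  norm_num at this

/-- The phase of the `T` gate. -/
noncomputable def phase : ℂ := Complex.exp (Complex.I * Real.pi / 4)

theorem phase_pow_four : phase ^ 4 = -1 := by
  rw [phase, ← Complex.exp_nat_mul, ← Complex.exp_pi_mul_I]
  congr 1
  push_cast
  ring

theorem phase_norm : ‖phase‖ = 1 := by
  rw [phase, show Complex.I * Real.pi / 4 = ((Real.pi / 4 : ℝ) : ℂ) * Complex.I by push_cast; ring,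
    Complex.norm_exp_ofReal_mul_I]

/-- The images of the basis states are orthonormal: classical gates act injectively, the phase of
`T` has modulus 1, and for the Hadamard gate the four cases of the two bits on its wire are
computed. -/
theorem Raw.l2norm_apply {g : Raw} (hg : g.Valid) (v : QState) :
    l2norm (g.apply v) = l2norm v := by
  classical
  refine l2norm_map_of_orthonormal g.apply (fun s t => ?_) v
  simp only [Raw.apply_single, one_smul]
  by_cases hcl : g.Cl
  · rw [hcl.onBasis, hcl.onBasis, braket_single, braket_single, (Raw.act_injective hg).eq_iff]
  · cases g with
    | not i => exact absurd trivial hcl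
    | cnot a i => exact absurd trivial hcl
    | tof a b i => exact absurd trivial hcl
    | tg i =>
      simp only [Raw.onBasis, braket_single]
      split_ifs with h1 h2 h3 h3
      · have := Complex.conj_mul' phase
        rw [phase_norm] at this
        simpa [phase] using this
      · exact absurd (h1 ▸ h2) h3
      · exact absurd (h1 ▸ h3) h2
      · simp
      · rfl
    | had i =>
      simp only [Raw.onBasis, braket_add_left, braket_add_right, braket_single,
        update_eq_update_iff]
      have hst : s = t ↔ s i = t i ∧ ∀ j, j ≠ i → s j = t j := by
        constructor
        · rintro rfl; simp
        · rintro ⟨h1, h2⟩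
          funext j
          by_cases hj : j = i
          · rw [hj, h1]
          · exact h2 j hj
      have h2 := sqrt_two_mul_self
      have h0 := sqrt_two_ne_zero
      rw [hst]
      -- The other wires enter only through the question whether the two states agree on them.
      generalize (∀ j, j ≠ i → s j = t j) = p
      by_cases h : p
      · cases hs : s i <;> cases ht : t i <;> simp [h] <;> field_simp <;>
          simp [pow_two, h2] <;> norm_num
      · simp [h]

theorem rapply_l2norm {C : List Raw} (hC : ∀ g ∈ C, g.Valid) (v : QState) :
    l2norm (rapply C v) = l2norm v := by
  induction C generalizing v with
  | nil => rfl
  | cons g C ih =>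
    rw [rapply_cons, ih fun g' hg => hC g' (List.mem_cons_of_mem _ hg),
      Raw.l2norm_apply (hC g List.mem_cons_self)]

theorem Raw.apply_apply_inv {g : Raw} (hg : g.Valid) (v : QState) :
    rapply g.inv (g.apply v) = v := by
  classical
  induction v using Finsupp.induction_linear with
  | zero => simp
  | add u v hu hv => rw [map_add, map_add, hu, hv]
  | single s c =>
    have hc : Finsupp.single s c = c • Finsupp.single s (1 : ℂ) := by simp
    rw [hc, map_smul, map_smul]
    congr 1
    rw [Raw.apply_single, one_smul]
    by_cases hcl : g.Cl
    · have hinv : g.inv = [g] := by cases g <;> first | rfl | exact hcl.elim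
      rw [hcl.onBasis, hinv, rapply_cons, rapply_nil, Raw.apply_single, hcl.onBasis, one_smul]
      congr 1
      funext j
      cases g with
      | not i => by_cases hj : j = i <;> simp [Raw.act, hj]
      | cnot a i =>
        have ha : a ≠ i := hg
        by_cases hj : j = i <;> simp [Raw.act, hj, ha]
      | tof a b i =>
        obtain ⟨-, ha, hb⟩ : a ≠ b ∧ a ≠ i ∧ b ≠ i := hg
        by_cases hj : j = i <;> simp [Raw.act, hj, ha, hb]
      | had i => exact hcl.elim
      | tg i => exact hcl.elim
    · cases g with
      | not i => exact absurd trivial hcl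
      | cnot a i => exact absurd trivial hcl
      | tof a b i => exact absurd trivial hcl
      | tg i =>
        have h8 : phase ^ 8 = 1 := by
          have := phase_pow_four
          linear_combination (phase ^ 4 - 1) * this
        change rapply (List.replicate 7 (.tg i)) (Finsupp.single s (if s i = true then phase else 1)) = _
        simp only [List.replicate, rapply_cons, rapply_nil, Raw.apply_single, Raw.onBasis,
          Finsupp.smul_single, smul_eq_mul]
        change Finsupp.single s (_ * (if s i = true then phase else 1)) = _
        congr 1
        split_ifs
        · change phase * phase * phase * phase * phase * phase * phase * phase = 1
          linear_combination h8
        · simp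
      | had i =>
        have h2 := sqrt_two_mul_self
        have h0 := sqrt_two_ne_zero
        simp only [Raw.inv, rapply_cons, rapply_nil, Raw.onBasis, map_add, Raw.apply_single,
          Function.update_self, Function.update_idem, smul_add, Finsupp.smul_single, smul_eq_mul]
        cases hs : s i
        · have : Function.update s i false = s := by rw [← hs]; simp
          rw [this]
          have e1 : ((Real.sqrt 2 : ℝ) : ℂ)⁻¹ * ((Real.sqrt 2 : ℝ) : ℂ)⁻¹ = 1 / 2 := by
            rw [← mul_inv, h2]; norm_num
          ext j
          simp only [Finsupp.add_apply, Finsupp.single_apply]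
          simp only [Bool.false_eq_true, if_false, if_true, one_div, neg_div]
          split_ifs <;> simp [e1] <;> ring
        · have : Function.update s i true = s := by rw [← hs]; simp
          rw [this]
          have e1 : ((Real.sqrt 2 : ℝ) : ℂ)⁻¹ * ((Real.sqrt 2 : ℝ) : ℂ)⁻¹ = 1 / 2 := by
            rw [← mul_inv, h2]; norm_num
          ext j
          simp only [Finsupp.add_apply, Finsupp.single_apply]
          simp only [Bool.false_eq_true, if_false, if_true, one_div, neg_div]
          split_ifs <;> simp [e1] <;> ring

theorem rapply_rinv {C : List Raw} (hC : ∀ g ∈ C, g.Valid) (v : QState) :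
    rapply (rinv C) (rapply C v) = v := by
  induction C generalizing v with
  | nil => rfl
  | cons g C ih =>
    rw [rinv, rapply_append, rapply_cons, ih fun g' hg => hC g' (List.mem_cons_of_mem _ hg),
      Raw.apply_apply_inv (hC g List.mem_cons_self)]

theorem rinv_forall {Q : Raw → Prop} {C : List Raw} (hC : ∀ g ∈ C, Q g) : ∀ g ∈ rinv C, Q g := by
  induction C with
  | nil => simp [rinv]
  | cons g C ih =>
    intro g' hg'
    rw [rinv, List.mem_append] at hg'
    rcases hg' with h | h
    · exact ih (fun g hg => hC g (List.mem_cons_of_mem _ hg)) g' h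
    · have : g' = g := by
        cases g <;> first | exact List.eq_of_mem_singleton h | exact List.eq_of_mem_replicate h
      exact this ▸ hC g List.mem_cons_self

/-! ### Classical circuits -/

theorem rapply_classical {C : List Raw} (hC : ∀ g ∈ C, g.Cl) (s : BasisState) (c : ℂ) :
    rapply C (Finsupp.single s c) = Finsupp.single (ract C s) c := by
  induction C generalizing s with
  | nil => rfl
  | cons g C ih =>
    rw [rapply_cons, Raw.apply_single, (hC g List.mem_cons_self).onBasis, Finsupp.smul_single,
      smul_eq_mul, mul_one, ih fun g' hg => hC g' (List.mem_cons_of_mem _ hg), ract_cons]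

theorem rapply_rinv_classical {C : List Raw} (hC : ∀ g ∈ C, g.Valid) (hcl : ∀ g ∈ C, g.Cl)
    (s : BasisState) : ract (rinv C) (ract C s) = s := by
  have h := rapply_rinv hC (Finsupp.single s 1)
  rw [rapply_classical hcl, rapply_classical (rinv_forall hcl)] at h
  exact Finsupp.single_left_injective one_ne_zero h

theorem Raw.act_of_not_on {g : Raw} {P : ℕ → Prop} (hg : g.On P) (s : BasisState) {w : ℕ}
    (hw : ¬ P w) : g.act s w = s w := by
  cases g with
  | not i => exact Function.update_of_ne (fun e => hw (by rw [e]; exact hg)) _ _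
  | cnot a i => exact Function.update_of_ne (fun e => hw (by rw [e]; exact hg.2)) _ _
  | tof a b i => exact Function.update_of_ne (fun e => hw (by rw [e]; exact hg.2.2)) _ _
  | had i => rfl
  | tg i => rfl

theorem Raw.act_congr {g : Raw} {P : ℕ → Prop} (hg : g.On P) {s t : BasisState}
    (h : ∀ w, P w → s w = t w) : ∀ w, P w → g.act s w = g.act t w := by
  intro w hw
  cases g with
  | not i =>
    by_cases e : w = i
    · subst e; simp [Raw.act, h w hw]
    · simp [Raw.act, e, h w hw]
  | cnot a i =>
    by_cases e : w = i
    · subst e; simp [Raw.act, h w hw, h a hg.1]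
    · simp [Raw.act, e, h w hw]
  | tof a b i =>
    by_cases e : w = i
    · subst e; simp [Raw.act, h w hw, h a hg.1, h b hg.2.1]
    · simp [Raw.act, e, h w hw]
  | had i => exact h w hw
  | tg i => exact h w hw

theorem ract_of_not_on {C : List Raw} {P : ℕ → Prop} (hC : ∀ g ∈ C, g.On P) (s : BasisState)
    {w : ℕ} (hw : ¬ P w) : ract C s w = s w := by
  induction C generalizing s with
  | nil => rfl
  | cons g C ih =>
    rw [ract_cons, ih fun g' hg => hC g' (List.mem_cons_of_mem _ hg),
      Raw.act_of_not_on (hC g List.mem_cons_self) s hw]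

theorem ract_congr {C : List Raw} {P : ℕ → Prop} (hC : ∀ g ∈ C, g.On P) {s t : BasisState}
    (h : ∀ w, P w → s w = t w) : ∀ w, P w → ract C s w = ract C t w := by
  induction C generalizing s t with
  | nil => exact h
  | cons g C ih =>
    exact ih (fun g' hg => hC g' (List.mem_cons_of_mem _ hg))
      (Raw.act_congr (hC g List.mem_cons_self) h)

theorem Raw.On.mono {g : Raw} {P Q : ℕ → Prop} (h : ∀ w, P w → Q w) (hg : g.On P) : g.On Q := by
  cases g <;> simp_all [Raw.On]

theorem symmDiff_apply_bool (s r : BasisState) (w : ℕ) : (s ∆ r) w = xor (s w) (r w) := by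
  rw [Pi.symmDiff_apply, Bool.symmDiff_eq_xor]

/-- Translation of a superposition of basis states. -/
noncomputable def qtrans (r : BasisState) : QState →ₗ[ℂ] QState :=
  Finsupp.lmapDomain ℂ ℂ fun s => s ∆ r

theorem qtrans_single (r s : BasisState) (c : ℂ) :
    qtrans r (Finsupp.single s c) = Finsupp.single (s ∆ r) c := by
  simp [qtrans, Finsupp.mapDomain_single]

theorem qtrans_l2norm (r : BasisState) (v : QState) : l2norm (qtrans r v) = l2norm v :=
  l2norm_mapDomain _ (symmDiff_left_injective r) v

theorem update_symmDiff (s r : BasisState) (i : ℕ) (a : Bool) (hr : r i = false) :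
    Function.update s i a ∆ r = Function.update (s ∆ r) i a := by
  funext j
  by_cases hj : j = i
  · subst hj; simp [hr]
  · simp [hj]

/-- The pattern `r` lives on wires that the gate neither reads nor writes. Commuting with such
translations replaces tensoring with the identity on idle registers. -/
theorem Raw.apply_qtrans {g : Raw} {r : BasisState} (hg : g.On fun w => r w = false) (v : QState) :
    g.apply (qtrans r v) = qtrans r (g.apply v) := by
  induction v using Finsupp.induction_linear with
  | zero => simp
  | add u v hu hv => simp only [map_add, hu, hv]
  | single s c =>
    rw [qtrans_single, Raw.apply_single, Raw.apply_single, map_smul]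
    congr 1
    cases g with
    | not i =>
      have h1 : r i = false := hg
      simp [Raw.onBasis, qtrans_single, update_symmDiff, h1]
    | cnot a i =>
      obtain ⟨h1, h2⟩ : r a = false ∧ r i = false := hg
      simp [Raw.onBasis, qtrans_single, update_symmDiff, h1, h2]
    | tof a b i =>
      obtain ⟨h1, h2, h3⟩ : r a = false ∧ r b = false ∧ r i = false := hg
      simp [Raw.onBasis, qtrans_single, update_symmDiff, h1, h2, h3]
    | had i =>
      have h1 : r i = false := hg
      simp [Raw.onBasis, qtrans_single, update_symmDiff, h1]
    | tg i =>
      have h1 : r i = false := hg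
      simp [Raw.onBasis, qtrans_single, h1]

theorem rapply_qtrans {C : List Raw} {r : BasisState} (hC : ∀ g ∈ C, g.On fun w => r w = false)
    (v : QState) : rapply C (qtrans r v) = qtrans r (rapply C v) := by
  induction C generalizing v with
  | nil => rfl
  | cons g C ih =>
    rw [rapply_cons, Raw.apply_qtrans (hC g List.mem_cons_self),
      ih fun g' hg => hC g' (List.mem_cons_of_mem _ hg), rapply_cons]

theorem ract_symmDiff {C : List Raw} {r : BasisState} (hcl : ∀ g ∈ C, g.Cl)
    (hC : ∀ g ∈ C, g.On fun w => r w = false) (s : BasisState) :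
    ract C (s ∆ r) = ract C s ∆ r := by
  have h := rapply_qtrans hC (Finsupp.single s 1)
  rw [qtrans_single, rapply_classical hcl, rapply_classical hcl, qtrans_single] at h
  exact Finsupp.single_left_injective one_ne_zero h

/-- Each term of the superposition that a gate produces from a basis state differs from it on the
wires of the gate only. -/
theorem Raw.support_apply {g : Raw} {P : ℕ → Prop} (hg : g.On P) (Q : BasisState → Prop)
    (hQ : ∀ s t : BasisState, (∀ w, ¬ P w → s w = t w) → Q s → Q t) {v : QState}
    (hv : ∀ s ∈ v.support, Q s) : ∀ s ∈ (g.apply v).support, Q s := by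
  classical
  have key : ∀ s, ∀ t ∈ (g.onBasis s).support, ∀ w, ¬ P w → s w = t w := by
    intro s t ht w hw
    have hup : ∀ i b, P i → t = Function.update s i b → s w = t w := by
      rintro i b hi rfl
      rw [Function.update_of_ne (fun e => hw (by rw [e]; exact hi))]
    cases g with
    | not i => exact hup i _ hg (Finset.mem_singleton.1 (Finsupp.support_single_subset ht))
    | cnot a i => exact hup i _ hg.2 (Finset.mem_singleton.1 (Finsupp.support_single_subset ht))
    | tof a b i => exact hup i _ hg.2.2 (Finset.mem_singleton.1 (Finsupp.support_single_subset ht))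
    | tg i => rw [Finset.mem_singleton.1 (Finsupp.support_single_subset ht)]
    | had i =>
      rcases Finset.mem_union.1 (Finsupp.support_add ht) with h | h
      · exact hup i _ hg (Finset.mem_singleton.1 (Finsupp.support_single_subset h))
      · exact hup i _ hg (Finset.mem_singleton.1 (Finsupp.support_single_subset h))
  intro t ht
  rw [Raw.apply, Finsupp.linearCombination_apply, Finsupp.sum] at ht
  obtain ⟨s, hs, hst⟩ := Finset.mem_biUnion.1 (Finsupp.support_finsetSum ht)
  exact hQ s t (key s t (Finsupp.support_smul hst)) (hv s hs)

theorem support_rapply {C : List Raw} {P : ℕ → Prop} (hC : ∀ g ∈ C, g.On P) (Q : BasisState → Prop)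
    (hQ : ∀ s t : BasisState, (∀ w, ¬ P w → s w = t w) → Q s → Q t) {v : QState}
    (hv : ∀ s ∈ v.support, Q s) : ∀ s ∈ (rapply C v).support, Q s := by
  induction C generalizing v with
  | nil => exact hv
  | cons g C ih =>
    exact ih (fun g' hg => hC g' (List.mem_cons_of_mem _ hg))
      (Raw.support_apply (hC g List.mem_cons_self) Q hQ hv)

/-- Two circuits that agree on the basis states in the support of `v` agree on `v`. -/
theorem linearMap_congr_support {f g : QState →ₗ[ℂ] QState} {v : QState}
    (h : ∀ s ∈ v.support, f (Finsupp.single s 1) = g (Finsupp.single s 1)) : f v = g v := by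
  rw [← Finsupp.sum_single v, Finsupp.sum, map_sum, map_sum]
  refine Finset.sum_congr rfl fun s hs => ?_
  have hc : Finsupp.single s (v s) = v s • Finsupp.single s (1 : ℂ) := by simp
  rw [hc, map_smul, map_smul, h s hs]

/-- A family of classical gates with distinct targets, which are not used as controls. -/
theorem ract_map_range (n : ℕ) (gate : ℕ → Raw) (τ : ℕ → ℕ) (val : ℕ → BasisState → Bool)
    (hτ : ∀ i < n, ∀ j < n, τ i = τ j → i = j)
    (h1 : ∀ i < n, ∀ s, (gate i).act s = Function.update s (τ i) (xor (s (τ i)) (val i s)))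
    (h2 : ∀ i < n, ∀ s t : BasisState, (∀ w, (∀ j < n, w ≠ τ j) → s w = t w) → val i s = val i t)
    (s : BasisState) :
    (∀ i < n, ract ((List.range n).map gate) s (τ i) = xor (s (τ i)) (val i s)) ∧
      ∀ w, (∀ i < n, w ≠ τ i) → ract ((List.range n).map gate) s w = s w := by
  have key : ∀ m ≤ n,
      (∀ i < n, ract ((List.range m).map gate) s (τ i) =
        if i < m then xor (s (τ i)) (val i s) else s (τ i)) ∧
      ∀ w, (∀ i < n, w ≠ τ i) → ract ((List.range m).map gate) s w = s w := by
    intro m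
    induction m with
    | zero => simp
    | succ m ih =>
      intro hm
      obtain ⟨ih1, ih2⟩ := ih (by omega)
      have hm' : m < n := by omega
      rw [List.range_succ, List.map_append, ract_append]
      simp only [List.map_cons, List.map_nil, ract_cons, ract_nil]
      rw [h1 m hm', h2 m hm' _ s ih2]
      constructor
      · intro i hi
        by_cases e : i = m
        · subst e
          rw [Function.update_self, ih1 i hi]
          simp
        · rw [Function.update_of_ne (fun e' => e (hτ i hi m hm' e')), ih1 i hi]
          have : i < m ↔ i < m + 1 := by omega
          simp [this]
      · intro w hw
        rw [Function.update_of_ne (hw m hm'), ih2 w hw]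
  obtain ⟨k1, k2⟩ := key n le_rfl
  exact ⟨fun i hi => by rw [k1 i hi, if_pos hi], k2⟩

end RawGates

/-! ## Polynomial bounds -/

section PolynomialBounds

/-- `t` is bounded by a polynomial. -/
def PolyB (t : ℕ → ℕ) : Prop := ∃ c, ∀ B, t B ≤ (B + 2) ^ c

theorem PolyB.const (k : ℕ) : PolyB fun _ => k :=
  ⟨k, fun B => (Nat.lt_two_pow_self).le.trans (Nat.pow_le_pow_left (by omega) k)⟩

theorem PolyB.id : PolyB fun B => B := ⟨1, fun B => by simp⟩

theorem PolyB.mul {s t : ℕ → ℕ} (hs : PolyB s) (ht : PolyB t) : PolyB fun B => s B * t B := by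
  obtain ⟨c, hc⟩ := hs
  obtain ⟨d, hd⟩ := ht
  exact ⟨c + d, fun B => (Nat.mul_le_mul (hc B) (hd B)).trans_eq (pow_add _ _ _).symm⟩

theorem PolyB.add {s t : ℕ → ℕ} (hs : PolyB s) (ht : PolyB t) : PolyB fun B => s B + t B := by
  obtain ⟨c, hc⟩ := hs
  obtain ⟨d, hd⟩ := ht
  refine ⟨c + d + 1, fun B => ?_⟩
  have h1 : (B + 2) ^ c ≤ (B + 2) ^ (c + d) := Nat.pow_le_pow_right (by omega) (by omega)
  have h2 : (B + 2) ^ d ≤ (B + 2) ^ (c + d) := Nat.pow_le_pow_right (by omega) (by omega)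
  -- The factor 2 of a sum of two equal powers is absorbed by one more power of a base that is at
  -- least 2.
  have h3 : (B + 2) ^ (c + d) * 2 ≤ (B + 2) ^ (c + d + 1) := by
    rw [pow_succ]
    exact Nat.mul_le_mul_left _ (by omega)
  have h4 := hc B
  have h5 := hd B
  dsimp only
  omega

theorem PolyB.pow {s : ℕ → ℕ} (hs : PolyB s) (k : ℕ) : PolyB fun B => s B ^ k := by
  obtain ⟨c, hc⟩ := hs
  exact ⟨c * k, fun B => (Nat.pow_le_pow_left (hc B) k).trans_eq (pow_mul _ _ _).symm⟩

theorem PolyB.mono {s t : ℕ → ℕ} (ht : PolyB t) (h : ∀ B, s B ≤ t B) : PolyB s := by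
  obtain ⟨c, hc⟩ := ht
  exact ⟨c, fun B => (h B).trans (hc B)⟩

theorem PolyB.comp {s t : ℕ → ℕ} (ht : PolyB t) (hs : PolyB s) : PolyB fun B => t (s B) := by
  obtain ⟨c, hc⟩ := ht
  exact ((hs.add (PolyB.const 2)).pow c).mono fun B => hc (s B)

end PolynomialBounds

/-! ## Runs of programs -/

section Runs

/-- `p` takes the registers `σ` to `τ` in at most `t` steps. -/
def Run (p : Prog) (σ : ℕ → List Bool) (t : ℕ) (τ : ℕ → List Bool) : Prop :=
  ∃ n ≤ t, p.Exec σ n τ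

theorem Run.mono {p : Prog} {σ τ : ℕ → List Bool} {s t : ℕ} (h : Run p σ s τ) (hst : s ≤ t) :
    Run p σ t τ := by
  obtain ⟨n, hn, h⟩ := h
  exact ⟨n, hn.trans hst, h⟩

theorem Run.congr {p : Prog} {σ τ τ' : ℕ → List Bool} {t : ℕ} (h : Run p σ t τ) (e : τ' = τ) :
    Run p σ t τ' := e ▸ h

theorem Run.skip (σ : ℕ → List Bool) : Run .skip σ 1 σ := ⟨1, le_rfl, .skip σ⟩

theorem Run.push (σ : ℕ → List Bool) (r : ℕ) (b : Bool) :
    Run (.push r b) σ 1 (Function.update σ r (b :: σ r)) := ⟨1, le_rfl, .push σ r b⟩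

theorem Run.pop (σ : ℕ → List Bool) (r : ℕ) :
    Run (.pop r) σ 1 (Function.update σ r (σ r).tail) := ⟨1, le_rfl, .pop σ r⟩

theorem Run.seq {p q : Prog} {σ τ υ : ℕ → List Bool} {s t : ℕ} (hp : Run p σ s τ)
    (hq : Run q τ t υ) : Run (.seq p q) σ (s + t) υ := by
  obtain ⟨n, hn, hp⟩ := hp
  obtain ⟨m, hm, hq⟩ := hq
  exact ⟨n + m, by omega, .seq hp hq⟩

theorem Run.branch_true {p q : Prog} {σ τ : ℕ → List Bool} {r t : ℕ}
    (h : (σ r).head? = some true) (hp : Run p σ t τ) : Run (.branch r p q) σ (t + 1) τ := by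
  obtain ⟨n, hn, hp⟩ := hp
  exact ⟨n + 1, by omega, .branch_true h hp⟩

theorem Run.branch_false {p q : Prog} {σ τ : ℕ → List Bool} {r t : ℕ}
    (h : (σ r).head? ≠ some true) (hq : Run q σ t τ) : Run (.branch r p q) σ (t + 1) τ := by
  obtain ⟨n, hn, hq⟩ := hq
  exact ⟨n + 1, by omega, .branch_false h hq⟩

theorem Run.loop_done {p : Prog} {σ : ℕ → List Bool} {r : ℕ} (h : σ r = []) :
    Run (.loop r p) σ 1 σ := ⟨1, le_rfl, .loop_done h⟩

theorem Run.loop_step {p : Prog} {σ τ υ : ℕ → List Bool} {r s t : ℕ} (h : σ r ≠ [])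
    (hp : Run p σ s τ) (hq : Run (.loop r p) τ t υ) : Run (.loop r p) σ (s + t + 1) υ := by
  obtain ⟨n, hn, hp⟩ := hp
  obtain ⟨m, hm, hq⟩ := hq
  exact ⟨n + m + 1, by omega, .loop_step h hp hq⟩

/-- The registers used by a program are below its bound. -/
def Prog.bound : Prog → ℕ
  | .skip => 0
  | .push r _ => r + 1
  | .pop r => r + 1
  | .seq p q => max p.bound q.bound
  | .branch r p q => max (r + 1) (max p.bound q.bound)
  | .loop r p => max (r + 1) p.bound

/-- Relocation of the registers. -/
def Prog.shift (K : ℕ) : Prog → Prog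
  | .skip => .skip
  | .push r b => .push (K + r) b
  | .pop r => .pop (K + r)
  | .seq p q => .seq (p.shift K) (q.shift K)
  | .branch r p q => .branch (K + r) (p.shift K) (q.shift K)
  | .loop r p => .loop (K + r) (p.shift K)

/-- A program reads and writes only registers below its bound, so it can serve as a subroutine on a
window of the registers of a larger program. The window may exceed the bound, to include inputs and
outputs that lie beyond it. -/
theorem Prog.Exec.shift {p : Prog} {σ τ : ℕ → List Bool} {n : ℕ} (h : p.Exec σ n τ) (K m : ℕ)
    (hm : p.bound ≤ m) (σ' : ℕ → List Bool) (hσ : ∀ r < m, σ' (K + r) = σ r) :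
    ∃ τ', (p.shift K).Exec σ' n τ' ∧ (∀ r < m, τ' (K + r) = τ r) ∧
      ∀ r, r < K ∨ K + m ≤ r → τ' r = σ' r := by
  induction h generalizing σ' with
  | skip σ => exact ⟨σ', .skip σ', hσ, fun _ _ => rfl⟩
  | push σ r b =>
    refine ⟨_, .push σ' (K + r) b, fun r' hr' => ?_, fun r' hr' => ?_⟩
    · have hr : r < m := hm
      by_cases e : r' = r
      · subst e; simp [hσ _ hr]
      · simp [e, hσ _ hr']
    · have hr : r < m := hm
      rw [Function.update_of_ne (by omega)]
  | pop σ r =>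
    refine ⟨_, .pop σ' (K + r), fun r' hr' => ?_, fun r' hr' => ?_⟩
    · have hr : r < m := hm
      by_cases e : r' = r
      · subst e; simp [hσ _ hr]
      · simp [e, hσ _ hr']
    · have hr : r < m := hm
      rw [Function.update_of_ne (by omega)]
  | seq _ _ ih1 ih2 =>
    rw [Prog.bound, max_le_iff] at hm
    obtain ⟨τ1, h1, h2, h3⟩ := ih1 hm.1 σ' hσ
    obtain ⟨τ2, k1, k2, k3⟩ := ih2 hm.2 τ1 h2
    exact ⟨τ2, .seq h1 k1, k2, fun r hr => (k3 r hr).trans (h3 r hr)⟩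
  | branch_true hc _ ih =>
    rw [Prog.bound, max_le_iff, max_le_iff] at hm
    obtain ⟨τ1, h1, h2, h3⟩ := ih hm.2.1 σ' hσ
    exact ⟨τ1, .branch_true (by rwa [hσ _ hm.1]) h1, h2, h3⟩
  | branch_false hc _ ih =>
    rw [Prog.bound, max_le_iff, max_le_iff] at hm
    obtain ⟨τ1, h1, h2, h3⟩ := ih hm.2.2 σ' hσ
    exact ⟨τ1, .branch_false (by rwa [hσ _ hm.1]) h1, h2, h3⟩
  | loop_done hc =>
    rw [Prog.bound, max_le_iff] at hm
    exact ⟨σ', .loop_done (by rwa [hσ _ hm.1]), hσ, fun _ _ => rfl⟩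
  | loop_step hc _ _ ih1 ih2 =>
    have hm' := hm
    rw [Prog.bound, max_le_iff] at hm'
    obtain ⟨τ1, h1, h2, h3⟩ := ih1 hm'.2 σ' hσ
    obtain ⟨τ2, k1, k2, k3⟩ := ih2 hm τ1 h2
    exact ⟨τ2, .loop_step (by rwa [hσ _ hm'.1]) h1 k1, k2, fun r hr => (k3 r hr).trans (h3 r hr)⟩

/-- A step pushes at most one bit. Running times thus bound the lengths of results, and the number
of wires needed for the stacks of a compiled program. -/
theorem Prog.Exec.length_le {p : Prog} {σ τ : ℕ → List Bool} {n : ℕ} (h : p.Exec σ n τ) (r : ℕ) :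
    (τ r).length ≤ (σ r).length + n := by
  induction h with
  | skip σ => omega
  | push σ r' b =>
    by_cases e : r = r'
    · subst e; simp
    · simp [e]
  | pop σ r' =>
    by_cases e : r = r'
    · subst e; simp; omega
    · simp [e]
  | seq _ _ ih1 ih2 => omega
  | branch_true hc _ ih => omega
  | branch_false hc _ ih => omega
  | loop_done hc => omega
  | loop_step hc _ _ ih1 ih2 => omega

/-- Empty the register `r`. -/
def Prog.clear (r : ℕ) : Prog := .loop r (.pop r)

theorem run_clear (r : ℕ) (l : List Bool) (σ : ℕ → List Bool) (h : σ r = l) :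
    Run (.clear r) σ (2 * l.length + 1) (Function.update σ r []) := by
  induction l generalizing σ with
  | nil =>
    have : Function.update σ r [] = σ := by rw [← h]; simp
    rw [this]
    exact Run.loop_done h
  | cons b l ih =>
    have h1 := ih (Function.update σ r (σ r).tail) (by simp [h])
    rw [Function.update_idem] at h1
    exact (Run.loop_step (by simp [h]) (Run.pop σ r) h1).mono (by simp; omega)

/-- Push the bits of register `a`, which becomes empty, on register `b`. -/
def Prog.move (a b : ℕ) : Prog :=
  .loop a (.branch a (.seq (.push b true) (.pop a)) (.seq (.push b false) (.pop a)))

theorem run_move {a b : ℕ} (hab : a ≠ b) (l : List Bool) (σ : ℕ → List Bool) (h : σ a = l) :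
    Run (.move a b) σ (4 * l.length + 1)
      (Function.update (Function.update σ b (l.reverse ++ σ b)) a []) := by
  induction l generalizing σ with
  | nil =>
    have : Function.update (Function.update σ b ([].reverse ++ σ b)) a [] = σ := by
      funext r
      by_cases e : r = a
      · subst e; simp [h]
      · by_cases e' : r = b
        · subst e'; simp [e]
        · simp [e]
    rw [this]
    exact Run.loop_done h
  | cons x l ih =>
    have hstep : Run (.branch a (.seq (.push b true) (.pop a)) (.seq (.push b false) (.pop a)))
        σ 3 (Function.update (Function.update σ b (x :: σ b)) a l) := by
      have hb : ∀ x, Run (.seq (.push b x) (.pop a)) σ 2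
          (Function.update (Function.update σ b (x :: σ b)) a l) := by
        intro x
        have h1 := Run.seq (Run.push σ b x) (Run.pop (Function.update σ b (x :: σ b)) a)
        rwa [Function.update_of_ne hab, h] at h1
      cases x
      · exact Run.branch_false (by simp [h]) (hb false)
      · exact Run.branch_true (by simp [h]) (hb true)
    have h1 := ih (Function.update (Function.update σ b (x :: σ b)) a l) (by simp)
    have h2 : Function.update (Function.update (Function.update (Function.update σ b (x :: σ b)) a l)
        b (l.reverse ++ Function.update (Function.update σ b (x :: σ b)) a l b)) a [] =
        Function.update (Function.update σ b ((x :: l).reverse ++ σ b)) a [] := by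
      funext r
      by_cases e : r = a
      · subst e; simp
      · by_cases e' : r = b
        · subst e'; simp [e]
        · simp [e, e']
    rw [h2] at h1
    exact (Run.loop_step (by simp [h]) hstep h1).mono (by simp; omega)

/-- Push the bits of register `a`, which becomes empty, on the registers `b` and `c`. -/
def Prog.dup (a b c : ℕ) : Prog :=
  .loop a (.branch a (.seq (.push b true) (.seq (.push c true) (.pop a)))
    (.seq (.push b false) (.seq (.push c false) (.pop a))))

theorem run_dup {a b c : ℕ} (hab : a ≠ b) (hac : a ≠ c) (hbc : b ≠ c) (l : List Bool)
    (σ : ℕ → List Bool) (h : σ a = l) :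
    Run (.dup a b c) σ (5 * l.length + 1)
      (Function.update (Function.update (Function.update σ b (l.reverse ++ σ b)) c
        (l.reverse ++ σ c)) a []) := by
  induction l generalizing σ with
  | nil =>
    have : Function.update (Function.update (Function.update σ b ([].reverse ++ σ b)) c
        ([].reverse ++ σ c)) a [] = σ := by
      funext r
      by_cases e : r = a
      · subst e; simp [h]
      · by_cases e' : r = b
        · subst e'; simp [e]
        · by_cases e'' : r = c
          · subst e''; simp [e]
          · simp [e]
    rw [this]
    exact Run.loop_done h
  | cons x l ih =>
    have hstep : Run (.branch a (.seq (.push b true) (.seq (.push c true) (.pop a)))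
        (.seq (.push b false) (.seq (.push c false) (.pop a)))) σ 4
        (Function.update (Function.update (Function.update σ b (x :: σ b)) c (x :: σ c)) a l) := by
      have hb : ∀ x, Run (.seq (.push b x) (.seq (.push c x) (.pop a))) σ 3
          (Function.update (Function.update (Function.update σ b (x :: σ b)) c (x :: σ c)) a l) := by
        intro x
        have h1 := Run.seq (Run.push σ b x) (Run.seq (Run.push _ c x) (Run.pop _ a))
        rwa [Function.update_of_ne hac, Function.update_of_ne hab, h,
          Function.update_of_ne hbc.symm] at h1
      cases x
      · exact Run.branch_false (by simp [h]) (hb false)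
      · exact Run.branch_true (by simp [h]) (hb true)
    have h1 := ih (Function.update (Function.update (Function.update σ b (x :: σ b)) c
      (x :: σ c)) a l) (by simp)
    refine (Run.loop_step (by simp [h]) hstep (h1.congr ?_)).mono (by simp; omega)
    funext r
    by_cases e : r = a
    · subst e; simp
    · by_cases e' : r = b
      · subst e'; simp [e, hbc]
      · by_cases e'' : r = c
        · subst e''; simp [e]
        · simp [e, e', e'']

/-- Push the bits of `l` on register `r`, so that `l` ends on top. -/
def Prog.pushAll (r : ℕ) : List Bool → Prog
  | [] => .skip
  | b :: l => .seq (Prog.pushAll r l) (.push r b)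

theorem run_pushAll (r : ℕ) (l : List Bool) (σ : ℕ → List Bool) :
    Run (.pushAll r l) σ (l.length + 1) (Function.update σ r (l ++ σ r)) := by
  induction l with
  | nil => simpa using! Run.skip σ
  | cons b l ih =>
    have h := Run.seq ih (Run.push _ r b)
    simpa using! h

/-- Empty the registers `K, …, K + n - 1`. -/
def Prog.clearAll (K : ℕ) : ℕ → Prog
  | 0 => .skip
  | n + 1 => .seq (Prog.clearAll K n) (.clear (K + n))

theorem run_clearAll (K n L : ℕ) (σ : ℕ → List Bool) (h : ∀ r, K ≤ r → r < K + n → (σ r).length ≤ L) :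
    Run (.clearAll K n) σ (n * (2 * L + 1) + 1)
      (fun r => if K ≤ r ∧ r < K + n then [] else σ r) := by
  induction n with
  | zero =>
    have : (fun r => if K ≤ r ∧ r < K + 0 then [] else σ r) = σ := by
      funext r; rw [if_neg (by omega)]
    rw [this]
    exact (Run.skip σ).mono (by omega)
  | succ n ih =>
    have h1 := run_clear (K + n) _ (fun r => if K ≤ r ∧ r < K + n then [] else σ r) rfl
    have h2 := Run.seq (ih fun r hr hr' => h r hr (by omega)) h1
    have : Function.update (fun r => if K ≤ r ∧ r < K + n then [] else σ r) (K + n) [] =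
        (fun r => if K ≤ r ∧ r < K + (n + 1) then [] else σ r) := by
      funext r
      by_cases e : r = K + n
      · subst e; simp
      · rw [Function.update_of_ne e]
        have : (K ≤ r ∧ r < K + n) ↔ (K ≤ r ∧ r < K + (n + 1)) := by omega
        simp [this]
    rw [this] at h2
    refine h2.mono ?_
    have h3 : (if K ≤ K + n ∧ K + n < K + n then [] else σ (K + n)).length ≤ L := by
      simpa using h (K + n) (by omega) (by omega)
    have h4 : (n + 1) * (2 * L + 1) = n * (2 * L + 1) + (2 * L + 1) := by ring
    omega

end Runs

/-! ## Efficiently computable functions of contexts -/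

section Contexts

variable {α β : Type*}

/-- A context: an element `a : α` is presented by the strings `R a 0, …, R a (n - 1)`. -/
structure Ctx (α : Type*) where
  n : ℕ
  R : α → ℕ → List Bool

/-- The context extended by a number in unary. -/
def Ctx.nat (X : Ctx α) : Ctx (α × ℕ) :=
  ⟨X.n + 1, fun b => Function.update (X.R b.1) X.n (unary b.2)⟩

/-- `f` is computable in polynomial time: for every placement `ρ` of the strings of the context
below `k` there is a program, with temporary registers `k, …, m - 1`, that pushes `f a` on any
given register `o ≥ m`. -/
def PS (X : Ctx α) (f : α → List Bool) : Prop :=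
  ∀ (ρ : ℕ → ℕ) (k : ℕ), (∀ v < X.n, ρ v < k) →
    ∃ (m : ℕ) (t : ℕ → ℕ) (p : ℕ → Prog), k ≤ m ∧ PolyB t ∧
      ∀ (a : α) (B o : ℕ) (σ : ℕ → List Bool), m ≤ o → (∀ v < X.n, σ (ρ v) = X.R a v) →
        (∀ r, k ≤ r → r < m → σ r = []) → (∀ v < X.n, (X.R a v).length ≤ B) →
        Run (p o) σ (t B) (Function.update σ o (f a ++ σ o))

/-- `f` is computable in unary in polynomial time. -/
def PN (X : Ctx α) (f : α → ℕ) : Prop := PS X fun a => unary (f a)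

theorem PS.congr {X : Ctx α} {f g : α → List Bool} (hf : PS X f) (h : ∀ a, g a = f a) : PS X g := by
  have : g = f := funext h
  rwa [this]

theorem PS.const (X : Ctx α) (l : List Bool) : PS X fun _ => l := fun _ k _ =>
  ⟨k, _, fun o => .pushAll o l, le_rfl, PolyB.const (l.length + 1), fun _ _ o σ _ _ _ _ =>
    run_pushAll o l σ⟩

theorem PS.append {X : Ctx α} {f g : α → List Bool} (hf : PS X f) (hg : PS X g) :
    PS X fun a => f a ++ g a := by
  intro ρ k hρ
  obtain ⟨m1, t1, p1, hm1, ht1, h1⟩ := hf ρ k hρ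
  obtain ⟨m2, t2, p2, hm2, ht2, h2⟩ := hg ρ k hρ
  -- The string `g a` is pushed first, so that `f a` ends on top of it.
  refine ⟨max m1 m2, _, fun o => .seq (p2 o) (p1 o), by omega, ht2.add ht1, ?_⟩
  intro a B o σ ho hv ht hB
  have r2 := h2 a B o σ (by omega) hv (fun r hr hr' => ht r hr (by omega)) hB
  have r1 := h1 a B o (Function.update σ o (g a ++ σ o)) (by omega)
    (fun v hv' => by
      rw [Function.update_of_ne (by have := hρ v hv'; omega)]; exact hv v hv')
    (fun r hr hr' => by
      rw [Function.update_of_ne (by omega)]; exact ht r hr (by omega)) hB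
  rw [Function.update_self, Function.update_idem, ← List.append_assoc] at r1
  exact r2.seq r1

theorem PS.read (X : Ctx α) {v : ℕ} (hv : v < X.n) : PS X fun a => X.R a v := by
  intro ρ k hρ
  -- The move reverses the string. Duplication reverses it once more, which restores the register
  -- and yields a copy in the right order.
  refine ⟨k + 1, _, fun o => .seq (.move (ρ v) k) (.dup k (ρ v) o), by omega,
    (((PolyB.const 4).mul PolyB.id).add (PolyB.const 1)).add
      (((PolyB.const 5).mul PolyB.id).add (PolyB.const 1)), ?_⟩
  intro a B o σ ho hσ ht hB
  have hk := hρ v hv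
  have h1 := run_move (show ρ v ≠ k by omega) _ σ (hσ v hv)
  have h2 := run_dup (show k ≠ ρ v by omega) (show k ≠ o by omega) (show ρ v ≠ o by omega) _
    (Function.update (Function.update σ k ((X.R a v).reverse ++ σ k)) (ρ v) [])
    (by rw [Function.update_of_ne (by omega), Function.update_self])
  have h3 := h1.seq h2
  have hkn : σ k = [] := ht k le_rfl (by omega)
  have hL := hB v hv
  convert h3.mono (t := 4 * B + 1 + (5 * B + 1)) ?_ using 1
  · funext r
    by_cases e : r = k
    · subst e
      rw [Function.update_of_ne (by omega), Function.update_self, hkn]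
    · by_cases e' : r = o
      · subst e'
        rw [Function.update_self, Function.update_of_ne e, Function.update_self,
          Function.update_of_ne (by omega), Function.update_of_ne e, hkn]
        simp
      · by_cases e'' : r = ρ v
        · subst e''
          rw [Function.update_of_ne e', Function.update_of_ne e, Function.update_of_ne e',
            Function.update_self, Function.update_self, hkn, hσ v hv]
          simp
        · simp only [Function.update_of_ne e, Function.update_of_ne e', Function.update_of_ne e'']
  · simp only [hkn, List.append_nil, List.length_reverse]
    omega

/-- The functions of the old context are functions of the extended context. -/
theorem PS.weaken_nat {X : Ctx α} {f : α → List Bool} (hf : PS X f) : PS X.nat fun b => f b.1 := by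
  intro ρ k hρ
  obtain ⟨m, t, p, hm, ht, h⟩ := hf ρ k fun v hv => hρ v (Nat.lt_succ_of_lt hv)
  refine ⟨m, t, p, hm, ht, fun b B o σ ho hσ hr hB => h b.1 B o σ ho (fun v hv => ?_) hr fun v hv => ?_⟩
  · rw [hσ v (Nat.lt_succ_of_lt hv)]
    exact Function.update_of_ne hv.ne _ _
  · have e : X.nat.R b v = X.R b.1 v := Function.update_of_ne hv.ne _ _
    exact e ▸ hB v (Nat.lt_succ_of_lt hv)

theorem PN.last (X : Ctx α) : PN X.nat fun b => b.2 :=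
  (PS.read X.nat (Nat.lt_succ_self X.n)).congr fun b => by simp [Ctx.nat]

theorem length_unary (n : ℕ) : (unary n).length = n := by simp [unary]

theorem Run.length_le {p : Prog} {σ τ : ℕ → List Bool} {t : ℕ} (h : Run p σ t τ) (r : ℕ) :
    (τ r).length ≤ (σ r).length + t := by
  obtain ⟨n, hn, h⟩ := h
  have := h.length_le r
  omega

end Contexts

/-! ### Closure of the computable functions under loops and calls of programs -/

section ContextLoops

variable {α β : Type*}

/-- Count the bits of register `a`, which becomes empty, in unary on register `b`. -/
def Prog.count (a b : ℕ) : Prog := .loop a (.seq (.pop a) (.push b true))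

theorem run_count {a b : ℕ} (hab : a ≠ b) (l : List Bool) (σ : ℕ → List Bool) (h : σ a = l) :
    Run (.count a b) σ (3 * l.length + 1)
      (Function.update (Function.update σ b (unary l.length ++ σ b)) a []) := by
  induction l generalizing σ with
  | nil =>
    have : Function.update (Function.update σ b (unary 0 ++ σ b)) a [] = σ := by
      funext r
      by_cases e : r = a
      · subst e; simp [h]
      · by_cases e' : r = b
        · subst e'; simp [e, unary]
        · simp [e, e']
    rw [List.length_nil, this]
    exact Run.loop_done h
  | cons x l ih =>
    have hstep := Run.seq (Run.pop σ a) (Run.push _ b true)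
    have h1 := ih _ (show Function.update (Function.update σ a (σ a).tail) b
      (true :: Function.update σ a (σ a).tail b) a = l by simp [hab, h])
    refine (Run.loop_step (by simp [h]) hstep (h1.congr ?_)).mono (by simp; omega)
    funext r
    by_cases e : r = a
    · subst e; simp
    · by_cases e' : r = b
      · subst e'
        have : unary (l.length + 1) = unary l.length ++ [true] := List.replicate_succ'
        simp [e, this]
      · simp [e, e']

theorem take_succ_reverse (s : List Bool) (j : ℕ) (hj : j < s.length) :
    (s.take (j + 1)).reverse = s.getD j false :: (s.take j).reverse := by
  rw [List.take_succ_eq_append_getElem hj, List.reverse_append]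
  simp [hj]

/-- A loop over the bits of a string and their positions. -/
theorem PS.bits {X : Ctx α} {f : α → List Bool} (hf : PS X f) {g₁ g₀ : α × ℕ → List Bool}
    (hg₁ : PS X.nat g₁) (hg₀ : PS X.nat g₀) :
    PS X fun a => (List.range (f a).length).flatMap fun i =>
      if (f a).getD i false = true then g₁ (a, i) else g₀ (a, i) := by
  intro ρ k hρ
  have hρ' : ∀ v < X.nat.n, Function.update ρ X.n k v < k + 1 := by
    intro v hv
    have hv' : v < X.n + 1 := hv
    by_cases e : v = X.n
    · subst e; simp
    · rw [Function.update_of_ne e]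
      have := hρ v (by omega)
      omega
  obtain ⟨m1, t1, p1, hm1, ht1, h1⟩ := hf ρ k hρ
  obtain ⟨m2, t2, p2, hm2, ht2, h2⟩ := hg₁ (Function.update ρ X.n k) (k + 1) hρ'
  obtain ⟨m3, t3, p3, hm3, ht3, h3⟩ := hg₀ (Function.update ρ X.n k) (k + 1) hρ'
  obtain ⟨M, hM⟩ : ∃ M, M = max m1 (max m2 m3) := ⟨_, rfl⟩
  -- In the loop the context also contains the counter. Its length is at most that of the string,
  -- and this is at most the time `t1 B` needed to write the string.
  have hB' : PolyB fun B => B + t1 B := PolyB.id.add ht1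
  -- Outputs are pushed on top, so the bits are treated from the last to the first. Register `M + 1`
  -- holds the remaining bits in reverse order and `k` their number in unary, which after the pop is
  -- the position of the current bit.
  refine ⟨M + 3, _, fun o => .seq (p1 M) (.seq (.dup M (M + 1) (M + 2)) (.seq (.count (M + 2) k)
    (.loop (M + 1) (.branch (M + 1) (.seq (.pop (M + 1)) (.seq (.pop k) (p2 o)))
      (.seq (.pop (M + 1)) (.seq (.pop k) (p3 o))))))), by omega,
    ht1.add ((((PolyB.const 5).mul ht1).add (PolyB.const 1)).add
      ((((PolyB.const 3).mul ht1).add (PolyB.const 1)).add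
        ((ht1.mul (((ht2.comp hB').add (ht3.comp hB')).add (PolyB.const 4))).add (PolyB.const 1)))),
    ?_⟩
  intro a B o σ ho hσ ht hB
  have r1 := h1 a B M σ (by omega) hσ (fun r hr hr' => ht r hr (by omega)) hB
  rw [ht M (by omega) (by omega), List.append_nil] at r1
  obtain ⟨s, hs⟩ : ∃ s, s = f a := ⟨_, rfl⟩
  beta_reduce
  rw [← hs] at r1 ⊢
  have hlen : s.length ≤ t1 B := by
    have := r1.length_le M
    rw [Function.update_self, ht M (by omega) (by omega)] at this
    simpa using this
  have hM1 : σ (M + 1) = [] := ht _ (by omega) (by omega)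
  have hM2 : σ (M + 2) = [] := ht _ (by omega) (by omega)
  have hM0 : σ M = [] := ht _ (by omega) (by omega)
  have hk0 : σ k = [] := ht _ (by omega) (by omega)
  have r2 := run_dup (show M ≠ M + 1 by omega) (show M ≠ M + 2 by omega)
    (show M + 1 ≠ M + 2 by omega) s (Function.update σ M s) (by simp)
  replace r2 := r2.congr (τ' := Function.update (Function.update σ (M + 1) s.reverse) (M + 2) s.reverse) (by
    funext r
    by_cases e1 : r = M
    · subst e1; simp [hM0]
    · by_cases e2 : r = M + 1
      · subst e2; simp [hM1]
      · by_cases e3 : r = M + 2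
        · subst e3; simp [hM2]
        · simp [e1, e2, e3])
  have r3 := run_count (show M + 2 ≠ k by omega) s.reverse
    (Function.update (Function.update σ (M + 1) s.reverse) (M + 2) s.reverse) (by simp)
  -- The registers when the bits from position `j` on have been treated and `w` is in the output
  -- register.
  let st : ℕ → List Bool → ℕ → List Bool := fun j w =>
    Function.update (Function.update (Function.update σ (M + 1) (s.take j).reverse) k (unary j)) o w
  have hst1 : ∀ j w, st j w (M + 1) = (s.take j).reverse := fun j w => by
    simp only [st]
    rw [Function.update_of_ne (by omega), Function.update_of_ne (by omega), Function.update_self]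
  have hstk : ∀ j w, st j w k = unary j := fun j w => by
    simp only [st]
    rw [Function.update_of_ne (by omega), Function.update_self]
  have hsto : ∀ j w, st j w o = w := fun j w => by
    simp only [st]
    rw [Function.update_self]
  have hst : ∀ j w r, r ≠ M + 1 → r ≠ k → r ≠ o → st j w r = σ r := fun j w r h1 h2 h3 => by
    simp only [st]
    rw [Function.update_of_ne h3, Function.update_of_ne h2, Function.update_of_ne h1]
  replace r3 := r3.congr (τ' := st s.length (σ o)) (by
    funext r
    by_cases e1 : r = M + 1
    · subst e1; rw [hst1]; simp [show M + 1 ≠ k by omega]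
    · by_cases e2 : r = k
      · subst e2
        rw [hstk]; simp [hk0, show r ≠ M + 2 by omega, show r ≠ M + 1 by omega]
      · by_cases e3 : r = o
        · subst e3
          rw [hsto]; simp [show r ≠ M + 2 by omega, e1, e2]
        · rw [hst _ _ _ e1 e2 e3]
          by_cases e4 : r = M + 2
          · subst e4; simp [hM2]
          · simp [e4, e1, e2])
  have hval : ∀ j w, ∀ v < X.nat.n, st j w (Function.update ρ X.n k v) = X.nat.R (a, j) v := by
    intro j w v hv
    have hv' : v < X.n + 1 := hv
    by_cases e : v = X.n
    · subst e; simp [hstk, Ctx.nat]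
    · have := hρ v (by omega)
      rw [Function.update_of_ne e, hst _ _ _ (by omega) (by omega) (by omega), hσ v (by omega)]
      simp [Ctx.nat, e]
  have hBv : ∀ j ≤ s.length, ∀ v < X.nat.n, (X.nat.R (a, j) v).length ≤ B + t1 B := by
    intro j hj v hv
    have hv' : v < X.n + 1 := hv
    by_cases e : v = X.n
    · subst e; simp [Ctx.nat, unary]; omega
    · simp only [Ctx.nat, Function.update_of_ne e]
      have := hB v (by omega)
      omega
  have hloop : ∀ j ≤ s.length, ∀ w, Run (.loop (M + 1) (.branch (M + 1)
      (.seq (.pop (M + 1)) (.seq (.pop k) (p2 o)))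
      (.seq (.pop (M + 1)) (.seq (.pop k) (p3 o))))) (st j w)
      (j * (t2 (B + t1 B) + t3 (B + t1 B) + 4) + 1)
      (st 0 (((List.range j).flatMap fun i =>
        if s.getD i false = true then g₁ (a, i) else g₀ (a, i)) ++ w)) := by
    intro j
    induction j with
    | zero =>
      intro _ w
      refine (Run.loop_done ?_).mono (by omega)
      rw [hst1]; simp
    | succ j ih =>
      intro hj w
      have hpop : Function.update (Function.update (st (j + 1) w) (M + 1) (st (j + 1) w (M + 1)).tail)
          k (Function.update (st (j + 1) w) (M + 1) (st (j + 1) w (M + 1)).tail k).tail = st j w := by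
        rw [hst1, take_succ_reverse s j (by omega), List.tail_cons,
          Function.update_of_ne (show k ≠ M + 1 by omega), hstk]
        funext r
        by_cases e1 : r = M + 1
        · subst e1; rw [hst1]; simp [show M + 1 ≠ k by omega]
        · by_cases e2 : r = k
          · subst e2; rw [hstk]; simp [unary]
          · by_cases e3 : r = o
            · subst e3; simp [e1, e2, hsto]
            · simp [e1, e2, hst _ _ _ e1 e2 e3]
      have htemp : ∀ r, k + 1 ≤ r → r < M → st j w r = [] := fun r hr hr' => by
        rw [hst _ _ _ (by omega) (by omega) (by omega)]
        exact ht r (by omega) (by omega)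
      have hupd : ∀ w', Function.update (st j w) o w' = st j w' := fun w' => by
        simp only [st, Function.update_idem]
      have k2 := h2 (a, j) (B + t1 B) o (st j w) (by omega) (hval j w)
        (fun r hr hr' => htemp r hr (by omega)) (hBv j (by omega))
      have k3 := h3 (a, j) (B + t1 B) o (st j w) (by omega) (hval j w)
        (fun r hr hr' => htemp r hr (by omega)) (hBv j (by omega))
      rw [hsto, hupd] at k2 k3
      have hp1 := Run.pop (st (j + 1) w) (M + 1)
      have hp2 := Run.pop (Function.update (st (j + 1) w) (M + 1) (st (j + 1) w (M + 1)).tail) k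
      rw [hpop] at hp2
      have hbody : Run (.branch (M + 1) (.seq (.pop (M + 1)) (.seq (.pop k) (p2 o)))
          (.seq (.pop (M + 1)) (.seq (.pop k) (p3 o)))) (st (j + 1) w)
          (t2 (B + t1 B) + t3 (B + t1 B) + 3)
          (st j ((if s.getD j false = true then g₁ (a, j) else g₀ (a, j)) ++ w)) := by
        have hhead : (st (j + 1) w (M + 1)).head? = some (s.getD j false) := by
          rw [hst1, take_succ_reverse s j (by omega)]; rfl
        cases hb : s.getD j false
        · rw [hb] at hhead
          simp only [Bool.false_eq_true, if_false]
          exact (Run.branch_false (by simp [hhead]) (hp1.seq (hp2.seq k3))).mono (by omega)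
        · rw [hb] at hhead
          simp only [if_true]
          exact (Run.branch_true hhead (hp1.seq (hp2.seq k2))).mono (by omega)
      have hih := ih (by omega) ((if s.getD j false = true then g₁ (a, j) else g₀ (a, j)) ++ w)
      have hne : st (j + 1) w (M + 1) ≠ [] := by
        rw [hst1, take_succ_reverse s j (by omega)]; simp
      rw [List.range_succ, List.flatMap_append]
      simp only [List.flatMap_cons, List.flatMap_nil, List.append_nil, List.append_assoc]
      refine (Run.loop_step hne hbody hih).mono ?_
      have : (j + 1) * (t2 (B + t1 B) + t3 (B + t1 B) + 4) =
        j * (t2 (B + t1 B) + t3 (B + t1 B) + 4) + (t2 (B + t1 B) + t3 (B + t1 B) + 4) := by ring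
      omega
  have r4 := hloop s.length le_rfl (σ o)
  have hfin : ∀ w, st 0 w = Function.update σ o w := fun w => by
    funext r
    by_cases e3 : r = o
    · subst e3; rw [hsto]; simp
    · by_cases e1 : r = M + 1
      · subst e1; rw [hst1]; simp [e3, hM1]
      · by_cases e2 : r = k
        · subst e2; rw [hstk]; simp [e3, hk0, unary]
        · rw [hst _ _ _ e1 e2 e3]; simp [e3]
  rw [hfin] at r4
  refine (r1.seq (r2.seq (r3.seq r4))).mono ?_
  have := Nat.mul_le_mul_right (t2 (B + t1 B) + t3 (B + t1 B) + 4) hlen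
  simp only [List.length_reverse]
  omega

theorem unary_getD (n i : ℕ) (hi : i < n) : (unary n).getD i false = true := by
  simp [unary, hi]

theorem flatMap_replicate {γ : Type*} (l : List γ) (n : ℕ) :
    (l.flatMap fun _ => List.replicate n true) = List.replicate (l.length * n) true := by
  induction l with
  | nil => simp
  | cons x l ih =>
    rw [List.flatMap_cons, ih, List.length_cons, ← List.replicate_add]
    congr 1
    ring

/-- A loop over the numbers below a given one. -/
theorem PS.flatMap {X : Ctx α} {m : α → ℕ} (hm : PN X m) {g : α × ℕ → List Bool}
    (hg : PS X.nat g) : PS X fun a => (List.range (m a)).flatMap fun i => g (a, i) := by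
  refine (PS.bits hm hg (PS.const _ [])).congr fun a => ?_
  rw [length_unary]
  refine List.flatMap_congr fun i hi => ?_
  rw [unary_getD _ _ (List.mem_range.1 hi), if_pos rfl]

theorem PS.length {X : Ctx α} {f : α → List Bool} (hf : PS X f) : PN X fun a => (f a).length := by
  refine (PS.bits hf (PS.const _ [true]) (PS.const _ [true])).congr fun a => ?_
  simpa [unary] using (flatMap_replicate (List.range (f a).length) 1).symm

theorem PN.const (X : Ctx α) (k : ℕ) : PN X fun _ => k := PS.const X _

theorem PN.add {X : Ctx α} {f g : α → ℕ} (hf : PN X f) (hg : PN X g) : PN X fun a => f a + g a :=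
  (PS.append hf hg).congr fun _ => List.replicate_add ..

theorem PN.weaken {X : Ctx α} {f : α → ℕ} (hf : PN X f) : PN X.nat fun b => f b.1 :=
  PS.weaken_nat hf

theorem PN.mul {X : Ctx α} {f g : α → ℕ} (hf : PN X f) (hg : PN X g) : PN X fun a => f a * g a := by
  refine (PS.flatMap hf (PN.weaken hg)).congr fun a => ?_
  simp [unary, flatMap_replicate]

theorem PN.pow {X : Ctx α} {f : α → ℕ} (hf : PN X f) (k : ℕ) : PN X fun a => f a ^ k := by
  induction k with
  | zero => simpa using PN.const X 1
  | succ k ih => simpa only [pow_succ] using PN.mul ih hf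

/-- A call of a program. -/
theorem PS.call {X : Ctx α} {f₁ f₂ f₃ : α → List Bool} (h₁ : PS X f₁) (h₂ : PS X f₂)
    (h₃ : PS X f₃) (q : Prog) (F : α → List Bool) (t : ℕ → ℕ) (ht : PolyB t)
    (hq : ∀ a B, (∀ v < X.n, (X.R a v).length ≤ B) → q.Computes (t B) [f₁ a, f₂ a, f₃ a] [F a]) :
    PS X F := by
  intro ρ k hρ
  obtain ⟨m1, t1, p1, hm1, ht1, g1⟩ := h₁ ρ k hρ
  obtain ⟨m2, t2, p2, hm2, ht2, g2⟩ := h₂ ρ k hρ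
  obtain ⟨m3, t3, p3, hm3, ht3, g3⟩ := h₃ ρ k hρ
  obtain ⟨M, hM⟩ : ∃ M, M = max m1 (max m2 m3) := ⟨_, rfl⟩
  obtain ⟨N, hN⟩ : ∃ N, N = max q.bound 3 := ⟨_, rfl⟩
  have hT : PolyB fun B => t1 B + t2 B + t3 B + t B := ((ht1.add ht2).add ht3).add ht
  -- The subroutine works in the window `M, …, M + N - 1`. Its result passes through `M + N` because
  -- a single move would reverse it, and the window is cleared because temporary registers have to
  -- be empty again for the next call.
  refine ⟨M + N + 1, _, fun o => .seq (p1 M) (.seq (p2 (M + 1)) (.seq (p3 (M + 2))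
    (.seq (q.shift M) (.seq (.move M (M + N)) (.seq (.move (M + N) o) (.clearAll M N)))))), by omega,
    ht1.add (ht2.add (ht3.add (ht.add ((((PolyB.const 4).mul hT).add (PolyB.const 1)).add
      ((((PolyB.const 4).mul hT).add (PolyB.const 1)).add
        (((PolyB.const N).mul (((PolyB.const 2).mul hT).add (PolyB.const 1))).add
          (PolyB.const 1))))))), ?_⟩
  intro a B o σ ho hσ hemp hB
  have hemp' : ∀ r, k ≤ r → r < M + N + 1 → σ r = [] := hemp
  have r1 := g1 a B M σ (by omega) hσ (fun r hr hr' => hemp r hr (by omega)) hB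
  rw [hemp M (by omega) (by omega), List.append_nil] at r1
  have l1 := r1.length_le M
  rw [Function.update_self, hemp M (by omega) (by omega)] at l1
  obtain ⟨σ1, hσ1⟩ : ∃ σ1, σ1 = Function.update σ M (f₁ a) := ⟨_, rfl⟩
  rw [← hσ1] at r1
  have v1 : ∀ r, r ≠ M → σ1 r = σ r := fun r hr => by rw [hσ1, Function.update_of_ne hr]
  have r2 := g2 a B (M + 1) σ1 (by omega)
    (fun v hv => by rw [v1 _ (by have := hρ v hv; omega), hσ v hv])
    (fun r hr hr' => by rw [v1 _ (by omega)]; exact hemp r hr (by omega)) hB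
  rw [v1 _ (by omega), hemp (M + 1) (by omega) (by omega), List.append_nil] at r2
  have l2 := r2.length_le (M + 1)
  rw [Function.update_self, v1 _ (by omega), hemp (M + 1) (by omega) (by omega)] at l2
  obtain ⟨σ2, hσ2⟩ : ∃ σ2, σ2 = Function.update σ1 (M + 1) (f₂ a) := ⟨_, rfl⟩
  rw [← hσ2] at r2
  have v2 : ∀ r, r ≠ M → r ≠ M + 1 → σ2 r = σ r := fun r hr hr' => by
    rw [hσ2, Function.update_of_ne hr', v1 _ hr]
  have r3 := g3 a B (M + 2) σ2 (by omega)
    (fun v hv => by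
      have := hρ v hv
      rw [v2 _ (by omega) (by omega), hσ v hv])
    (fun r hr hr' => by rw [v2 _ (by omega) (by omega)]; exact hemp r hr (by omega)) hB
  rw [v2 _ (by omega) (by omega), hemp (M + 2) (by omega) (by omega), List.append_nil] at r3
  have l3 := r3.length_le (M + 2)
  rw [Function.update_self, v2 _ (by omega) (by omega), hemp (M + 2) (by omega) (by omega)] at l3
  obtain ⟨σ3, hσ3⟩ : ∃ σ3, σ3 = Function.update σ2 (M + 2) (f₃ a) := ⟨_, rfl⟩
  rw [← hσ3] at r3
  have v3 : ∀ r, r ≠ M → r ≠ M + 1 → r ≠ M + 2 → σ3 r = σ r := fun r hr hr' hr'' => by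
    rw [hσ3, Function.update_of_ne hr'', v2 _ hr hr']
  obtain ⟨n, τ, hn, hx, hτ⟩ := hq a B hB
  have hin : ∀ r < N, σ3 (M + r) = [f₁ a, f₂ a, f₃ a].getD r [] := by
    intro r hr
    rcases r with _ | _ | _ | r
    · rw [hσ3, Function.update_of_ne (by omega), hσ2, Function.update_of_ne (by omega), hσ1]
      simp
    · rw [hσ3, Function.update_of_ne (by omega), hσ2]; simp
    · rw [hσ3]; simp
    · rw [v3 _ (by omega) (by omega) (by omega), hemp _ (by omega) (by omega)]; simp
  obtain ⟨τ', hx', hτ1, hτ2⟩ := hx.shift M N (by omega) σ3 hin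
  have r4 : Run (q.shift M) σ3 (t B) τ' := ⟨n, hn, hx'⟩
  have hlen : ∀ r, M ≤ r → r < M + N → (τ' r).length ≤ t1 B + t2 B + t3 B + t B := by
    intro r hr hr'
    have h4 := r4.length_le r
    obtain ⟨j, rfl⟩ := Nat.exists_eq_add_of_le hr
    rw [hin j (by omega)] at h4
    have h5 : ([f₁ a, f₂ a, f₃ a].getD j []).length ≤ t1 B + t2 B + t3 B := by
      rcases j with _ | _ | _ | j <;> simp at l1 l2 l3 ⊢ <;> omega
    omega
  have h0 : τ' M = F a := by
    have := hτ1 0 (by omega)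
    rw [Nat.add_zero] at this
    rw [this, hτ 0 (by simp)]; rfl
  have hFlen : (F a).length ≤ t1 B + t2 B + t3 B + t B := h0 ▸ hlen M le_rfl (by omega)
  have hMN : τ' (M + N) = [] := by
    rw [hτ2 _ (Or.inr le_rfl), v3 _ (by omega) (by omega) (by omega)]
    exact hemp _ (by omega) (by omega)
  have r5 := run_move (show M ≠ M + N by omega) (F a) τ' h0
  rw [hMN, List.append_nil] at r5
  obtain ⟨σ5, hσ5⟩ : ∃ σ5, σ5 = Function.update (Function.update τ' (M + N) (F a).reverse) M [] :=
    ⟨_, rfl⟩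
  rw [← hσ5] at r5
  have r6 := run_move (show M + N ≠ o by omega) (F a).reverse σ5 (by
    rw [hσ5, Function.update_of_ne (by omega), Function.update_self])
  rw [List.reverse_reverse] at r6
  obtain ⟨σ6, hσ6⟩ : ∃ σ6, σ6 = Function.update (Function.update σ5 o (F a ++ σ5 o)) (M + N) [] :=
    ⟨_, rfl⟩
  rw [← hσ6] at r6
  have v6 : ∀ r, M < r → r < M + N → σ6 r = τ' r := fun r h1 h2 => by
    rw [hσ6, Function.update_of_ne (by omega), Function.update_of_ne (by omega), hσ5,
      Function.update_of_ne (by omega), Function.update_of_ne (by omega)]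
  have r7 := run_clearAll M N (t1 B + t2 B + t3 B + t B) σ6 (by
    intro r hr hr'
    by_cases e : r = M
    · subst e
      rw [hσ6, Function.update_of_ne (by omega), Function.update_of_ne (by omega), hσ5,
        Function.update_self]
      simp
    · rw [v6 r (by omega) hr']
      exact hlen r hr hr')
  have hfin : (fun r => if M ≤ r ∧ r < M + N then [] else σ6 r) =
      Function.update σ o (F a ++ σ o) := by
    funext r
    by_cases e1 : M ≤ r ∧ r < M + N
    · rw [if_pos e1, Function.update_of_ne (by omega), hemp r (by omega) (by omega)]
    · rw [if_neg e1]
      by_cases e2 : r = M + N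
      · subst e2
        rw [hσ6, Function.update_self, Function.update_of_ne (by omega),
          hemp _ (by omega) (by omega)]
      · have h5 : σ5 r = σ r := by
          rw [hσ5, Function.update_of_ne (by omega), Function.update_of_ne e2, hτ2 r (by omega),
            v3 r (by omega) (by omega) (by omega)]
        by_cases e3 : r = o
        · subst e3
          rw [hσ6, Function.update_of_ne e2, Function.update_self, Function.update_self, h5]
        · rw [hσ6, Function.update_of_ne e2, Function.update_of_ne e3, h5,
            Function.update_of_ne e3]
  rw [hfin] at r7
  refine (r1.seq (r2.seq (r3.seq (r4.seq (r5.seq (r6.seq r7)))))).mono ?_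
  simp only [List.length_reverse]
  omega

/-- A computable function of three strings is computed by a program. -/
theorem PS.computes {X : Ctx α} {f : α → List Bool} (hf : PS X f) (hX : X.n = 3) :
    ∃ (p : Prog) (t : ℕ → ℕ), PolyB t ∧ ∀ a B, (∀ v < 3, (X.R a v).length ≤ B) →
      p.Computes (t B) [X.R a 0, X.R a 1, X.R a 2] [f a] := by
  obtain ⟨m, t, p, hm, ht, h⟩ := hf id 3 (by simp [hX])
  -- The first input is still in register `0`, which has to be cleared before the result can be
  -- moved there.
  refine ⟨.seq (p m) (.seq (.move m (m + 1)) (.seq (.clear 0) (.move (m + 1) 0))), _,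
    ht.add ((((PolyB.const 4).mul ht).add (PolyB.const 1)).add
      ((((PolyB.const 2).mul PolyB.id).add (PolyB.const 1)).add
        (((PolyB.const 4).mul ht).add (PolyB.const 1)))), fun a B hB => ?_⟩
  obtain ⟨σ, hσ⟩ : ∃ σ : ℕ → List Bool, σ = fun r => [X.R a 0, X.R a 1, X.R a 2].getD r [] :=
    ⟨_, rfl⟩
  have hbig : ∀ r, 3 ≤ r → σ r = [] := fun r hr => by
    rw [hσ]; rcases r with _ | _ | _ | r <;> first | omega | simp
  have r1 := h a B m σ le_rfl (fun v hv => by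
    rw [hX] at hv
    rw [hσ]; rcases v with _ | _ | _ | v <;> first | omega | simp)
    (fun r hr _ => hbig r hr) (fun v hv => hB v (hX ▸ hv))
  rw [hbig m hm, List.append_nil] at r1
  have l1 := r1.length_le m
  rw [Function.update_self, hbig m hm] at l1
  have r2 := run_move (show m ≠ m + 1 by omega) (f a) (Function.update σ m (f a)) (by simp)
  have r3 := run_clear 0 (X.R a 0) (Function.update (Function.update (Function.update σ m (f a)) (m + 1)
    ((f a).reverse ++ Function.update σ m (f a) (m + 1))) m []) (by
      rw [Function.update_of_ne (by omega), Function.update_of_ne (by omega),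
        Function.update_of_ne (by omega), hσ]; simp)
  have r4 := run_move (show m + 1 ≠ 0 by omega) (f a).reverse _
    (show Function.update (Function.update (Function.update (Function.update σ m (f a)) (m + 1)
    ((f a).reverse ++ Function.update σ m (f a) (m + 1))) m []) 0 [] (m + 1) = _ by
      rw [Function.update_of_ne (by omega), Function.update_of_ne (by omega), Function.update_self,
        Function.update_of_ne (by omega), hbig _ (by omega), List.append_nil])
  obtain ⟨n, hn, hx⟩ := r1.seq (r2.seq (r3.seq r4))
  refine ⟨n, _, hn.trans ?_, hσ ▸ hx, ?_⟩
  · have h0 := hB 0 (by omega)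
    simp only [List.length_reverse] at l1 ⊢
    simp only [List.length_nil] at l1
    omega
  · intro r hr
    have : r = 0 := by simpa using hr
    subst this
    rw [Function.update_of_ne (by omega), Function.update_self]
    simp

end ContextLoops

/-! ## Parsing of circuit descriptions -/

section Parsing

/-- The registers with the contents `l`. -/
def regs (l : List (List Bool)) : ℕ → List Bool := fun r => l.getD r []

theorem regs_update (l : List (List Bool)) (r : ℕ) (hr : r < l.length) (w : List Bool) :
    Function.update (regs l) r w = regs (l.set r w) := by
  funext j
  by_cases e : j = r
  · subst e; simp [regs, hr]
  · simp [regs, e, List.getD_eq_getElem?_getD, List.getElem?_set_ne (Ne.symm e)]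

theorem Run.regs_push (l : List (List Bool)) (r : ℕ) (hr : r < l.length) (b : Bool) :
    Run (.push r b) (regs l) 1 (regs (l.set r (b :: regs l r))) :=
  (Run.push _ r b).congr (regs_update l r hr _).symm

theorem Run.regs_pop (l : List (List Bool)) (r : ℕ) (hr : r < l.length) :
    Run (.pop r) (regs l) 1 (regs (l.set r (regs l r).tail)) :=
  (Run.pop _ r).congr (regs_update l r hr _).symm

theorem Run.regs_clear (l : List (List Bool)) (r : ℕ) (hr : r < l.length) :
    Run (.clear r) (regs l) (2 * (regs l r).length + 1) (regs (l.set r [])) :=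
  (run_clear r _ _ rfl).congr (regs_update l r hr _).symm

theorem Run.regs_pushAll (l : List (List Bool)) (r : ℕ) (hr : r < l.length) (w : List Bool) :
    Run (.pushAll r w) (regs l) (w.length + 1) (regs (l.set r (w ++ regs l r))) :=
  (run_pushAll r w _).congr (regs_update l r hr _).symm

theorem Run.regs_move (l : List (List Bool)) (a b : ℕ) (hab : a ≠ b) (ha : a < l.length)
    (hb : b < l.length) :
    Run (.move a b) (regs l) (4 * (regs l a).length + 1)
      (regs ((l.set b ((regs l a).reverse ++ regs l b)).set a [])) :=
  (run_move hab _ _ rfl).congr (by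
    rw [regs_update l b hb, regs_update _ a (by simpa using ha)])

theorem Run.regs_dup (l : List (List Bool)) (a b c : ℕ) (hab : a ≠ b) (hac : a ≠ c) (hbc : b ≠ c)
    (ha : a < l.length) (hb : b < l.length) (hc : c < l.length) :
    Run (.dup a b c) (regs l) (5 * (regs l a).length + 1)
      (regs (((l.set b ((regs l a).reverse ++ regs l b)).set c
        ((regs l a).reverse ++ regs l c)).set a [])) :=
  (run_dup hab hac hbc _ _ rfl).congr (by
    rw [regs_update l b hb, regs_update _ c (by simpa using hc),
      regs_update _ a (by simpa using ha)])

/-- Move the description of a wire from register `0` to register `r`. -/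
def Prog.wire (r : ℕ) : Prog :=
  .seq (.push r false) (.seq (.push 3 true)
    (.loop 3 (.branch 0 (.seq (.pop 0) (.push r true)) (.seq (.pop 0) (.pop 3)))))

/-- Register `3` holds one bit as the loop condition, removed when the end mark of the wire number
is met. The end mark of the copy lies at the bottom of register `r` from the beginning, below the
bits counted here. -/
theorem run_wire_loop {r : ℕ} (h0 : r ≠ 0) (h3 : r ≠ 3) (i : ℕ) (c : List Bool)
    (σ : ℕ → List Bool) (hσ : σ 0 = wireCode i ++ c) (hσ3 : σ 3 = [true]) :
    Run (.loop 3 (.branch 0 (.seq (.pop 0) (.push r true)) (.seq (.pop 0) (.pop 3)))) σ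
      (4 * i + 5) (Function.update (Function.update (Function.update σ 0 c) 3 []) r
        (List.replicate i true ++ σ r)) := by
  induction i generalizing σ with
  | zero =>
    have hs := Run.branch_false (p := .seq (.pop 0) (.push r true))
      (show (σ 0).head? ≠ some true by simp [hσ, wireCode])
      ((Run.pop σ 0).seq (Run.pop _ 3))
    refine (Run.loop_step (by simp [hσ3]) hs ((Run.loop_done (by simp [hσ3])).congr ?_)).mono
      (by omega)
    funext j
    by_cases e : j = r
    · subst e; simp [h0, h3]
    · by_cases e3 : j = 3
      · subst e3; simp [e, hσ3]
      · by_cases e0 : j = 0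
        · subst e0; simp [e, hσ, wireCode]
        · simp [e, e3, e0]
  | succ i ih =>
    have hs := Run.branch_true (q := .seq (.pop 0) (.pop 3))
      (show (σ 0).head? = some true by simp [hσ, wireCode, List.replicate_succ])
      ((Run.pop σ 0).seq (Run.push _ r true))
    refine (Run.loop_step (by simp [hσ3]) hs ((ih _ ?_ ?_).congr ?_)).mono (by omega)
    · simp [h0.symm, hσ, wireCode, List.replicate_succ]
    · simp [h3.symm, hσ3]
    · funext j
      by_cases e : j = r
      · subst e; simp [h0, List.replicate_succ']
      · by_cases e3 : j = 3
        · subst e3; simp [e]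
        · by_cases e0 : j = 0
          · subst e0; simp [e]
          · simp [e, e3, e0]

theorem Run.regs_wire (l : List (List Bool)) (r : ℕ) (h0 : r ≠ 0) (h3 : r ≠ 3) (hr : r < l.length)
    (i : ℕ) (c : List Bool) (hl : regs l 0 = wireCode i ++ c) (hl3 : regs l 3 = [])
    (hlr : regs l r = []) :
    Run (.wire r) (regs l) (4 * i + 7) (regs ((l.set 0 c).set r (wireCode i))) := by
  have h1 := Run.push (regs l) r false
  have h2 := Run.push (Function.update (regs l) r (false :: regs l r)) 3 true
  have k3 := run_wire_loop h0 h3 i c (Function.update (Function.update (regs l) r (false :: regs l r))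
    3 (true :: Function.update (regs l) r (false :: regs l r) 3)) (by simp [h0.symm, hl])
    (by simp [h3.symm, hl3])
  refine ((h1.seq (h2.seq k3)).congr ?_).mono (by omega)
  rw [← regs_update _ r (by simpa using hr), ← regs_update _ 0 (by omega)]
  funext j
  by_cases e : j = r
  · subst e; simp [h3, hlr, wireCode]
  · by_cases e3 : j = 3
    · subst e3; simp [e, hl3]
    · by_cases e0 : j = 0
      · subst e0; simp [e]
      · simp [e, e3, e0]

/-- The strings that describe a gate: its controls and its target, and a mark for its kind. -/
def Raw.ctrl : Raw → List (List Bool)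
  | .not i => [[], [], wireCode i, [true], [], [], [], []]
  | .cnot a i => [wireCode a, [], wireCode i, [], [true], [], [], []]
  | .tof a b i => [wireCode a, wireCode b, wireCode i, [], [], [true], [], []]
  | .had i => [[], [], wireCode i, [], [], [], [true], []]
  | .tg i => [[], [], wireCode i, [], [], [], [], [true]]

/-- Read a gate. -/
def Prog.gate : Prog :=
  .branch 0 (.seq (.pop 0) (.seq (.pop 0) (.seq (.pop 0) (.seq (.push 11 true) (.wire 6)))))
    (.seq (.pop 0) (.branch 0
      (.seq (.pop 0) (.branch 0
        (.seq (.pop 0) (.seq (.push 10 true) (.wire 6)))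
        (.seq (.pop 0) (.seq (.push 9 true) (.seq (.wire 4) (.seq (.wire 5) (.wire 6)))))))
      (.seq (.pop 0) (.branch 0
        (.seq (.pop 0) (.seq (.push 8 true) (.seq (.wire 4) (.wire 6))))
        (.seq (.pop 0) (.seq (.push 7 true) (.wire 6)))))))

/-- Descriptions of gates can be parsed without lookahead: three bits fix the kind, hence the number
of wires, and each wire number has an end mark. -/
theorem run_gate (g : Raw) (c o : List Bool) :
    Run .gate (regs ([g.code ++ c, o, [], []] ++ List.replicate 8 [])) (4 * g.code.length + 28)
      (regs ([c, o, [], []] ++ g.ctrl)) := by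
  cases g with
  | not i =>
    simp only [Raw.code, List.cons_append, List.nil_append]
    refine Run.mono (Run.branch_false (by simp [regs]) ((Run.regs_pop _ 0 (by simp)).seq
      (Run.branch_false (by simp [regs]) ((Run.regs_pop _ 0 (by simp)).seq
      (Run.branch_false (by simp [regs]) ((Run.regs_pop _ 0 (by simp)).seq
      ((Run.regs_push _ 7 (by simp) true).seq
      ((Run.regs_wire _ 6 (by simp) (by simp) (by simp) i c rfl rfl rfl)))))))))
      (by simp [wireCode]; omega)
  | cnot a i =>
    simp only [Raw.code, List.append_assoc, List.cons_append, List.nil_append]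
    refine Run.mono (Run.branch_false (by simp [regs]) ((Run.regs_pop _ 0 (by simp)).seq
      (Run.branch_false (by simp [regs]) ((Run.regs_pop _ 0 (by simp)).seq
      (Run.branch_true (by simp [regs]) ((Run.regs_pop _ 0 (by simp)).seq
      ((Run.regs_push _ 8 (by simp) true).seq
      ((Run.regs_wire _ 4 (by simp) (by simp) (by simp) a (wireCode i ++ c) rfl rfl rfl).seq
      (Run.regs_wire _ 6 (by simp) (by simp) (by simp) i c rfl rfl rfl)))))))))
      (by simp [wireCode]; omega)
  | tof a b i =>
    simp only [Raw.code, List.append_assoc, List.cons_append, List.nil_append]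
    refine Run.mono (Run.branch_false (by simp [regs]) ((Run.regs_pop _ 0 (by simp)).seq
      (Run.branch_true (by simp [regs]) ((Run.regs_pop _ 0 (by simp)).seq
      (Run.branch_false (by simp [regs]) ((Run.regs_pop _ 0 (by simp)).seq
      ((Run.regs_push _ 9 (by simp) true).seq
      ((Run.regs_wire _ 4 (by simp) (by simp) (by simp) a (wireCode b ++ (wireCode i ++ c))
        rfl rfl rfl).seq
      ((Run.regs_wire _ 5 (by simp) (by simp) (by simp) b (wireCode i ++ c) rfl rfl rfl).seq
      (Run.regs_wire _ 6 (by simp) (by simp) (by simp) i c rfl rfl rfl))))))))))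
      (by simp [wireCode]; omega)
  | had i =>
    simp only [Raw.code, List.cons_append, List.nil_append]
    refine Run.mono (Run.branch_false (by simp [regs]) ((Run.regs_pop _ 0 (by simp)).seq
      (Run.branch_true (by simp [regs]) ((Run.regs_pop _ 0 (by simp)).seq
      (Run.branch_true (by simp [regs]) ((Run.regs_pop _ 0 (by simp)).seq
      ((Run.regs_push _ 10 (by simp) true).seq
      ((Run.regs_wire _ 6 (by simp) (by simp) (by simp) i c rfl rfl rfl)))))))))
      (by simp [wireCode]; omega)
  | tg i =>
    simp only [Raw.code, List.cons_append, List.nil_append]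
    refine Run.mono (Run.branch_true (by simp [regs]) ((Run.regs_pop _ 0 (by simp)).seq
      ((Run.regs_pop _ 0 (by simp)).seq ((Run.regs_pop _ 0 (by simp)).seq
      ((Run.regs_push _ 11 (by simp) true).seq
      ((Run.regs_wire _ 6 (by simp) (by simp) (by simp) i c rfl rfl rfl)))))))
      (by simp [wireCode]; omega)

/-- Clear the description of a gate. -/
def Prog.clearGate : Prog :=
  .seq (.clear 4) (.seq (.clear 5) (.seq (.clear 6) (.seq (.clear 7) (.seq (.clear 8)
    (.seq (.clear 9) (.seq (.clear 10) (.clear 11)))))))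

theorem run_clearGate (c o : List Bool) (l : List (List Bool)) (hl : l.length = 8) (L : ℕ)
    (hL : ∀ w ∈ l, w.length ≤ L) :
    Run .clearGate (regs ([c, o, [], []] ++ l)) (16 * L + 8)
      (regs ([c, o, [], []] ++ List.replicate 8 [])) := by
  obtain ⟨a0, a1, a2, a3, a4, a5, a6, a7, rfl⟩ : ∃ a0 a1 a2 a3 a4 a5 a6 a7,
      l = [a0, a1, a2, a3, a4, a5, a6, a7] := by
    match l, hl with
    | [a0, a1, a2, a3, a4, a5, a6, a7], _ => exact ⟨a0, a1, a2, a3, a4, a5, a6, a7, rfl⟩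
  refine Run.mono ((Run.regs_clear _ 4 (by simp)).seq ((Run.regs_clear _ 5 (by simp)).seq
    ((Run.regs_clear _ 6 (by simp)).seq ((Run.regs_clear _ 7 (by simp)).seq
    ((Run.regs_clear _ 8 (by simp)).seq ((Run.regs_clear _ 9 (by simp)).seq
    ((Run.regs_clear _ 10 (by simp)).seq (Run.regs_clear _ 11 (by simp))))))))) ?_
  simp only [List.mem_cons, List.not_mem_nil, or_false, forall_eq_or_imp, forall_eq] at hL
  simp [regs]
  omega

theorem Raw.length_ctrl (g : Raw) : g.ctrl.length = 8 := by cases g <;> rfl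

theorem Raw.ctrl_length_le (g : Raw) : ∀ w ∈ g.ctrl, w.length ≤ g.code.length := by
  cases g <;> simp [Raw.ctrl, Raw.code] <;> omega

/-- Replace the description of the gate in the registers `4, …, 11` by that of the first gate of
the circuit in register `0`. -/
def Prog.nextGate : Prog :=
  -- The loop is a test for a nonempty circuit: its body moves the rest of the description to
  -- register `2`, so it is executed at most once. On an empty description the gate registers stay
  -- cleared.
  .seq .clearGate (.seq (.loop 0 (.seq .gate (.move 0 2))) (.move 2 0))

/-- The bound collects `16 L + 8` for clearing, `4 L + 28` for the gate, twice `4 L + 1` for the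
moves, and 2 for the tests of the loop. -/
theorem run_nextGate_cons (g : Raw) (c : List Bool) (l : List (List Bool)) (hl : l.length = 8)
    (L : ℕ) (hL : ∀ w ∈ l, w.length ≤ L) (hgc : (g.code ++ c).length ≤ L) :
    Run .nextGate (regs ([g.code ++ c, [], [], []] ++ l)) (28 * L + 40)
      (regs ([c, [], [], []] ++ g.ctrl)) := by
  have r1 := run_clearGate (g.code ++ c) [] l hl L hL
  have r2 := run_gate g c []
  obtain ⟨a0, a1, a2, a3, a4, a5, a6, a7, hg⟩ : ∃ a0 a1 a2 a3 a4 a5 a6 a7,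
      g.ctrl = [a0, a1, a2, a3, a4, a5, a6, a7] := by
    match g.ctrl, g.length_ctrl with
    | [a0, a1, a2, a3, a4, a5, a6, a7], _ => exact ⟨a0, a1, a2, a3, a4, a5, a6, a7, rfl⟩
  rw [hg] at r2 ⊢
  have hne : g.code ++ c ≠ [] := by cases g <;> simp [Raw.code]
  have r3 := Run.regs_move ([c, [], [], []] ++ [a0, a1, a2, a3, a4, a5, a6, a7]) 0 2 (by simp)
    (by simp) (by simp)
  have r4 := Run.loop_step (r := 0) hne (r2.seq r3) (Run.loop_done rfl)
  have r5 := Run.regs_move ([[], [], c.reverse, []] ++ [a0, a1, a2, a3, a4, a5, a6, a7]) 2 0 (by simp)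
    (by simp) (by simp)
  have e4 : (([c, [], [], []] ++ [a0, a1, a2, a3, a4, a5, a6, a7]).set 2
      ((regs ([c, [], [], []] ++ [a0, a1, a2, a3, a4, a5, a6, a7]) 0).reverse ++
        regs ([c, [], [], []] ++ [a0, a1, a2, a3, a4, a5, a6, a7]) 2)).set 0 [] =
      [[], [], c.reverse, []] ++ [a0, a1, a2, a3, a4, a5, a6, a7] := by simp [regs]
  rw [e4] at r4
  refine Run.mono ((r1.seq (r4.seq r5)).congr ?_) ?_
  · simp [regs]
  · simp [regs] at hgc ⊢
    omega

theorem run_nextGate_nil (l : List (List Bool)) (hl : l.length = 8)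
    (L : ℕ) (hL : ∀ w ∈ l, w.length ≤ L) :
    Run .nextGate (regs ([[], [], [], []] ++ l)) (28 * L + 40)
      (regs ([[], [], [], []] ++ List.replicate 8 [])) := by
  have r1 := run_clearGate [] [] l hl L hL
  refine Run.mono (r1.seq ((Run.loop_done rfl).seq ((Run.regs_move _ 2 0 (by simp)
    (by simp) (by simp)).congr ?_))) ?_
  · simp [regs]
  · simp [regs]
    omega

/-- Put the contents of register `r`, which becomes empty, before those of register `1`. -/
def Prog.prepend (r : ℕ) : Prog := .seq (.move r 2) (.move 2 1)

/-- Put a copy of the contents of register `6` before those of register `1`. -/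
def Prog.prependTg : Prog :=
  .seq (.move 6 2) (.seq (.dup 2 6 1) (.pushAll 1 [true, false, false]))

/-- Put the inverse of the gate described in the registers `4, …, 11` before the contents of
register `1`. -/
def Prog.emitInv : Prog :=
  .branch 7 (.seq (.prepend 6) (.pushAll 1 [false, false, false]))
    (.branch 8 (.seq (.prepend 6) (.seq (.prepend 4) (.pushAll 1 [false, false, true])))
      (.branch 9 (.seq (.prepend 6) (.seq (.prepend 5) (.seq (.prepend 4)
          (.pushAll 1 [false, true, false]))))
        (.branch 10 (.seq (.prepend 6) (.pushAll 1 [false, true, true]))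
          (.seq .prependTg (.seq .prependTg (.seq .prependTg (.seq .prependTg (.seq .prependTg
            (.seq .prependTg .prependTg)))))))))

theorem Run.regs_prepend (l : List (List Bool)) (r : ℕ) (h1 : r ≠ 1) (h2 : r ≠ 2)
    (hr : r < l.length) (h3 : 2 < l.length) (hl2 : regs l 2 = []) :
    Run (.prepend r) (regs l) (8 * (regs l r).length + 2)
      (regs ((l.set 1 (regs l r ++ regs l 1)).set r [])) := by
  have r1 := run_move h2 _ (regs l) rfl
  have r2 := run_move (show 2 ≠ 1 by simp) (regs l r).reverse (Function.update (Function.update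
    (regs l) 2 ((regs l r).reverse ++ regs l 2)) r []) (by simp [h2.symm, hl2])
  refine Run.mono ((r1.seq r2).congr ?_) (by simp; omega)
  rw [← regs_update _ r (by simpa using hr), ← regs_update _ 1 (by omega)]
  funext j
  by_cases e2 : j = 2
  · subst e2; simp [h2.symm, hl2]
  · by_cases e1 : j = 1
    · subst e1; simp [h1.symm]
    · by_cases e : j = r
      · subst e; simp [e1, e2]
      · simp [e, e1, e2]

theorem run_prependTg (l : List (List Bool)) (w o : List Bool) (c : List Bool) :
    Run .prependTg (regs ([c, o, [], [], [], [], w] ++ l)) (9 * w.length + 6)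
      (regs ([c, [true, false, false] ++ w ++ o, [], [], [], [], w] ++ l)) := by
  refine Run.mono (((Run.regs_move _ 6 2 (by simp) (by simp) (by simp)).seq
    ((Run.regs_dup _ 2 6 1 (by simp) (by simp) (by simp) (by simp) (by simp) (by simp)).seq
    (Run.regs_pushAll _ 1 (by simp) _))).congr ?_) (by simp [regs]; omega)
  simp [regs]

/-- Every gate other than `T` is emitted as it is; `T` is emitted seven times, with its wire kept in
register `6`. The strings `l` are what remains to be cleared. -/
theorem run_emitInv (g : Raw) (c o : List Bool) :
    ∃ l, l.length = 8 ∧ (∀ w ∈ l, w.length ≤ g.code.length) ∧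
    Run .emitInv (regs ([c, o, [], []] ++ g.ctrl)) (64 * g.code.length + 80)
      (regs ([c, rcode g.inv ++ o, [], []] ++ l)) := by
  cases g with
  | not i =>
    refine ⟨[[], [], [], [true], [], [], [], []], rfl, by simp [Raw.code], ?_⟩
    refine Run.mono ((Run.branch_true (by simp [regs, Raw.ctrl])
      ((Run.regs_prepend _ 6 (by simp) (by simp) (by simp [Raw.ctrl]) (by simp) rfl).seq
      (Run.regs_pushAll _ 1 (by simp) _))).congr ?_) (by simp [regs, Raw.ctrl, Raw.code]; omega)
    simp [regs, Raw.ctrl, Raw.inv, Raw.code]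
  | cnot a i =>
    refine ⟨[[], [], [], [], [true], [], [], []], rfl, by simp [Raw.code], ?_⟩
    refine Run.mono ((Run.branch_false (by simp [regs, Raw.ctrl])
      (Run.branch_true (by simp [regs, Raw.ctrl])
      ((Run.regs_prepend _ 6 (by simp) (by simp) (by simp [Raw.ctrl]) (by simp) rfl).seq
      ((Run.regs_prepend _ 4 (by simp) (by simp) (by simp [Raw.ctrl]) (by simp) rfl).seq
      (Run.regs_pushAll _ 1 (by simp) _))))).congr ?_) (by simp [regs, Raw.ctrl, Raw.code]; omega)
    simp [regs, Raw.ctrl, Raw.inv, Raw.code]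
  | tof a b i =>
    refine ⟨[[], [], [], [], [], [true], [], []], rfl, by simp [Raw.code], ?_⟩
    refine Run.mono ((Run.branch_false (by simp [regs, Raw.ctrl])
      (Run.branch_false (by simp [regs, Raw.ctrl]) (Run.branch_true (by simp [regs, Raw.ctrl])
      ((Run.regs_prepend _ 6 (by simp) (by simp) (by simp [Raw.ctrl]) (by simp) rfl).seq
      ((Run.regs_prepend _ 5 (by simp) (by simp) (by simp [Raw.ctrl]) (by simp) rfl).seq
      ((Run.regs_prepend _ 4 (by simp) (by simp) (by simp [Raw.ctrl]) (by simp) rfl).seq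
      (Run.regs_pushAll _ 1 (by simp) _))))))).congr ?_) (by simp [regs, Raw.ctrl, Raw.code]; omega)
    simp [regs, Raw.ctrl, Raw.inv, Raw.code]
  | had i =>
    refine ⟨[[], [], [], [], [], [], [true], []], rfl, by simp [Raw.code], ?_⟩
    refine Run.mono ((Run.branch_false (by simp [regs, Raw.ctrl])
      (Run.branch_false (by simp [regs, Raw.ctrl]) (Run.branch_false (by simp [regs, Raw.ctrl])
      (Run.branch_true (by simp [regs, Raw.ctrl])
      ((Run.regs_prepend _ 6 (by simp) (by simp) (by simp [Raw.ctrl]) (by simp) rfl).seq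
      (Run.regs_pushAll _ 1 (by simp) _)))))).congr ?_) (by simp [regs, Raw.ctrl, Raw.code]; omega)
    simp [regs, Raw.ctrl, Raw.inv, Raw.code]
  | tg i =>
    refine ⟨[[], [], wireCode i, [], [], [], [], [true]], rfl, by simp [Raw.code]; omega, ?_⟩
    refine Run.mono ((Run.branch_false (by simp [regs])
      (Run.branch_false (by simp [regs]) (Run.branch_false (by simp [regs])
      (Run.branch_false (by simp [regs])
      ((run_prependTg _ (wireCode i) _ c).seq ((run_prependTg _ (wireCode i) _ c).seq
      ((run_prependTg _ (wireCode i) _ c).seq ((run_prependTg _ (wireCode i) _ c).seq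
      ((run_prependTg _ (wireCode i) _ c).seq ((run_prependTg _ (wireCode i) _ c).seq
      (run_prependTg [[], [], [], [], [true]] (wireCode i) _ c))))))))))).congr ?_)
      (by simp [Raw.code]; omega)
    simp [Raw.inv, Raw.code, List.replicate]

/-- Replace the description of a circuit by that of the inverse circuit. -/
def Prog.inv : Prog :=
  -- Each inverse gate is put before those already emitted, which reverses the order of the gates.
  .seq (.loop 0 (.seq .gate (.seq .emitInv .clearGate))) (.seq (.move 1 2) (.move 2 0))

theorem Raw.length_inv_le (g : Raw) : (rcode g.inv).length ≤ 7 * g.code.length := by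
  cases g <;> simp [Raw.inv, Raw.code, List.replicate]; omega

theorem length_rinv_le (C : List Raw) : (rcode (rinv C)).length ≤ 7 * (rcode C).length := by
  induction C with
  | nil => simp [rinv]
  | cons g C ih =>
    have := g.length_inv_le
    simp only [rinv, rcode_append, rcode_cons, List.length_append]
    omega

theorem Raw.length_code_pos (g : Raw) : 1 ≤ g.code.length := by
  cases g <;> simp [Raw.code]

/-- A round for a gate with a description of length `c` costs at most `84 c + 117`, hence at most
`201 c` since `c ≥ 1`. -/
theorem run_inv_loop (C : List Raw) (o : List Bool) :
    Run (.loop 0 (.seq .gate (.seq .emitInv .clearGate)))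
      (regs ([rcode C, o, [], []] ++ List.replicate 8 [])) (201 * (rcode C).length + 1)
      (regs ([[], rcode (rinv C) ++ o, [], []] ++ List.replicate 8 [])) := by
  induction C generalizing o with
  | nil => exact Run.loop_done rfl
  | cons g C ih =>
    have r1 := run_gate g (rcode C) o
    obtain ⟨l, hl, hL, r2⟩ := run_emitInv g (rcode C) o
    have r3 := run_clearGate (rcode C) (rcode g.inv ++ o) l hl _ hL
    have hne : g.code ++ rcode C ≠ [] := by cases g <;> simp [Raw.code]
    have r4 := Run.loop_step (r := 0) hne (r1.seq (r2.seq r3)) (ih _)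
    have := g.length_code_pos
    refine (r4.congr ?_).mono ?_
    · simp [rinv]
    · simp
      omega

/-- To the `201` of the loop come `2 · 4 · 7` for two moves of a description that is at most seven
times as long. -/
theorem run_inv (C : List Raw) :
    Run .inv (regs [rcode C, [], []]) (257 * (rcode C).length + 3)
      (regs ([rcode (rinv C), [], [], []] ++ List.replicate 8 [])) := by
  have r1 := run_inv_loop C []
  have r2 := Run.regs_move ([[], rcode (rinv C), [], []] ++ List.replicate 8 []) 1 2 (by simp)
    (by simp) (by simp)
  have r3 := Run.regs_move ([[], [], (rcode (rinv C)).reverse, []] ++ List.replicate 8 []) 2 0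
    (by simp) (by simp) (by simp)
  have e0 : regs ([rcode C, [], [], []] ++ List.replicate 8 []) = regs [rcode C, [], []] := by
    funext r
    rcases r with _ | _ | _ | _ | r
    · rfl
    · rfl
    · rfl
    · rfl
    · simp [regs, List.getD_eq_getElem?_getD]
      rcases r with _ | _ | _ | _ | _ | _ | _ | _ | r <;> rfl
  rw [e0, List.append_nil] at r1
  have hlen := length_rinv_le C
  refine Run.mono ((r1.seq ((r2.congr (τ' := regs ([[], [], (rcode (rinv C)).reverse, []] ++
    List.replicate 8 [])) ?_).seq (r3.congr ?_))).congr rfl) ?_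
  · simp [regs]
  · simp [regs]
  · simp [regs]
    omega

/-- A result cannot be longer than the time it takes to write it. -/
theorem PS.length_le {α : Type*} {X : Ctx α} {f : α → List Bool} (hf : PS X f) :
    ∃ t, PolyB t ∧ ∀ a B, (∀ v < X.n, (X.R a v).length ≤ B) → (f a).length ≤ t B := by
  obtain ⟨m, t, p, hm, ht, h⟩ := hf id X.n fun v hv => hv
  refine ⟨t, ht, fun a B hB => ?_⟩
  have r := h a B m (fun v => if v < X.n then X.R a v else []) le_rfl
    (fun v hv => by simp [hv]) (fun r hr _ => by simp [Nat.not_lt.2 hr]) hB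
  have := r.length_le m
  simpa [Nat.not_lt.2 hm] using this

/-- The description of the inverse circuit. -/
theorem PS.rinv {α : Type*} {X : Ctx α} {C : α → List Raw} (hC : PS X fun a => rcode (C a)) :
    PS X fun a => rcode (rinv (C a)) := by
  obtain ⟨t, ht, hl⟩ := hC.length_le
  refine PS.call hC (PS.const _ []) (PS.const _ []) .inv _ (fun B => 257 * t B + 3)
    (((PolyB.const 257).mul ht).add (PolyB.const 3)) fun a B hB => ?_
  obtain ⟨n, hn, hx⟩ := run_inv (C a)
  refine ⟨n, _, ?_, hx, ?_⟩
  · have := hl a B hB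
    omega
  · intro r hr
    have : r = 0 := by simpa using hr
    subst this
    rfl

end Parsing

/-! ## Compilation of programs into classical circuits -/

section Compiler

/-- The target of a gate. -/
def Raw.tgt : Raw → ℕ
  | .not i => i
  | .cnot _ i => i
  | .tof _ _ i => i
  | .had i => i
  | .tg i => i

theorem Raw.act_of_ne_tgt (g : Raw) (s : BasisState) {w : ℕ} (hw : w ≠ g.tgt) :
    g.act s w = s w := by
  cases g with
  | not i => exact Function.update_of_ne hw _ _
  | cnot a i => exact Function.update_of_ne hw _ _
  | tof a b i => exact Function.update_of_ne hw _ _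
  | had i => rfl
  | tg i => rfl

theorem ract_of_ne_tgt {C : List Raw} {w : ℕ} (hw : ∀ g ∈ C, w ≠ g.tgt) (s : BasisState) :
    ract C s w = s w := by
  induction C generalizing s with
  | nil => rfl
  | cons g C ih =>
    rw [ract_cons, ih fun g' hg => hw g' (List.mem_cons_of_mem _ hg),
      g.act_of_ne_tgt s (hw g List.mem_cons_self)]

/-- The gate `g` is controlled by the wire `f`. -/
def Raw.ControlledBy (f : ℕ) : Raw → Prop
  | .cnot a _ => a = f
  | .tof a _ _ => a = f
  | _ => False

/-- While the control is unset, the gates controlled by it do nothing, and no gate of the circuit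
can set it. -/
theorem ract_of_controlled {C : List Raw} {f w : ℕ} (hC : ∀ g ∈ C, f ≠ g.tgt)
    (hw : ∀ g ∈ C, w ≠ g.tgt ∨ g.ControlledBy f) (s : BasisState) (hs : s f = false) :
    ract C s w = s w := by
  induction C generalizing s with
  | nil => rfl
  | cons g C ih =>
    have hf := g.act_of_ne_tgt s (hC g List.mem_cons_self)
    rw [ract_cons, ih (fun g' hg => hC g' (List.mem_cons_of_mem _ hg))
      (fun g' hg => hw g' (List.mem_cons_of_mem _ hg)) _ (hf.trans hs)]
    rcases hw g List.mem_cons_self with h | h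
    · exact g.act_of_ne_tgt s h
    · cases g with
      | cnot a i =>
        have e : a = f := h
        subst e
        by_cases ew : w = i
        · subst ew; simp [Raw.act, hs]
        · simp [Raw.act, ew]
      | tof a b i =>
        have e : a = f := h
        subst e
        by_cases ew : w = i
        · subst ew; simp [Raw.act, hs]
        · simp [Raw.act, ew]
      | _ => exact h.elim

/-- Two wires for each bit of a stack: one for `1` and one for `0`. -/
def enc2 (l : List Bool) : List Bool := l.flatMap fun b => [b, !b]

@[simp] theorem enc2_nil : enc2 [] = [] := rfl
@[simp] theorem enc2_cons (b : Bool) (l : List Bool) : enc2 (b :: l) = b :: (!b) :: enc2 l := rfl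

theorem length_enc2 (l : List Bool) : (enc2 l).length = 2 * l.length := by
  induction l with
  | nil => rfl
  | cons b l ih => simp [ih]; ring

/-- The layout of the circuit of a program: loops are run `T` times, registers have `K + 2` wires,
and are followed by auxiliary areas of the same size. -/
structure Layout where
  T : ℕ
  K : ℕ
  rb : ℕ
  gb : ℕ

/-- The first wire of the register `r`. -/
def Layout.reg (L : Layout) (r : ℕ) : ℕ := L.rb + r * (L.K + 2)

/-- The first wire of the auxiliary area `c`. -/
def Layout.area (L : Layout) (c : ℕ) : ℕ := L.gb + c * (L.K + 2)

theorem Layout.reg_succ (L : Layout) (r : ℕ) : L.reg (r + 1) = L.reg r + (L.K + 2) := by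
  simp only [Layout.reg]; ring

theorem Layout.area_succ (L : Layout) (c : ℕ) : L.area (c + 1) = L.area c + (L.K + 2) := by
  simp only [Layout.area]; ring

theorem Layout.reg_mono (L : Layout) {r r' : ℕ} (h : r ≤ r') : L.reg r ≤ L.reg r' :=
  Nat.add_le_add_left (Nat.mul_le_mul_right _ h) _

theorem Layout.area_mono (L : Layout) {r r' : ℕ} (h : r ≤ r') : L.area r ≤ L.area r' :=
  Nat.add_le_add_left (Nat.mul_le_mul_right _ h) _

theorem Layout.reg_add_le (L : Layout) {r N : ℕ} (h : r < N) : L.reg r + (L.K + 2) ≤ L.reg N :=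
  (L.reg_succ r).symm.trans_le (L.reg_mono h)

/-- The number of auxiliary areas of the circuit of a program. -/
def Layout.size (T : ℕ) : Prog → ℕ
  | .skip => 0
  | .push _ _ => 1
  | .pop _ => 1
  | .seq p q => Layout.size T p + Layout.size T q
  | .branch _ p q => 1 + (Layout.size T p + Layout.size T q)
  | .loop _ p => T * (Layout.size T p + 1)

/-- Copy the register `r` to the area `c`, and clear it if the flag `f` is set. -/
def Layout.fetch (L : Layout) (r f c : ℕ) : List Raw :=
  (List.range (L.K + 2)).map (fun j => .cnot (L.reg r + j) (L.area c + j)) ++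
    (List.range (L.K + 2)).map (fun j => .tof f (L.area c + j) (L.reg r + j))

/-- Repetition of a circuit with shifted auxiliary areas. -/
def iterCirc (body : ℕ → List Raw) (d k c : ℕ) : List Raw :=
  (List.range k).flatMap fun i => body (c + i * d)

theorem iterCirc_succ (body : ℕ → List Raw) (d k c : ℕ) :
    iterCirc body d (k + 1) c = body c ++ iterCirc body d k (c + d) := by
  rw [iterCirc, List.range_succ_eq_map, List.flatMap_cons, List.flatMap_map]
  simp only [Nat.zero_mul, Nat.add_zero, iterCirc]
  congr 2
  funext i
  congr 1
  simp only [Nat.succ_eq_add_one]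
  ring

/-- The circuit of a program with flag `f` and auxiliary areas from `c` on: it has the effect of
the program if `f` is set, and no effect on the registers otherwise. -/
def Layout.circ (L : Layout) : Prog → ℕ → ℕ → List Raw
  | .skip, _, _ => []
  -- The fetch leaves the old stack in the area and zeros in the register. The stack is written back
  -- one cell, that is two wires, further on, and the first cell receives `b`. The copy in the area
  -- is garbage that only the inverse circuit removes.
  | .push r b, f, c => L.fetch r f c ++
      ((List.range L.K).map (fun j => .tof f (L.area c + j) (L.reg r + (j + 2))) ++
        [.cnot f (L.reg r + if b then 0 else 1)])
  | .pop r, f, c => L.fetch r f c ++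
      (List.range L.K).map (fun j => .tof f (L.area c + (j + 2)) (L.reg r + j))
  | .seq p q, f, c => L.circ p f c ++ L.circ q f (c + Layout.size L.T p)
  -- The two flags are the conjunctions of `f` with the test and with its negation. Both are
  -- computed at the start, as the first alternative may change the tested register.
  | .branch r p q, f, c =>
      [.tof f (L.reg r) (L.area c), .cnot f (L.area c + 1), .cnot (L.area c) (L.area c + 1)] ++
        (L.circ p (L.area c) (c + 1) ++ L.circ q (L.area c + 1) (c + 1 + Layout.size L.T p))
  -- The two wires of a cell are never both set, so two Toffoli gates compute whether the flag is
  -- set and the register is nonempty. Each of the `T` rounds repeats the test; rounds after the end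
  -- of the loop idle.
  | .loop r p, f, c => iterCirc (fun c =>
      [.tof f (L.reg r) (L.area c), .tof f (L.reg r + 1) (L.area c)] ++
        L.circ p (L.area c) (c + 1)) (Layout.size L.T p + 1) L.T c

/-- The wires of the first `N` registers and the areas `c, …, d - 1`. -/
def Layout.Wire (L : Layout) (N c d w : ℕ) : Prop :=
  (L.reg 0 ≤ w ∧ w < L.reg N) ∨ (L.area c ≤ w ∧ w < L.area d)

/-- The gates of the circuit of a program. -/
structure Layout.Good (L : Layout) (N f c d : ℕ) (g : Raw) : Prop where
  cl : g.Cl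
  valid : g.Valid
  on : g.On fun w => w = f ∨ L.Wire N c d w
  tgt : L.Wire N c d g.tgt

theorem Layout.Good.mono {L : Layout} {N f c d f' c' d' : ℕ} {g : Raw} (h : L.Good N f c d g)
    (hc : c' ≤ c) (hd : d ≤ d') (hf : f = f' ∨ L.Wire N c' d' f) : L.Good N f' c' d' g := by
  have h1 := L.area_mono hc
  have h2 := L.area_mono hd
  have hw : ∀ w, L.Wire N c d w → L.Wire N c' d' w := by
    rintro w (hw | hw)
    · exact Or.inl hw
    · exact Or.inr ⟨by omega, by omega⟩
  refine ⟨h.cl, h.valid, h.on.mono ?_, hw _ h.tgt⟩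
  rintro w (rfl | hw')
  · rcases hf with hf | hf
    · exact Or.inl hf
    · exact Or.inr hf
  · exact Or.inr (hw _ hw')

/-- The flag `f` is on none of the wires of the registers and the areas from `c` on. -/
structure Layout.Flag (L : Layout) (N f c : ℕ) : Prop where
  le : L.reg N ≤ L.area 0
  reg : f < L.reg 0 ∨ L.reg N ≤ f
  area : f < L.area c

theorem Layout.Flag.mono {L : Layout} {N f c d : ℕ} (h : L.Flag N f c) (hcd : c ≤ d) :
    L.Flag N f d := ⟨h.le, h.reg, h.area.trans_le (L.area_mono hcd)⟩

theorem Layout.Flag.child {L : Layout} {N f c : ℕ} (h : L.Flag N f c) :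
    L.Flag N (L.area c) (c + 1) := by
  have h1 := L.area_mono (Nat.zero_le c)
  have h2 := L.area_succ c
  exact ⟨h.le, Or.inr (by have := h.le; omega), by omega⟩

theorem Layout.Flag.child' {L : Layout} {N f c : ℕ} (h : L.Flag N f c) :
    L.Flag N (L.area c + 1) (c + 1) := by
  have h1 := L.area_mono (Nat.zero_le c)
  have h2 := L.area_succ c
  exact ⟨h.le, Or.inr (by have := h.le; omega), by omega⟩

theorem Layout.Flag.not_wire {L : Layout} {N f c d : ℕ} (h : L.Flag N f c) : ¬ L.Wire N c d f := by
  have h1 := h.reg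
  have h2 := h.area
  rintro (h | h) <;> omega

theorem Layout.fetch_good {L : Layout} {N f c r : ℕ} (h : L.Flag N f c) (hr : r < N) :
    ∀ g ∈ L.fetch r f c, L.Good N f c (c + 1) g := by
  have h1 := L.reg_add_le hr
  have h2 := L.reg_mono (Nat.zero_le r)
  have h3 := L.area_succ c
  have h4 := L.area_mono (Nat.zero_le c)
  obtain ⟨h5, h6, h7⟩ := h
  intro g hg
  rw [Layout.fetch, List.mem_append] at hg
  rcases hg with hg | hg <;> obtain ⟨j, hj, rfl⟩ := List.mem_map.1 hg <;> rw [List.mem_range] at hj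
  · refine ⟨trivial, ?_, ?_, ?_⟩ <;> simp only [Raw.Valid, Raw.On, Raw.tgt, Layout.Wire] <;> omega
  · refine ⟨trivial, ?_, ?_, ?_⟩ <;> simp only [Raw.Valid, Raw.On, Raw.tgt, Layout.Wire, true_or, true_and] <;> omega

theorem Layout.iter_good {L : Layout} {N f d k c : ℕ} {body : ℕ → List Raw}
    (h : ∀ c' ≥ c, ∀ g ∈ body c', L.Good N f c' (c' + d) g) :
    ∀ g ∈ iterCirc body d k c, L.Good N f c (c + k * d) g := by
  intro g hg
  obtain ⟨i, hi, hg⟩ := List.mem_flatMap.1 hg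
  rw [List.mem_range] at hi
  refine (h _ (by omega) g hg).mono (by omega) ?_ (Or.inl rfl)
  have : (i + 1) * d ≤ k * d := Nat.mul_le_mul_right _ hi
  rw [Nat.add_assoc]
  rw [Nat.succ_mul] at this
  omega

/-- Writing is confined to the registers and to the areas allotted to `p`. So the flag survives, and
the areas of later parts of a program are still zero when they are reached. -/
theorem Layout.circ_good (L : Layout) (N : ℕ) (p : Prog) (hp : p.bound ≤ N) (f c : ℕ)
    (h : L.Flag N f c) :
    ∀ g ∈ L.circ p f c, L.Good N f c (c + Layout.size L.T p) g := by
  induction p generalizing f c with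
  | skip => intro g hg; exact absurd hg List.not_mem_nil
  | push r b =>
    have hr : r < N := hp
    intro g hg
    rw [Layout.circ, List.mem_append, List.mem_append] at hg
    rcases hg with hg | hg | hg
    · exact Layout.fetch_good h hr g hg
    · have h1 := L.reg_add_le hr
      have h2 := L.reg_mono (Nat.zero_le r)
      have h3 := L.area_succ c
      have h4 := L.area_mono (Nat.zero_le c)
      obtain ⟨h5, h6, h7⟩ := h
      obtain ⟨j, hj, rfl⟩ := List.mem_map.1 hg
      rw [List.mem_range] at hj
      refine ⟨trivial, ?_, ?_, ?_⟩ <;>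
        simp only [Raw.Valid, Raw.On, Raw.tgt, Layout.Wire, Layout.size, true_or, true_and] <;>
          omega
    · have h1 := L.reg_add_le hr
      have h2 := L.reg_mono (Nat.zero_le r)
      have h3 := L.area_succ c
      have h4 := L.area_mono (Nat.zero_le c)
      obtain ⟨h5, h6, h7⟩ := h
      rw [List.mem_singleton] at hg
      subst hg
      have h8 : (if b = true then 0 else 1) < 2 := by split_ifs <;> omega
      refine ⟨trivial, ?_, ?_, ?_⟩ <;>
        simp only [Raw.Valid, Raw.On, Raw.tgt, Layout.Wire, Layout.size, true_or, true_and] <;>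
          omega
  | pop r =>
    have hr : r < N := hp
    intro g hg
    rw [Layout.circ, List.mem_append] at hg
    rcases hg with hg | hg
    · exact Layout.fetch_good h hr g hg
    · have h1 := L.reg_add_le hr
      have h2 := L.reg_mono (Nat.zero_le r)
      have h3 := L.area_succ c
      have h4 := L.area_mono (Nat.zero_le c)
      obtain ⟨h5, h6, h7⟩ := h
      obtain ⟨j, hj, rfl⟩ := List.mem_map.1 hg
      rw [List.mem_range] at hj
      refine ⟨trivial, ?_, ?_, ?_⟩ <;>
        simp only [Raw.Valid, Raw.On, Raw.tgt, Layout.Wire, Layout.size, true_or, true_and] <;>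
          omega
  | seq p q ihp ihq =>
    rw [Prog.bound, max_le_iff] at hp
    intro g hg
    rw [Layout.circ, List.mem_append] at hg
    simp only [Layout.size]
    rcases hg with hg | hg
    · exact (ihp hp.1 f c h g hg).mono le_rfl (by omega) (Or.inl rfl)
    · exact (ihq hp.2 f _ (h.mono (by omega)) g hg).mono (by omega) (by omega) (Or.inl rfl)
  | branch r p q ihp ihq =>
    rw [Prog.bound, max_le_iff, max_le_iff] at hp
    have hr : r < N := hp.1
    intro g hg
    have h1 := L.reg_add_le hr
    have h2 := L.reg_mono (Nat.zero_le r)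
    have h3 := L.area_succ c
    have h4 := L.area_mono (Nat.zero_le c)
    have h5 := L.area_mono (show c + 1 ≤ c + (1 + (Layout.size L.T p + Layout.size L.T q)) by omega)
    obtain ⟨h6, h7, h8⟩ := h
    rw [Layout.circ, List.mem_append, List.mem_append] at hg
    simp only [Layout.size]
    rcases hg with hg | hg | hg
    · simp only [List.mem_cons, List.not_mem_nil, or_false] at hg
      rcases hg with rfl | rfl | rfl
      all_goals
        refine ⟨trivial, ?_, ?_, ?_⟩ <;>
          simp only [Raw.Valid, Raw.On, Raw.tgt, Layout.Wire, true_or, true_and] <;> omega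
    · refine (ihp hp.2.1 _ _ (Layout.Flag.child ⟨h6, h7, h8⟩) g hg).mono (by omega)
        (by omega) (Or.inr (Or.inr ⟨by omega, by omega⟩))
    · refine (ihq hp.2.2 _ _ ((Layout.Flag.child' ⟨h6, h7, h8⟩).mono (by omega)) g
        hg).mono (by omega) (by omega) (Or.inr (Or.inr ⟨by omega, by omega⟩))
  | loop r p ih =>
    rw [Prog.bound, max_le_iff] at hp
    have hr : r < N := hp.1
    refine Layout.iter_good fun c' hc' g hg => ?_
    have h1 := L.reg_add_le hr
    have h2 := L.reg_mono (Nat.zero_le r)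
    have h3 := L.area_succ c'
    have h4 := L.area_mono (Nat.zero_le c')
    have h5 := L.area_mono (show c' + 1 ≤ c' + (Layout.size L.T p + 1) by omega)
    obtain ⟨h6, h7, h8⟩ := h.mono hc'
    rw [List.mem_append] at hg
    rcases hg with hg | hg
    · simp only [List.mem_cons, List.not_mem_nil, or_false] at hg
      rcases hg with rfl | rfl
      all_goals
        refine ⟨trivial, ?_, ?_, ?_⟩ <;>
          simp only [Raw.Valid, Raw.On, Raw.tgt, Layout.Wire, true_or, true_and] <;> omega
    · refine (ih hp.2 _ _ (Layout.Flag.child ⟨h6, h7, h8⟩) g hg).mono (by omega)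
        (by omega) (Or.inr (Or.inr ⟨by omega, by omega⟩))

/-- A circuit of good gates keeps the other wires. -/
theorem Layout.ract_of_good {L : Layout} {N f c d : ℕ} {C : List Raw}
    (hC : ∀ g ∈ C, L.Good N f c d g) (s : BasisState) {w : ℕ} (hw : ¬ L.Wire N c d w) :
    ract C s w = s w :=
  ract_of_ne_tgt (fun g hg e => hw (by rw [e]; exact (hC g hg).tgt)) s

/-- The circuit has no effect on the registers if the flag is not set. -/
theorem Layout.circ_idle (L : Layout) (N : ℕ) (p : Prog) (hp : p.bound ≤ N) (f c : ℕ)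
    (h : L.Flag N f c) (s : BasisState) (hs : s f = false)
    (h0 : ∀ w, L.area c ≤ w → s w = false) (w : ℕ)
    (hw : w < L.reg N) : ract (L.circ p f c) s w = s w := by
  induction p generalizing f c s with
  | skip => rfl
  | push r b =>
    have hr : r < N := hp
    refine ract_of_controlled (f := f) (fun g hg e => h.not_wire (d := c + 1)
      (e ▸ (L.circ_good N _ hp f c h g hg).tgt)) (fun g hg => ?_) s hs
    rw [Layout.circ, Layout.fetch, List.mem_append, List.mem_append, List.mem_append] at hg
    rcases hg with (hg | hg) | hg | hg
    · obtain ⟨j, hj, rfl⟩ := List.mem_map.1 hg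
      have h1 := h.le
      have h2 := L.area_mono (Nat.zero_le c)
      left
      simp only [Raw.tgt]
      omega
    · obtain ⟨j, hj, rfl⟩ := List.mem_map.1 hg
      exact Or.inr rfl
    · obtain ⟨j, hj, rfl⟩ := List.mem_map.1 hg
      exact Or.inr rfl
    · rw [List.mem_singleton.1 hg]
      exact Or.inr rfl
  | pop r =>
    have hr : r < N := hp
    refine ract_of_controlled (f := f) (fun g hg e => h.not_wire (d := c + 1)
      (e ▸ (L.circ_good N _ hp f c h g hg).tgt)) (fun g hg => ?_) s hs
    rw [Layout.circ, Layout.fetch, List.mem_append, List.mem_append] at hg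
    rcases hg with (hg | hg) | hg
    · obtain ⟨j, hj, rfl⟩ := List.mem_map.1 hg
      have h1 := h.le
      have h2 := L.area_mono (Nat.zero_le c)
      left
      simp only [Raw.tgt]
      omega
    · obtain ⟨j, hj, rfl⟩ := List.mem_map.1 hg
      exact Or.inr rfl
    · obtain ⟨j, hj, rfl⟩ := List.mem_map.1 hg
      exact Or.inr rfl
  | seq p q ihp ihq =>
    rw [Prog.bound, max_le_iff] at hp
    have hgood := L.circ_good N p hp.1 f c h
    rw [Layout.circ, ract_append, ihq hp.2 f _ (h.mono (by omega)), ihp hp.1 f c h s hs h0]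
    · rw [Layout.ract_of_good hgood s h.not_wire, hs]
    · intro w hw
      have h1 := L.area_mono (show c ≤ c + Layout.size L.T p by omega)
      have h2 := L.area_mono (Nat.zero_le c)
      have h3 := h.le
      rw [Layout.ract_of_good hgood s, h0 w (by omega)]
      rintro (h | h) <;> omega
  | branch r p q ihp ihq =>
    rw [Prog.bound, max_le_iff, max_le_iff] at hp
    have hr : r < N := hp.1
    have h1 := L.reg_add_le hr
    have h2 := L.reg_mono (Nat.zero_le r)
    have h3 := L.area_succ c
    have h4 := L.area_mono (Nat.zero_le c)
    have h6 := h.le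
    have h7 := h.reg
    have h8 := h.area
    have hf0 : Function.update s (L.area c) false = s := by
      rw [Function.update_eq_self_iff, h0 _ le_rfl]
    have hf1 : Function.update s (L.area c + 1) false = s := by
      rw [Function.update_eq_self_iff, h0 _ (by omega)]
    have hhead : ract [.tof f (L.reg r) (L.area c), .cnot f (L.area c + 1),
        .cnot (L.area c) (L.area c + 1)] s = s := by
      simp only [ract_cons, ract_nil, Raw.act, hs, h0 _ le_rfl, Bool.false_and, Bool.xor_false, hf0,
        h0 (L.area c + 1) (by omega), hf1]
    have hgood := L.circ_good N p hp.2.1 (L.area c) (c + 1) h.child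
    have h9 := L.area_mono (show c + 1 ≤ c + 1 + Layout.size L.T p by omega)
    rw [Layout.circ, ract_append, hhead, ract_append,
      ihq hp.2.2 _ _ (h.child'.mono (by omega)),
      ihp hp.2.1 _ _ h.child s (h0 _ le_rfl) (fun w hw => h0 w (by omega))]
    · rw [Layout.ract_of_good hgood s, h0 _ (by omega)]
      rintro (h | h) <;> omega
    · intro w hw
      rw [Layout.ract_of_good hgood s, h0 w (by omega)]
      rintro (h | h) <;> omega
  | loop r p ih =>
    rw [Prog.bound, max_le_iff] at hp
    have hr : r < N := hp.1
    suffices hk : ∀ k (c : ℕ) (_ : L.Flag N f c) (s : BasisState) (_ : s f = false)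
        (_ : ∀ w, L.area c ≤ w → s w = false),
        ract (iterCirc (fun c => [.tof f (L.reg r) (L.area c), .tof f (L.reg r + 1) (L.area c)] ++
          L.circ p (L.area c) (c + 1)) (Layout.size L.T p + 1) k c) s w = s w from
      hk L.T c h s hs h0
    clear h h0 hs s c
    intro k
    induction k with
    | zero => intros; rfl
    | succ k ihk =>
      intro c h s hs h0
      have h1 := L.reg_add_le hr
      have h2 := L.reg_mono (Nat.zero_le r)
      have h3 := L.area_succ c
      have h4 := L.area_mono (Nat.zero_le c)
      have h6 := h.le
      have h7 := h.reg
      have h8 := h.area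
      have hf0 : Function.update s (L.area c) false = s := by
        rw [Function.update_eq_self_iff, h0 _ le_rfl]
      have hhead : ract [.tof f (L.reg r) (L.area c), .tof f (L.reg r + 1) (L.area c)] s = s := by
        simp only [ract_cons, ract_nil, Raw.act, hs, h0 _ le_rfl, Bool.false_and, Bool.xor_false,
          hf0]
      have hgood := L.circ_good N p hp.2 (L.area c) (c + 1) h.child
      have h9 := L.area_mono (show c + 1 ≤ c + 1 + Layout.size L.T p by omega)
      have e : c + (Layout.size L.T p + 1) = c + 1 + Layout.size L.T p := by omega
      rw [iterCirc_succ, ract_append, ract_append, hhead, ihk _ (h.mono (by omega)),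
        ih hp.2 _ _ h.child s (h0 _ le_rfl) (fun w hw => h0 w (by omega))]
      · rw [Layout.ract_of_good hgood s, hs]
        rintro (h | h) <;> omega
      · intro w hw
        rw [e] at hw
        rw [Layout.ract_of_good hgood s, h0 w (by omega)]
        rintro (h | h) <;> omega

end Compiler

/-! ### Correctness of the circuits of programs -/

section CompilerCorrectness

/-- The register `r` holds the string `l`. -/
def Layout.Holds (L : Layout) (s : BasisState) (r : ℕ) (l : List Bool) : Prop :=
  ∀ j < L.K + 2, s (L.reg r + j) = (enc2 l).getD j false

theorem Layout.Holds.congr {L : Layout} {s s' : BasisState} {r N : ℕ} {l : List Bool}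
    (h : L.Holds s r l) (hr : r < N) (hs : ∀ w, w < L.reg N → s' w = s w) : L.Holds s' r l :=
  fun j hj => by
    rw [hs _ (by have := L.reg_add_le hr; omega)]
    exact h j hj

/-- The area is fresh, so adding the register to it makes a copy; adding the copy back clears the
register. -/
theorem Layout.fetch_spec {L : Layout} {N r f c : ℕ} (h : L.Flag N f c) (hr : r < N)
    (s : BasisState) (hs : s f = true) (h0 : ∀ w, L.area c ≤ w → s w = false) :
    (∀ j < L.K + 2, ract (L.fetch r f c) s (L.area c + j) = s (L.reg r + j)) ∧
    (∀ j < L.K + 2, ract (L.fetch r f c) s (L.reg r + j) = false) ∧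
    ∀ w, (w < L.reg r ∨ L.reg r + (L.K + 2) ≤ w) → w < L.area c →
      ract (L.fetch r f c) s w = s w := by
  have h1 := L.reg_add_le hr
  have h2 := L.reg_mono (Nat.zero_le r)
  have h4 := L.area_mono (Nat.zero_le c)
  obtain ⟨h6, h7, h8⟩ := h
  obtain ⟨c1, c2⟩ := ract_map_range (L.K + 2) (fun j => .cnot (L.reg r + j) (L.area c + j))
    (fun j => L.area c + j) (fun j s => s (L.reg r + j)) (fun i _ j _ e => by omega)
    (fun i hi s => rfl) (fun i hi s t hst => hst _ fun j hj => by omega) s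
  obtain ⟨d1, d2⟩ := ract_map_range (L.K + 2) (fun j => .tof f (L.area c + j) (L.reg r + j))
    (fun j => L.reg r + j) (fun j s => s f && s (L.area c + j)) (fun i _ j _ e => by omega)
    (fun i hi s => rfl) (fun i hi s t hst => by
      rw [hst _ fun j hj => by omega, hst _ fun j hj => by omega])
    (ract ((List.range (L.K + 2)).map fun j => .cnot (L.reg r + j) (L.area c + j)) s)
  rw [Layout.fetch]
  simp only [ract_append]
  refine ⟨fun j hj => ?_, fun j hj => ?_, fun w hw hw' => ?_⟩
  · rw [d2 _ fun i hi => by omega, c1 j hj, h0 (L.area c + j) (by omega)]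
    simp
  · rw [d1 j hj, c2 _ fun i hi => by omega, c2 f fun i hi => by omega, c1 j hj, h0 (L.area c + j) (by omega), hs]
    simp
  · rw [d2 _ fun i hi => by omega, c2 _ fun i hi => by omega]

theorem enc2_getD_of_le (l : List Bool) (j : ℕ) (h : 2 * l.length ≤ j) :
    (enc2 l).getD j false = false :=
  List.getD_eq_default _ _ (by rw [length_enc2]; exact h)

theorem Layout.push_spec {L : Layout} {N r f c : ℕ} (b : Bool) (h : L.Flag N f c) (hr : r < N)
    (s : BasisState) (hs : s f = true) (h0 : ∀ w, L.area c ≤ w → s w = false)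
    (σ : ℕ → List Bool) (hσ : ∀ r < N, L.Holds s r (σ r)) :
    ∀ r' < N, L.Holds (ract (L.circ (.push r b) f c) s) r' (Function.update σ r (b :: σ r) r') := by
  have h1 := L.reg_add_le hr
  have h2 := L.reg_mono (Nat.zero_le r)
  have h4 := L.area_mono (Nat.zero_le c)
  obtain ⟨f1, f2, f3⟩ := Layout.fetch_spec h hr s hs h0
  obtain ⟨h6, h7, h8⟩ := h
  obtain ⟨d1, d2⟩ := ract_map_range L.K (fun j => .tof f (L.area c + j) (L.reg r + (j + 2)))
    (fun j => L.reg r + (j + 2)) (fun j s => s f && s (L.area c + j)) (fun i _ j _ e => by omega)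
    (fun i hi s => rfl) (fun i hi s t hst => by
      rw [hst _ fun j hj => by omega, hst _ fun j hj => by omega])
    (ract (L.fetch r f c) s)
  intro r' hr' j hj
  rw [Layout.circ, ract_append, ract_append]
  simp only [ract_cons, ract_nil, Raw.act]
  by_cases e : r' = r
  · subst e
    rw [Function.update_self, d2 f fun i hi => by omega, f3 f (by omega) h8, hs]
    rcases j with _ | _ | j
    · have hz := f2 0 (by omega)
      rw [Nat.add_zero] at hz
      cases b
      · simp only [Bool.false_eq_true, if_false]
        rw [Function.update_of_ne (by omega), Nat.add_zero, d2 _ fun i hi => by omega, hz]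
        simp
      · simp only [if_true, Nat.add_zero]
        rw [Function.update_self, d2 _ fun i hi => by omega, hz]
        simp
    · have hz := f2 1 (by omega)
      rw [Nat.zero_add]
      cases b
      · simp only [Bool.false_eq_true, if_false]
        rw [Function.update_self, d2 _ fun i hi => by omega, hz]
        simp
      · simp only [if_true, Nat.add_zero]
        rw [Function.update_of_ne (by omega), d2 _ fun i hi => by omega, hz]
        simp
    · have hb : (if b = true then 0 else 1) < 2 := by split_ifs <;> omega
      rw [Function.update_of_ne (by omega), d1 j (by omega), f2 _ (by omega),
        f3 f (by omega) h8, hs, f1 j (by omega), hσ r' hr' j (by omega)]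
      simp
  · have hb : (if b = true then 0 else 1) < 2 := by split_ifs <;> omega
    have h5 := L.reg_add_le hr'
    have h9 : L.reg r' + (L.K + 2) ≤ L.reg r ∨ L.reg r + (L.K + 2) ≤ L.reg r' := by
      rcases Nat.lt_or_gt_of_ne e with e | e
      · exact Or.inl (L.reg_add_le e)
      · exact Or.inr (L.reg_add_le e)
    rw [Function.update_of_ne (show r' ≠ r from e), Function.update_of_ne (by omega),
      d2 _ fun i hi => by omega, f3 _ (by omega) (by omega)]
    exact hσ r' hr' j hj

theorem enc2_tail (l : List Bool) (j : ℕ) :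
    (enc2 l.tail).getD j false = (enc2 l).getD (j + 2) false := by
  cases l <;> simp

theorem Layout.pop_spec {L : Layout} {N r f c : ℕ} (h : L.Flag N f c) (hr : r < N)
    (s : BasisState) (hs : s f = true) (h0 : ∀ w, L.area c ≤ w → s w = false)
    (σ : ℕ → List Bool) (hσ : ∀ r < N, L.Holds s r (σ r)) (hK : 2 * (σ r).length ≤ L.K) :
    ∀ r' < N, L.Holds (ract (L.circ (.pop r) f c) s) r' (Function.update σ r (σ r).tail r') := by
  have h1 := L.reg_add_le hr
  have h2 := L.reg_mono (Nat.zero_le r)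
  have h4 := L.area_mono (Nat.zero_le c)
  obtain ⟨f1, f2, f3⟩ := Layout.fetch_spec h hr s hs h0
  obtain ⟨h6, h7, h8⟩ := h
  obtain ⟨d1, d2⟩ := ract_map_range L.K (fun j => .tof f (L.area c + (j + 2)) (L.reg r + j))
    (fun j => L.reg r + j) (fun j s => s f && s (L.area c + (j + 2))) (fun i _ j _ e => by omega)
    (fun i hi s => rfl) (fun i hi s t hst => by
      rw [hst _ fun j hj => by omega, hst _ fun j hj => by omega])
    (ract (L.fetch r f c) s)
  intro r' hr' j hj
  rw [Layout.circ, ract_append]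
  by_cases e : r' = r
  · subst e
    rw [Function.update_self]
    by_cases hjK : j < L.K
    · rw [d1 j hjK, f2 j hj, f3 f (by omega) h8, hs, f1 _ (by omega), hσ r' hr' _ (by omega),
        enc2_tail]
      simp
    · rw [d2 _ fun i hi => by omega, f2 j hj, enc2_getD_of_le]
      rw [List.length_tail]
      omega
  · have h5 := L.reg_add_le hr'
    have h9 : L.reg r' + (L.K + 2) ≤ L.reg r ∨ L.reg r + (L.K + 2) ≤ L.reg r' := by
      rcases Nat.lt_or_gt_of_ne e with e | e
      · exact Or.inl (L.reg_add_le e)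
      · exact Or.inr (L.reg_add_le e)
    rw [Function.update_of_ne (show r' ≠ r from e),
      d2 _ fun i hi => by omega, f3 _ (by omega) (by omega)]
    exact hσ r' hr' j hj

theorem Layout.Holds.top {L : Layout} {s : BasisState} {r : ℕ} {l : List Bool}
    (h : L.Holds s r l) : s (L.reg r) = decide (l.head? = some true) := by
  have := h 0 (by omega)
  rw [Nat.add_zero] at this
  rw [this]
  cases l with
  | nil => simp
  | cons b l => cases b <;> simp

theorem Layout.Holds.top' {L : Layout} {s : BasisState} {r : ℕ} {l : List Bool}
    (h : L.Holds s r l) : s (L.reg r + 1) = decide (l.head? = some false) := by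
  rw [h 1 (by omega)]
  cases l with
  | nil => simp
  | cons b l => cases b <;> simp

/-- The state after the computation of the flag of a conditional. -/
def Layout.fork (L : Layout) (s : BasisState) (c : ℕ) (b b' : Bool) : BasisState :=
  Function.update (Function.update s (L.area c) b) (L.area c + 1) b'

/-- A run of `n ≤ T` steps has fewer than `T` rounds in any loop, and no stack outgrows its wires:
lengths increase by at most one per step, and a bit takes two wires. Conditionals rely on
`Layout.circ_idle` for the alternative that is not taken. -/
theorem Layout.circ_exec (L : Layout) (N : ℕ) (p : Prog) (hp : p.bound ≤ N) (σ τ : ℕ → List Bool)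
    (n : ℕ) (hx : p.Exec σ n τ) (f c : ℕ) (h : L.Flag N f c) (s : BasisState) (hs : s f = true)
    (h0 : ∀ w, L.area c ≤ w → s w = false) (hσ : ∀ r < N, L.Holds s r (σ r)) (hT : n ≤ L.T)
    (hK : ∀ r < N, 2 * ((σ r).length + n) ≤ L.K) :
    ∀ r < N, L.Holds (ract (L.circ p f c) s) r (τ r) := by
  induction p generalizing σ τ n f c s with
  | skip => cases hx; exact hσ
  | push r b =>
    cases hx
    exact Layout.push_spec b h hp s hs h0 σ hσ
  | pop r =>
    cases hx
    have hr : r < N := hp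
    exact Layout.pop_spec h hr s hs h0 σ hσ (by have := hK r hr; omega)
  | seq p q ihp ihq =>
    rw [Prog.bound, max_le_iff] at hp
    cases hx with
    | @seq _ _ _ τ1 _ m n h1 h2 =>
    have hgood := L.circ_good N p hp.1 f c h
    have k1 := ihp hp.1 σ τ1 m h1 f c h s hs h0 hσ (by omega)
      (fun r hr => by have := hK r hr; omega)
    rw [Layout.circ, ract_append]
    refine ihq hp.2 τ1 τ n h2 f _ (h.mono (by omega)) _ ?_ ?_ k1 (by omega) fun r hr => ?_
    · rw [Layout.ract_of_good hgood s h.not_wire, hs]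
    · intro w hw
      have h1 := L.area_mono (show c ≤ c + Layout.size L.T p by omega)
      have h2 := L.area_mono (Nat.zero_le c)
      have h3 := h.le
      rw [Layout.ract_of_good hgood s, h0 w (by omega)]
      rintro (h | h) <;> omega
    · have := h1.length_le r
      have := hK r hr
      omega
  | branch r p q ihp ihq =>
    rw [Prog.bound, max_le_iff, max_le_iff] at hp
    have hr : r < N := hp.1
    have h1 := L.reg_add_le hr
    have h2 := L.reg_mono (Nat.zero_le r)
    have h3 := L.area_succ c
    have h4 := L.area_mono (Nat.zero_le c)
    have h6 := h.le
    have h7 := h.reg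
    have h8 := h.area
    have h9 := L.area_mono (show c + 1 ≤ c + 1 + Layout.size L.T p by omega)
    have hgood := L.circ_good N p hp.2.1 (L.area c) (c + 1) h.child
    have hhead : ract [.tof f (L.reg r) (L.area c), .cnot f (L.area c + 1),
        .cnot (L.area c) (L.area c + 1)] s =
        L.fork s c (decide ((σ r).head? = some true)) (!decide ((σ r).head? = some true)) := by
      simp only [ract_cons, ract_nil, Raw.act]
      rw [Layout.fork, Function.update_self, Function.update_of_ne (show L.area c + 1 ≠ L.area c by omega),
        Function.update_of_ne (show f ≠ L.area c by omega),
        Function.update_of_ne (show L.area c ≠ L.area c + 1 by omega), Function.update_self, hs,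
        h0 (L.area c) le_rfl, h0 (L.area c + 1) (by omega), (hσ r hr).top, Function.update_idem]
      simp
    have hfork : ∀ b b' w, w < L.area c → L.fork s c b b' w = s w := fun b b' w hw => by
      rw [Layout.fork, Function.update_of_ne (by omega), Function.update_of_ne (by omega)]
    have hfork0 : ∀ b b' w, L.area (c + 1) ≤ w → L.fork s c b b' w = false := fun b b' w hw => by
      rw [Layout.fork, Function.update_of_ne (by omega), Function.update_of_ne (by omega)]
      exact h0 w (by omega)
    have hforkb : ∀ b b', L.fork s c b b' (L.area c) = b := fun b b' => by
      rw [Layout.fork, Function.update_of_ne (by omega), Function.update_self]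
    have hforkb' : ∀ b b', L.fork s c b b' (L.area c + 1) = b' := fun b b' => by
      rw [Layout.fork, Function.update_self]
    have hforkσ : ∀ b b', ∀ r < N, L.Holds (L.fork s c b b') r (σ r) := fun b b' r hr =>
      (hσ r hr).congr hr fun w hw => hfork b b' w (by omega)
    have hnw : ∀ w, (w = L.area c + 1 ∨ L.area (c + 1 + Layout.size L.T p) ≤ w) →
        ¬ L.Wire N (c + 1) (c + 1 + Layout.size L.T p) w := by
      rintro w hw (h | h) <;> omega
    rw [Layout.circ, ract_append, hhead, ract_append]
    cases hx with
    | branch_true hc hx =>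
      have hb : decide ((σ r).head? = some true) = true := by simp [hc]
      rw [hb]
      have k1 := ihp hp.2.1 σ τ _ hx _ _ h.child _ (hforkb true (!true)) (hfork0 _ _) (hforkσ _ _)
        (by omega) (fun r hr => by have := hK r hr; omega)
      intro r' hr'
      refine (k1 r' hr').congr hr' fun w hw => ?_
      refine L.circ_idle N q hp.2.2 _ _ (h.child'.mono (by omega)) _ ?_ ?_ w hw
      · rw [Layout.ract_of_good hgood _ (hnw _ (Or.inl rfl)), hforkb']
        rfl
      · intro w hw
        rw [Layout.ract_of_good hgood _ (hnw _ (Or.inr hw)), hfork0 _ _ _ (by omega)]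
    | branch_false hc hx =>
      have hb : decide ((σ r).head? = some true) = false := by simp [hc]
      rw [hb]
      have k1 := L.circ_idle N p hp.2.1 _ _ h.child _ (hforkb false (!false)) (fun w hw =>
        hfork0 _ _ w hw)
      refine ihq hp.2.2 σ τ _ hx _ _ (h.child'.mono (by omega)) _ ?_ ?_ (fun r hr =>
        (hforkσ _ _ r hr).congr hr k1) (by omega) (fun r hr => by have := hK r hr; omega)
      · rw [Layout.ract_of_good hgood _ (hnw _ (Or.inl rfl)), hforkb']
        rfl
      · intro w hw
        rw [Layout.ract_of_good hgood _ (hnw _ (Or.inr hw)), hfork0 _ _ _ (by omega)]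
  | loop r p ih =>
    rw [Prog.bound, max_le_iff] at hp
    have hr : r < N := hp.1
    -- Induction on the number `k` of rounds that the circuit still provides. The final test costs a
    -- step of its own, so a run of at most `k + 1` steps has at most `k` rounds.
    suffices hk : ∀ k (σ τ : ℕ → List Bool) (n : ℕ) (_ : (Prog.loop r p).Exec σ n τ) (c : ℕ)
        (_ : L.Flag N f c) (s : BasisState) (_ : s f = true)
        (_ : ∀ w, L.area c ≤ w → s w = false) (_ : ∀ r < N, L.Holds s r (σ r)) (_ : n ≤ k + 1)
        (_ : n ≤ L.T) (_ : ∀ r < N, 2 * ((σ r).length + n) ≤ L.K),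
        ∀ r' < N, L.Holds (ract (iterCirc (fun c =>
          [.tof f (L.reg r) (L.area c), .tof f (L.reg r + 1) (L.area c)] ++
          L.circ p (L.area c) (c + 1)) (Layout.size L.T p + 1) k c) s) r' (τ r') from
      hk L.T σ τ n hx c h s hs h0 hσ (by omega) hT hK
    clear h h0 hs s c hσ hK hT hx n σ τ
    intro k
    induction k with
    | zero =>
      intro σ τ n hx c h s hs h0 hσ hn hT hK
      cases hx with
      | loop_done hc => exact hσ
      | @loop_step _ _ _ τ1 _ m n hc hx1 hx2 =>
        exfalso
        have : 0 < n := by cases hx2 <;> omega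
        omega
    | succ k ihk =>
      intro σ τ n hx c h s hs h0 hσ hn hT hK
      have h1 := L.reg_add_le hr
      have h2 := L.reg_mono (Nat.zero_le r)
      have h3 := L.area_succ c
      have h4 := L.area_mono (Nat.zero_le c)
      have h6 := h.le
      have h7 := h.reg
      have h8 := h.area
      have h9 := L.area_mono (show c + 1 ≤ c + 1 + Layout.size L.T p by omega)
      have hgood := L.circ_good N p hp.2 (L.area c) (c + 1) h.child
      have e : c + (Layout.size L.T p + 1) = c + 1 + Layout.size L.T p := by omega
      have hhead : ract [.tof f (L.reg r) (L.area c), .tof f (L.reg r + 1) (L.area c)] s =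
          Function.update s (L.area c) (decide (σ r ≠ [])) := by
        simp only [ract_cons, ract_nil, Raw.act]
        rw [Function.update_self, Function.update_of_ne (show f ≠ L.area c by omega),
          Function.update_of_ne (show L.reg r + 1 ≠ L.area c by omega), Function.update_idem, hs,
          h0 (L.area c) le_rfl, (hσ r hr).top, (hσ r hr).top']
        congr 1
        rcases σ r with _ | ⟨b, l⟩
        · simp
        · cases b <;> simp
      have hup : ∀ b w, w < L.area c → Function.update s (L.area c) b w = s w := fun b w hw =>
        Function.update_of_ne (by omega) _ _
      have hup0 : ∀ b w, L.area (c + 1) ≤ w → Function.update s (L.area c) b w = false :=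
        fun b w hw => by
          rw [Function.update_of_ne (by omega)]
          exact h0 w (by omega)
      have hupσ : ∀ b, ∀ r < N, L.Holds (Function.update s (L.area c) b) r (σ r) := fun b r hr =>
        (hσ r hr).congr hr fun w hw => hup b w (by omega)
      have hnw : ∀ w, (w = f ∨ L.area (c + 1 + Layout.size L.T p) ≤ w) →
          ¬ L.Wire N (c + 1) (c + 1 + Layout.size L.T p) w := by
        rintro w hw (h | h) <;> omega
      rw [iterCirc_succ, ract_append, ract_append, hhead]
      have hs' : ∀ b, ract (L.circ p (L.area c) (c + 1)) (Function.update s (L.area c) b) f = true :=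
        fun b => by
          rw [Layout.ract_of_good hgood _ (hnw _ (Or.inl rfl)), hup _ _ h8, hs]
      have h0' : ∀ b w, L.area (c + (Layout.size L.T p + 1)) ≤ w →
          ract (L.circ p (L.area c) (c + 1)) (Function.update s (L.area c) b) w = false :=
        fun b w hw => by
          rw [e] at hw
          rw [Layout.ract_of_good hgood _ (hnw _ (Or.inr hw)), hup0 _ _ (by omega)]
      cases hx with
      | loop_done hc =>
        have hb : decide (σ r ≠ []) = false := by simp [hc]
        rw [hb]
        have k1 := L.circ_idle N p hp.2 _ _ h.child (Function.update s (L.area c) false)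
          (Function.update_self _ _ _) (hup0 _)
        exact ihk σ σ 1 (.loop_done hc) _ (h.mono (by omega)) _ (hs' _) (h0' _)
          (fun r hr => (hupσ _ r hr).congr hr k1) (by omega) hT hK
      | @loop_step _ _ _ τ1 _ m n hc hx1 hx2 =>
        have hb : decide (σ r ≠ []) = true := by simp [hc]
        rw [hb]
        have k1 := ih hp.2 σ τ1 m hx1 _ _ h.child (Function.update s (L.area c) true)
          (Function.update_self _ _ _) (hup0 _) (hupσ _) (by omega)
          (fun r hr => by have := hK r hr; omega)
        exact ihk τ1 τ n hx2 _ (h.mono (by omega)) _ (hs' _) (h0' _) k1 (by omega) (by omega)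
          (fun r hr => by
            have := hK r hr
            have := hx1.length_le r
            omega)

end CompilerCorrectness

/-! ## Generation of circuit descriptions -/

section Generation

variable {α : Type u}

theorem PN.wireCode {X : Ctx α} {w : α → ℕ} (hw : PN X w) : PS X fun a => wireCode (w a) :=
  PS.append hw (PS.const X [false])

/-- A circuit that depends on a context can be described in polynomial time. -/
def PC (X : Ctx α) (C : α → List Raw) : Prop := PS X fun a => rcode (C a)

theorem PC.nil (X : Ctx α) : PC X fun _ => [] := PS.const X []

theorem PC.congr {X : Ctx α} {C D : α → List Raw} (hC : PC X C) (h : ∀ a, D a = C a) : PC X D :=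
  PS.congr hC fun a => by rw [h]

theorem PN.congr {X : Ctx α} {f g : α → ℕ} (hf : PN X f) (h : ∀ a, g a = f a) : PN X g :=
  PS.congr hf fun a => by rw [h]

theorem PC.append {X : Ctx α} {C D : α → List Raw} (hC : PC X C) (hD : PC X D) :
    PC X fun a => C a ++ D a :=
  (PS.append hC hD).congr fun _ => rcode_append _ _

theorem PC.not {X : Ctx α} {i : α → ℕ} (hi : PN X i) : PC X fun a => [.not (i a)] :=
  (PS.append (PS.const X [false, false, false]) hi.wireCode).congr fun a => by
    simp [Raw.code]

theorem PC.cnot {X : Ctx α} {j i : α → ℕ} (hj : PN X j) (hi : PN X i) :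
    PC X fun a => [.cnot (j a) (i a)] :=
  (PS.append (PS.append (PS.const X [false, false, true]) hj.wireCode) hi.wireCode).congr fun a => by
    simp [Raw.code]

theorem PC.tof {X : Ctx α} {k j i : α → ℕ} (hk : PN X k) (hj : PN X j) (hi : PN X i) :
    PC X fun a => [.tof (k a) (j a) (i a)] :=
  (PS.append (PS.append (PS.append (PS.const X [false, true, false]) hk.wireCode) hj.wireCode)
    hi.wireCode).congr fun a => by simp [Raw.code]

theorem PC.had {X : Ctx α} {i : α → ℕ} (hi : PN X i) : PC X fun a => [.had (i a)] :=
  (PS.append (PS.const X [false, true, true]) hi.wireCode).congr fun a => by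
    simp [Raw.code]

theorem PC.tg {X : Ctx α} {i : α → ℕ} (hi : PN X i) : PC X fun a => [.tg (i a)] :=
  (PS.append (PS.const X [true, false, false]) hi.wireCode).congr fun a => by
    simp [Raw.code]

theorem PC.flatMap {X : Ctx α} {n : α → ℕ} (hn : PN X n) {C : α × ℕ → List Raw} (hC : PC X.nat C) :
    PC X fun a => (List.range (n a)).flatMap fun i => C (a, i) :=
  (PS.flatMap hn hC).congr fun _ => rcode_flatMap _ _

theorem PC.map {X : Ctx α} {n : α → ℕ} (hn : PN X n) {g : α × ℕ → Raw}
    (hg : PC X.nat fun b => [g b]) :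
    PC X fun a => (List.range (n a)).map fun i => g (a, i) :=
  (PC.flatMap hn hg).congr fun a => by
    induction List.range (n a) with
    | nil => rfl
    | cons x l ih => simp_all

theorem PC.weaken {X : Ctx α} {C : α → List Raw} (hC : PC X C) : PC X.nat fun b => C b.1 :=
  PS.weaken_nat hC

theorem PC.rinv {X : Ctx α} {C : α → List Raw} (hC : PC X C) : PC X fun a => rinv (C a) :=
  PS.rinv hC

/-- A layout that depends on a context can be computed in polynomial time. -/
structure PL (X : Ctx α) (L : α → Layout) : Prop where
  T : PN X fun a => (L a).T
  K : PN X fun a => (L a).K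
  rb : PN X fun a => (L a).rb
  gb : PN X fun a => (L a).gb

theorem PL.weaken {X : Ctx α} {L : α → Layout} (hL : PL X L) : PL X.nat fun b => L b.1 :=
  ⟨hL.T.weaken, hL.K.weaken, hL.rb.weaken, hL.gb.weaken⟩

theorem PL.width {X : Ctx α} {L : α → Layout} (hL : PL X L) : PN X fun a => (L a).K + 2 :=
  hL.K.add (PN.const X 2)

theorem PL.reg {X : Ctx α} {L : α → Layout} (hL : PL X L) {r : α → ℕ} (hr : PN X r) :
    PN X fun a => (L a).reg (r a) :=
  hL.rb.add (hr.mul hL.width)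

theorem PL.area {X : Ctx α} {L : α → Layout} (hL : PL X L) {c : α → ℕ} (hc : PN X c) :
    PN X fun a => (L a).area (c a) :=
  hL.gb.add (hc.mul hL.width)

theorem PL.size {X : Ctx α} {L : α → Layout} (hL : PL X L) (p : Prog) :
    PN X fun a => Layout.size (L a).T p := by
  induction p with
  | skip => exact PN.const X 0
  | push => exact PN.const X 1
  | pop => exact PN.const X 1
  | seq p q ihp ihq => exact ihp.add ihq
  | branch r p q ihp ihq => exact (PN.const X 1).add (ihp.add ihq)
  | loop r p ih => exact hL.T.mul (ih.add (PN.const X 1))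

theorem PL.fetch {X : Ctx α} {L : α → Layout} (hL : PL X L) (r : ℕ) {f c : α → ℕ} (hf : PN X f)
    (hc : PN X c) : PC X fun a => (L a).fetch r (f a) (c a) := by
  have hr := (hL.reg (PN.const X r)).weaken.add (PN.last X)
  have ha := (hL.area hc).weaken.add (PN.last X)
  exact (PC.map hL.width (PC.cnot hr ha)).append (PC.map hL.width (PC.tof hf.weaken ha hr))

/-- Recursion on the fixed program `p`. The type of contexts varies, because the body of a loop is
generated in the context extended by the number of the round. -/
theorem PL.circ {X : Ctx α} {L : α → Layout} (hL : PL X L) (p : Prog) {f c : α → ℕ} (hf : PN X f)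
    (hc : PN X c) : PC X fun a => (L a).circ p (f a) (c a) := by
  induction p generalizing α with
  | skip => exact PC.nil X
  | push r b =>
    have hr := (hL.reg (PN.const X r)).weaken.add ((PN.last X).add (PN.const _ 2))
    have ha := (hL.area hc).weaken.add (PN.last X)
    exact (hL.fetch r hf hc).append ((PC.map hL.K (PC.tof hf.weaken ha hr)).append
      (PC.cnot hf ((hL.reg (PN.const X r)).add (PN.const X _))))
  | pop r =>
    have hr := (hL.reg (PN.const X r)).weaken.add (PN.last X)
    have ha := (hL.area hc).weaken.add ((PN.last X).add (PN.const _ 2))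
    exact (hL.fetch r hf hc).append (PC.map hL.K (PC.tof hf.weaken ha hr))
  | seq p q ihp ihq => exact (ihp hL hf hc).append (ihq hL hf (hc.add (hL.size p)))
  | branch r p q ihp ihq =>
    have hr := hL.reg (PN.const X r)
    have ha := hL.area hc
    have ha' := ha.add (PN.const X 1)
    have hc' := hc.add (PN.const X 1)
    exact ((PC.tof hf hr ha).append ((PC.cnot hf ha').append (PC.cnot ha ha'))).append
      ((ihp hL ha hc').append (ihq hL ha' (hc'.add (hL.size p))))
  | loop r p ih =>
    have hc' := hc.weaken.add ((PN.last X).mul ((hL.size p).add (PN.const X 1)).weaken)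
    have hL' := hL.weaken
    have hr := hL'.reg (PN.const _ r)
    have ha := hL'.area hc'
    exact PC.flatMap hL.T (((PC.tof hf.weaken hr ha).append (PC.tof hf.weaken
      (hr.add (PN.const _ 1)) ha)).append (ih hL' ha (hc'.add (PN.const _ 1))))

end Generation

/-! ## A circuit that applies a gate described by its wires -/

section Interpreter

/-- Classical gates on wires that satisfy `P`. -/
def Tidy (P : ℕ → Prop) (C : List Raw) : Prop := ∀ g ∈ C, g.Cl ∧ g.Valid ∧ g.On P

theorem Tidy.append {P : ℕ → Prop} {C D : List Raw} (hC : Tidy P C) (hD : Tidy P D) :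
    Tidy P (C ++ D) := fun g hg => (List.mem_append.1 hg).elim (hC g) (hD g)

theorem Tidy.mono {P Q : ℕ → Prop} {C : List Raw} (hC : Tidy P C) (h : ∀ w, P w → Q w) :
    Tidy Q C := fun g hg => ⟨(hC g hg).1, (hC g hg).2.1, (hC g hg).2.2.mono h⟩

theorem Tidy.rinv {P : ℕ → Prop} {C : List Raw} (hC : Tidy P C) : Tidy P (rinv C) :=
  rinv_forall hC

theorem Tidy.cl {P : ℕ → Prop} {C : List Raw} (hC : Tidy P C) : ∀ g ∈ C, g.Cl :=
  fun g hg => (hC g hg).1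

theorem Tidy.valid {P : ℕ → Prop} {C : List Raw} (hC : Tidy P C) : ∀ g ∈ C, g.Valid :=
  fun g hg => (hC g hg).2.1

theorem Tidy.on {P : ℕ → Prop} {C : List Raw} (hC : Tidy P C) : ∀ g ∈ C, g.On P :=
  fun g hg => (hC g hg).2.2

theorem Tidy.map {P : ℕ → Prop} {n : ℕ} {f : ℕ → Raw}
    (h : ∀ i < n, (f i).Cl ∧ (f i).Valid ∧ (f i).On P) : Tidy P ((List.range n).map f) := by
  intro g hg
  obtain ⟨i, hi, rfl⟩ := List.mem_map.1 hg
  exact h i (List.mem_range.1 hi)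

theorem Tidy.flatMap {P : ℕ → Prop} {n : ℕ} {f : ℕ → List Raw}
    (h : ∀ i < n, Tidy P (f i)) : Tidy P ((List.range n).flatMap f) := by
  intro g hg
  obtain ⟨i, hi, hg⟩ := List.mem_flatMap.1 hg
  exact h i (List.mem_range.1 hi) g hg

theorem Tidy.singleton {P : ℕ → Prop} {g : Raw} (h1 : g.Cl) (h2 : g.Valid) (h3 : g.On P) :
    Tidy P [g] := fun g' hg => by
  rw [List.mem_singleton.1 hg]
  exact ⟨h1, h2, h3⟩

theorem Tidy.rapply {P : ℕ → Prop} {C : List Raw} (hC : Tidy P C) (s : BasisState) :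
    rapply C (Finsupp.single s 1) = Finsupp.single (ract C s) 1 :=
  rapply_classical hC.cl s 1

theorem Tidy.ract_rinv {P : ℕ → Prop} {C : List Raw} (hC : Tidy P C) (s : BasisState) :
    ract (_root_.rinv C) (ract C s) = s :=
  rapply_rinv_classical hC.valid hC.cl s

/-- The Hadamard gate on `x` controlled by `y`, up to the state of `x` at the start. -/
def hadBasis (x : ℕ) : List Raw := [.tg x, .tg x, .had x, .tg x]

/-- The Hadamard gate on `x` controlled by `y`. -/
def ctrlHad (y x : ℕ) : List Raw := hadBasis x ++ ([.cnot y x] ++ rinv (hadBasis x))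

theorem hadBasis_valid (x : ℕ) : ∀ g ∈ hadBasis x, g.Valid := by
  intro g hg
  simp only [hadBasis, List.mem_cons, List.not_mem_nil, or_false] at hg
  rcases hg with rfl | rfl | rfl | rfl <;> trivial

theorem ctrlHad_valid {y x : ℕ} (h : y ≠ x) : ∀ g ∈ ctrlHad y x, g.Valid := by
  intro g hg
  rw [ctrlHad, List.mem_append, List.mem_append, List.mem_singleton] at hg
  rcases hg with hg | rfl | hg
  · exact hadBasis_valid x g hg
  · exact h
  · exact rinv_forall (hadBasis_valid x) g hg

theorem Raw.tg_single (x : ℕ) (s : BasisState) (c : ℂ) :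
    (Raw.tg x).apply (Finsupp.single s c) =
      Finsupp.single s (c * if s x = true then phase else 1) := by
  rw [Raw.apply_single, Raw.onBasis, Finsupp.smul_single, smul_eq_mul]
  rfl

theorem Raw.had_single (x : ℕ) (s : BasisState) (c : ℂ) :
    (Raw.had x).apply (Finsupp.single s c) =
      Finsupp.single (Function.update s x false) (c * (Real.sqrt 2 : ℂ)⁻¹) +
      Finsupp.single (Function.update s x true)
        (c * ((if s x = true then -1 else 1) * (Real.sqrt 2 : ℂ)⁻¹)) := by
  rw [Raw.apply_single, Raw.onBasis, smul_add, Finsupp.smul_single, smul_eq_mul,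
    Finsupp.smul_single, smul_eq_mul, one_div, div_eq_mul_inv]

theorem Raw.not_single (x : ℕ) (s : BasisState) (c : ℂ) :
    (Raw.not x).apply (Finsupp.single s c) = Finsupp.single (Function.update s x (!(s x))) c := by
  rw [Raw.apply_single, Raw.onBasis, Finsupp.smul_single, smul_eq_mul, mul_one]

theorem hadBasis_single (x : ℕ) (s : BasisState) (c : ℂ) :
    rapply (hadBasis x) (Finsupp.single s c) =
      Finsupp.single (Function.update s x false)
        (c * ((if s x = true then phase ^ 2 else 1) * (Real.sqrt 2 : ℂ)⁻¹)) +
      Finsupp.single (Function.update s x true)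
        (c * ((if s x = true then -phase ^ 3 else phase) * (Real.sqrt 2 : ℂ)⁻¹)) := by
  simp only [hadBasis, rapply_cons, rapply_nil, Raw.tg_single, Raw.had_single, map_add,
    Function.update_self]
  cases h : s x
  · simp only [Bool.false_eq_true, if_false, if_true, mul_one]
    congr 2
    · ring
    · ring
  · simp only [Bool.false_eq_true, if_false, if_true, mul_one]
    congr 2
    · ring
    · ring

theorem phase_eq : phase = (1 + Complex.I) / (Real.sqrt 2 : ℂ) := by
  have h := sqrt_two_ne_zero
  have h2 := sqrt_two_mul_self
  rw [phase, show Complex.I * Real.pi / 4 = ((Real.pi / 4 : ℝ) : ℂ) * Complex.I by push_cast; ring,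
    Complex.exp_mul_I, ← Complex.ofReal_cos, ← Complex.ofReal_sin, Real.cos_pi_div_four,
    Real.sin_pi_div_four]
  push_cast
  field_simp
  linear_combination (1 + Complex.I) * h2

theorem phase_sq : phase ^ 2 = Complex.I := by
  have h := sqrt_two_ne_zero
  have h2 := sqrt_two_mul_self
  rw [phase_eq, div_pow, pow_two ((Real.sqrt 2 : ℝ) : ℂ), h2]
  linear_combination Complex.I_sq / 2

/-- For the circuit `V = hadBasis x` this reads `X V = V H`. Conjugation by `V` thus takes NOT to
the Hadamard gate, and CNOT to the controlled Hadamard gate. -/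
theorem not_hadBasis (x : ℕ) (s : BasisState) :
    (Raw.not x).apply (rapply (hadBasis x) (Finsupp.single s 1)) =
      rapply (hadBasis x) ((Raw.had x).apply (Finsupp.single s 1)) := by
  classical
  have hq2 : ((Real.sqrt 2 : ℝ) : ℂ)⁻¹ ^ 2 = 1 / 2 := by
    rw [inv_pow, pow_two, sqrt_two_mul_self]; norm_num
  have hp : phase = (1 + Complex.I) * ((Real.sqrt 2 : ℝ) : ℂ)⁻¹ := by
    rw [phase_eq, div_eq_mul_inv]
  have hp3 : phase ^ 3 = Complex.I * phase := by rw [pow_succ, phase_sq]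
  have hI := Complex.I_sq
  simp only [hadBasis_single, map_add, Raw.had_single, Raw.not_single, Function.update_self,
    Function.update_idem, Bool.not_false, Bool.not_true, phase_sq, hp3]
  rw [hp]
  generalize ((Real.sqrt 2 : ℝ) : ℂ)⁻¹ = q at hq2 hp
  cases hs : s x
  · ext j
    simp only [Bool.false_eq_true, if_false, if_true, Finsupp.add_apply, Finsupp.single_apply]
    split_ifs with h1 h2 h2
    · exact absurd (congrFun (h1.trans h2.symm) x) (by simp)
    · linear_combination (-2 * q) * hq2 + q ^ 3 * hI
    · ring
    · ring
  · ext j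
    simp only [Bool.false_eq_true, if_false, if_true, Finsupp.add_apply, Finsupp.single_apply]
    split_ifs with h1 h2 h2
    · exact absurd (congrFun (h1.trans h2.symm) x) (by simp)
    · linear_combination (-2 * Complex.I * q) * hq2 - q ^ 3 * hI
    · linear_combination -(q ^ 2) * hI
    · ring

theorem cnot_apply_of_support {y x : ℕ} (b : Bool) (v : QState) (hv : ∀ s ∈ v.support, s y = b) :
    (Raw.cnot y x).apply v = if b = true then (Raw.not x).apply v else v := by
  have h : ∀ s ∈ v.support, (Raw.cnot y x).apply (Finsupp.single s 1) =
      (if b = true then (Raw.not x).apply else LinearMap.id) (Finsupp.single s 1) := by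
    intro s hs
    have := hv s hs
    cases b
    · simp [Raw.onBasis, this]
    · simp [Raw.onBasis, this]
  rw [linearMap_congr_support h]
  split_ifs <;> rfl

theorem ctrlHad_single {y x : ℕ} (h : y ≠ x) (s : BasisState) :
    rapply (ctrlHad y x) (Finsupp.single s 1) =
      if s y = true then (Raw.had x).apply (Finsupp.single s 1) else Finsupp.single s 1 := by
  -- The change of basis touches the wire `x` only, so the control has a definite value throughout.
  have hsup : ∀ t ∈ (rapply (hadBasis x) (Finsupp.single s 1)).support, t y = s y := by
    refine support_rapply (P := fun w => w = x) (fun g hg => ?_) (fun t => t y = s y)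
      (fun t t' htt' ht => (htt' y h).symm.trans ht) (fun t ht => ?_)
    · simp only [hadBasis, List.mem_cons, List.not_mem_nil, or_false] at hg
      rcases hg with rfl | rfl | rfl | rfl <;> rfl
    · rw [Finset.mem_singleton.1 (Finsupp.support_single_subset ht)]
  rw [ctrlHad, rapply_append, rapply_append, rapply_cons, rapply_nil,
    cnot_apply_of_support _ _ hsup]
  split_ifs with hs
  · rw [not_hadBasis, rapply_rinv (hadBasis_valid x)]
  · rw [rapply_rinv (hadBasis_valid x)]

/-- The wires used to apply a gate: the data are on the `M` wires from `db` on, the controls and the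
target of the gate are marked on the wires `xa + 2 w + 1`, `xb + 2 w + 1`, `xi + 2 w + 1`, its kind
on the wires `y`, and there are auxiliary wires from `qb` on. -/
structure Panel where
  db : ℕ
  M : ℕ
  qb : ℕ
  xa : ℕ
  xb : ℕ
  xi : ℕ
  y : Fin 5 → ℕ

namespace Panel

/-- Add the marked data bit to the wire `t`. -/
def fetch (D : Panel) (x t : ℕ) : List Raw :=
  (List.range D.M).map fun w => .tof (x + 2 * w + 1) (D.db + w) t

/-- Compute the bit that is to be added to the target. -/
def value (D : Panel) : List Raw :=
  D.fetch D.xa D.qb ++ (D.fetch D.xb (D.qb + 1) ++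
    [.cnot (D.y 0) (D.qb + 3), .tof (D.y 1) D.qb (D.qb + 3), .tof D.qb (D.qb + 1) (D.qb + 4),
      .tof (D.y 2) (D.qb + 4) (D.qb + 3)])

def write (D : Panel) : List Raw :=
  (List.range D.M).map fun w => .tof (D.xi + 2 * w + 1) (D.qb + 3) (D.db + w)

/-- Compute the control of the phase. -/
def phaseBit (D : Panel) : List Raw :=
  D.fetch D.xi (D.qb + 2) ++ [.tof (D.y 4) (D.qb + 2) (D.qb + 5)]

def hadAt (D : Panel) (w : ℕ) : List Raw :=
  [.tof (D.y 3) (D.xi + 2 * w + 1) (D.qb + 6)] ++ (ctrlHad (D.qb + 6) (D.db + w) ++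
    [.tof (D.y 3) (D.xi + 2 * w + 1) (D.qb + 6)])

/-- Apply the gate. -/
def step (D : Panel) : List Raw :=
  -- Three stages, each idle unless the kind on display calls for it: a bit is added to the target;
  -- a `T` gate is applied to an ancilla that copies the target; Hadamard gates, controlled by the
  -- marks, are offered to all data wires.
  (D.value ++ (D.write ++ rinv D.value)) ++
    ((D.phaseBit ++ ([.tg (D.qb + 5)] ++ rinv D.phaseBit)) ++ (List.range D.M).flatMap D.hadAt)

/-- The auxiliary wires. -/
def Aux (D : Panel) (w : ℕ) : Prop := D.qb ≤ w ∧ w < D.qb + 7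

def Data (D : Panel) (w : ℕ) : Prop := D.db ≤ w ∧ w < D.db + D.M

/-- The wires used. -/
def Used (D : Panel) (w : ℕ) : Prop :=
  D.Aux w ∨ D.Data w ∨ (∃ j, w = D.y j) ∨
    ∃ i < D.M, w = D.xa + 2 * i + 1 ∨ w = D.xb + 2 * i + 1 ∨ w = D.xi + 2 * i + 1

/-- The wires used are distinct. -/
structure Ok (D : Panel) : Prop where
  data : ∀ w, D.Data w → ¬ D.Aux w
  y : ∀ j, ¬ D.Data (D.y j) ∧ ¬ D.Aux (D.y j)
  x : ∀ i < D.M, (¬ D.Data (D.xa + 2 * i + 1) ∧ ¬ D.Aux (D.xa + 2 * i + 1)) ∧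
    (¬ D.Data (D.xb + 2 * i + 1) ∧ ¬ D.Aux (D.xb + 2 * i + 1)) ∧
    (¬ D.Data (D.xi + 2 * i + 1) ∧ ¬ D.Aux (D.xi + 2 * i + 1))
  y3 : ∀ i < D.M, D.y 3 ≠ D.xi + 2 * i + 1

end Panel

/-- The marks of a gate. -/
def Raw.marks : Raw → Option ℕ × Option ℕ × Option ℕ × Option (Fin 5)
  | .not i => (none, none, some i, some 0)
  | .cnot a i => (some a, none, some i, some 1)
  | .tof a b i => (some a, some b, some i, some 2)
  | .had i => (none, none, some i, some 3)
  | .tg i => (none, none, some i, some 4)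

namespace Panel

/-- The marks on the panel. -/
structure Shows (D : Panel) (s : BasisState)
    (m : Option ℕ × Option ℕ × Option ℕ × Option (Fin 5)) : Prop where
  a : ∀ w < D.M, s (D.xa + 2 * w + 1) = decide (m.1 = some w)
  b : ∀ w < D.M, s (D.xb + 2 * w + 1) = decide (m.2.1 = some w)
  i : ∀ w < D.M, s (D.xi + 2 * w + 1) = decide (m.2.2.1 = some w)
  y : ∀ j, s (D.y j) = decide (m.2.2.2 = some j)
  aux : ∀ w, D.Aux w → s w = false

/-- The data bit with a mark. -/
def read (D : Panel) (s : BasisState) (o : Option ℕ) : Bool := o.elim false fun a => s (D.db + a)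

/-- At most one data wire is marked, so the sum of the marked bits is the bit looked for, or `0`
without a mark. -/
theorem ract_fetch (D : Panel) (x t : ℕ) (s : BasisState) (o : Option ℕ) (ho : ∀ a ∈ o, a < D.M)
    (hx : ∀ w < D.M, s (x + 2 * w + 1) = decide (o = some w)) (ht : ∀ w < D.M, x + 2 * w + 1 ≠ t)
    (htd : ¬ D.Data t) :
    ract (D.fetch x t) s = Function.update s t (xor (s t) (D.read s o)) := by
  have key : ∀ m ≤ D.M, ract ((List.range m).map fun w => .tof (x + 2 * w + 1) (D.db + w) t) s =
      Function.update s t (xor (s t) (o.elim false fun a => decide (a < m) && s (D.db + a))) := by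
    intro m
    induction m with
    | zero =>
      intro _
      have : (o.elim false fun a => decide (a < 0) && s (D.db + a)) = false := by
        cases o <;> simp
      rw [this]
      simp
    | succ m ih =>
      intro hm
      rw [List.range_succ, List.map_append, ract_append, ih (by omega)]
      simp only [List.map_cons, List.map_nil, ract_cons, ract_nil, Raw.act]
      have h1 : D.db + m ≠ t := fun e => htd ⟨by omega, by omega⟩
      rw [Function.update_self, Function.update_of_ne (ht m (by omega)), Function.update_of_ne h1,
        Function.update_idem, hx m (by omega)]
      congr 1
      cases o with
      | none => simp
      | some a =>
        by_cases e : a = m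
        · subst e; simp
        · have : a < m ↔ a < m + 1 := by omega
          simp [e, this]
  rw [fetch, key D.M le_rfl]
  congr 2
  cases o with
  | none => rfl
  | some a => simp [read, ho a rfl]

end Panel

end Interpreter

/-! ### Correctness of the circuit that applies a displayed gate -/

section InterpreterCorrectness

namespace Panel

variable {D : Panel}

/-- The bit that is added to the target. -/
def bit (D : Panel) (s : BasisState) (m : Option ℕ × Option ℕ × Option ℕ × Option (Fin 5)) : Bool :=
  xor (xor (decide (m.2.2.2 = some 0)) (decide (m.2.2.2 = some 1) && D.read s m.1))
    (decide (m.2.2.2 = some 2) && (D.read s m.1 && D.read s m.2.1))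

/-- The marks are on data wires. -/
def Bounded (D : Panel) (m : Option ℕ × Option ℕ × Option ℕ × Option (Fin 5)) : Prop :=
  (∀ a ∈ m.1, a < D.M) ∧ (∀ a ∈ m.2.1, a < D.M) ∧ ∀ a ∈ m.2.2.1, a < D.M

theorem Ok.value_tidy (h : D.Ok) : Tidy D.Used D.value := by
  have hy := h.y
  have hA : ∀ j < 7, D.Aux (D.qb + j) := fun j hj => ⟨by omega, by omega⟩
  have hne : ∀ w j, j < 7 → ¬ D.Aux w → w ≠ D.qb + j := fun w j hj hw e => hw (e ▸ hA j hj)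
  have hU : ∀ j < 7, D.Used (D.qb + j) := fun j hj => Or.inl (hA j hj)
  have hUy : ∀ j, D.Used (D.y j) := fun j => Or.inr (Or.inr (Or.inl ⟨j, rfl⟩))
  have hD : ∀ w < D.M, D.Data (D.db + w) := fun w hw => ⟨by omega, by omega⟩
  have hfetch : ∀ x j, j < 7 → (∀ i < D.M, (¬ D.Data (x + 2 * i + 1) ∧ ¬ D.Aux (x + 2 * i + 1)) ∧
      D.Used (x + 2 * i + 1)) → Tidy D.Used (D.fetch x (D.qb + j)) := by
    intro x j hj hx
    refine Tidy.map fun i hi => ⟨trivial, ⟨?_, ?_, ?_⟩, ?_, ?_, ?_⟩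
    · exact fun e => (hx i hi).1.1 (e ▸ hD i hi)
    · exact hne _ _ hj (hx i hi).1.2
    · exact hne _ _ hj (h.data _ (hD i hi))
    · exact (hx i hi).2
    · exact Or.inr (Or.inl (hD i hi))
    · exact hU j hj
  have ha := hfetch D.xa 0 (by omega) fun i hi => ⟨(h.x i hi).1,
    Or.inr (Or.inr (Or.inr ⟨i, hi, Or.inl rfl⟩))⟩
  have hb := hfetch D.xb 1 (by omega) fun i hi => ⟨(h.x i hi).2.1,
    Or.inr (Or.inr (Or.inr ⟨i, hi, Or.inr (Or.inl rfl)⟩))⟩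
  refine ha.append (hb.append ?_)
  refine Tidy.append (C := [_]) (Tidy.singleton (g := .cnot _ _) trivial (hne _ 3 (by omega) (hy 0).2)
      ⟨hUy 0, hU 3 (by omega)⟩)
    (Tidy.append (C := [_]) (Tidy.singleton (g := .tof _ _ _) trivial ⟨?_, ?_, ?_⟩
      ⟨hUy 1, hU 0 (by omega), hU 3 (by omega)⟩)
    (Tidy.append (C := [_]) (Tidy.singleton (g := .tof _ _ _) trivial ⟨?_, ?_, ?_⟩
      ⟨hU 0 (by omega), hU 1 (by omega), hU 4 (by omega)⟩)
    (Tidy.singleton (g := .tof _ _ _) trivial ⟨?_, ?_, ?_⟩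
      ⟨hUy 2, hU 4 (by omega), hU 3 (by omega)⟩)))
  · exact hne _ 0 (by omega) (hy 1).2
  · exact hne _ 3 (by omega) (hy 1).2
  · omega
  · omega
  · omega
  · omega
  · exact hne _ 4 (by omega) (hy 2).2
  · exact hne _ 3 (by omega) (hy 2).2
  · omega

theorem Ok.write_tidy (h : D.Ok) : Tidy D.Used D.write := by
  have hA : ∀ j < 7, D.Aux (D.qb + j) := fun j hj => ⟨by omega, by omega⟩
  have hD : ∀ w < D.M, D.Data (D.db + w) := fun w hw => ⟨by omega, by omega⟩
  refine Tidy.map fun i hi => ⟨trivial, ⟨?_, ?_, ?_⟩, ?_, ?_, ?_⟩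
  · exact fun e => (h.x i hi).2.2.2 (e ▸ hA 3 (by omega))
  · exact fun e => (h.x i hi).2.2.1 (e ▸ hD i hi)
  · exact fun e => h.data _ (hD i hi) (e ▸ hA 3 (by omega))
  · exact Or.inr (Or.inr (Or.inr ⟨i, hi, Or.inr (Or.inr rfl)⟩))
  · exact Or.inl (hA 3 (by omega))
  · exact Or.inr (Or.inl (hD i hi))

theorem Ok.phaseBit_tidy (h : D.Ok) : Tidy D.Used D.phaseBit := by
  have hA : ∀ j < 7, D.Aux (D.qb + j) := fun j hj => ⟨by omega, by omega⟩
  have hD : ∀ w < D.M, D.Data (D.db + w) := fun w hw => ⟨by omega, by omega⟩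
  refine Tidy.append (Tidy.map fun i hi => ⟨trivial, ⟨?_, ?_, ?_⟩, ?_, ?_, ?_⟩)
    (Tidy.singleton trivial ⟨?_, ?_, ?_⟩ ⟨?_, ?_, ?_⟩)
  · exact fun e => (h.x i hi).2.2.1 (e ▸ hD i hi)
  · exact fun e => (h.x i hi).2.2.2 (e ▸ hA 2 (by omega))
  · exact fun e => h.data _ (hD i hi) (e ▸ hA 2 (by omega))
  · exact Or.inr (Or.inr (Or.inr ⟨i, hi, Or.inr (Or.inr rfl)⟩))
  · exact Or.inr (Or.inl (hD i hi))
  · exact Or.inl (hA 2 (by omega))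
  · exact fun e => (h.y 4).2 (e ▸ hA 2 (by omega))
  · exact fun e => (h.y 4).2 (e ▸ hA 5 (by omega))
  · omega
  · exact Or.inr (Or.inr (Or.inl ⟨4, rfl⟩))
  · exact Or.inl (hA 2 (by omega))
  · exact Or.inl (hA 5 (by omega))

theorem Ok.ctrl_tidy (h : D.Ok) {w : ℕ} (hw : w < D.M) :
    Tidy D.Used [.tof (D.y 3) (D.xi + 2 * w + 1) (D.qb + 6)] := by
  have hA : ∀ j < 7, D.Aux (D.qb + j) := fun j hj => ⟨by omega, by omega⟩
  refine Tidy.singleton trivial ⟨h.y3 w hw, ?_, ?_⟩ ⟨?_, ?_, ?_⟩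
  · exact fun e => (h.y 3).2 (e ▸ hA 6 (by omega))
  · exact fun e => (h.x w hw).2.2.2 (e ▸ hA 6 (by omega))
  · exact Or.inr (Or.inr (Or.inl ⟨3, rfl⟩))
  · exact Or.inr (Or.inr (Or.inr ⟨w, hw, Or.inr (Or.inr rfl)⟩))
  · exact Or.inl (hA 6 (by omega))

theorem hadBasis_on {P : ℕ → Prop} {x : ℕ} (hx : P x) : ∀ g ∈ hadBasis x, g.On P := by
  intro g hg
  simp only [hadBasis, List.mem_cons, List.not_mem_nil, or_false] at hg
  rcases hg with rfl | rfl | rfl | rfl <;> exact hx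

/-- The gates are valid and use the wires of the panel only. -/
theorem Ok.step_valid (h : D.Ok) : ∀ g ∈ D.step, g.Valid ∧ g.On D.Used := by
  have hA : ∀ j < 7, D.Aux (D.qb + j) := fun j hj => ⟨by omega, by omega⟩
  have hD : ∀ w < D.M, D.Data (D.db + w) := fun w hw => ⟨by omega, by omega⟩
  intro g hg
  simp only [step, List.mem_append] at hg
  rcases hg with (hg | hg | hg) | (hg | hg | hg) | hg
  · exact (h.value_tidy g hg).2
  · exact (h.write_tidy g hg).2
  · exact (h.value_tidy.rinv g hg).2
  · exact (h.phaseBit_tidy g hg).2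
  · rw [List.mem_singleton.1 hg]
    exact ⟨trivial, Or.inl (hA 5 (by omega))⟩
  · exact (h.phaseBit_tidy.rinv g hg).2
  · obtain ⟨w, hw, hg⟩ := List.mem_flatMap.1 hg
    rw [List.mem_range] at hw
    have hne : D.qb + 6 ≠ D.db + w := fun e => h.data _ (hD w hw) (e ▸ hA 6 (by omega))
    simp only [hadAt, List.mem_append] at hg
    have hu : D.Used (D.db + w) := Or.inr (Or.inl (hD w hw))
    rcases hg with hg | hg | hg
    · exact (h.ctrl_tidy hw g hg).2
    · refine ⟨ctrlHad_valid hne g hg, ?_⟩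
      rw [ctrlHad, List.mem_append, List.mem_append, List.mem_singleton] at hg
      rcases hg with hg | rfl | hg
      · exact hadBasis_on hu g hg
      · exact ⟨Or.inl (hA 6 (by omega)), hu⟩
      · exact rinv_forall (hadBasis_on hu) g hg
    · exact (h.ctrl_tidy hw g hg).2

theorem read_update (D : Panel) (s : BasisState) (o : Option ℕ) (ho : ∀ a ∈ o, a < D.M) {t : ℕ} (b : Bool)
    (ht : ∀ a ∈ o, t ≠ D.db + a) : D.read (Function.update s t b) o = D.read s o := by
  cases o with
  | none => rfl
  | some a => exact Function.update_of_ne (ht a rfl).symm _ _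

theorem Ok.ract_value (h : D.Ok) {s : BasisState} {m} (hs : D.Shows s m) (hm : D.Bounded m) :
    ract D.value s = Function.update (Function.update (Function.update (Function.update s D.qb
      (D.read s m.1)) (D.qb + 1) (D.read s m.2.1)) (D.qb + 3) (D.bit s m)) (D.qb + 4)
        (D.read s m.1 && D.read s m.2.1) := by
  have hA : ∀ j < 7, D.Aux (D.qb + j) := fun j hj => ⟨by omega, by omega⟩
  have hD : ∀ w < D.M, D.Data (D.db + w) := fun w hw => ⟨by omega, by omega⟩
  have hyne : ∀ i j, j < 7 → D.y i ≠ D.qb + j := fun i j hj e => (h.y i).2 (e ▸ hA j hj)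
  have hz : ∀ j < 7, s (D.qb + j) = false := fun j hj => hs.aux _ (hA j hj)
  rw [value, ract_append, ract_append,
    D.ract_fetch D.xa D.qb s m.1 hm.1 hs.a (fun w hw e => (h.x w hw).1.2 (e ▸ hA 0 (by omega)))
      (fun e => h.data _ e (hA 0 (by omega))),
    D.ract_fetch D.xb (D.qb + 1) _ m.2.1 hm.2.1
      (fun w hw => by
        rw [Function.update_of_ne (by exact fun e => (h.x w hw).2.1.2 (e ▸ hA 0 (by omega)))]
        exact hs.b w hw)
      (fun w hw e => (h.x w hw).2.1.2 (e ▸ hA 1 (by omega)))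
      (fun e => h.data _ e (hA 1 (by omega))),
    D.read_update _ _ hm.2.1 _ (t := D.qb) (fun a ha e => h.data _ (hD a (hm.2.1 a ha))
      (e ▸ hA 0 (by omega)))]
  have hz0 := hz 0 (by omega)
  rw [Nat.add_zero] at hz0
  have hy0 : ∀ i, D.y i ≠ D.qb := fun i => hyne i 0 (by omega)
  simp only [ract_cons, ract_nil, Raw.act]
  simp only [Function.update_self, Function.update_idem, Function.update_of_ne (hyne _ 1 (by omega)),
    Function.update_of_ne (hyne _ 3 (by omega)), Function.update_of_ne (hyne _ 4 (by omega)),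
    Function.update_of_ne (hy0 _), hz0, hz 1 (by omega), hz 3 (by omega), hz 4 (by omega), hs.y,
    Function.update_of_ne (show D.qb ≠ D.qb + 1 by omega),
    Function.update_of_ne (show D.qb ≠ D.qb + 3 by omega),
    Function.update_of_ne (show D.qb + 1 ≠ D.qb by omega),
    Function.update_of_ne (show D.qb + 1 ≠ D.qb + 3 by omega),
    Function.update_of_ne (show D.qb + 3 ≠ D.qb by omega),
    Function.update_of_ne (show D.qb + 3 ≠ D.qb + 1 by omega),
    Function.update_of_ne (show D.qb + 3 ≠ D.qb + 4 by omega),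
    Function.update_of_ne (show D.qb + 4 ≠ D.qb by omega),
    Function.update_of_ne (show D.qb + 4 ≠ D.qb + 1 by omega),
    Function.update_of_ne (show D.qb + 4 ≠ D.qb + 3 by omega), Bool.false_xor, bit]
  rw [Function.update_comm (show D.qb + 3 ≠ D.qb + 4 by omega), Function.update_idem,
    Function.update_comm (show D.qb + 4 ≠ D.qb + 3 by omega)]

theorem Ok.ract_write (h : D.Ok) {s : BasisState} {i : Option ℕ} (hi : ∀ a ∈ i, a < D.M)
    (hs : ∀ w < D.M, s (D.xi + 2 * w + 1) = decide (i = some w)) :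
    ract D.write s = i.elim s fun a =>
      Function.update s (D.db + a) (xor (s (D.db + a)) (s (D.qb + 3))) := by
  have hA : ∀ j < 7, D.Aux (D.qb + j) := fun j hj => ⟨by omega, by omega⟩
  have hD : ∀ w < D.M, D.Data (D.db + w) := fun w hw => ⟨by omega, by omega⟩
  have hq : ∀ j < D.M, D.qb + 3 ≠ D.db + j := fun j hj e =>
    h.data _ (hD j hj) (e ▸ hA 3 (by omega))
  obtain ⟨d1, d2⟩ := ract_map_range D.M (fun w => .tof (D.xi + 2 * w + 1) (D.qb + 3) (D.db + w))
    (fun w => D.db + w) (fun w s => s (D.xi + 2 * w + 1) && s (D.qb + 3))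
    (fun i _ j _ e => by omega) (fun i hi s => rfl) (fun i hi s t hst => by
      rw [hst (D.xi + 2 * i + 1) fun j hj e => (h.x i hi).2.2.1 (e ▸ hD j hj), hst _ hq]) s
  change ∀ i < D.M, ract D.write s (D.db + i) = _ at d1
  change ∀ w, _ → ract D.write s w = _ at d2
  funext w
  by_cases hw : D.Data w
  · obtain ⟨a, rfl⟩ := Nat.exists_eq_add_of_le hw.1
    have ha : a < D.M := by have := hw.2; omega
    rw [d1 a ha, hs a ha]
    cases i with
    | none => simp
    | some b =>
      by_cases e : b = a
      · subst e; simp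
      · have e' : D.db + a ≠ D.db + b := by omega
        dsimp only [Option.elim]
        rw [Function.update_of_ne e']
        simp [e]
  · rw [d2 w fun a ha e => hw (e ▸ hD a ha)]
    cases i with
    | none => rfl
    | some b =>
      have : w ≠ D.db + b := fun e => hw (e ▸ hD b (hi b rfl))
      simp [this]

theorem Shows.update_data (h : D.Ok) {s : BasisState} {m} (hs : D.Shows s m) {a : ℕ} (ha : a < D.M)
    (b : Bool) : D.Shows (Function.update s (D.db + a) b) m := by
  have hd : D.Data (D.db + a) := ⟨by omega, by omega⟩
  refine ⟨fun w hw => ?_, fun w hw => ?_, fun w hw => ?_, fun j => ?_, fun w hw => ?_⟩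
  · rw [Function.update_of_ne (by exact fun e => (h.x w hw).1.1 (e ▸ hd)), hs.a w hw]
  · rw [Function.update_of_ne (by exact fun e => (h.x w hw).2.1.1 (e ▸ hd)), hs.b w hw]
  · rw [Function.update_of_ne (by exact fun e => (h.x w hw).2.2.1 (e ▸ hd)), hs.i w hw]
  · rw [Function.update_of_ne (by exact fun e => (h.y j).1 (e ▸ hd)), hs.y j]
  · rw [Function.update_of_ne (by exact fun e => h.data _ hd (e ▸ hw)), hs.aux w hw]

/-- The classical part of a step. -/
theorem Ok.ract_classical (h : D.Ok) {s : BasisState} {m} (hs : D.Shows s m) (hm : D.Bounded m)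
    (hd : D.bit s m = false ∨ ∀ a ∈ m.2.2.1, a ∉ m.1 ∧ a ∉ m.2.1) :
    ract (D.value ++ (D.write ++ rinv D.value)) s = m.2.2.1.elim s fun a =>
      Function.update s (D.db + a) (xor (s (D.db + a)) (D.bit s m)) := by
  have hA : ∀ j < 7, D.Aux (D.qb + j) := fun j hj => ⟨by omega, by omega⟩
  have hD : ∀ w < D.M, D.Data (D.db + w) := fun w hw => ⟨by omega, by omega⟩
  have hx : ∀ w < D.M, ract D.value s (D.xi + 2 * w + 1) = decide (m.2.2.1 = some w) := by
    intro w hw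
    have hne : ∀ j < 7, D.xi + 2 * w + 1 ≠ D.qb + j := fun j hj e =>
      (h.x w hw).2.2.2 (e ▸ hA j hj)
    rw [h.ract_value hs hm, Function.update_of_ne (hne 4 (by omega)),
      Function.update_of_ne (hne 3 (by omega)), Function.update_of_ne (hne 1 (by omega)),
      Function.update_of_ne (show _ ≠ D.qb from hne 0 (by omega)), hs.i w hw]
  rw [ract_append, ract_append, h.ract_write hm.2.2 hx]
  obtain ⟨ma, mb, mi, mk⟩ := m
  cases mi with
  | none => exact h.value_tidy.ract_rinv s
  | some i =>
    have hi : i < D.M := hm.2.2 i rfl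
    have hne : ∀ j < 7, D.db + i ≠ D.qb + j := fun j hj e => h.data _ (hD i hi) (e ▸ hA j hj)
    have hne0 : D.db + i ≠ D.qb := hne 0 (by omega)
    dsimp only [Option.elim]
    dsimp only at hd hm
    -- The computation of the bit can be undone after the write only if it would give the same bit
    -- again. This holds as either nothing was added or the target is not among the controls.
    suffices hsuff : Function.update (ract D.value s) (D.db + i) (xor (ract D.value s (D.db + i))
        (ract D.value s (D.qb + 3))) = ract D.value (Function.update s (D.db + i)
          (xor (s (D.db + i)) (D.bit s (ma, mb, some i, mk)))) by
      rw [hsuff, h.value_tidy.ract_rinv]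
    have hread : Function.update s (D.db + i) (xor (s (D.db + i)) (D.bit s (ma, mb, some i, mk))) = s ∨
        (i ∉ ma ∧ i ∉ mb) := by
      rcases hd with hd | hd
      · left; rw [hd]; simp
      · exact Or.inr (hd i rfl)
    have hra : D.read (Function.update s (D.db + i) (xor (s (D.db + i))
        (D.bit s (ma, mb, some i, mk)))) ma = D.read s ma := by
      rcases hread with e | e
      · rw [e]
      · exact D.read_update _ _ hm.1 _ fun a ha e' => e.1 (by
          have : i = a := by omega
          rwa [this])
    have hrb : D.read (Function.update s (D.db + i) (xor (s (D.db + i))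
        (D.bit s (ma, mb, some i, mk)))) mb = D.read s mb := by
      rcases hread with e | e
      · rw [e]
      · exact D.read_update _ _ hm.2.1 _ fun a ha e' => e.2 (by
          have : i = a := by omega
          rwa [this])
    have hbit : D.bit (Function.update s (D.db + i) (xor (s (D.db + i))
        (D.bit s (ma, mb, some i, mk)))) (ma, mb, some i, mk) = D.bit s (ma, mb, some i, mk) := by
      simp only [bit] at hra hrb ⊢
      rw [hra, hrb]
    rw [h.ract_value (hs.update_data h hi _) hm, h.ract_value hs hm, hbit]
    dsimp only
    rw [hra, hrb, Function.update_of_ne (hne 4 (by omega)), Function.update_of_ne (hne 3 (by omega)),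
      Function.update_of_ne (hne 1 (by omega)), Function.update_of_ne hne0,
      Function.update_of_ne (show D.qb + 3 ≠ D.qb + 4 by omega), Function.update_self,
      Function.update_comm (hne 4 (by omega)).symm, Function.update_comm (hne 3 (by omega)).symm,
      Function.update_comm (hne 1 (by omega)).symm, Function.update_comm hne0.symm]

/-- A `T` gate is diagonal, so applying it to a copy of the target bit gives the same phase as
applying it to the target, and the copy can be erased. -/
theorem Ok.rapply_phase (h : D.Ok) {s : BasisState} {m} (hs : D.Shows s m) (hm : D.Bounded m) :
    rapply (D.phaseBit ++ ([.tg (D.qb + 5)] ++ rinv D.phaseBit)) (Finsupp.single s 1) =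
      Finsupp.single s (if (decide (m.2.2.2 = some 4) && D.read s m.2.2.1) = true then phase else 1) := by
  have hA : ∀ j < 7, D.Aux (D.qb + j) := fun j hj => ⟨by omega, by omega⟩
  have hbit : ract D.phaseBit s (D.qb + 5) = (decide (m.2.2.2 = some 4) && D.read s m.2.2.1) := by
    rw [phaseBit, ract_append, D.ract_fetch D.xi (D.qb + 2) s m.2.2.1 hm.2.2 hs.i
      (fun w hw e => (h.x w hw).2.2.2 (e ▸ hA 2 (by omega)))
      (fun e => h.data _ e (hA 2 (by omega)))]
    simp only [ract_cons, ract_nil, Raw.act]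
    rw [Function.update_self, Function.update_of_ne (by omega), hs.aux _ (hA 5 (by omega)),
      hs.aux _ (hA 2 (by omega)), Function.update_self,
      Function.update_of_ne (by exact fun e => (h.y 4).2 (e ▸ hA 2 (by omega))), hs.y]
    simp
  rw [rapply_append, rapply_append, h.phaseBit_tidy.rapply, rapply_cons, rapply_nil, Raw.tg_single,
    hbit, rapply_classical h.phaseBit_tidy.rinv.cl, h.phaseBit_tidy.ract_rinv, one_mul]

/-- The control in the ancilla depends on the marks and not on the data, so it can be removed after
the data wire has gone into superposition. -/
theorem Ok.rapply_hadAt (h : D.Ok) {s : BasisState} {m} (hs : D.Shows s m) {w : ℕ} (hw : w < D.M) :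
    rapply (D.hadAt w) (Finsupp.single s 1) =
      if m.2.2.2 = some 3 ∧ m.2.2.1 = some w then (Raw.had (D.db + w)).apply (Finsupp.single s 1)
      else Finsupp.single s 1 := by
  have hA : D.Aux (D.qb + 6) := ⟨by omega, by omega⟩
  have hD : D.Data (D.db + w) := ⟨by omega, by omega⟩
  have hne : D.qb + 6 ≠ D.db + w := fun e => h.data _ hD (e ▸ hA)
  have hact : ∀ b, ract [.tof (D.y 3) (D.xi + 2 * w + 1) (D.qb + 6)]
      (Function.update s (D.db + w) b) = Function.update (Function.update s (D.db + w) b) (D.qb + 6)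
        (decide (m.2.2.2 = some 3) && decide (m.2.2.1 = some w)) := by
    intro b
    have hs' := hs.update_data h hw b
    simp only [ract_cons, ract_nil, Raw.act, hs'.y, hs'.i w hw, hs'.aux _ hA, Bool.false_xor]
  have hcan : ∀ t : BasisState, ract [.tof (D.y 3) (D.xi + 2 * w + 1) (D.qb + 6)]
      (ract [.tof (D.y 3) (D.xi + 2 * w + 1) (D.qb + 6)] t) = t := fun t =>
    (h.ctrl_tidy hw).ract_rinv t
  have hs0 : Function.update s (D.db + w) (s (D.db + w)) = s := Function.update_eq_self _ _
  have hact0 := hact (s (D.db + w))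
  rw [hs0] at hact0
  rw [hadAt, rapply_append, rapply_append, (h.ctrl_tidy hw).rapply, ctrlHad_single hne]
  have hb : ract [.tof (D.y 3) (D.xi + 2 * w + 1) (D.qb + 6)] s (D.qb + 6) =
      decide (m.2.2.2 = some 3 ∧ m.2.2.1 = some w) := by
    rw [hact0, Function.update_self, Bool.decide_and]
  rw [hb]
  by_cases hc : m.2.2.2 = some 3 ∧ m.2.2.1 = some w
  · have hcb : (decide (m.2.2.2 = some 3) && decide (m.2.2.1 = some w)) = true := by
      simp [hc.1, hc.2]
    rw [if_pos (by simpa using hc), if_pos hc, Raw.had_single, Raw.had_single, map_add,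
      rapply_classical (h.ctrl_tidy hw).cl, rapply_classical (h.ctrl_tidy hw).cl]
    have hswap : ∀ b, Function.update (ract [.tof (D.y 3) (D.xi + 2 * w + 1) (D.qb + 6)] s) (D.db + w) b =
        ract [.tof (D.y 3) (D.xi + 2 * w + 1) (D.qb + 6)] (Function.update s (D.db + w) b) := fun b => by
      rw [hact, hact0, Function.update_comm hne]
    rw [hswap, hswap, hcan, hcan, hact0, Function.update_of_ne hne.symm]
  · rw [if_neg (by simpa using hc), if_neg hc, (h.ctrl_tidy hw).rapply, hcan]

theorem Ok.rapply_hads (h : D.Ok) {s : BasisState} {m} (hs : D.Shows s m) (n : ℕ) (hn : n ≤ D.M) :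
    rapply ((List.range n).flatMap D.hadAt) (Finsupp.single s 1) =
      if m.2.2.2 = some 3 then m.2.2.1.elim (Finsupp.single s 1) fun i =>
        if i < n then (Raw.had (D.db + i)).apply (Finsupp.single s 1) else Finsupp.single s 1
      else Finsupp.single s 1 := by
  induction n with
  | zero =>
    cases m.2.2.1 <;> simp
  | succ n ih =>
    rw [List.range_succ, List.flatMap_append, rapply_append, ih (by omega)]
    simp only [List.flatMap_cons, List.flatMap_nil, List.append_nil]
    have hn' : n < D.M := by omega
    by_cases h3 : m.2.2.2 = some 3
    · rw [if_pos h3, if_pos h3]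
      cases hi : m.2.2.1 with
      | none =>
        dsimp only [Option.elim]
        rw [h.rapply_hadAt hs hn', if_neg (by simp [hi])]
      | some i =>
        dsimp only [Option.elim]
        by_cases e : i = n
        · subst e
          rw [if_neg (lt_irrefl _), if_pos (Nat.lt_succ_self _), h.rapply_hadAt hs hn',
            if_pos ⟨h3, hi⟩]
        · have hlt : i < n + 1 ↔ i < n := by omega
          have hni : ∀ t, D.Shows t m → ∀ c, rapply (D.hadAt n) (Finsupp.single t c) =
              Finsupp.single t c := fun t ht c => by
            have hc : Finsupp.single t c = c • Finsupp.single t (1 : ℂ) := by simp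
            rw [hc, map_smul, h.rapply_hadAt ht hn', if_neg (by simp [hi, e])]
          simp only [hlt]
          split_ifs with hlt'
          · rw [Raw.had_single, map_add, hni _ (hs.update_data h (by omega) _),
              hni _ (hs.update_data h (by omega) _)]
          · exact hni s hs 1
    · rw [if_neg h3, if_neg h3, h.rapply_hadAt hs hn', if_neg (by simp [h3])]

/-- The state with the data `s` and the other wires as in `ρ`. -/
def embed (D : Panel) (ρ s : BasisState) : BasisState := fun w =>
  if D.db ≤ w ∧ w < D.db + D.M then s (w - D.db) else ρ w

theorem embed_data (D : Panel) (ρ s : BasisState) {a : ℕ} (ha : a < D.M) :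
    D.embed ρ s (D.db + a) = s a := by
  simp [embed, ha]

theorem embed_of_not_data {ρ s : BasisState} {w : ℕ} (h : ¬ D.Data w) :
    D.embed ρ s w = ρ w := if_neg h

theorem embed_update (D : Panel) (ρ s : BasisState) {a : ℕ} (ha : a < D.M) (b : Bool) :
    D.embed ρ (Function.update s a b) = Function.update (D.embed ρ s) (D.db + a) b := by
  funext w
  by_cases hw : w = D.db + a
  · subst hw; rw [embed_data _ _ _ ha]; simp
  · rw [Function.update_of_ne hw]
    simp only [embed]
    split_ifs with h
    · rw [Function.update_of_ne (by omega)]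
    · rfl

theorem Shows.embed (h : D.Ok) {ρ : BasisState} {m} (hs : D.Shows ρ m) (s : BasisState) :
    D.Shows (D.embed ρ s) m := by
  refine ⟨fun w hw => ?_, fun w hw => ?_, fun w hw => ?_, fun j => ?_, fun w hw => ?_⟩
  · rw [embed_of_not_data (h.x w hw).1.1, hs.a w hw]
  · rw [embed_of_not_data (h.x w hw).2.1.1, hs.b w hw]
  · rw [embed_of_not_data (h.x w hw).2.2.1, hs.i w hw]
  · rw [embed_of_not_data (h.y j).1, hs.y j]
  · rw [embed_of_not_data fun e => h.data _ e hw, hs.aux w hw]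

theorem rapply_mapDomain {C : List Raw} {f : BasisState → BasisState} {A : QState →ₗ[ℂ] QState}
    (h : ∀ s, rapply C (Finsupp.single (f s) 1) = Finsupp.mapDomain f (A (Finsupp.single s 1)))
    (v : QState) : rapply C (Finsupp.mapDomain f v) = Finsupp.mapDomain f (A v) := by
  have : rapply C ∘ₗ Finsupp.lmapDomain ℂ ℂ f = Finsupp.lmapDomain ℂ ℂ f ∘ₗ A := by
    refine Finsupp.lhom_ext' fun s => LinearMap.ext_ring ?_
    simpa [Finsupp.mapDomain_single] using h s
  exact LinearMap.congr_fun this v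

/-- The step has no effect if there are no marks. -/
theorem Ok.step_idle (h : D.Ok) {ρ : BasisState} (hρ : D.Shows ρ (none, none, none, none))
    (v : QState) : rapply D.step (Finsupp.mapDomain (D.embed ρ) v) = Finsupp.mapDomain (D.embed ρ) v := by
  refine rapply_mapDomain (A := LinearMap.id) (fun s => ?_) v
  have hs := hρ.embed h s
  have hm : D.Bounded (none, none, none, none) := ⟨by simp, by simp, by simp⟩
  rw [step, rapply_append, rapply_classical (h.value_tidy.append
    (h.write_tidy.append h.value_tidy.rinv)).cl, h.ract_classical hs hm (Or.inl (by simp [bit])),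
    rapply_append]
  dsimp only [Option.elim]
  rw [h.rapply_phase hs hm, if_neg (by simp), h.rapply_hads hs _ le_rfl, if_neg (by simp)]
  simp [Finsupp.mapDomain_single]

/-- The step applies the marked gate. -/
theorem Ok.step_apply (h : D.Ok) {ρ : BasisState} {g : Raw} (hg : g.Valid) (hM : g.On fun w => w < D.M)
    (hρ : D.Shows ρ g.marks) (v : QState) :
    rapply D.step (Finsupp.mapDomain (D.embed ρ) v) = Finsupp.mapDomain (D.embed ρ) (g.apply v) := by
  refine rapply_mapDomain (A := g.apply) (fun s => ?_) v
  have hs := hρ.embed h s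
  have hm : D.Bounded g.marks := by
    cases g <;> simp_all [Raw.marks, Bounded, Raw.On]
  have hcl : ∀ g ∈ D.value ++ (D.write ++ rinv D.value), g.Cl :=
    (h.value_tidy.append (h.write_tidy.append h.value_tidy.rinv)).cl
  have hd : D.bit (D.embed ρ s) g.marks = false ∨ ∀ a ∈ g.marks.2.2.1, a ∉ g.marks.1 ∧ a ∉ g.marks.2.1 := by
    cases g <;> simp_all [Raw.marks, bit, Raw.Valid]
  rw [step, rapply_append, rapply_append, rapply_classical hcl, h.ract_classical hs hm hd]
  cases g with
  | not i =>
    have hi : i < D.M := hM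
    have hs' := hs.update_data h hi (xor (D.embed ρ s (D.db + i)) (D.bit (D.embed ρ s) (Raw.not i).marks))
    dsimp only [Raw.marks, Option.elim] at hs' ⊢
    rw [h.rapply_phase hs' hm, if_neg (by simp), h.rapply_hads hs' _ le_rfl,
      if_neg (by simp), Raw.not_single, Finsupp.mapDomain_single, embed_update _ _ _ hi,
      embed_data _ _ _ hi]
    simp [bit]
  | cnot a i =>
    obtain ⟨ha, hi⟩ : a < D.M ∧ i < D.M := hM
    have hs' := hs.update_data h hi (xor (D.embed ρ s (D.db + i))
      (D.bit (D.embed ρ s) (Raw.cnot a i).marks))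
    dsimp only [Raw.marks, Option.elim] at hs' ⊢
    rw [h.rapply_phase hs' hm, if_neg (by simp), h.rapply_hads hs' _ le_rfl,
      if_neg (by simp), Raw.apply_single, Raw.onBasis, one_smul, Finsupp.mapDomain_single,
      embed_update _ _ _ hi, embed_data _ _ _ hi]
    simp [bit, read, embed_data _ _ _ ha]
  | tof a b i =>
    obtain ⟨ha, hb, hi⟩ : a < D.M ∧ b < D.M ∧ i < D.M := hM
    have hs' := hs.update_data h hi (xor (D.embed ρ s (D.db + i))
      (D.bit (D.embed ρ s) (Raw.tof a b i).marks))
    dsimp only [Raw.marks, Option.elim] at hs' ⊢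
    rw [h.rapply_phase hs' hm, if_neg (by simp), h.rapply_hads hs' _ le_rfl,
      if_neg (by simp), Raw.apply_single, Raw.onBasis, one_smul, Finsupp.mapDomain_single,
      embed_update _ _ _ hi, embed_data _ _ _ hi]
    simp [bit, read, embed_data _ _ _ ha, embed_data _ _ _ hb]
  | had i =>
    have hi : i < D.M := hM
    have hb : D.bit (D.embed ρ s) (Raw.had i).marks = false := by simp [bit, Raw.marks]
    dsimp only [Raw.marks, Option.elim] at hs hb ⊢
    rw [hb, Bool.xor_false, Function.update_eq_self, h.rapply_phase hs hm,
      if_neg (by simp), h.rapply_hads hs _ le_rfl, if_pos rfl]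
    dsimp only [Option.elim]
    rw [if_pos hi, Raw.had_single, Raw.had_single, Finsupp.mapDomain_add, Finsupp.mapDomain_single,
      Finsupp.mapDomain_single, embed_update _ _ _ hi, embed_update _ _ _ hi, embed_data _ _ _ hi]
  | tg i =>
    have hi : i < D.M := hM
    have hb : D.bit (D.embed ρ s) (Raw.tg i).marks = false := by simp [bit, Raw.marks]
    dsimp only [Raw.marks, Option.elim] at hs hb ⊢
    have hc : ∀ t : BasisState, ∀ c : ℂ, Finsupp.single t c = c • Finsupp.single t 1 := by simp
    have hh := h.rapply_hads hs D.M le_rfl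
    rw [if_neg (by simp)] at hh
    rw [hb, Bool.xor_false, Function.update_eq_self, h.rapply_phase hs hm, hc, map_smul,
      hh, Raw.tg_single, Finsupp.mapDomain_single]
    simp only [read, Option.elim, embed_data _ _ _ hi]
    cases s i <;> simp

end Panel

end InterpreterCorrectness

/-! ## Reversible computation of functions -/

section Reversible

open scoped symmDiff

/-- The basis state with the bits of `l` on the wires from `o` on. -/
def blk (o : ℕ) (l : List Bool) : BasisState := fun w => if o ≤ w then l.getD (w - o) false else false

theorem blk_add (o : ℕ) (l : List Bool) (j : ℕ) : blk o l (o + j) = l.getD j false := by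
  simp [blk]

theorem blk_of_lt {o : ℕ} {l : List Bool} {w : ℕ} (h : w < o) : blk o l w = false :=
  if_neg (by omega)

theorem blk_of_le {o : ℕ} {l : List Bool} {w : ℕ} (h : o + l.length ≤ w) : blk o l w = false := by
  rw [blk, if_pos (by omega), List.getD_eq_default _ _ (by omega)]

theorem blk_eq_true {o : ℕ} {l : List Bool} {w : ℕ} (h : blk o l w = true) :
    o ≤ w ∧ w < o + l.length := by
  by_contra hc
  rcases (by omega : w < o ∨ o + l.length ≤ w) with h' | h'
  · rw [blk_of_lt h'] at h; exact Bool.noConfusion h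
  · rw [blk_of_le h'] at h; exact Bool.noConfusion h

theorem blk_nil (o : ℕ) : blk o [] = ⊥ := by
  funext w
  simp [blk]

theorem blk_append (o : ℕ) (l l' : List Bool) :
    blk o (l ++ l') = blk o l ∆ blk (o + l.length) l' := by
  funext w
  rw [symmDiff_apply_bool]
  by_cases h1 : w < o
  · rw [blk_of_lt h1, blk_of_lt h1, blk_of_lt (by omega)]; rfl
  · obtain ⟨j, rfl⟩ := Nat.exists_eq_add_of_le (Nat.not_lt.1 h1)
    rw [blk_add, blk_add]
    by_cases h2 : j < l.length
    · rw [blk_of_lt (by omega), List.getD_append _ _ _ _ h2, Bool.xor_false]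
    · obtain ⟨i, rfl⟩ := Nat.exists_eq_add_of_le (Nat.not_lt.1 h2)
      rw [← Nat.add_assoc, blk_add, List.getD_append_right _ _ _ _ (by omega),
        List.getD_eq_default l _ (by omega)]
      simp

theorem enc2_getD_even (l : List Bool) (j : ℕ) : (enc2 l).getD (2 * j) false = l.getD j false := by
  induction l generalizing j with
  | nil => simp
  | cons b l ih =>
    cases j with
    | zero => simp
    | succ j =>
      rw [Nat.mul_succ, enc2_cons, List.getD_cons_succ, List.getD_cons_succ, List.getD_cons_succ, ih]

theorem enc2_getD_odd (l : List Bool) (j : ℕ) :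
    (enc2 l).getD (2 * j + 1) false = (decide (j < l.length) && !l.getD j false) := by
  induction l generalizing j with
  | nil => simp
  | cons b l ih =>
    cases j with
    | zero => simp
    | succ j =>
      rw [Nat.mul_succ, enc2_cons, show 2 * j + 2 + 1 = (2 * j + 1) + 1 + 1 by ring,
        List.getD_cons_succ, List.getD_cons_succ, List.getD_cons_succ, ih]
      simp

/-- The even wires carry the bits; the odd wires tell a cell that holds `0` from an empty cell. -/
theorem Layout.holds_iff {L : Layout} {s : BasisState} {r : ℕ} {l : List Bool} :
    L.Holds s r l ↔ (∀ j, 2 * j < L.K + 2 → s (L.reg r + 2 * j) = l.getD j false) ∧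
      ∀ j, 2 * j + 1 < L.K + 2 → s (L.reg r + (2 * j + 1)) = (decide (j < l.length) && !l.getD j false) := by
  constructor
  · intro h
    exact ⟨fun j hj => by rw [h _ hj, enc2_getD_even], fun j hj => by rw [h _ hj, enc2_getD_odd]⟩
  · rintro ⟨h1, h2⟩ j hj
    rcases Nat.even_or_odd' j with ⟨i, rfl | rfl⟩
    · rw [h1 i hj, enc2_getD_even]
    · rw [h2 i hj, enc2_getD_odd]

/-- The input of a computation: a constant, or the contents of `n` wires from `a` on. -/
inductive Src : Type
  | const (l : List Bool) : Src
  | wires (a n : ℕ) : Src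

/-- The wires of an input. -/
def Src.Uses : Src → ℕ → Prop
  | .const _, _ => False
  | .wires a n, w => a ≤ w ∧ w < a + n

/-- The input is `l` in the state `s`. -/
def Src.Reads (s : BasisState) : Src → List Bool → Prop
  | .const l', l => l = l'
  | .wires a n, l => l.length = n ∧ ∀ j < n, s (a + j) = l.getD j false

theorem Src.Reads.congr {s s' : BasisState} {S : Src} {l : List Bool} (h : S.Reads s l)
    (hs : ∀ w, S.Uses w → s' w = s w) : S.Reads s' l := by
  cases S with
  | const => exact h
  | wires a n => exact ⟨h.1, fun j hj => (hs _ ⟨by omega, by omega⟩).trans (h.2 j hj)⟩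

namespace Layout

variable {L : Layout}

/-- Load an input into the register `r`. -/
def load (L : Layout) (r : ℕ) : Src → List Raw
  | .const l => (List.range l.length).flatMap fun j =>
      if l.getD j false = true then [.not (L.reg r + 2 * j)] else [.not (L.reg r + (2 * j + 1))]
  -- Both wires of a cell receive the bit, and the second one is negated. Cells from `n` on stay
  -- empty.
  | .wires a n => (List.range n).map (fun j => .cnot (a + j) (L.reg r + 2 * j)) ++
      ((List.range n).map (fun j => .cnot (a + j) (L.reg r + (2 * j + 1))) ++
        (List.range n).map fun j => .not (L.reg r + (2 * j + 1)))

theorem load_const_eq (L : Layout) (r : ℕ) (l : List Bool) : L.load r (.const l) =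
    (List.range l.length).map fun j => .not (L.reg r + (2 * j + if l.getD j false = true then 0 else 1)) := by
  rw [load]
  induction List.range l.length with
  | nil => rfl
  | cons j t ih =>
    rw [List.flatMap_cons, ih, List.map_cons]
    split_ifs <;> simp

theorem load_tidy {r f : ℕ} {S : Src} (hf : f ≤ L.reg 0) (hS : ∀ w, S.Uses w → w < f) : Tidy (fun w => S.Uses w ∨ f ≤ w) (L.load r S) := by
  have h1 := L.reg_mono (Nat.zero_le r)
  cases S with
  | const l' =>
    rw [load_const_eq]
    refine Tidy.map fun i hi => ⟨trivial, trivial, Or.inr ?_⟩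
    omega
  | wires a n =>
    have hS' : ∀ j < n, a + j < f := fun j hj => hS _ ⟨by omega, by omega⟩
    refine Tidy.append (Tidy.map fun i hi => ⟨trivial, ?_, Or.inl ⟨by omega, by omega⟩, Or.inr ?_⟩)
      (Tidy.append (Tidy.map fun i hi => ⟨trivial, ?_, Or.inl ⟨by omega, by omega⟩, Or.inr ?_⟩)
      (Tidy.map fun i hi => ⟨trivial, trivial, Or.inr ?_⟩))
    all_goals
      have := hS' i hi
      first | omega | (change a + i ≠ _; omega)

theorem load_spec {r f : ℕ} {S : Src} {l : List Bool} {s : BasisState}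
    (hf : f ≤ L.reg 0) (hS : ∀ w, S.Uses w → w < f) (hl : S.Reads s l)
    (hK : 2 * l.length ≤ L.K + 2) (h0 : ∀ j < L.K + 2, s (L.reg r + j) = false) :
    L.Holds (ract (L.load r S) s) r l ∧
      ∀ w, (w < L.reg r ∨ L.reg r + (L.K + 2) ≤ w) → ract (L.load r S) s w = s w := by
  have h1 := L.reg_mono (Nat.zero_le r)
  cases S with
  | const l' =>
    have hl' : l = l' := hl
    subst hl'
    have hb : ∀ j, (if l.getD j false = true then 0 else 1) < 2 := fun j => by split_ifs <;> omega
    obtain ⟨d1, d2⟩ := ract_map_range l.length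
      (fun j => .not (L.reg r + (2 * j + if l.getD j false = true then 0 else 1)))
      (fun j => L.reg r + (2 * j + if l.getD j false = true then 0 else 1)) (fun _ _ => true)
      (fun i _ j _ e => by have := hb i; have := hb j; omega)
      (fun i hi s => by simp [Raw.act]) (fun _ _ _ _ _ => rfl) s
    rw [load_const_eq]
    refine ⟨holds_iff.2 ⟨fun j hj => ?_, fun j hj => ?_⟩, fun w hw => ?_⟩
    · by_cases hjl : j < l.length
      · by_cases hc : l.getD j false = true
        · have := d1 j hjl
          rw [if_pos hc, Nat.add_zero, h0 _ hj] at this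
          rw [this, hc]; rfl
        · rw [d2, h0 _ hj]
          · simpa using hc
          · intro i hi e
            have := hb i
            have hij : i = j := by omega
            subst hij
            rw [if_neg hc] at e
            omega
      · rw [d2, h0 _ hj, List.getD_eq_default _ _ (by omega)]
        intro i hi
        have := hb i
        omega
    · by_cases hjl : j < l.length
      · by_cases hc : l.getD j false = true
        · rw [d2, h0 _ hj, hc]
          · simp
          · intro i hi e
            have := hb i
            have hij : i = j := by omega
            subst hij
            rw [if_pos hc] at e
            omega
        · have := d1 j hjl
          rw [if_neg hc, h0 _ hj] at this
          rw [this]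
          simp only [Bool.not_eq_true] at hc
          simp only [hc, hjl]
          rfl
      · rw [d2, h0 _ hj]
        · simp [hjl]
        · intro i hi
          have := hb i
          omega
    · refine d2 w fun i hi => ?_
      have := hb i
      omega
  | wires a n =>
    have hS' : ∀ j < n, a + j < f := fun j hj => hS _ ⟨by omega, by omega⟩
    obtain ⟨hn, hl⟩ : l.length = n ∧ ∀ j < n, s (a + j) = l.getD j false := hl
    obtain ⟨c1, c2⟩ := ract_map_range n (fun j => .cnot (a + j) (L.reg r + 2 * j))
      (fun j => L.reg r + 2 * j) (fun j s => s (a + j)) (fun i _ j _ e => by omega)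
      (fun i hi s => rfl) (fun i hi s t hst => hst _ fun j hj => by have := hS' i hi; omega) s
    obtain ⟨d1, d2⟩ := ract_map_range n (fun j => .cnot (a + j) (L.reg r + (2 * j + 1)))
      (fun j => L.reg r + (2 * j + 1)) (fun j s => s (a + j)) (fun i _ j _ e => by omega)
      (fun i hi s => rfl) (fun i hi s t hst => hst _ fun j hj => by have := hS' i hi; omega)
      (ract ((List.range n).map (fun j => .cnot (a + j) (L.reg r + 2 * j))) s)
    obtain ⟨e1, e2⟩ := ract_map_range n (fun j => .not (L.reg r + (2 * j + 1)))
      (fun j => L.reg r + (2 * j + 1)) (fun _ _ => true) (fun i _ j _ e => by omega)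
      (fun i hi s => by simp [Raw.act]) (fun _ _ _ _ _ => rfl)
      (ract ((List.range n).map (fun j => .cnot (a + j) (L.reg r + (2 * j + 1))))
        (ract ((List.range n).map (fun j => .cnot (a + j) (L.reg r + 2 * j))) s))
    rw [load, ract_append, ract_append]
    refine ⟨holds_iff.2 ⟨fun j hj => ?_, fun j hj => ?_⟩, fun w hw => ?_⟩
    · rw [e2 _ fun i hi => by omega, d2 _ fun i hi => by omega]
      by_cases hjn : j < n
      · rw [c1 j hjn, h0 _ hj, hl j hjn]; simp
      · rw [c2 _ fun i hi => by omega, h0 _ hj, List.getD_eq_default _ _ (by omega)]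
    · by_cases hjn : j < n
      · rw [e1 j hjn, d1 j hjn, c2 _ fun i hi => by omega, h0 _ hj,
          c2 _ fun i hi => by have := hS' j hjn; omega, hl j hjn]
        simp [hn, hjn]
      · rw [e2 _ fun i hi => by omega, d2 _ fun i hi => by omega, c2 _ fun i hi => by omega, h0 _ hj]
        simp [hn, hjn]
    · rw [e2 _ fun i hi => by omega, d2 _ fun i hi => by omega, c2 _ fun i hi => by omega]

/-- The standard layout: the flag is the wire `f`, followed by `N` registers and the auxiliary
areas. -/
def std (T K N f : ℕ) : Layout := ⟨T, K, f + 1, f + 1 + N * (K + 2)⟩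

theorem std_flag (T K N f : ℕ) : (std T K N f).Flag N f 0 := by
  have h : (std T K N f).reg N = (std T K N f).area 0 := by simp [std, reg, area]
  have h1 : f < (std T K N f).reg 0 := by simp [std, reg]
  have h2 := (std T K N f).reg_mono (Nat.zero_le N)
  exact ⟨h.le, Or.inl h1, by omega⟩

/-- Load three inputs and run a program. -/
def compute (L : Layout) (f : ℕ) (q : Prog) (S : ℕ → Src) : List Raw :=
  L.load 0 (S 0) ++ (L.load 1 (S 1) ++ (L.load 2 (S 2) ++ ([.not f] ++ L.circ q f 0)))

theorem compute_tidy {N f : ℕ} {S : ℕ → Src} {q : Prog}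
    (hq : q.bound ≤ N) (hfl : L.Flag N f 0) (hf : f < L.reg 0)
    (hS : ∀ r < 3, ∀ w, (S r).Uses w → w < f) :
    Tidy (fun w => (∃ r < 3, (S r).Uses w) ∨ f ≤ w) (L.compute f q S) := by
  have hload : ∀ r < 3, Tidy (fun w => (∃ r < 3, (S r).Uses w) ∨ f ≤ w) (L.load r (S r)) :=
    fun r hr => (load_tidy hf.le (hS r hr)).mono fun w hw =>
      hw.elim (fun h => Or.inl ⟨r, hr, h⟩) Or.inr
  refine (hload 0 (by omega)).append ((hload 1 (by omega)).append ((hload 2 (by omega)).append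
    ((Tidy.singleton (P := fun w => (∃ r < 3, (S r).Uses w) ∨ f ≤ w) (g := .not f) trivial trivial
      (Or.inr le_rfl)).append fun g hg => ?_)))
  have hg' := L.circ_good N q hq f 0 hfl g hg
  refine ⟨hg'.cl, hg'.valid, hg'.on.mono ?_⟩
  have h2 := hfl.le
  have h3 := L.reg_mono (Nat.zero_le N)
  rintro w (rfl | hw | hw)
  · exact Or.inr le_rfl
  · exact Or.inr (by omega)
  · exact Or.inr (by omega)

/-- After loading, the NOT gate raises the flag of the whole program and `Layout.circ_exec` applies.
The wires below `f`, among them the inputs, are unchanged, and the areas after those used are still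
zero for circuits that follow. -/
theorem compute_spec {N f n : ℕ} {S : ℕ → Src} {l : ℕ → List Bool} {s : BasisState} {q : Prog}
    {σ τ : ℕ → List Bool}
    (hN : 3 ≤ N) (hq : q.bound ≤ N) (hfl : L.Flag N f 0) (hf : f < L.reg 0)
    (hS : ∀ r < 3, ∀ w, (S r).Uses w → w < f) (hl : ∀ r < 3, (S r).Reads s (l r))
    (hσ : ∀ r < 3, σ r = l r) (hσ' : ∀ r, 3 ≤ r → σ r = [])
    (hx : q.Exec σ n τ) (hT : n ≤ L.T) (hK : ∀ r < 3, 2 * ((l r).length + n) ≤ L.K)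
    (h0 : ∀ w, f ≤ w → s w = false) :
    (∀ r < N, L.Holds (ract (L.compute f q S) s) r (τ r)) ∧
      ract (L.compute f q S) s f = true ∧
      (∀ w < f, ract (L.compute f q S) s w = s w) ∧
      ∀ w, L.area (Layout.size L.T q) ≤ w → ract (L.compute f q S) s w = false := by
  have hreg : ∀ r, L.reg (r + 1) = L.reg r + (L.K + 2) := L.reg_succ
  have h01 := hreg 0
  have h12 := hreg 1
  have h23 := hreg 2
  simp only [Nat.zero_add, Nat.reduceAdd] at h01 h12 h23
  have h3N := L.reg_mono hN
  have hK' : ∀ r < 3, 2 * (l r).length ≤ L.K + 2 := fun r hr => by have := hK r hr; omega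
  obtain ⟨a1, a2⟩ := load_spec (r := 0) hf.le (hS 0 (by omega)) (hl 0 (by omega)) (hK' 0 (by omega))
    fun j hj => h0 _ (by omega)
  obtain ⟨s1, hs1⟩ : ∃ s1, s1 = ract (L.load 0 (S 0)) s := ⟨_, rfl⟩
  rw [← hs1] at a1 a2
  obtain ⟨b1, b2⟩ := load_spec (s := s1) (r := 1) hf.le (hS 1 (by omega)) ((hl 1 (by omega)).congr fun w hw =>
    a2 w (by have := hS 1 (by omega) w hw; omega)) (hK' 1 (by omega)) fun j hj => by
      rw [a2 _ (by omega), h0 _ (by omega)]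
  obtain ⟨s2, hs2⟩ : ∃ s2, s2 = ract (L.load 1 (S 1)) s1 := ⟨_, rfl⟩
  rw [← hs2] at b1 b2
  obtain ⟨c1, c2⟩ := load_spec (s := s2) (r := 2) hf.le (hS 2 (by omega)) ((hl 2 (by omega)).congr fun w hw => by
    have := hS 2 (by omega) w hw
    rw [b2 w (by omega), a2 w (by omega)]) (hK' 2 (by omega)) fun j hj => by
      rw [b2 _ (by omega), a2 _ (by omega), h0 _ (by omega)]
  obtain ⟨s3, hs3⟩ : ∃ s3, s3 = ract (L.load 2 (S 2)) s2 := ⟨_, rfl⟩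
  rw [← hs3] at c1 c2
  obtain ⟨s4, hs4⟩ : ∃ s4, s4 = Function.update s3 f (!(s3 f)) := ⟨_, rfl⟩
  have hcomp : ract (L.compute f q S) s = ract (L.circ q f 0) s4 := by
    rw [compute, ract_append, ← hs1, ract_append, ← hs2, ract_append, ← hs3, ract_append, hs4]
    rfl
  have hout : ∀ w, (w < L.reg 0 ∨ L.reg 3 ≤ w) → s3 w = s w := fun w hw => by
    rw [c2 w (by omega), b2 w (by omega), a2 w (by omega)]
  have h4f : s4 f = true := by
    rw [hs4, Function.update_self, hout f (by omega), h0 f le_rfl]; rfl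
  have h4 : ∀ w, w ≠ f → s4 w = s3 w := fun w hw => by rw [hs4, Function.update_of_ne hw]
  have hleN := hfl.le
  have h4area : ∀ w, L.area 0 ≤ w → s4 w = false := fun w hw => by
    rw [h4 w (by omega), hout w (by omega), h0 w (by omega)]
  have hholds : ∀ r < N, L.Holds s4 r (σ r) := by
    intro r hr
    have hr0 := L.reg_mono (Nat.zero_le r)
    rcases (by omega : r = 0 ∨ r = 1 ∨ r = 2 ∨ 3 ≤ r) with rfl | rfl | rfl | hr3
    · rw [hσ 0 (by omega)]
      intro j hj
      rw [h4 _ (by omega), c2 _ (by omega), b2 _ (by omega)]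
      exact a1 j hj
    · rw [hσ 1 (by omega)]
      intro j hj
      rw [h4 _ (by omega), c2 _ (by omega)]
      exact b1 j hj
    · rw [hσ 2 (by omega)]
      intro j hj
      rw [h4 _ (by omega)]
      exact c1 j hj
    · rw [hσ' r hr3]
      intro j hj
      have := L.reg_mono hr3
      rw [h4 _ (by omega), hout _ (by omega), h0 _ (by omega)]
      simp
  have hgood := L.circ_good N q hq f 0 hfl
  rw [hcomp]
  refine ⟨L.circ_exec N q hq σ τ n hx f 0 hfl s4 h4f h4area hholds hT fun r hr => ?_, ?_, ?_, ?_⟩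
  · by_cases hr3 : r < 3
    · rw [hσ r hr3]; exact hK r hr3
    · rw [hσ' r (by omega)]
      have := hK 0 (by omega)
      simp only [List.length_nil]
      omega
  · rw [ract_of_good hgood _ hfl.not_wire, h4f]
  · intro w hw
    rw [ract_of_good hgood _, h4 w (by omega), hout w (by omega)]
    have := L.area_mono (Nat.zero_le (0 + Layout.size L.T q))
    have := L.reg_mono (Nat.zero_le N)
    rintro (h | h) <;> omega
  · intro w hw
    have := L.area_mono (Nat.zero_le (Layout.size L.T q))
    rw [ract_of_good hgood _, h4area w (by omega)]
    rw [Nat.zero_add]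
    rintro (h | h) <;> omega

/-- Add the contents of the register `r` to `n` wires from `o` on. -/
def store (L : Layout) (r o n : ℕ) : List Raw :=
  (List.range n).map fun j => .cnot (L.reg r + 2 * j) (o + j)

theorem store_spec {r o n : ℕ} {l : List Bool} {s : BasisState} (ho : o + n ≤ L.reg 0)
    (hs : L.Holds s r l) (hl : l.length = n) (hK : 2 * n ≤ L.K + 2) :
    ract (L.store r o n) s = s ∆ blk o l := by
  have h1 := L.reg_mono (Nat.zero_le r)
  obtain ⟨c1, c2⟩ := ract_map_range n (fun j => .cnot (L.reg r + 2 * j) (o + j))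
    (fun j => o + j) (fun j s => s (L.reg r + 2 * j)) (fun i _ j _ e => by omega)
    (fun i hi s => rfl) (fun i hi s t hst => hst _ fun j hj => by omega) s
  funext w
  rw [symmDiff_apply_bool, store]
  by_cases hw : o ≤ w ∧ w < o + n
  · obtain ⟨j, rfl⟩ := Nat.exists_eq_add_of_le hw.1
    rw [c1 j (by omega), blk_add, (holds_iff.1 hs).1 j (by omega)]
  · rw [c2 w fun i hi => by omega]
    have : blk o l w = false := by
      rcases (by omega : w < o ∨ o + l.length ≤ w) with h | h
      · exact blk_of_lt h
      · exact blk_of_le h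
    rw [this, Bool.xor_false]

theorem store_tidy {r o n : ℕ} (ho : o + n ≤ L.reg 0) :
    Tidy (fun w => (o ≤ w ∧ w < o + n) ∨ L.reg 0 ≤ w) (L.store r o n) := by
  have h1 := L.reg_mono (Nat.zero_le r)
  refine Tidy.map fun i hi => ⟨trivial, ?_, Or.inr ?_, Or.inl ⟨?_, ?_⟩⟩
  · change _ ≠ _
    omega
  all_goals omega

end Layout

/-- Computation, use of the result and undoing of the computation. -/
theorem ract_conj {P : ℕ → Prop} {C D : List Raw} {s d : BasisState} (hC : Tidy P C)
    (hD : ract D (ract C s) = ract C s ∆ d) (hd : ∀ w, P w → d w = false) :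
    ract (C ++ (D ++ rinv C)) s = s ∆ d := by
  rw [ract_append, ract_append, hD,
    ract_symmDiff hC.rinv.cl (fun g hg => (hC.rinv.on g hg).mono hd), hC.ract_rinv]

section

variable {α : Type u} {X : Ctx α} {L : α → Layout}

theorem PL.load_const (hL : PL X L) (r : ℕ) {l : α → List Bool} (hl : PS X l) :
    PC X fun a => (L a).load r (.const (l a)) := by
  have hr := (hL.reg (PN.const X r)).weaken
  refine (PS.bits hl (PC.not (hr.add ((PN.const _ 2).mul (PN.last X))))
    (PC.not (hr.add (((PN.const _ 2).mul (PN.last X)).add (PN.const _ 1))))).congr fun a => ?_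
  simp only [Layout.load]
  rw [rcode_flatMap]
  refine List.flatMap_congr fun j _ => ?_
  split_ifs <;> rfl

theorem PL.load_wires (hL : PL X L) (r : ℕ) {b n : α → ℕ} (hb : PN X b) (hn : PN X n) :
    PC X fun a => (L a).load r (.wires (b a) (n a)) := by
  have hr := (hL.reg (PN.const X r)).weaken
  have h2 := (PN.const X.nat 2).mul (PN.last X)
  have hb' := hb.weaken.add (PN.last X)
  exact (PC.map hn (PC.cnot hb' (hr.add h2))).append ((PC.map hn (PC.cnot hb' (hr.add
    (h2.add (PN.const _ 1))))).append (PC.map hn (PC.not (hr.add (h2.add (PN.const _ 1))))))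

theorem PL.compute (hL : PL X L) {f : α → ℕ} (hf : PN X f) (q : Prog) {S : α → ℕ → Src}
    (hS : ∀ r < 3, PC X fun a => (L a).load r (S a r)) :
    PC X fun a => (L a).compute (f a) q (S a) :=
  (hS 0 (by omega)).append ((hS 1 (by omega)).append ((hS 2 (by omega)).append
    ((PC.not hf).append (hL.circ q hf (PN.const X 0)))))

theorem PL.store (hL : PL X L) (r : ℕ) {o n : α → ℕ} (ho : PN X o) (hn : PN X n) :
    PC X fun a => (L a).store r (o a) (n a) :=
  PC.map hn (PC.cnot ((hL.reg (PN.const X r)).weaken.add ((PN.const _ 2).mul (PN.last X)))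
    (ho.weaken.add (PN.last X)))

theorem PL.std {T K f : α → ℕ} (hT : PN X T) (hK : PN X K) (N : ℕ) (hf : PN X f) :
    PL X fun a => Layout.std (T a) (K a) N (f a) :=
  ⟨hT, hK, hf.add (PN.const X 1), (hf.add (PN.const X 1)).add
    ((PN.const X N).mul (hK.add (PN.const X 2)))⟩

end

end Reversible

/-! ## A circuit that carries out the circuit written by a program -/

section CircuitInterpreter

theorem Prog.bound_shift (p : Prog) (K : ℕ) : (p.shift K).bound ≤ K + p.bound := by
  induction p with
  | skip => exact Nat.zero_le _
  | push r b => exact le_rfl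
  | pop r => exact le_rfl
  | seq p q ihp ihq => simp only [Prog.shift, Prog.bound]; omega
  | branch r p q ihp ihq => simp only [Prog.shift, Prog.bound]; omega
  | loop r p ih => simp only [Prog.shift, Prog.bound]; omega

theorem Prog.bound_nextGate : Prog.nextGate.bound = 12 := by decide

theorem wireCode_getD (a j : ℕ) : (wireCode a).getD j false = decide (j < a) := by
  by_cases h : j < a
  · rw [wireCode, List.getD_append _ _ _ _ (by simpa using h)]
    simp [h]
  · rw [wireCode, List.getD_append_right _ _ _ _ (by simpa using h)]
    obtain ⟨i, rfl⟩ := Nat.exists_eq_add_of_le (Nat.not_lt.1 h)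
    rcases i with _ | i <;> simp

/-- The circuit neither reads nor writes data wires, so it acts on the background alone. -/
theorem Panel.ract_embed {D : Panel} {P : ℕ → Prop} {C : List Raw} (hC : Tidy P C)
    (hP : ∀ w, P w → ¬ D.Data w) (ρ s : BasisState) :
    ract C (D.embed ρ s) = D.embed (ract C ρ) s := by
  funext w
  by_cases hw : P w
  · rw [Panel.embed_of_not_data (hP w hw)]
    exact ract_congr hC.on (fun w hw => Panel.embed_of_not_data (hP w hw)) w hw
  · rw [ract_of_not_on hC.on _ hw]
    simp only [Panel.embed]
    split_ifs
    · rfl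
    · rw [ract_of_not_on hC.on _ hw]

theorem Panel.rapply_embed {D : Panel} {P : ℕ → Prop} {C : List Raw} (hC : Tidy P C)
    (hP : ∀ w, P w → ¬ D.Data w) (ρ : BasisState) (v : QState) :
    rapply C (Finsupp.mapDomain (D.embed ρ) v) = Finsupp.mapDomain (D.embed (ract C ρ)) v := by
  rw [← LinearMap.id_apply (R := ℂ) (Finsupp.mapDomain (D.embed (ract C ρ)) v),
    Finsupp.mapDomain, Finsupp.mapDomain, Finsupp.sum, Finsupp.sum, map_sum, map_sum]
  refine Finset.sum_congr rfl fun s _ => ?_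
  rw [rapply_classical hC.cl, Panel.ract_embed hC hP]
  rfl

namespace Layout

variable {L : Layout}

/-- The panel that shows the gate in the registers `m + 4, …, m + 11`. -/
def panel (L : Layout) (m db M qb : ℕ) : Panel :=
  ⟨db, M, qb, L.reg (m + 4), L.reg (m + 5), L.reg (m + 6), fun j => L.reg (m + 7 + j)⟩

theorem panel_ok {m db M qb : ℕ} (h1 : db + M ≤ qb) (h2 : qb + 7 ≤ L.reg 0) (h3 : 2 * M ≤ L.K) :
    (L.panel m db M qb).Ok := by
  have hm : ∀ r, L.reg 0 ≤ L.reg r := fun r => L.reg_mono (Nat.zero_le r)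
  have m4 := hm (m + 4)
  have m5 := hm (m + 5)
  have m6 := hm (m + 6)
  have s6 := L.reg_succ (m + 6)
  have y3 := L.reg_mono (show m + 6 + 1 ≤ m + 7 + 3 by omega)
  refine ⟨fun w hw hw' => ?_, fun j => ⟨fun h => ?_, fun h => ?_⟩,
    fun i hi => ⟨⟨fun h => ?_, fun h => ?_⟩, ⟨fun h => ?_, fun h => ?_⟩, fun h => ?_, fun h => ?_⟩,
    fun i hi e => ?_⟩
  · have := hw.2; have := hw'.1; simp only [panel] at *; omega
  · have := h.2; have := hm (m + 7 + j); simp only [panel] at *; omega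
  · have := h.2; have := hm (m + 7 + j); simp only [panel] at *; omega
  · have := h.2; simp only [panel] at *; omega
  · have := h.2; simp only [panel] at *; omega
  · have := h.2; simp only [panel] at *; omega
  · have := h.2; simp only [panel] at *; omega
  · have := h.2; simp only [panel] at *; omega
  · have := h.2; simp only [panel] at *; omega
  · change L.reg (m + 7 + 3) = L.reg (m + 6) + 2 * i + 1 at e
    simp only [panel] at hi
    omega

/-- The circuit `C` is in the register `m`, and `l` in the registers `m + 4, …, m + 11`. -/
structure Reading (L : Layout) (N B m f c : ℕ) (ρ : BasisState) (C : List Raw)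
    (l : List (List Bool)) : Prop where
  flag : ρ f = true
  zero : ∀ w, L.area c ≤ w → ρ w = false
  holds : ∃ σ : ℕ → List Bool, (∀ r < 12, σ (m + r) = regs ([rcode C, [], [], []] ++ l) r) ∧
    ∀ r < N, (σ r).length ≤ B ∧ L.Holds ρ r (σ r)

theorem Reading.length_le {N B m f c : ℕ} {ρ : BasisState} {C : List Raw} {l : List (List Bool)}
    (h : L.Reading N B m f c ρ C l) (hN : m + 12 ≤ N) (hl : l.length = 8) :
    (rcode C).length ≤ B ∧ ∀ w ∈ l, w.length ≤ B := by
  obtain ⟨σ, h1, h2⟩ := h.holds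
  have key : ∀ r < 12, (regs ([rcode C, [], [], []] ++ l) r).length ≤ B := fun r hr => by
    rw [← h1 r hr]; exact (h2 _ (by omega)).1
  refine ⟨key 0 (by omega), fun w hw => ?_⟩
  obtain ⟨i, hi, rfl⟩ := List.getElem_of_mem hw
  have := key (4 + i) (by omega)
  rwa [regs, List.getD_append_right _ _ _ _ (by simp), List.length_cons, List.length_cons,
    List.length_cons, List.length_cons, List.length_nil, Nat.add_sub_cancel_left,
    List.getD_eq_getElem _ _ hi] at this

/-- One run of `Prog.nextGate`, moved to the registers from `m` on and compiled with areas from `c`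
on; the next reading uses the areas after these. -/
theorem Reading.step {N B m f c : ℕ} {ρ : BasisState} {C C' : List Raw} {l l' : List (List Bool)}
    (h : L.Reading N B m f c ρ C l) (hN : m + 12 ≤ N) (hfl : L.Flag N f 0)
    (hl' : l'.length = 8) (hB : (rcode C').length ≤ B) (hB' : ∀ w ∈ l', w.length ≤ B)
    (hT : 28 * B + 40 ≤ L.T) (hK : 2 * (B + (28 * B + 40)) ≤ L.K)
    (hx : Run .nextGate (regs ([rcode C, [], [], []] ++ l)) (28 * B + 40)
      (regs ([rcode C', [], [], []] ++ l'))) :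
    L.Reading N B m f (c + Layout.size L.T (Prog.nextGate.shift m))
      (ract (L.circ (Prog.nextGate.shift m) f c) ρ) C' l' := by
  obtain ⟨n, hn, hx⟩ := hx
  obtain ⟨σ, h1, h2⟩ := h.holds
  obtain ⟨τ, t1, t2, t3⟩ := hx.shift m 12 Prog.bound_nextGate.le σ h1
  have hb : (Prog.nextGate.shift m).bound ≤ N :=
    ((Prog.nextGate.bound_shift m).trans_eq (by rw [Prog.bound_nextGate])).trans hN
  have hfl' := hfl.mono (Nat.zero_le c)
  have hgood := L.circ_good N _ hb f c hfl'
  refine ⟨?_, fun w hw => ?_, τ, t2, fun r hr => ⟨?_, ?_⟩⟩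
  · rw [ract_of_good hgood _ hfl'.not_wire, h.flag]
  · have h4 := L.area_mono (Nat.le_add_right c (Layout.size L.T (Prog.nextGate.shift m)))
    have h5 := L.area_mono (Nat.zero_le c)
    have h6 := hfl.le
    rw [ract_of_good hgood _, h.zero w (by omega)]
    rintro (h | h) <;> omega
  · by_cases hr' : r < m ∨ m + 12 ≤ r
    · rw [t3 r hr']; exact (h2 r hr).1
    · obtain ⟨i, rfl⟩ := Nat.exists_eq_add_of_le (show m ≤ r by omega)
      rw [t2 i (by omega)]
      by_cases hi : i < 4
      · interval_cases i
        · exact hB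
        all_goals exact Nat.zero_le _
      · obtain ⟨j, rfl⟩ := Nat.exists_eq_add_of_le (show 4 ≤ i by omega)
        rw [regs, List.getD_append_right _ _ _ _ (by simp), List.length_cons, List.length_cons,
          List.length_cons, List.length_cons, List.length_nil, Nat.add_sub_cancel_left,
          List.getD_eq_getElem _ _ (by omega)]
        exact hB' _ (List.getElem_mem _)
  · refine L.circ_exec N _ hb σ τ n t1 f c hfl' ρ h.flag h.zero (fun r hr => (h2 r hr).2)
      (by omega) (fun r hr => ?_) r hr
    have := (h2 r hr).1
    omega

theorem Reading.holds_ctrl {N B m f c i : ℕ} {ρ : BasisState} {C : List Raw} {l : List (List Bool)}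
    (h : L.Reading N B m f c ρ C l) (hN : m + 12 ≤ N) (hi : i < 8) :
    L.Holds ρ (m + (4 + i)) (l.getD i []) := by
  obtain ⟨σ, h1, h2⟩ := h.holds
  have := (h2 (m + (4 + i)) (by omega)).2
  rwa [h1 (4 + i) (by omega), regs, List.getD_append_right _ _ _ _ (by simp), List.length_cons,
    List.length_cons, List.length_cons, List.length_cons, List.length_nil,
    Nat.add_sub_cancel_left] at this

/-- The string `wireCode a` consists of `a` ones and a final zero, and the second wire of a cell is
set exactly if the cell holds a zero, here for `w = a` only. The stack holding the number of a wire
is therefore at the same time a mark at that wire. -/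
theorem Holds.mark {s : BasisState} {r M : ℕ} (hM : 2 * M ≤ L.K) (o : Option ℕ)
    (h : L.Holds s r (o.elim [] wireCode)) :
    ∀ w < M, s (L.reg r + 2 * w + 1) = decide (o = some w) := by
  intro w hw
  rw [Nat.add_assoc, (holds_iff.1 h).2 w (by omega)]
  cases o with
  | none => simp
  | some a =>
    have hlen : (wireCode a).length = a + 1 := by simp [wireCode]
    change (decide (w < (wireCode a).length) && !(wireCode a).getD w false) = decide (some a = some w)
    rw [wireCode_getD, Bool.eq_iff_iff]
    simp only [hlen, Bool.and_eq_true, decide_eq_true_eq, Bool.not_eq_true', decide_eq_false_iff_not,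
      Option.some.injEq]
    omega

theorem Holds.kind {s : BasisState} {r : ℕ} (b : Bool) (h : L.Holds s r (if b = true then [true] else [])) :
    s (L.reg r) = b := by
  have := (holds_iff.1 h).1 0 (by omega)
  rw [Nat.mul_zero, Nat.add_zero] at this
  rw [this]
  cases b <;> rfl

theorem Reading.shows {N B m f c db M qb : ℕ} {ρ : BasisState} {C : List Raw}
    {l : List (List Bool)} (h : L.Reading N B m f c ρ C l) (hN : m + 12 ≤ N) (hM : 2 * M ≤ L.K)
    (haux : ∀ w, qb ≤ w ∧ w < qb + 7 → ρ w = false)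
    (k : Option ℕ × Option ℕ × Option ℕ × Option (Fin 5))
    (ha : l.getD 0 [] = k.1.elim [] wireCode) (hb : l.getD 1 [] = k.2.1.elim [] wireCode)
    (hi : l.getD 2 [] = k.2.2.1.elim [] wireCode)
    (hy : ∀ j : Fin 5, l.getD (3 + j) [] = if decide (k.2.2.2 = some j) = true then [true] else []) :
    (L.panel m db M qb).Shows ρ k := by
  refine ⟨?_, ?_, ?_, fun j => ?_, haux⟩
  · exact Holds.mark hM _ (ha ▸ h.holds_ctrl hN (i := 0) (by omega))
  · exact Holds.mark hM _ (hb ▸ h.holds_ctrl hN (i := 1) (by omega))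
  · exact Holds.mark hM _ (hi ▸ h.holds_ctrl hN (i := 2) (by omega))
  · have := Holds.kind _ (hy j ▸ h.holds_ctrl hN (i := 3 + j) (by omega))
    rw [← this]
    change ρ (L.reg (m + 7 + j)) = _
    congr 2
    omega

theorem Reading.shows_ctrl {N B m f c db M qb : ℕ} {ρ : BasisState} {C : List Raw} {g : Raw}
    (h : L.Reading N B m f c ρ C g.ctrl) (hN : m + 12 ≤ N) (hM : 2 * M ≤ L.K)
    (haux : ∀ w, qb ≤ w ∧ w < qb + 7 → ρ w = false) :
    (L.panel m db M qb).Shows ρ g.marks := by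
  cases g <;> refine h.shows hN hM haux _ rfl rfl rfl fun j => ?_ <;> fin_cases j <;> rfl

theorem Reading.shows_nil {N B m f c db M qb : ℕ} {ρ : BasisState} {C : List Raw}
    (h : L.Reading N B m f c ρ C (List.replicate 8 [])) (hN : m + 12 ≤ N) (hM : 2 * M ≤ L.K)
    (haux : ∀ w, qb ≤ w ∧ w < qb + 7 → ρ w = false) :
    (L.panel m db M qb).Shows ρ (none, none, none, none) := by
  refine h.shows hN hM haux _ rfl rfl rfl fun j => ?_
  fin_cases j <;> rfl

/-- The repeated reading of a gate. -/
def reads (L : Layout) (m f k c : ℕ) : List Raw :=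
  iterCirc (fun c => L.circ (Prog.nextGate.shift m) f c)
    (Layout.size L.T (Prog.nextGate.shift m)) k c

/-- The repeated reading and application of a gate. -/
def steps (L : Layout) (m f db M qb k c : ℕ) : List Raw :=
  iterCirc (fun c => L.circ (Prog.nextGate.shift m) f c ++ (L.panel m db M qb).step)
    (Layout.size L.T (Prog.nextGate.shift m)) k c

theorem bound_shift_nextGate {m N : ℕ} (hN : m + 12 ≤ N) : (Prog.nextGate.shift m).bound ≤ N :=
  ((Prog.nextGate.bound_shift m).trans_eq (by rw [Prog.bound_nextGate])).trans hN

theorem circ_tidy {N f c lo : ℕ} {p : Prog} (hp : p.bound ≤ N) (hfl : L.Flag N f c)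
    (hlo : lo ≤ f) (hf : f < L.reg 0) : Tidy (fun w => lo ≤ w) (L.circ p f c) := by
  intro g hg
  have h := L.circ_good N p hp f c hfl g hg
  refine ⟨h.cl, h.valid, h.on.mono ?_⟩
  have h1 := hfl.le
  have h2 := L.reg_mono (Nat.zero_le N)
  have h3 := L.area_mono (Nat.zero_le c)
  rintro w (rfl | hw | hw)
  · exact hlo
  · omega
  · omega

theorem reads_tidy {N m f k c lo : ℕ} (hN : m + 12 ≤ N) (hfl : L.Flag N f 0)
    (hlo : lo ≤ f) (hf : f < L.reg 0) : Tidy (fun w => lo ≤ w) (L.reads m f k c) :=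
  Tidy.flatMap fun _ _ => circ_tidy (bound_shift_nextGate hN) (hfl.mono (Nat.zero_le _)) hlo hf

/-- Each round brings the next gate on display and applies it to the data. Once the description is
used up nothing is marked and the rounds idle, so a fixed number `k` of rounds serves all circuits
with at most `k` gates. The background evolves as under `reads`, independently of the data, and can
later be restored. -/
theorem steps_spec {N B m f db M qb : ℕ} (hN : m + 12 ≤ N) (hfl : L.Flag N f 0) (hf : f < L.reg 0)
    (hdb : db + M ≤ qb) (hqb : qb + 7 ≤ f) (hM : 2 * M ≤ L.K)
    (hT : 28 * B + 40 ≤ L.T) (hK : 2 * (B + (28 * B + 40)) ≤ L.K)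
    (k c : ℕ) (ρ : BasisState) (C : List Raw) (l : List (List Bool)) (hl : l.length = 8)
    (hC : ∀ g ∈ C, g.Valid ∧ g.On fun w => w < M) (hk : C.length ≤ k)
    (h : L.Reading N B m f c ρ C l) (haux : ∀ w, qb ≤ w ∧ w < qb + 7 → ρ w = false) (v : QState) :
    rapply (L.steps m f db M qb k c) (Finsupp.mapDomain ((L.panel m db M qb).embed ρ) v) =
      Finsupp.mapDomain ((L.panel m db M qb).embed (ract (L.reads m f k c) ρ)) (rapply C v) := by
  have hok : (L.panel m db M qb).Ok := panel_ok hdb (by omega) hM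
  have hp := bound_shift_nextGate hN
  have hdata : ∀ w, f ≤ w → ¬ (L.panel m db M qb).Data w := fun w hw hd => by
    have := hd.2
    simp only [panel] at this
    omega
  induction k generalizing c ρ C l v with
  | zero =>
    have : C = [] := List.eq_nil_of_length_eq_zero (by omega)
    subst this
    rfl
  | succ k ih =>
    have hcirc := circ_tidy (c := c) hp (hfl.mono (Nat.zero_le c)) le_rfl hf
    have haux' : ∀ w, qb ≤ w ∧ w < qb + 7 →
        ract (L.circ (Prog.nextGate.shift m) f c) ρ w = false := fun w hw => by
      rw [ract_of_not_on hcirc.on _ (by omega), haux w hw]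
    obtain ⟨hB, hBl⟩ := h.length_le hN hl
    rw [steps, iterCirc_succ, rapply_append, rapply_append, Panel.rapply_embed hcirc hdata,
      reads, iterCirc_succ, ract_append]
    cases C with
    | nil =>
      have h' := h.step (C' := []) (l' := List.replicate 8 []) hN hfl (by simp) hB (by simp) hT hK
        (run_nextGate_nil l hl B hBl)
      rw [hok.step_idle (h'.shows_nil hN hM haux')]
      exact ih _ _ [] _ (by simp) (by simp) (by simp) h' haux' v
    | cons g C =>
      have hgc : (g.code ++ rcode C).length ≤ B := hB
      rw [List.length_append] at hgc
      have h' := h.step (C' := C) (l' := g.ctrl) hN hfl g.length_ctrl (by omega)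
        (fun w hw => (g.ctrl_length_le w hw).trans (by omega)) hT hK
        (run_nextGate_cons g (rcode C) l hl B hBl hB)
      have hg := hC g List.mem_cons_self
      rw [hok.step_apply hg.1 hg.2 (h'.shows_ctrl hN hM haux')]
      exact ih _ _ C _ g.length_ctrl (fun g hg => hC g (List.mem_cons_of_mem _ hg))
        (by simpa using hk) h' haux' (g.apply v)

end Layout

end CircuitInterpreter

/-! ## Oracles -/

section Oracles

open scoped symmDiff

theorem Prog.shift_zero (p : Prog) : p.shift 0 = p := by
  induction p <;> simp_all [Prog.shift]

/-- The registers above the bound of a program keep their contents. -/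
theorem Prog.Computes.exists_exec {p : Prog} {t : ℕ} {inp out : List (List Bool)}
    (h : p.Computes t inp out) (m : ℕ) (hp : p.bound ≤ m) (hout : out.length ≤ m) :
    ∃ (n : ℕ) (τ : ℕ → List Bool), n ≤ t ∧ p.Exec (fun r => inp.getD r []) n τ ∧
      (∀ r < out.length, τ r = out.getD r []) ∧ ∀ r, m ≤ r → τ r = inp.getD r [] := by
  obtain ⟨n, τ, hn, hx, hτ⟩ := h
  obtain ⟨τ', h1, h2, h3⟩ := hx.shift 0 m hp _ fun r _ => by rw [Nat.zero_add]
  rw [Prog.shift_zero] at h1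
  refine ⟨n, τ', hn, h1, fun r hr => ?_, fun r hr => h3 r (Or.inr (by omega))⟩
  rw [← hτ r hr, ← h2 r (by omega), Nat.zero_add]

/-- Run `p` and move its result to the register `m + 1`. -/
def Prog.emit (p : Prog) (m : ℕ) : Prog := .seq p (.seq (.move 0 m) (.move m (m + 1)))

theorem Prog.bound_emit {p : Prog} {m : ℕ} (hp : p.bound ≤ m) : (p.emit m).bound = m + 2 := by
  simp only [Prog.emit, Prog.move, Prog.bound]
  omega

/-- The parser wants the description in a register followed by empty ones. The registers from `m` on
are not used by `p` and still empty after its run; two moves preserve the order of the bits. -/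
theorem Prog.Computes.emit {p : Prog} {t : ℕ} {inp : List (List Bool)} {o : List Bool}
    (h : p.Computes t inp [o]) (m : ℕ) (hp : p.bound ≤ m) (hm : inp.length ≤ m) (hm' : 1 ≤ m) :
    ∃ (n : ℕ) (τ : ℕ → List Bool), n ≤ t + (8 * o.length + 2) ∧
      (p.emit m).Exec (fun r => inp.getD r []) n τ ∧ τ (m + 1) = o ∧ ∀ r, m + 1 < r → τ r = [] := by
  obtain ⟨n, τ, hn, hx, h1, h2⟩ := h.exists_exec m hp hm'
  have h0 : τ 0 = o := h1 0 (by simp)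
  have hz : ∀ r, m ≤ r → τ r = [] := fun r hr => by
    rw [h2 r hr, List.getD_eq_default _ _ (by omega)]
  obtain ⟨n2, hn2, hx2⟩ := run_move (show 0 ≠ m by omega) o τ h0
  obtain ⟨n3, hn3, hx3⟩ := run_move (show m ≠ m + 1 by omega) o.reverse
    (Function.update (Function.update τ m (o.reverse ++ τ m)) 0 []) (by
      rw [Function.update_of_ne (by omega), Function.update_self, hz m le_rfl, List.append_nil])
  refine ⟨_, _, ?_, .seq hx (.seq hx2 hx3), ?_, fun r hr => ?_⟩
  · rw [List.length_reverse] at hn3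
    omega
  · rw [Function.update_of_ne (by omega), Function.update_self, Function.update_of_ne (by omega),
      Function.update_of_ne (by omega), hz _ (by omega)]
    simp
  · rw [Function.update_of_ne (by omega), Function.update_of_ne (by omega),
      Function.update_of_ne (by omega), Function.update_of_ne (by omega), hz r (by omega)]

/-- Wires are described in unary, so the number of a wire is smaller than the length of the
description. -/
theorem Raw.on_code (g : Raw) : g.On fun w => w < g.code.length := by
  cases g <;> simp [Raw.On, Raw.code, wireCode] <;> omega

theorem rcode_length_of_mem {C : List Raw} {g : Raw} (hg : g ∈ C) :
    g.code.length ≤ (rcode C).length := by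
  induction C with
  | nil => exact absurd hg List.not_mem_nil
  | cons g' C ih =>
    rw [rcode, List.flatMap_cons, List.length_append]
    rcases List.mem_cons.1 hg with rfl | hg
    · omega
    · exact (ih hg).trans (Nat.le_add_left _ _)

theorem on_rcode {C : List Raw} {M : ℕ} (hM : (rcode C).length ≤ M) :
    ∀ g ∈ C, g.On fun w => w < M := fun g hg =>
  g.on_code.mono fun _ hw => hw.trans_le ((rcode_length_of_mem hg).trans hM)

theorem length_le_rcode (C : List Raw) : C.length ≤ (rcode C).length := by
  induction C with
  | nil => exact le_rfl
  | cons g C ih =>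
    rw [rcode, List.flatMap_cons, List.length_append, List.length_cons]
    have := g.length_code_pos
    have : (rcode C).length = (C.flatMap Raw.code).length := rfl
    omega

/-- The three inputs of a computation. -/
def Src.three (S₀ S₁ S₂ : Src) : ℕ → Src := fun r => [S₀, S₁, S₂].getD r (.const [])

/-- Add the results of `p` to the wires: the result `r` has `n` bits and is added to the wires
from `o r` on. The work wires are `f, f + 1, …`. -/
def oracle (p : Prog) (S : ℕ → Src) (W f : ℕ) (n : ℕ) (o : List ℕ) : List Raw :=
  let L := Layout.std W (4 * W) (max p.bound 3) f
  let K := L.compute f p S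
  K ++ ((List.range o.length).flatMap (fun r => L.store r (o.getD r 0) n) ++ rinv K)

/-- The sum of the strings in `l` on the wires given by `o`. -/
def blks (l : List (List Bool)) (o : List ℕ) (k : ℕ) : BasisState :=
  (List.range k).foldl (fun s r => s ∆ blk (o.getD r 0) (l.getD r [])) ⊥

theorem Layout.std_reg_zero (T K N f : ℕ) : (Layout.std T K N f).reg 0 = f + 1 := by
  simp [Layout.std, Layout.reg]

/-- The program is run on work wires, its results are added to the target wires, and the run is
undone. The targets are disjoint from the inputs and from the work wires, so the undoing does not
notice that they have changed. -/
theorem oracle_spec {p : Prog} {t W f n : ℕ} {l : ℕ → List Bool} {out : List (List Bool)}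
    {S : ℕ → Src} {o : List ℕ} {s : BasisState} (h : p.Computes t [l 0, l 1, l 2] out)
    (ho : o.length = out.length) (ho3 : out.length ≤ 3) (hout : ∀ r < out.length, (out.getD r []).length = n)
    (hof : ∀ r < out.length, o.getD r 0 + n ≤ f)
    (hS : ∀ r < 3, ∀ w, (S r).Uses w → w < f) (hl : ∀ r < 3, (S r).Reads s (l r))
    (hd : ∀ r < 3, ∀ w, (S r).Uses w → ∀ i < out.length, w < o.getD i 0 ∨ o.getD i 0 + n ≤ w)
    (hW : ∀ r < 3, (l r).length + t ≤ W) (hn : n ≤ W) (h0 : ∀ w, f ≤ w → s w = false) :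
    ract (oracle p S W f n o) s = s ∆ blks out o out.length := by
  obtain ⟨m, τ, hm, hx, hτ⟩ := h
  obtain ⟨L, hL⟩ : ∃ L, L = Layout.std W (4 * W) (max p.bound 3) f := ⟨_, rfl⟩
  have hfl : L.Flag (max p.bound 3) f 0 := hL ▸ Layout.std_flag _ _ _ _
  have hreg : L.reg 0 = f + 1 := hL ▸ Layout.std_reg_zero _ _ _ _
  have hLT : L.T = W := hL ▸ rfl
  have hLK : L.K = 4 * W := hL ▸ rfl
  have hKt := Layout.compute_tidy (L := L) (S := S) (le_max_left _ _) hfl (by omega) hS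
  obtain ⟨c1, c2, c3, c4⟩ := Layout.compute_spec (L := L) (s := s) (le_max_right _ _) (le_max_left _ _) hfl
    (by omega) hS hl (fun r hr => by interval_cases r <;> rfl)
    (fun r hr => List.getD_eq_default _ _ (by simpa using hr)) hx
    (by have := hW 0 (by omega); omega) (fun r hr => by have := hW r hr; omega) h0
  have hblks : ∀ k w, k ≤ out.length → (blks out o k w = true) →
      ∃ i < out.length, o.getD i 0 ≤ w ∧ w < o.getD i 0 + n := by
    intro k
    induction k with
    | zero => intro w _ h; exact Bool.noConfusion h
    | succ k ih =>
      intro w hk hw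
      rw [blks, List.range_succ, List.foldl_append] at hw
      by_cases hb : blks out o k w = true
      · exact ih w (by omega) hb
      · refine ⟨k, hk, ?_⟩
        have hb' : blk (o.getD k 0) (out.getD k []) w = true := by
          change (blks out o k ∆ blk (o.getD k 0) (out.getD k [])) w = true at hw
          rw [symmDiff_apply_bool, Bool.eq_false_iff.2 hb] at hw
          simpa using hw
        have := blk_eq_true hb'
        rwa [hout k hk] at this
  have hstore : ∀ k ≤ out.length, ract ((List.range k).flatMap fun r => L.store r (o.getD r 0) n)
      (ract (L.compute f p S) s) = ract (L.compute f p S) s ∆ blks out o k := by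
    intro k
    induction k with
    | zero => intro _; exact (symmDiff_bot _).symm
    | succ k ih =>
      intro hk
      rw [List.range_succ, List.flatMap_append, ract_append, ih (by omega), List.flatMap_cons,
        List.flatMap_nil, List.append_nil]
      rw [Layout.store_spec (l := out.getD k []) (by have := hof k hk; omega) ?_ (hout k hk) (by omega),
        symmDiff_assoc]
      · rw [blks, blks, List.range_succ, List.foldl_append]; rfl
      · rw [← hτ k hk]
        intro j hj
        rw [symmDiff_apply_bool, c1 k (lt_max_of_lt_right (by omega)) j hj]
        have : blks out o k (L.reg k + j) = false := by
          by_contra hc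
          obtain ⟨i, hi, h1, h2⟩ := hblks k _ (by omega) (by simpa using hc)
          have := hof i hi
          have := L.reg_mono (Nat.zero_le k)
          omega
        rw [this, Bool.xor_false]
  rw [oracle, ← hL]
  refine ract_conj hKt (by rw [ho]; exact hstore _ le_rfl) fun w hw => ?_
  by_contra hc
  obtain ⟨i, hi, h1, h2⟩ := hblks _ w le_rfl (by simpa using hc)
  rcases hw with ⟨r, hr, hw⟩ | hw
  · rcases hd r hr w hw i hi with h | h <;> omega
  · have := hof i hi
    omega

theorem oracle_tidy {p : Prog} {W f n : ℕ} {S : ℕ → Src} {o : List ℕ}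
    (hof : ∀ r < o.length, o.getD r 0 + n ≤ f) (hS : ∀ r < 3, ∀ w, (S r).Uses w → w < f) :
    Tidy (fun _ => True) (oracle p S W f n o) := by
  obtain ⟨L, hL⟩ : ∃ L, L = Layout.std W (4 * W) (max p.bound 3) f := ⟨_, rfl⟩
  have hfl : L.Flag (max p.bound 3) f 0 := hL ▸ Layout.std_flag _ _ _ _
  have hreg : L.reg 0 = f + 1 := hL ▸ Layout.std_reg_zero _ _ _ _
  have hKt := (Layout.compute_tidy (L := L) (S := S) (le_max_left _ _) hfl (by omega) hS).mono
    (Q := fun _ => True) fun _ _ => trivial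
  rw [oracle, ← hL]
  refine hKt.append (Tidy.append (Tidy.flatMap fun i hi => ?_) hKt.rinv)
  exact (Layout.store_tidy (by have := hof i hi; omega)).mono fun _ _ => trivial

/-- Carry out the circuit that `p` describes on the `W` wires from `db` on. The work wires are
`wb, wb + 1, …`. -/
def interpret (p : Prog) (S : ℕ → Src) (W db wb : ℕ) : List Raw :=
  let m := max p.bound 3
  -- A register holds at most `W` bits from its input and the time of `p`, and at most `8 W + 2`
  -- more from the two moves of the result. The number of steps is the cost of `Prog.nextGate` on
  -- strings of length `B`, and a stack needs two wires for each bit it may acquire in that time.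
  let B := 9 * W + 2
  let L := Layout.std (28 * B + 40) (2 * (B + (28 * B + 40))) (m + 13) (wb + 7)
  let K := L.compute (wb + 7) (p.emit m) S
  let c := Layout.size L.T (p.emit m)
  -- The readings concern the background only, so one inverse circuit removes the description, the
  -- marks and all garbage after the gates have been applied.
  K ++ (L.steps (m + 1) (wb + 7) db W wb W c ++ rinv (K ++ L.reads (m + 1) (wb + 7) W c))

/-- The states with the data `s` and the other wires as in `ρ`. -/
def insertData (db M : ℕ) (ρ s : BasisState) : BasisState := fun w =>
  if db ≤ w ∧ w < db + M then s (w - db) else ρ w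

/-- `W` bounds the length of the description, hence the number of gates and the wires they act on:
`W` rounds and `W` data wires suffice. -/
theorem interpret_spec {p : Prog} {t W db wb : ℕ} {l : ℕ → List Bool} {C : List Raw}
    {S : ℕ → Src} {ρ : BasisState} (h : p.Computes t [l 0, l 1, l 2] [rcode C])
    (hC : ∀ g ∈ C, g.Valid) (hdb : db + W ≤ wb)
    (hS : ∀ r < 3, ∀ w, (S r).Uses w → w < wb) (hl : ∀ r < 3, (S r).Reads ρ (l r))
    (hd : ∀ r < 3, ∀ w, (S r).Uses w → w < db ∨ db + W ≤ w)
    (hW : ∀ r < 3, (l r).length + t ≤ W) (h0 : ∀ w, wb ≤ w → ρ w = false) (v : QState) :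
    rapply (interpret p S W db wb) (Finsupp.mapDomain (insertData db W ρ) v) =
      Finsupp.mapDomain (insertData db W ρ) (rapply C v) := by
  obtain ⟨m, hm⟩ : ∃ m, m = max p.bound 3 := ⟨_, rfl⟩
  obtain ⟨B, hB⟩ : ∃ B, B = 9 * W + 2 := ⟨_, rfl⟩
  obtain ⟨L, hL⟩ : ∃ L, L = Layout.std (28 * B + 40) (2 * (B + (28 * B + 40))) (m + 13) (wb + 7) :=
    ⟨_, rfl⟩
  have hfl : L.Flag (m + 13) (wb + 7) 0 := hL ▸ Layout.std_flag _ _ _ _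
  have hreg : L.reg 0 = wb + 7 + 1 := hL ▸ Layout.std_reg_zero _ _ _ _
  have hLT : L.T = 28 * B + 40 := hL ▸ rfl
  have hLK : L.K = 2 * (B + (28 * B + 40)) := hL ▸ rfl
  have hpm : p.bound ≤ m := by omega
  have hcode : (rcode C).length ≤ W := by
    obtain ⟨n, τ, hn, hx, hτ⟩ := h
    have h1 := hx.length_le 0
    have h2 : τ 0 = rcode C := hτ 0 (by simp)
    rw [h2] at h1
    have h3 : (rcode C).length ≤ (l 0).length + n := h1
    have := hW 0 (by omega)
    omega
  obtain ⟨n, τ, hn, hx, ho, hτ⟩ := h.emit m hpm (by simp; omega) (by omega)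
  have hl3 : ∀ r < 3, [l 0, l 1, l 2].getD r [] = l r := fun r hr => by interval_cases r <;> rfl
  have hemit : (p.emit m).bound ≤ m + 13 := by rw [Prog.bound_emit hpm]; omega
  have hS' : ∀ r < 3, ∀ w, (S r).Uses w → w < wb + 7 := fun r hr w hw => by
    have := hS r hr w hw
    omega
  have hnB : n ≤ 28 * B + 40 := by have := hW 0 (by omega); omega
  have hKt := Layout.compute_tidy (L := L) (S := S) hemit hfl (by omega) hS'
  obtain ⟨c1, c2, c3, c4⟩ := Layout.compute_spec (L := L) (s := ρ) (by omega) hemit hfl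
    (by omega) hS' hl hl3
    (fun r hr => List.getD_eq_default _ _ (by simpa using hr)) hx
    (by omega) (fun r hr => by have := hW r hr; omega) fun w hw => h0 w (by omega)
  have hRead : L.Reading (m + 13) B (m + 1) (wb + 7) (Layout.size L.T (p.emit m))
      (ract (L.compute (wb + 7) (p.emit m) S) ρ) C (List.replicate 8 []) := by
    refine ⟨c2, c4, τ, fun r hr => ?_, fun r hr => ⟨?_, c1 r hr⟩⟩
    · rcases Nat.eq_zero_or_pos r with rfl | hr'
      · exact ho
      · rw [hτ _ (by omega)]
        interval_cases r <;> rfl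
    · have h1 := hx.length_le r
      by_cases hr3 : r < 3
      · rw [hl3 r hr3] at h1
        have := hW r hr3
        omega
      · rw [List.getD_eq_default _ _ (by simpa using hr3), List.length_nil] at h1
        have := hW 0 (by omega)
        omega
  have hdata : ∀ w, (∃ r < 3, (S r).Uses w) ∨ wb + 7 ≤ w → ¬ (L.panel (m + 1) db W wb).Data w := by
    rintro w (⟨r, hr, hw⟩ | hw) hD
    · rcases hd r hr w hw with h | h
      · exact absurd hD.1 (by simp only [Layout.panel]; omega)
      · exact absurd hD.2 (by simp only [Layout.panel]; omega)
    · exact absurd hD.2 (by simp only [Layout.panel]; omega)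
  have hrt := (Layout.reads_tidy (L := L) (N := m + 13) (m := m + 1) (k := W)
    (c := Layout.size L.T (p.emit m)) (by omega) hfl le_rfl (by omega)).mono
    (Q := fun w => (∃ r < 3, (S r).Uses w) ∨ wb + 7 ≤ w) fun w hw => Or.inr hw
  have hsteps := Layout.steps_spec (L := L) (N := m + 13) (m := m + 1) (f := wb + 7) (db := db) (M := W)
    (qb := wb) (by omega) hfl (by omega) hdb le_rfl (by omega) hLT.ge hLK.ge W _ _ C _
    (by simp) (fun g hg => ⟨hC g hg, on_rcode hcode g hg⟩) ((length_le_rcode C).trans hcode) hRead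
    (fun w hw => by rw [c3 w (by omega), h0 w (by omega)]) v
  rw [interpret, ← hm, ← hB, ← hL]
  change rapply _ (Finsupp.mapDomain ((L.panel (m + 1) db W wb).embed ρ) v) =
    Finsupp.mapDomain ((L.panel (m + 1) db W wb).embed ρ) (rapply C v)
  rw [rapply_append, rapply_append, Panel.rapply_embed hKt hdata, hsteps,
    Panel.rapply_embed (hKt.append hrt).rinv hdata, ← ract_append (L.compute (wb + 7) (p.emit m) S), (hKt.append hrt).ract_rinv]

theorem interpret_valid {p : Prog} {W db wb : ℕ} {S : ℕ → Src} (hdb : db + W ≤ wb)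
    (hS : ∀ r < 3, ∀ w, (S r).Uses w → w < wb) : ∀ g ∈ interpret p S W db wb, g.Valid := by
  obtain ⟨m, hm⟩ : ∃ m, m = max p.bound 3 := ⟨_, rfl⟩
  obtain ⟨B, hB⟩ : ∃ B, B = 9 * W + 2 := ⟨_, rfl⟩
  obtain ⟨L, hL⟩ : ∃ L, L = Layout.std (28 * B + 40) (2 * (B + (28 * B + 40))) (m + 13) (wb + 7) :=
    ⟨_, rfl⟩
  have hfl : L.Flag (m + 13) (wb + 7) 0 := hL ▸ Layout.std_flag _ _ _ _
  have hreg : L.reg 0 = wb + 7 + 1 := hL ▸ Layout.std_reg_zero _ _ _ _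
  have hLK : L.K = 2 * (B + (28 * B + 40)) := hL ▸ rfl
  have hpm : p.bound ≤ m := by omega
  have hemit : (p.emit m).bound ≤ m + 13 := by rw [Prog.bound_emit hpm]; omega
  have hKt := Layout.compute_tidy (L := L) (S := S) hemit hfl (by omega) fun r hr w hw => by
    have := hS r hr w hw
    omega
  have hrt := Layout.reads_tidy (L := L) (N := m + 13) (m := m + 1) (k := W)
    (c := Layout.size L.T (p.emit m)) (by omega) hfl le_rfl (by omega)
  have hok := Layout.panel_ok (L := L) (m := m + 1) (db := db) (M := W) (qb := wb) hdb (by omega) (by omega)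
  intro g hg
  rw [interpret, ← hm, ← hB, ← hL, List.mem_append, List.mem_append] at hg
  rcases hg with hg | hg | hg
  · exact hKt.valid g hg
  · obtain ⟨i, _, hg⟩ := List.mem_flatMap.1 hg
    rcases List.mem_append.1 hg with hg | hg
    · exact (Layout.circ_tidy (L := L) (lo := wb + 7) (Layout.bound_shift_nextGate (by omega))
        (hfl.mono (Nat.zero_le _)) le_rfl (by omega)).valid g hg
    · exact (hok.step_valid g hg).1
  · refine rinv_forall (fun g hg => ?_) g hg
    rcases List.mem_append.1 hg with hg | hg
    · exact hKt.valid g hg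
    · exact hrt.valid g hg

end Oracles

/-! ## Generation of oracles -/

section OracleGeneration

variable {α : Type u} {X : Ctx α}

/-- The input of a computation depends on a context. -/
def PSrc (X : Ctx α) (S : α → Src) : Prop :=
  (∃ l, PS X l ∧ ∀ a, S a = .const (l a)) ∨
    ∃ b n, PN X b ∧ PN X n ∧ ∀ a, S a = .wires (b a) (n a)

theorem PSrc.const {l : α → List Bool} (hl : PS X l) : PSrc X fun a => .const (l a) :=
  Or.inl ⟨l, hl, fun _ => rfl⟩

theorem PSrc.wires {b n : α → ℕ} (hb : PN X b) (hn : PN X n) : PSrc X fun a => .wires (b a) (n a) :=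
  Or.inr ⟨b, n, hb, hn, fun _ => rfl⟩

theorem PSrc.load {L : α → Layout} (hL : PL X L) (r : ℕ) {S : α → Src} (hS : PSrc X S) :
    PC X fun a => (L a).load r (S a) := by
  rcases hS with ⟨l, hl, h⟩ | ⟨b, n, hb, hn, h⟩
  · exact (hL.load_const r hl).congr fun a => by rw [h]
  · exact (hL.load_wires r hb hn).congr fun a => by rw [h]

theorem PSrc.three {S₀ S₁ S₂ : α → Src} (h₀ : PSrc X S₀) (h₁ : PSrc X S₁) (h₂ : PSrc X S₂) :
    ∀ r < 3, PSrc X fun a => Src.three (S₀ a) (S₁ a) (S₂ a) r := by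
  intro r hr
  interval_cases r
  · exact h₀
  · exact h₁
  · exact h₂

theorem PC.range (k : ℕ) {C : α → ℕ → List Raw} (hC : ∀ r < k, PC X fun a => C a r) :
    PC X fun a => (List.range k).flatMap (C a) := by
  induction k with
  | zero => exact PC.nil X
  | succ k ih =>
    exact ((ih fun r hr => hC r (by omega)).append (hC k (by omega))).congr fun a => by
      rw [List.range_succ, List.flatMap_append]
      simp

theorem PC.oracle (p : Prog) {S : α → ℕ → Src} (hS : ∀ r < 3, PSrc X fun a => S a r) {W f n : α → ℕ}
    (hW : PN X W) (hf : PN X f) (hn : PN X n) (k : ℕ) {o : α → List ℕ} (hk : ∀ a, (o a).length = k)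
    (ho : ∀ r < k, PN X fun a => (o a).getD r 0) :
    PC X fun a => oracle p (S a) (W a) (f a) (n a) (o a) := by
  have hL : PL X fun a => Layout.std (W a) (4 * W a) (max p.bound 3) (f a) :=
    PL.std hW ((PN.const X 4).mul hW) _ hf
  have hK := hL.compute hf p fun r hr => (hS r hr).load hL r
  exact (hK.append ((PC.range k fun r hr => hL.store r (ho r hr) hn).append hK.rinv)).congr
    fun a => by rw [← hk a]; rfl

/-- A panel depends on a context. -/
structure PPanel (X : Ctx α) (D : α → Panel) : Prop where
  db : PN X fun a => (D a).db
  M : PN X fun a => (D a).M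
  qb : PN X fun a => (D a).qb
  xa : PN X fun a => (D a).xa
  xb : PN X fun a => (D a).xb
  xi : PN X fun a => (D a).xi
  y : ∀ j, PN X fun a => (D a).y j

theorem PC.ctrlHad {x y : α → ℕ} (hy : PN X y) (hx : PN X x) :
    PC X fun a => ctrlHad (y a) (x a) := by
  have h : PC X fun a => hadBasis (x a) :=
    (PC.tg hx).append ((PC.tg hx).append ((PC.had hx).append (PC.tg hx)))
  exact h.append ((PC.cnot hy hx).append h.rinv)

theorem PPanel.step {D : α → Panel} (hD : PPanel X D) : PC X fun a => (D a).step := by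
  have hq : ∀ k, PN X fun a => (D a).qb + k := fun k => hD.qb.add (PN.const X k)
  have hx : ∀ {x : α → ℕ}, PN X x → PN X.nat fun b => x b.1 + 2 * b.2 + 1 := fun hx =>
    (hx.weaken.add ((PN.const X.nat 2).mul (PN.last X))).add (PN.const X.nat 1)
  have hd : PN X.nat fun b => (D b.1).db + b.2 := hD.db.weaken.add (PN.last X)
  have hfetch : ∀ {x t : α → ℕ}, PN X x → PN X t → PC X fun a => (D a).fetch (x a) (t a) :=
    fun h ht => PC.map hD.M (PC.tof (hx h) hd ht.weaken)
  have hvalue : PC X fun a => (D a).value :=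
    (hfetch hD.xa hD.qb).append ((hfetch hD.xb (hq 1)).append
      ((PC.cnot (hD.y 0) (hq 3)).append ((PC.tof (hD.y 1) hD.qb (hq 3)).append
        ((PC.tof hD.qb (hq 1) (hq 4)).append (PC.tof (hD.y 2) (hq 4) (hq 3))))))
  have hwrite : PC X fun a => (D a).write := PC.map hD.M (PC.tof (hx hD.xi) (hq 3).weaken hd)
  have hphase : PC X fun a => (D a).phaseBit :=
    (hfetch hD.xi (hq 2)).append (PC.tof (hD.y 4) (hq 2) (hq 5))
  have hc : PC X.nat fun b => [Raw.tof ((D b.1).y 3) ((D b.1).xi + 2 * b.2 + 1) ((D b.1).qb + 6)] :=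
    PC.tof (hD.y 3).weaken (hx hD.xi) (hq 6).weaken
  have hhad : PC X fun a => (List.range (D a).M).flatMap (D a).hadAt :=
    PC.flatMap hD.M (C := fun b => (D b.1).hadAt b.2)
      (hc.append ((PC.ctrlHad (hq 6).weaken hd).append hc))
  exact (hvalue.append (hwrite.append hvalue.rinv)).append
    ((hphase.append ((PC.tg (hq 5)).append hphase.rinv)).append hhad)

theorem PC.interpret (p : Prog) {S : α → ℕ → Src} (hS : ∀ r < 3, PSrc X fun a => S a r)
    {W db wb : α → ℕ} (hW : PN X W) (hdb : PN X db) (hwb : PN X wb) :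
    PC X fun a => interpret p (S a) (W a) (db a) (wb a) := by
  have hB : PN X fun a => 9 * W a + 2 := ((PN.const X 9).mul hW).add (PN.const X 2)
  have hT : PN X fun a => 28 * (9 * W a + 2) + 40 := ((PN.const X 28).mul hB).add (PN.const X 40)
  have hf := hwb.add (PN.const X 7)
  have hL := PL.std hT ((PN.const X 2).mul (hB.add hT)) (max p.bound 3 + 13) hf
  have hK := hL.compute hf (p.emit (max p.bound 3)) fun r hr => (hS r hr).load hL r
  have hd := hL.size (Prog.nextGate.shift (max p.bound 3 + 1))
  have hc := hL.size (p.emit (max p.bound 3))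
  have hcirc := hL.weaken.circ (Prog.nextGate.shift (max p.bound 3 + 1)) hf.weaken
    (hc.weaken.add ((PN.last X).mul hd.weaken))
  have hreg : ∀ r, PN X _ := fun r => hL.reg (PN.const X r)
  have hpanel : PPanel X fun a => (Layout.std (28 * (9 * W a + 2) + 40)
      (2 * (9 * W a + 2 + (28 * (9 * W a + 2) + 40))) (max p.bound 3 + 13) (wb a + 7)).panel
        (max p.bound 3 + 1) (db a) (W a) (wb a) :=
    ⟨hdb, hW, hwb, hreg _, hreg _, hreg _, fun j => hreg _⟩
  exact hK.append ((PC.flatMap hW (hcirc.append hpanel.step.weaken)).append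
    (hK.append (PC.flatMap hW hcirc)).rinv)

end OracleGeneration

/-! ## Arrays of strings of a common length -/

section Slots

open scoped symmDiff

/-- The basis state that holds the strings of `l`, each in a slot of `n` wires. -/
def slots (n : ℕ) (l : List (List Bool)) : BasisState := fun w =>
  (l.getD (w / n) []).getD (w % n) false

theorem blk_slot {n : ℕ} (r : ℕ) {v : List Bool} (hv : v.length ≤ n) (w : ℕ) :
    blk (r * n) v w = if w / n = r then v.getD (w % n) false else false := by
  rcases Nat.eq_zero_or_pos n with rfl | hn
  · have : v = [] := List.eq_nil_of_length_eq_zero (by omega)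
    subst this
    simp [blk]
  · have h := Nat.div_add_mod' w n
    have hlt := Nat.mod_lt w hn
    split_ifs with e
    · subst e
      have := blk_add (w / n * n) v (w % n)
      rwa [h] at this
    · rcases Nat.lt_or_gt_of_ne e with h' | h'
      · have : (w / n + 1) * n ≤ r * n := Nat.mul_le_mul_right _ h'
        rw [Nat.succ_mul] at this
        exact blk_of_lt (by omega)
      · have : (r + 1) * n ≤ w / n * n := Nat.mul_le_mul_right _ h'
        rw [Nat.succ_mul] at this
        exact blk_of_le (by omega)

theorem slots_symmDiff_blk {n r : ℕ} {l : List (List Bool)} {v : List Bool} (v' : List Bool)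
    (hr : r < l.length) (hv : v.length ≤ n)
    (h : ∀ j, xor ((l.getD r []).getD j false) (v.getD j false) = v'.getD j false) :
    slots n l ∆ blk (r * n) v = slots n (l.set r v') := by
  funext w
  rw [symmDiff_apply_bool, blk_slot r hv, slots, slots]
  split_ifs with e
  · rw [e, h, show (l.set r v').getD r [] = v' by
      rw [List.getD_eq_getElem _ _ (by simpa using hr), List.getElem_set_self]]
  · rw [Bool.xor_false]
    congr 1
    simp only [List.getD_eq_getElem?_getD, List.getElem?_set_ne (Ne.symm e)]

theorem slots_put {n r : ℕ} {l : List (List Bool)} {v : List Bool} (hr : r < l.length)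
    (hv : v.length ≤ n) (h : l.getD r [] = []) : slots n l ∆ blk (r * n) v = slots n (l.set r v) :=
  slots_symmDiff_blk v hr hv fun j => by rw [h]; simp

theorem slots_erase {n r : ℕ} {l : List (List Bool)} {v : List Bool} (hr : r < l.length)
    (hv : v.length ≤ n) (h : l.getD r [] = v) : slots n l ∆ blk (r * n) v = slots n (l.set r []) :=
  slots_symmDiff_blk [] hr hv fun j => by rw [h]; simp

theorem slots_reads {n r : ℕ} {l : List (List Bool)} {v : List Bool} (hv : v.length = n)
    (h : l.getD r [] = v) : (Src.wires (r * n) n).Reads (slots n l) v := by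
  refine ⟨hv, fun j hj => ?_⟩
  rw [slots, Nat.mul_comm, Nat.mul_add_div (by omega), Nat.div_eq_of_lt hj, Nat.mul_add_mod,
    Nat.mod_eq_of_lt hj, Nat.add_zero, h]

/-- Labels can be read off a basis state. This gives the injectivity of the output encoding and the
disjointness of the blocks. -/
theorem Src.Reads.unique {s : BasisState} {S : Src} {l l' : List Bool} (h : S.Reads s l)
    (h' : S.Reads s l') : l = l' := by
  cases S with
  | const => exact Eq.trans h (Eq.symm h')
  | wires a n =>
    refine List.ext_getElem (h.1.trans h'.1.symm) fun j h1 h2 => ?_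
    have e1 := h.2 j (h.1 ▸ h1)
    have e2 := h'.2 j (h.1 ▸ h1)
    rw [e1] at e2
    simpa [h1, h2] using e2

theorem slots_of_le {n w : ℕ} {l : List (List Bool)} (hl : ∀ x ∈ l, x.length ≤ n)
    (hw : l.length * n ≤ w) : slots n l w = false := by
  rcases Nat.eq_zero_or_pos n with rfl | hn
  · rw [slots, Nat.div_zero]
    cases l with
    | nil => simp
    | cons x l =>
      have : x = [] := List.eq_nil_of_length_eq_zero (by have := hl x List.mem_cons_self; omega)
      subst this
      simp
  · rw [slots, List.getD_eq_default _ _ ((Nat.le_div_iff_mul_le hn).2 hw)]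
    rfl

theorem ofBits_flatten {n : ℕ} {l : List (List Bool)} (hl : ∀ x ∈ l, x.length = n) :
    BasisState.ofBits l.flatten = slots n l := by
  funext w
  induction l generalizing w with
  | nil => simp [BasisState.ofBits, slots]
  | cons x l ih =>
    have hx := hl x List.mem_cons_self
    have hl' := fun y hy => hl y (List.mem_cons_of_mem _ hy)
    rw [BasisState.ofBits, List.flatten_cons]
    rcases Nat.lt_or_ge w n with hw | hw
    · rw [List.getD_append _ _ _ _ (by omega), slots, Nat.div_eq_of_lt hw, Nat.mod_eq_of_lt hw]
      rfl
    · rw [List.getD_append_right _ _ _ _ (by omega), hx]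
      change BasisState.ofBits l.flatten (w - n) = _
      rw [ih hl']
      rcases Nat.eq_zero_or_pos n with rfl | hn
      · rw [slots_of_le (fun y hy => (hl' y hy).le) (by omega),
          slots_of_le (fun y hy => (hl y hy).le) (by omega)]
      · rw [slots, slots, Nat.div_eq w n, if_pos ⟨hn, hw⟩, List.getD_cons_succ, ← Nat.mod_eq_sub_mod hw]

theorem slots_append_replicate (n k : ℕ) (l : List (List Bool)) :
    slots n (l ++ List.replicate k []) = slots n l := by
  funext w
  rw [slots, slots]
  congr 1
  rcases Nat.lt_or_ge (w / n) l.length with h | h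
  · rw [List.getD_append _ _ _ _ h]
  · rw [List.getD_append_right _ _ _ _ h, List.getD_eq_default l _ h]
    rcases Nat.lt_or_ge (w / n - l.length) k with h' | h'
    · rw [List.getD_replicate _ h']
    · rw [List.getD_eq_default _ _ (by simpa using h')]

theorem insertData_slots {n M : ℕ} {l l' : List (List Bool)} (hl : ∀ x ∈ l, x.length ≤ n)
    (hl' : ∀ x ∈ l', x.length ≤ n) (hM : l'.length * n ≤ M) :
    insertData (l.length * n) M (slots n l) (slots n l') = slots n (l ++ l') := by
  funext w
  have hall : ∀ x ∈ l ++ l', x.length ≤ n := fun x hx =>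
    (List.mem_append.1 hx).elim (hl x) (hl' x)
  rcases Nat.lt_or_ge w (l.length * n) with h | h
  · rw [insertData, if_neg (by omega), slots, slots,
      List.getD_append _ _ _ _ (Nat.div_lt_of_lt_mul (by rwa [Nat.mul_comm]))]
  · rcases Nat.lt_or_ge w ((l.length + l'.length) * n) with h2 | h2
    · rw [Nat.add_mul] at h2
      have hn : 0 < n := Nat.pos_of_ne_zero fun e => by subst e; omega
      rw [insertData, if_pos (by omega), slots, slots, List.getD_append_right _ _ _ _
        ((Nat.le_div_iff_mul_le hn).2 h)]
      obtain ⟨i, rfl⟩ := Nat.exists_eq_add_of_le h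
      rw [Nat.add_sub_cancel_left, Nat.mul_comm, Nat.mul_add_div hn, Nat.mul_add_mod,
        Nat.add_sub_cancel_left]
    · rw [slots_of_le hall (by rwa [List.length_append]), insertData]
      rw [Nat.add_mul] at h2
      split_ifs
      · exact slots_of_le hl' (by omega)
      · exact slots_of_le hl h

/-- Add the contents of `n` wires from `a` on to those from `b` on. -/
def addWires (a b n : ℕ) : List Raw := (List.range n).map fun j => .cnot (a + j) (b + j)

theorem addWires_tidy {a b n : ℕ} (h : a + n ≤ b ∨ b + n ≤ a) :
    Tidy (fun w => (a ≤ w ∧ w < a + n) ∨ (b ≤ w ∧ w < b + n)) (addWires a b n) := by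
  refine Tidy.map fun i hi => ⟨trivial, ?_, Or.inl ⟨?_, ?_⟩, Or.inr ⟨?_, ?_⟩⟩
  · change _ ≠ _
    omega
  all_goals omega

theorem addWires_spec {a b n : ℕ} {l : List Bool} {s : BasisState} (h : a + n ≤ b ∨ b + n ≤ a)
    (hl : (Src.wires a n).Reads s l) : ract (addWires a b n) s = s ∆ blk b l := by
  obtain ⟨h1, h2⟩ := hl
  obtain ⟨c1, c2⟩ := ract_map_range n (fun j => .cnot (a + j) (b + j))
    (fun j => b + j) (fun j s => s (a + j)) (fun i _ j _ e => by omega)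
    (fun i hi s => rfl) (fun i hi s t hst => hst _ fun j hj => by omega) s
  funext w
  rw [symmDiff_apply_bool, addWires]
  by_cases hw : b ≤ w ∧ w < b + n
  · obtain ⟨j, rfl⟩ := Nat.exists_eq_add_of_le hw.1
    rw [c1 j (by omega), blk_add, h2 j (by omega)]
  · rw [c2 w fun i hi => by omega]
    have : blk b l w = false := by
      by_contra hc
      have := blk_eq_true (by simpa using hc)
      omega
    rw [this, Bool.xor_false]

/-- Move the contents of the slot `a` to the empty slot `b`. -/
def moveSlot (n a b : ℕ) : List Raw := addWires (a * n) (b * n) n ++ addWires (b * n) (a * n) n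

theorem slot_sep {a b : ℕ} (h : a ≠ b) (n : ℕ) : a * n + n ≤ b * n ∨ b * n + n ≤ a * n := by
  rcases Nat.lt_or_gt_of_ne h with h | h
  · left; have := Nat.mul_le_mul_right n h; rwa [Nat.succ_mul] at this
  · right; have := Nat.mul_le_mul_right n h; rwa [Nat.succ_mul] at this

theorem moveSlot_tidy {n a b : ℕ} (h : a ≠ b) : Tidy (fun _ => True) (moveSlot n a b) :=
  ((addWires_tidy (slot_sep h n)).mono fun _ _ => trivial).append
    ((addWires_tidy (slot_sep h.symm n)).mono fun _ _ => trivial)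

theorem moveSlot_spec {n a b : ℕ} {l : List (List Bool)} (v : List Bool) (h : a ≠ b)
    (ha : a < l.length) (hb : b < l.length) (hv : v.length = n) (hla : l.getD a [] = v)
    (hlb : l.getD b [] = []) :
    ract (moveSlot n a b) (slots n l) = slots n ((l.set b v).set a []) := by
  rw [moveSlot, ract_append, addWires_spec (slot_sep h n) (slots_reads hv hla),
    slots_put hb hv.le hlb, addWires_spec (slot_sep h.symm n) (slots_reads hv ?_),
    slots_erase (by simpa using ha) hv.le ?_]
  · rw [List.getD_eq_getElem?_getD, List.getElem?_set_ne h.symm, ← List.getD_eq_getElem?_getD, hla]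
  · rw [List.getD_eq_getElem _ _ (by simpa using hb), List.getElem_set_self]

/-- Add a constant to the wires from `o` on. -/
def setBits (o : ℕ) (l : List Bool) : List Raw :=
  (List.range l.length).flatMap fun j => if l.getD j false = true then [.not (o + j)] else []

theorem setBits_tidy (o : ℕ) (l : List Bool) :
    Tidy (fun w => o ≤ w ∧ w < o + l.length) (setBits o l) := by
  refine Tidy.flatMap fun i hi => ?_
  split_ifs
  · exact Tidy.singleton (g := .not (o + i)) trivial trivial
      (show o ≤ o + i ∧ o + i < o + l.length from ⟨by omega, by omega⟩)
  · exact fun g hg => absurd hg List.not_mem_nil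

theorem setBits_spec (o : ℕ) (l : List Bool) (s : BasisState) :
    ract (setBits o l) s = s ∆ blk o l := by
  have key : ∀ k, k ≤ l.length → ract ((List.range k).flatMap fun j =>
      if l.getD j false = true then [.not (o + j)] else []) s = s ∆ blk o (l.take k) := by
    intro k
    induction k with
    | zero => intro _; rw [List.take_zero, blk_nil, symmDiff_bot]; rfl
    | succ k ih =>
      intro hk
      rw [List.range_succ, List.flatMap_append, ract_append, ih (by omega), List.flatMap_cons,
        List.flatMap_nil, List.append_nil, List.take_succ_eq_append_getElem hk, blk_append,
        ← symmDiff_assoc, List.length_take_of_le (by omega), List.getD_eq_getElem _ _ hk]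
      funext w
      rw [symmDiff_apply_bool (s ∆ _)]
      by_cases hw : w = o + k
      · subst hw
        have e : blk (o + k) [l[k]] (o + k) = l[k] := by
          have := blk_add (o + k) [l[k]] 0
          simpa using this
        rw [e]
        split_ifs with hb
        · rw [hb]
          simp [ract_cons, Raw.act]
        · rw [ract_nil, Bool.eq_false_iff.2 hb, Bool.xor_false]
      · have e : blk (o + k) [l[k]] w = false := by
          rcases Nat.lt_or_gt_of_ne hw with h | h
          · exact blk_of_lt h
          · exact blk_of_le (by simp; omega)
        rw [e, Bool.xor_false]
        split_ifs with hb
        · simp [ract_cons, Raw.act, hw]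
        · rfl
  rw [setBits, key _ le_rfl, List.take_length]

section

variable {α : Type u} {X : Ctx α}

theorem PC.addWires {a b n : α → ℕ} (ha : PN X a) (hb : PN X b) (hn : PN X n) :
    PC X fun x => addWires (a x) (b x) (n x) :=
  PC.map hn (PC.cnot (ha.weaken.add (PN.last X)) (hb.weaken.add (PN.last X)))

theorem PC.moveSlot {n : α → ℕ} (hn : PN X n) (a b : ℕ) : PC X fun x => moveSlot (n x) a b :=
  have h := fun k : ℕ => (PN.const X k).mul hn
  (PC.addWires (h a) (h b) hn).append (PC.addWires (h b) (h a) hn)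

theorem PC.setBits {o : α → ℕ} {l : α → List Bool} (ho : PN X o) (hl : PS X l) :
    PC X fun x => setBits (o x) (l x) := by
  refine (PS.bits hl (PC.not (ho.weaken.add (PN.last X))) (PC.nil X.nat)).congr fun a => ?_
  simp only [_root_.setBits]
  rw [rcode_flatMap]
  refine List.flatMap_congr fun j _ => ?_
  split_ifs <;> rfl

end

end Slots

/-! ## Norms of superpositions in blocks -/

section Blocks

variable {β γ : Type*}

theorem l2norm_single (b : β) (c : ℂ) : l2norm (Finsupp.single b c) = ‖c‖ := by
  rw [l2norm, Finsupp.sum_single_index (by simp), Real.sqrt_sq (norm_nonneg c)]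

theorem l2norm_sq_combination {v : β → γ →₀ ℂ} (c : β →₀ ℂ)
    (hv : ∀ a ∈ c.support, ∀ b ∈ c.support, a ≠ b → Disjoint (v a).support (v b).support) :
    l2norm (c.sum fun a z => z • v a) ^ 2 = c.sum fun a z => ‖z‖ ^ 2 * l2norm (v a) ^ 2 := by
  classical
  rw [Finsupp.sum, Finsupp.sum, l2norm_sq_sum]
  · exact Finset.sum_congr rfl fun a _ => by rw [l2norm_smul, mul_pow]
  · intro a b hab
    by_cases ha : a ∈ c.support
    · by_cases hb : b ∈ c.support
      · exact Finset.disjoint_of_subset_left Finsupp.support_smul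
          (Finset.disjoint_of_subset_right Finsupp.support_smul (hv a ha b hb hab))
      · rw [Finsupp.notMem_support_iff.1 hb, zero_smul, Finsupp.support_zero]
        exact Finset.disjoint_empty_right _
    · rw [Finsupp.notMem_support_iff.1 ha, zero_smul, Finsupp.support_zero]
      exact Finset.disjoint_empty_left _

theorem l2norm_mapDomain_of_injOn {f : β → γ} {v : β →₀ ℂ} (hf : Set.InjOn f v.support) :
    l2norm (Finsupp.mapDomain f v) = l2norm v := by
  classical
  have h : l2norm (Finsupp.mapDomain f v) ^ 2 = l2norm v ^ 2 := by
    have e : Finsupp.mapDomain f v = v.sum fun a z => z • Finsupp.single (f a) (1 : ℂ) := by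
      rw [Finsupp.mapDomain]
      exact Finsupp.sum_congr fun a _ => by rw [Finsupp.smul_single, smul_eq_mul, mul_one]
    rw [e, l2norm_sq_combination, l2norm_sq]
    · exact Finsupp.sum_congr fun a _ => by rw [l2norm_single]; simp
    · intro a ha b hb hab
      rw [Finsupp.support_single _ one_ne_zero, Finsupp.support_single _ one_ne_zero,
        Finset.disjoint_singleton]
      exact fun e => hab (hf ha hb e)
  exact (pow_left_inj₀ (l2norm_nonneg _) (l2norm_nonneg _) two_ne_zero).1 h

/-- A linear map that is bounded on each block and takes different blocks to disjoint supports. -/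
theorem l2norm_block_le {κ : Type*} [Finite κ] {ω : κ → Type*} {Ω : Type*} (e : (Σ a, ω a) ≃ Ω)
    (A : (Ω →₀ ℂ) →ₗ[ℂ] (γ →₀ ℂ)) {ε : ℝ} (hε : 0 ≤ ε)
    (hA : ∀ (a : κ) (c : ω a →₀ ℂ), l2norm (A (Finsupp.mapDomain (fun b => e ⟨a, b⟩) c)) ≤ ε * l2norm c)
    (hd : ∀ a a' (c : ω a →₀ ℂ) (c' : ω a' →₀ ℂ), a ≠ a' →
      Disjoint (A (Finsupp.mapDomain (fun b => e ⟨a, b⟩) c)).support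
        (A (Finsupp.mapDomain (fun b => e ⟨a', b⟩) c')).support) (c : Ω →₀ ℂ) :
    l2norm (A c) ≤ ε * l2norm c := by
  classical
  have := Fintype.ofFinite κ
  have hinj : ∀ a, Function.Injective fun b : ω a => e ⟨a, b⟩ := fun a b b' h => by
    simpa using h
  obtain ⟨d, hd'⟩ : ∃ d : ∀ a, ω a →₀ ℂ, ∀ a b, d a b = c (e ⟨a, b⟩) :=
    ⟨fun a => c.comapDomain _ (hinj a).injOn, fun a b => rfl⟩
  have hc : c = ∑ a, Finsupp.mapDomain (fun b => e ⟨a, b⟩) (d a) := by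
    ext x
    obtain ⟨⟨a, b⟩, rfl⟩ := e.surjective x
    rw [Finsupp.finsetSum_apply, Finset.sum_eq_single a, Finsupp.mapDomain_apply (hinj a), hd']
    · intro a' _ ha'
      refine Finsupp.mapDomain_of_notMem_range _ _ ?_
      rintro ⟨b', hb'⟩
      have := e.injective hb'
      exact ha' (congrArg Sigma.fst this)
    · simp
  have hsq : l2norm c ^ 2 = ∑ a, l2norm (d a) ^ 2 := by
    conv_lhs => rw [hc]
    rw [l2norm_sq_sum]
    · exact Finset.sum_congr rfl fun a _ => by rw [l2norm_mapDomain _ (hinj a)]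
    · intro a a' haa
      rw [Finset.disjoint_left]
      intro x hx hx'
      obtain ⟨b, _, rfl⟩ := Finset.mem_image.1 (Finsupp.mapDomain_support hx)
      obtain ⟨b', _, hb'⟩ := Finset.mem_image.1 (Finsupp.mapDomain_support hx')
      exact haa (congrArg Sigma.fst (e.injective hb')).symm
  refine (pow_le_pow_iff_left₀ (l2norm_nonneg _) (mul_nonneg hε (l2norm_nonneg _)) two_ne_zero).1 ?_
  rw [mul_pow, hsq]
  conv_lhs => rw [hc]
  -- With disjoint supports the squares of the norms add on both sides, so `ε` is not multiplied by
  -- the number of blocks.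
  rw [map_sum, l2norm_sq_sum _ _ fun a a' haa => hd a a' _ _ haa, Finset.mul_sum]
  refine Finset.sum_le_sum fun a _ => ?_
  rw [← mul_pow]
  exact pow_le_pow_left₀ (l2norm_nonneg _) (hA a _) 2

end Blocks

/-! ## The Fourier transform over the quantum double -/

section Defect

variable {α β : Type*} [Fintype α]

/-- The difference of the action of `C` and of the transformation to the basis `b`. -/
noncomputable def defect (C : List Raw) (inp : α → BasisState) (b : β → EuclideanSpace ℂ α)
    (out : β → BasisState) : (β →₀ ℂ) →ₗ[ℂ] QState :=
  Finsupp.linearCombination ℂ fun y => rapply C (loadState inp (b y)) - Finsupp.single (out y) 1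

/-- `loadState` as a linear map. -/
noncomputable def loadLin (inp : α → BasisState) : EuclideanSpace ℂ α →ₗ[ℂ] QState where
  toFun := loadState inp
  map_add' u v := by simp [loadState, Finset.sum_add_distrib]
  map_smul' c u := by simp [loadState, Finset.smul_sum]

theorem defect_apply (C : List Raw) (inp : α → BasisState) (b : β → EuclideanSpace ℂ α)
    (out : β → BasisState) (c : β →₀ ℂ) : defect C inp b out c =
      rapply C (loadState inp (Finsupp.linearCombination ℂ b c)) - Finsupp.mapDomain out c := by
  have : defect C inp b out = rapply C ∘ₗ loadLin inp ∘ₗ Finsupp.linearCombination ℂ b -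
      Finsupp.lmapDomain ℂ ℂ out := by
    refine Finsupp.lhom_ext' fun y => LinearMap.ext_ring ?_
    simp [defect, loadLin, Finsupp.mapDomain_single]
  rw [this]
  rfl

theorem carriesOut_iff (C : Circuit) (inp : α → BasisState) (b : β → EuclideanSpace ℂ α)
    (out : β → BasisState) (ε : ℝ) : C.CarriesOut inp b out ε ↔
      ∀ c, l2norm (defect (C.map Gate.toRaw) inp b out c) ≤ ε * l2norm c := by
  simp only [Circuit.CarriesOut, defect_apply, Circuit.apply_eq]

/-- The superpositions of states that are `0` on all wires from `M` on. -/
def lowStates (M : ℕ) : Submodule ℂ QState :=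
  Finsupp.supported ℂ ℂ {s | ∀ w, M ≤ w → s w = false}

theorem mem_lowStates {M : ℕ} {v : QState} :
    v ∈ lowStates M ↔ ∀ s ∈ v.support, ∀ w, M ≤ w → s w = false := Iff.rfl

theorem single_mem_lowStates {M : ℕ} {s : BasisState} (h : ∀ w, M ≤ w → s w = false) (c : ℂ) :
    Finsupp.single s c ∈ lowStates M := fun t ht => by
  rw [Finset.mem_singleton.1 (Finsupp.support_single_subset ht)]
  exact h

theorem rapply_mem_lowStates {M : ℕ} {C : List Raw} (hC : ∀ g ∈ C, g.On fun w => w < M) {v : QState}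
    (hv : v ∈ lowStates M) : rapply C v ∈ lowStates M :=
  mem_lowStates.2 (support_rapply hC (fun s => ∀ w, M ≤ w → s w = false)
    (fun s t h hs w hw => (h w (by omega)).symm.trans (hs w hw)) (mem_lowStates.1 hv))

theorem ofBits_eq_false {l : List Bool} {w : ℕ} (h : l.length ≤ w) : BasisState.ofBits l w = false :=
  List.getD_eq_default _ _ h

theorem loadState_mem_lowStates {M : ℕ} {inp : α → BasisState}
    (h : ∀ a w, M ≤ w → inp a w = false) (u : EuclideanSpace ℂ α) : loadState inp u ∈ lowStates M :=
  Submodule.sum_mem _ fun a _ => single_mem_lowStates (h a) _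

theorem defect_mem_lowStates {M : ℕ} {C : List Raw} {inp : α → BasisState}
    {b : β → EuclideanSpace ℂ α} {out : β → BasisState} (hC : ∀ g ∈ C, g.On fun w => w < M)
    (hi : ∀ a w, M ≤ w → inp a w = false) (ho : ∀ a w, M ≤ w → out a w = false) (c : β →₀ ℂ) :
    defect C inp b out c ∈ lowStates M := by
  rw [defect, Finsupp.linearCombination_apply, Finsupp.sum]
  exact Submodule.sum_mem _ fun y _ => Submodule.smul_mem _ _ (Submodule.sub_mem _
    (rapply_mem_lowStates hC (loadState_mem_lowStates hi _)) (single_mem_lowStates (ho y) 1))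

/-- States that vanish from wire `M` on are recovered from the window of `M` wires. -/
theorem insertData_injOn (db M : ℕ) (ρ : BasisState) :
    Set.InjOn (insertData db M ρ) {s | ∀ w, M ≤ w → s w = false} := by
  intro s hs s' hs' h
  funext w
  rcases Nat.lt_or_ge w M with hw | hw
  · have := congrFun h (db + w)
    simpa [insertData, hw] using this
  · rw [hs w hw, hs' w hw]

theorem Prog.Computes.length_le {p : Prog} {t : ℕ} {l : List Bool} {inp : List (List Bool)}
    {o : List Bool} (h : p.Computes t (l :: inp) [o]) : o.length ≤ l.length + t := by
  obtain ⟨n, τ, hn, hx, hτ⟩ := h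
  have h1 := hx.length_le 0
  have h2 : τ 0 = o := hτ 0 (by simp)
  rw [h2] at h1
  have h3 : o.length ≤ l.length + n := h1
  omega

end Defect

/-! ### The circuit of the Fourier transform over the quantum double -/

section DoubleTransform

open scoped symmDiff

theorem blks_one (v : List Bool) (a : ℕ) : blks [v] [a] 1 = blk a v := by
  simp [blks, List.range_succ, bot_symmDiff]

theorem blks_two (v v' : List Bool) (a a' : ℕ) :
    blks [v, v'] [a, a'] 2 = blk a v ∆ blk a' v' := by
  simp [blks, List.range_succ, bot_symmDiff]

/-- Replace `g, h` by `h, t, z` with `g = t z`. -/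
def splitCirc (pf pm : Prog) (name : List Bool) (n W : ℕ) : List Raw :=
  -- Slots `0` and `1` hold `g` and `h`. The factors `t` and `z` go to slot `3` and to slot `5`,
  -- where the data of the interpreted circuit begin. As `g` can be computed from them,
  -- multiplication erases slot `0`, and `h` takes its place.
  oracle pf (Src.three (.const name) (.wires (1 * n) n) (.wires (0 * n) n)) W (5 * n + W) n
      [3 * n, 5 * n] ++
    (oracle pm (Src.three (.const name) (.wires (3 * n) n) (.wires (5 * n) n)) W (5 * n + W) n
      [0 * n] ++ moveSlot n 1 0)

/-- Move the registers to their final places. -/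
def gatherCirc (n : ℕ) : List Raw := moveSlot n 5 1 ++ (moveSlot n 7 2 ++ moveSlot n 6 4)

/-- The circuit of the Fourier transform over the quantum double. -/
def doubleCirc (pf pm pq : Prog) (name : List Bool) (n k W : ℕ) : List Raw :=
  splitCirc pf pm name n W ++
    (interpret pq (Src.three (.const name) (.wires (0 * n) n) (.const (unary k))) W (5 * n) (5 * n + W) ++
      gatherCirc n)

theorem gatherCirc_tidy (n : ℕ) : Tidy (fun _ => True) (gatherCirc n) :=
  (moveSlot_tidy (by omega)).append ((moveSlot_tidy (by omega)).append (moveSlot_tidy (by omega)))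

/-- The transform of the centralizer leaves `ρ, i, j` in the slots `5, 6, 7`, while labels of `D(G)`
have the order `h, ρ, j, t, i`. -/
theorem gatherCirc_spec {n : ℕ} {a t i r c : List Bool} (hi : i.length = n) (hr : r.length = n)
    (hc : c.length = n) : ract (gatherCirc n) (slots n [a, [], [], t, [], i, r, c]) =
      slots n [a, i, c, t, r, [], [], []] := by
  rw [gatherCirc, ract_append, ract_append,
    moveSlot_spec i (by omega) (by simp) (by simp) hi rfl rfl,
    moveSlot_spec c (by omega) (by simp) (by simp) hc rfl rfl,
    moveSlot_spec r (by omega) (by simp) (by simp) hr rfl rfl]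
  rfl

theorem splitCirc_tidy (pf pm : Prog) (name : List Bool) {n W : ℕ} (hW : 3 * n ≤ W) :
    Tidy (fun _ => True) (splitCirc pf pm name n W) := by
  refine (oracle_tidy (fun r hr => ?_) fun r hr w hw => ?_).append
    ((oracle_tidy (fun r hr => ?_) fun r hr w hw => ?_).append (moveSlot_tidy (by omega)))
  · simp only [List.length_cons, List.length_nil] at hr
    interval_cases r
    · change 3 * n + n ≤ _; omega
    · change 5 * n + n ≤ _; omega
  · interval_cases r
    · exact hw.elim
    · have := hw.2; omega
    · have := hw.2; omega
  · simp only [List.length_cons, List.length_nil] at hr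
    interval_cases r
    change 0 * n + n ≤ _; omega
  · interval_cases r
    · exact hw.elim
    · have := hw.2; omega
    · have := hw.2; omega

theorem splitCirc_spec {pf pm : Prog} {name a b t z : List Bool} {n W tf tm : ℕ}
    (hf : pf.Computes tf [name, b, a] [t, z]) (hm : pm.Computes tm [name, t, z] [a])
    (ha : a.length = n) (hb : b.length = n) (ht : t.length = n) (hz : z.length = n)
    (hWn : 3 * n ≤ W) (hWf : name.length + n + tf ≤ W) (hWm : name.length + n + tm ≤ W) :
    ract (splitCirc pf pm name n W) (slots n [a, b, [], [], [], [], [], []]) =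
      slots n [b, [], [], t, [], z, [], []] := by
  have h0 : ∀ {l : List (List Bool)}, l.length = 8 → (∀ x ∈ l, x.length ≤ n) →
      ∀ w, 5 * n + W ≤ w → slots n l w = false := fun hl8 hl w hw => slots_of_le hl (by
        rw [hl8]; omega)
  rw [splitCirc, ract_append, ract_append,
    oracle_spec (l := fun r => [name, b, a].getD r []) (t := tf) (out := [t, z]) hf rfl (by simp)
      (fun r hr => ?_) (fun r hr => ?_) (fun r hr w hw => ?_) (fun r hr => ?_) (fun r hr w hw i hi => ?_)
      (fun r hr => ?_) (by omega) (h0 rfl (by simp; omega)),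
    show [t, z].length = 2 from rfl, blks_two, ← symmDiff_assoc,
    slots_put (by simp) ht.le rfl, slots_put (by simp) hz.le rfl]
  · change ract _ (ract _ (slots n [a, b, [], t, [], z, [], []])) = _
    rw [oracle_spec (l := fun r => [name, t, z].getD r []) (t := tm) (out := [a]) hm rfl (by simp)
      (fun r hr => ?_) (fun r hr => ?_) (fun r hr w hw => ?_) (fun r hr => ?_) (fun r hr w hw i hi => ?_)
      (fun r hr => ?_) (by omega) (h0 rfl (by simp; omega)),
      show [a].length = 1 from rfl, blks_one, slots_erase (by simp) ha.le rfl]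
    · change ract _ (slots n [[], b, [], t, [], z, [], []]) = _
      rw [moveSlot_spec b (by omega) (by simp) (by simp) hb rfl rfl]
      rfl
    · simp only [List.length_cons, List.length_nil] at hr
      interval_cases r
      exact ha
    · simp only [List.length_cons, List.length_nil] at hr
      interval_cases r
      change 0 * n + n ≤ _; omega
    · interval_cases r
      · exact hw.elim
      · have := hw.2; omega
      · have := hw.2; omega
    · interval_cases r
      · rfl
      · exact slots_reads ht rfl
      · exact slots_reads hz rfl
    · simp only [List.length_cons, List.length_nil] at hi
      interval_cases i
      right
      interval_cases r
      · exact hw.elim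
      · have := hw.1; change 0 * n + n ≤ _; omega
      · have := hw.1; change 0 * n + n ≤ _; omega
    · interval_cases r
      · change name.length + _ ≤ _; omega
      · change t.length + _ ≤ _; omega
      · change z.length + _ ≤ _; omega
  · simp only [List.length_cons, List.length_nil] at hr
    interval_cases r
    · exact ht
    · exact hz
  · simp only [List.length_cons, List.length_nil] at hr
    interval_cases r
    · change 3 * n + n ≤ _; omega
    · change 5 * n + n ≤ _; omega
  · interval_cases r
    · exact hw.elim
    · have := hw.2; omega
    · have := hw.2; omega
  · interval_cases r
    · rfl
    · exact slots_reads hb rfl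
    · exact slots_reads ha rfl
  · simp only [List.length_cons, List.length_nil] at hi
    left
    have : w < 3 * n := by
      interval_cases r
      · exact hw.elim
      · have := hw.2; omega
      · have := hw.2; omega
    interval_cases i
    · change w < 3 * n; omega
    · change w < 5 * n; omega
  · interval_cases r
    · change name.length + _ ≤ _; omega
    · change b.length + _ ≤ _; omega
    · change a.length + _ ≤ _; omega

end DoubleTransform

/-! ## Correctness of the Fourier transform over the quantum double -/

section DoubleCorrectness

variable {G : Type u} [Group G] [Fintype G]

theorem QuantumDouble.sum_apply {ι : Type*} (S : Finset ι) (f : ι → QuantumDouble G) (p : G × G) :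
    (∑ i ∈ S, f i : QuantumDouble G) p = ∑ i ∈ S, f i p := by
  classical
  induction S using Finset.induction_on with
  | empty => simp
  | insert a S ha ih => rw [Finset.sum_insert ha, Finset.sum_insert ha, QuantumDouble.add_apply, ih]

theorem loadState_cosetMap (inp : G × G → BasisState) (h t : G) (u : EuclideanSpace ℂ (Zc h)) :
    loadState inp (cosetMap h t u) =
      ∑ z : Zc h, Finsupp.single (inp (t * z, h)) (u z) := by
  classical
  have hcoord : ∀ p : G × G, (cosetMap h t u) p =
      ∑ z : Zc h, if p = (t * z, h) then u z else 0 := fun p => by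
    rw [cosetMap_def, QuantumDouble.sum_apply]
    refine Finset.sum_congr rfl fun z _ => ?_
    rw [QuantumDouble.smul_apply, QuantumDouble.ket, QuantumDouble.mk_apply]
    simp
  change ∑ p, Finsupp.single (inp p) ((cosetMap h t u) p) = _
  simp only [hcoord, Finsupp.single_finsetSum]
  rw [Finset.sum_comm]
  refine Finset.sum_congr rfl fun z _ => ?_
  rw [Finset.sum_eq_single (t * z, h)]
  · rw [if_pos rfl]
  · intro p _ hp
    rw [if_neg hp, Finsupp.single_zero]
  · simp

/-- The labels of the basis of the quantum double, in blocks. -/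
def doubleIndexEquiv (T : G → Set G) :
    (Σ a : (h : G) × T h, FourierIndex (Zc a.1)) ≃ DoubleIndex T where
  toFun a := ⟨a.1.1, a.1.2, a.2⟩
  invFun a := ⟨⟨a.1, a.2.1⟩, a.2.2⟩
  left_inv _ := rfl
  right_inv _ := rfl

variable {n : ℕ} {enc : G → List Bool}

/-- The registers of the label of a vector of the Fourier basis. -/
def FourierCode.out {H : Type u} [Group H] {n : ℕ} (L : FourierCode H n) (a : FourierIndex H) :
    BasisState := BasisState.ofBits (L.irr a.1 ++ L.row a.1 a.2.1 ++ L.col a.1 a.2.2)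

theorem FourierCode.out_eq {H : Type u} [Group H] {n : ℕ} (L : FourierCode H n) (a : FourierIndex H) :
    L.out a = slots n [L.irr a.1, L.row a.1 a.2.1, L.col a.1 a.2.2] := by
  rw [FourierCode.out, ← ofBits_flatten]
  · simp
  · simp [L.length_irr, L.length_row, L.length_col]

theorem FourierCode.out_injective {H : Type u} [Group H] {n : ℕ} (L : FourierCode H n) :
    Function.Injective L.out := by
  rintro ⟨ρ, i, j⟩ ⟨ρ', i', j'⟩ h
  rw [L.out_eq, L.out_eq] at h
  have h0 := (slots_reads (r := 0) (L.length_irr ρ) rfl).unique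
    (by rw [h]; exact slots_reads (r := 0) (L.length_irr ρ') rfl)
  obtain rfl := L.irr_injective h0
  have h1 := (slots_reads (r := 1) (L.length_row ρ i) rfl).unique
    (by rw [h]; exact slots_reads (r := 1) (L.length_row ρ i') rfl)
  have h2 := (slots_reads (r := 2) (L.length_col ρ j) rfl).unique
    (by rw [h]; exact slots_reads (r := 2) (L.length_col ρ j') rfl)
  obtain rfl := L.row_injective ρ h1
  obtain rfl := L.col_injective ρ h2
  rfl

/-- The registers of the label of a vector of the basis of the quantum double. -/
def doubleOut {T : G → Set G} (enc : G → List Bool) (L : ∀ h : G, FourierCode (Zc h) n)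
    (a : DoubleIndex T) : BasisState :=
  BasisState.ofBits (enc a.1 ++ (L a.1).irr a.2.2.1 ++ (L a.1).col a.2.2.1 a.2.2.2.2 ++
    enc a.2.1 ++ (L a.1).row a.2.2.1 a.2.2.2.1)

theorem doubleOut_eq {T : G → Set G} (henc : ∀ g, (enc g).length = n)
    (L : ∀ h : G, FourierCode (Zc h) n) (a : DoubleIndex T) :
    doubleOut enc L a = slots n [enc a.1, (L a.1).irr a.2.2.1, (L a.1).col a.2.2.1 a.2.2.2.2,
      enc a.2.1, (L a.1).row a.2.2.1 a.2.2.2.1] := by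
  rw [doubleOut, ← ofBits_flatten]
  · simp
  · simp [henc, FourierCode.length_irr, FourierCode.length_row, FourierCode.length_col]

/-- The state of the registers of the block `(h, t)`. -/
def blockState (n : ℕ) (enc : G → List Bool) (h t : G) : BasisState :=
  slots n [enc h, [], [], enc t, []]

theorem insertData_blockState {W : ℕ} (henc : ∀ g, (enc g).length = n) (h t : G)
    {l : List (List Bool)} (hl : ∀ x ∈ l, x.length ≤ n) (hW : l.length * n ≤ W) :
    insertData (5 * n) W (blockState n enc h t) (slots n l) =
      slots n ([enc h, [], [], enc t, []] ++ l) :=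
  insertData_slots (l := [enc h, [], [], enc t, []]) (by simp [henc]) hl hW

theorem slots_eq_replicate {n : ℕ} (l : List (List Bool)) (k : ℕ) :
    slots n l = slots n (l ++ List.replicate k []) := (slots_append_replicate n k l).symm

theorem doubleCirc_valid (pf pm pq : Prog) (name : List Bool) {k W : ℕ} (hW : 3 * n ≤ W) :
    ∀ g ∈ doubleCirc pf pm pq name n k W, g.Valid := by
  intro g hg
  rcases List.mem_append.1 hg with hg | hg
  · exact (splitCirc_tidy pf pm name hW).valid g hg
  rcases List.mem_append.1 hg with hg | hg
  · refine interpret_valid (by omega) (fun r hr w hw => ?_) g hg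
    interval_cases r
    · exact hw.elim
    · have := hw.2; omega
    · exact hw.elim
  · exact (gatherCirc_tidy n).valid g hg

/-- On the block of a pair `(h, t)` the circuit acts as `Q h` does on the data wires, with `h` and
`t` in the background. So the error on a block is a copy of the error of `Q h`; since errors in
different blocks have disjoint supports, the bound `ε` is kept. -/
theorem doubleCirc_defect {T : G → Set G}
    (B : ∀ h : G, FourierBasis (Zc h)) (L : ∀ h : G, FourierCode (Zc h) n)
    (henc : ∀ g, (enc g).length = n) (hinj : Function.Injective enc)
    {pf pm pq : Prog} {name : List Bool} {k W tf tm tq : ℕ} {ε : ℝ} (hε : 0 ≤ ε)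
    (hf : ∀ (h : G) (t : T h) (z : Zc h),
      pf.Computes tf [name, enc h, enc ((t : G) * z)] [enc t, enc z])
    (hm : ∀ g h : G, pm.Computes tm [name, enc g, enc h] [enc (g * h)])
    (Q : G → List Raw) (hQ : ∀ h, ∀ g ∈ Q h, g.Valid)
    (hq : ∀ h, pq.Computes tq [name, enc h, unary k] [rcode (Q h)])
    (hd : ∀ h c, l2norm (defect (Q h) (fun z : Zc h => BasisState.ofBits (enc z)) (B h).vec
      (L h).out c) ≤ ε * l2norm c)
    (hWn : 3 * n ≤ W) (hWf : name.length + n + tf ≤ W) (hWm : name.length + n + tm ≤ W)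
    (hWq : name.length + n + k + tq ≤ W) (c : DoubleIndex T →₀ ℂ) :
    l2norm (defect (doubleCirc pf pm pq name n k W)
      (fun gh : G × G => BasisState.ofBits (enc gh.1 ++ enc gh.2)) (doubleBasis T B)
      (doubleOut enc L) c) ≤ ε * l2norm c := by
  classical
  have hgv := (gatherCirc_tidy n).valid
  have hcodes : ∀ h, (rcode (Q h)).length ≤ W := fun h => by
    have := (hq h).length_le
    omega
  have hon : ∀ h, ∀ g ∈ Q h, g.On fun w => w < W := fun h => on_rcode (hcodes h)
  -- the action on a block
  have key : ∀ (a : (h : G) × T h) (c : FourierIndex (Zc a.1) →₀ ℂ),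
      rapply (rinv (gatherCirc n)) (defect (doubleCirc pf pm pq name n k W)
        (fun gh : G × G => BasisState.ofBits (enc gh.1 ++ enc gh.2)) (doubleBasis T B)
        (doubleOut enc L) (Finsupp.mapDomain (fun b => doubleIndexEquiv T ⟨a, b⟩) c)) =
      Finsupp.mapDomain (insertData (5 * n) W (blockState n enc a.1 a.2))
        (defect (Q a.1) (fun z : Zc a.1 => BasisState.ofBits (enc z)) (B a.1).vec (L a.1).out c) := by
    rintro ⟨h, t⟩ c
    have hlin : rapply (rinv (gatherCirc n)) ∘ₗ defect (doubleCirc pf pm pq name n k W)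
        (fun gh : G × G => BasisState.ofBits (enc gh.1 ++ enc gh.2)) (doubleBasis T B)
        (doubleOut enc L) ∘ₗ Finsupp.lmapDomain ℂ ℂ (fun b => doubleIndexEquiv T ⟨⟨h, t⟩, b⟩) =
        Finsupp.lmapDomain ℂ ℂ (insertData (5 * n) W (blockState n enc h t)) ∘ₗ
          defect (Q h) (fun z : Zc h => BasisState.ofBits (enc z)) (B h).vec (L h).out := by
      refine Finsupp.lhom_ext' fun b => LinearMap.ext_ring ?_
      simp only [LinearMap.comp_apply, Finsupp.lsingle_apply, Finsupp.lmapDomain_apply,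
        Finsupp.mapDomain_single, defect, Finsupp.linearCombination_single, one_smul]
      rw [map_sub, Finsupp.mapDomain_sub]
      congr 1
      · -- the state after the transformation
        have hsplit : rapply (splitCirc pf pm name n W) (loadState
            (fun gh : G × G => BasisState.ofBits (enc gh.1 ++ enc gh.2))
            (doubleBasis T B (doubleIndexEquiv T ⟨⟨h, t⟩, b⟩))) =
            Finsupp.mapDomain (insertData (5 * n) W (blockState n enc h t))
              (loadState (fun z : Zc h => BasisState.ofBits (enc z)) ((B h).vec b)) := by
          rw [show doubleBasis T B (doubleIndexEquiv T ⟨⟨h, t⟩, b⟩) = cosetMap h t ((B h).vec b) from rfl,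
            loadState_cosetMap, loadState, Finsupp.mapDomain_finsetSum, map_sum]
          refine Finset.sum_congr rfl fun z _ => ?_
          rw [rapply_classical (splitCirc_tidy pf pm name hWn).cl, Finsupp.mapDomain_single]
          congr 1
          rw [show enc ((t : G) * z) ++ enc h = [enc ((t : G) * z), enc h].flatten by simp,
            ofBits_flatten (n := n) (by simp [henc]), slots_eq_replicate _ 6,
            show enc (z : G) = [enc (z : G)].flatten by simp,
            ofBits_flatten (n := n) (by simp [henc]), insertData_blockState henc h t (by simp [henc])
              (by simp; omega), slots_eq_replicate ([enc h, [], [], enc t, []] ++ [enc (z : G)]) 2]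
          exact splitCirc_spec (hf h t z) (hm t z) (henc _) (henc _) (henc _) (henc _) hWn hWf hWm
        rw [doubleCirc, rapply_append, rapply_append, rapply_rinv hgv, hsplit]
        refine interpret_spec (l := fun r => [name, enc h, unary k].getD r []) (t := tq) (hq h) (hQ h)
          (by omega) (fun r hr w hw => ?_) (fun r hr => ?_) (fun r hr w hw => ?_) (fun r hr => ?_)
          (fun w hw => slots_of_le (by simp [henc]) (by simp; omega)) _
        · interval_cases r
          · exact hw.elim
          · have := hw.2; omega
          · exact hw.elim
        · interval_cases r
          · rfl
          · exact slots_reads (henc h) rfl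
          · rfl
        · interval_cases r
          · exact hw.elim
          · have := hw.2; omega
          · exact hw.elim
        · interval_cases r
          · change name.length + _ ≤ _; omega
          · change (enc h).length + _ ≤ _; rw [henc]; omega
          · change (unary k).length + _ ≤ _; rw [length_unary]; omega
      · -- the state that represents the label
        rw [Finsupp.mapDomain_single, (L h).out_eq, insertData_blockState henc h t
          (by simp [FourierCode.length_irr, FourierCode.length_row, FourierCode.length_col])
          (by simpa using hWn), doubleOut_eq henc, slots_eq_replicate _ 3]
        have hg := gatherCirc_spec (n := n) (a := enc h) (t := enc t) ((L h).length_irr b.1)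
          ((L h).length_row b.1 b.2.1) ((L h).length_col b.1 b.2.2)
        change rapply _ (Finsupp.single (slots n [enc h, (L h).irr b.1, (L h).col b.1 b.2.2, enc t,
          (L h).row b.1 b.2.1, [], [], []]) 1) = _
        rw [← hg, rapply_classical (gatherCirc_tidy n).rinv.cl, (gatherCirc_tidy n).ract_rinv]
        rfl
    exact LinearMap.congr_fun hlin c
  have hlow : ∀ (a : (h : G) × T h) (c : FourierIndex (Zc a.1) →₀ ℂ),
      defect (Q a.1) (fun z : Zc a.1 => BasisState.ofBits (enc z)) (B a.1).vec (L a.1).out c ∈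
        lowStates W := fun a c =>
    defect_mem_lowStates (hon a.1)
      (fun z w hw => ofBits_eq_false (by rw [henc]; omega))
      (fun b w hw => by
        rw [(L a.1).out_eq]
        exact slots_of_le (by simp [FourierCode.length_irr, FourierCode.length_row,
          FourierCode.length_col]) (by simp; omega)) c
  -- The final rearrangement is an isometry, so the defect may be measured before it. There `h` and
  -- `t` occupy slots `0` and `3`, which the data wires do not reach, and they separate the blocks.
  have hmain := l2norm_block_le (doubleIndexEquiv T) (rapply (rinv (gatherCirc n)) ∘ₗ
    defect (doubleCirc pf pm pq name n k W)
        (fun gh : G × G => BasisState.ofBits (enc gh.1 ++ enc gh.2)) (doubleBasis T B)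
        (doubleOut enc L)) hε (fun a c => ?_) (fun a a' c c' haa => ?_) c
  · rwa [LinearMap.comp_apply, rapply_l2norm (gatherCirc_tidy n).rinv.valid] at hmain
  · rw [LinearMap.comp_apply, key, l2norm_mapDomain_of_injOn]
    · exact hd a.1 c
    · exact (insertData_injOn _ _ _).mono (mem_lowStates.1 (hlow a c))
  · rw [LinearMap.comp_apply, LinearMap.comp_apply, key, key, Finset.disjoint_left]
    intro s hs hs'
    obtain ⟨s1, _, rfl⟩ := Finset.mem_image.1 (Finsupp.mapDomain_support hs)
    obtain ⟨s2, _, h2⟩ := Finset.mem_image.1 (Finsupp.mapDomain_support hs')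
    obtain ⟨h, t⟩ := a
    obtain ⟨h', t'⟩ := a'
    have hreads : ∀ (h t : G) (s : BasisState) (r : ℕ), r < 5 → ∀ x : List Bool, x.length = n →
        [enc h, [], [], enc t, []].getD r [] = x → (Src.wires (r * n) n).Reads
          (insertData (5 * n) W (blockState n enc h t) s) x := by
      intro h t s r hr x hx e
      refine (slots_reads hx e).congr fun w hw => ?_
      have h1 := hw.2
      have h2 := Nat.mul_le_mul_right n (show r + 1 ≤ 5 by omega)
      rw [Nat.succ_mul] at h2
      exact if_neg (by omega)
    have e0 := (hreads h t s1 0 (by omega) _ (henc h) rfl).unique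
      (h2 ▸ hreads h' t' s2 0 (by omega) _ (henc h') rfl)
    have e3 := (hreads h t s1 3 (by omega) _ (henc t) rfl).unique
      (h2 ▸ hreads h' t' s2 3 (by omega) _ (henc t') rfl)
    obtain rfl := hinj e0
    obtain rfl := Subtype.ext (hinj e3)
    exact haa rfl

end DoubleCorrectness

/-! ## Sufficiency -/

section Sufficiency

theorem Prog.Computes.mono {p : Prog} {s t : ℕ} {inp out : List (List Bool)} (h : p.Computes s inp out)
    (hst : s ≤ t) : p.Computes t inp out := by
  obtain ⟨n, τ, hn, hx⟩ := h
  exact ⟨n, τ, hn.trans hst, hx⟩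

variable {ι : Type u} {G : ι → Type v} [∀ x, Group (G x)] [∀ x, Fintype (G x)]

/-- There are at most `2 ^ E.len x` strings of the length `E.len x`. -/
theorem GroupEncoding.log_card_le (E : GroupEncoding G) (x : ι) :
    Nat.log 2 (Fintype.card (G x)) ≤ E.len x := by
  have h : Fintype.card (G x) ≤ 2 ^ E.len x := by
    have := Fintype.card_le_of_injective (fun (g : G x) (i : Fin (E.len x)) => (E.enc x g).getD i false)
      (fun g h e => E.enc_injective x (List.ext_getElem ((E.length_enc x g).trans
        (E.length_enc x h).symm) fun i h1 h2 => by
          have := congrFun e ⟨i, E.length_enc x g ▸ h1⟩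
          simpa [h1, h2] using this))
    simpa using this
  exact (Nat.log_mono_right h).trans (Nat.log_pow one_lt_two _).le

/-- An algorithm that writes a circuit is told the length of the encodings and not the order of the
group. The bound on the right is one that it can compute. -/
theorem GroupEncoding.polylog_le (E : GroupEncoding G) (x : ι) (k c : ℕ) :
    polylog (G x) k c ≤ (E.len x + k + 2) ^ c := by
  have := E.log_card_le x
  exact Nat.pow_le_pow_left (by omega) c

/-- Computability in polynomial time in terms of the order of a group. -/
theorem PS.computes_polylog {α : Type w} {X : Ctx α} {f : α → List Bool} (hf : PS X f) (hX : X.n = 3)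
    (E : GroupEncoding G) (x : α → ι) (k : α → ℕ) (h0 : ∀ a, (X.R a 0).length ≤ (E.name (x a)).length)
    (h1 : ∀ a, (X.R a 1).length ≤ E.len (x a)) (h2 : ∀ a, (X.R a 2).length ≤ k a) :
    ∃ (p : Prog) (c : ℕ), ∀ a, p.Computes (polylog (G (x a)) (k a) c)
      [X.R a 0, X.R a 1, X.R a 2] [f a] := by
  obtain ⟨p, t, ht, hp⟩ := hf.computes hX
  obtain ⟨c₀, hc₀⟩ := E.short
  obtain ⟨c, hc⟩ := ht.comp (((PolyB.id.add (PolyB.const 2)).pow c₀).add PolyB.id)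
  refine ⟨p, c, fun a => (hp a _ fun v hv => ?_).mono (hc (Nat.log 2 (Fintype.card (G (x a))) + k a))⟩
  have hle : polylog (G (x a)) 0 c₀ ≤ (Nat.log 2 (Fintype.card (G (x a))) + k a + 2) ^ c₀ :=
    Nat.pow_le_pow_left (by omega) c₀
  have h0 := h0 a
  have h1 := h1 a
  have h2 := h2 a
  obtain ⟨h3, h4⟩ := hc₀ (x a)
  interval_cases v <;> omega

theorem PC.doubleCirc {α : Type w} {X : Ctx α} (pf pm pq : Prog) {name : α → List Bool} {n k W : α → ℕ}
    (hname : PS X name) (hn : PN X n) (hk : PN X k) (hW : PN X W) :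
    PC X fun a => doubleCirc pf pm pq (name a) (n a) (k a) (W a) := by
  have hs : ∀ r : ℕ, PN X fun a => r * n a := fun r => (PN.const X r).mul hn
  have hf := (hs 5).add hW
  have hslot : ∀ r : ℕ, PSrc X fun a => .wires (r * n a) (n a) := fun r => PSrc.wires (hs r) hn
  have h1 := PC.oracle pf (PSrc.three (PSrc.const hname) (hslot 1) (hslot 0)) hW hf hn 2
    (o := fun a => [3 * n a, 5 * n a]) (fun _ => rfl) fun r hr => by
      interval_cases r
      · exact hs 3
      · exact hs 5
  have h2 := PC.oracle pm (PSrc.three (PSrc.const hname) (hslot 3) (hslot 5)) hW hf hn 1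
    (o := fun a => [0 * n a]) (fun _ => rfl) fun r hr => by
      interval_cases r
      exact hs 0
  have h3 := PC.interpret pq (PSrc.three (PSrc.const hname) (hslot 0) (PSrc.const hk)) hW (hs 5) hf
  exact (h1.append (h2.append (PC.moveSlot hn 1 0))).append (h3.append
    ((PC.moveSlot hn 5 1).append ((PC.moveSlot hn 7 2).append (PC.moveSlot hn 6 4))))

theorem precision_nonneg {δ : ℕ → ℝ} (hδ : δ = (fun _ => 0) ∨ δ = fun k => (1 / 2) ^ k) (k : ℕ) :
    0 ≤ δ k := by
  rcases hδ with rfl | rfl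
  · exact le_rfl
  · positivity

theorem efficientDoubleQFT_of (E : GroupEncoding G) (T : ∀ x, G x → Set (G x))
    (B : ∀ x (h : G x), FourierBasis (Zc h)) (L : ∀ x (h : G x), FourierCode (Zc h) (E.len x))
    {δ : ℕ → ℝ} (hδ : δ = (fun _ => 0) ∨ δ = fun k => (1 / 2) ^ k) (hmul : EfficientMul E)
    (hqft : EfficientCentralizerQFT E B L δ) (hfac : EfficientFactorization E T) :
    EfficientDoubleQFT E T B L δ := by
  obtain ⟨pm, cm, hm⟩ := hmul
  obtain ⟨Q, pq, cq, hq⟩ := hqft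
  obtain ⟨pf, cf, hf⟩ := hfac
  obtain ⟨X, hX⟩ : ∃ X : Ctx (ι × ℕ), X = ⟨3, fun a r =>
    [E.name a.1, unary (E.len a.1), unary a.2].getD r []⟩ := ⟨_, rfl⟩
  have hname : PS X fun a => E.name a.1 :=
    (PS.read X (v := 0) (by rw [hX]; change 0 < 3; omega)).congr fun a => by rw [hX]; rfl
  have hn : PN X fun a => E.len a.1 :=
    (PS.read X (v := 1) (by rw [hX]; change 1 < 3; omega)).congr fun a => by rw [hX]; rfl
  have hk : PN X fun a => a.2 :=
    (PS.read X (v := 2) (by rw [hX]; change 2 < 3; omega)).congr fun a => by rw [hX]; rfl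
  have hpow : ∀ c, PN X fun a => (E.len a.1 + a.2 + 2) ^ c := fun c =>
    ((hn.add hk).add (PN.const X 2)).pow c
  -- The width `W` exceeds every sum of input lengths and running times that occurs, leaves room for
  -- three labels, and is computable from the given data.
  have hW : PN X fun a => (E.name a.1).length + E.len a.1 + a.2 + ((E.len a.1 + a.2 + 2) ^ cf +
      (E.len a.1 + a.2 + 2) ^ cm + (E.len a.1 + a.2 + 2) ^ cq) + 3 * E.len a.1 :=
    (((hname.length.add hn).add hk).add (((hpow cf).add (hpow cm)).add (hpow cq))).add
      ((PN.const X 3).mul hn)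
  obtain ⟨p, c, hp⟩ := PS.computes_polylog (PC.doubleCirc pf pm pq hname hn hk hW) (by rw [hX]) E
    (fun a => a.1) (fun a => a.2) (fun a => by rw [hX]; exact le_rfl)
    (fun a => by rw [hX]; exact (length_unary _).le) (fun a => by rw [hX]; exact (length_unary _).le)
  have hcirc : ∀ (x : ι) (k : ℕ), ∃ D : Circuit, D.map Gate.toRaw =
      doubleCirc pf pm pq (E.name x) (E.len x) k ((E.name x).length + E.len x + k +
        ((E.len x + k + 2) ^ cf + (E.len x + k + 2) ^ cm + (E.len x + k + 2) ^ cq) + 3 * E.len x) :=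
    fun x k => exists_circuit _ (doubleCirc_valid pf pm pq _ (by omega))
  choose D hD using hcirc
  refine ⟨D, p, c, fun x k => ⟨?_, ?_⟩⟩
  · have := hp (x, k)
    rw [hX] at this
    rw [Circuit.code_eq, hD]
    exact this
  · have hle : ∀ c, polylog (G x) 0 c ≤ (E.len x + k + 2) ^ c := fun c =>
      (E.polylog_le x 0 c).trans (Nat.pow_le_pow_left (by omega) c)
    have hmle := hle cm
    have hfle := hle cf
    have hqle := E.polylog_le x k cq
    refine (carriesOut_iff _ _ _ _ _).2 fun v => ?_
    rw [hD]
    exact doubleCirc_defect (B x) (L x) (E.length_enc x) (E.enc_injective x) (precision_nonneg hδ k)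
      (hf x) (hm x) (fun h => (Q x h k).map Gate.toRaw) (fun h => Circuit.map_toRaw_valid _)
      (fun h => by rw [← Circuit.code_eq]; exact (hq x h k).1)
      (fun h => (carriesOut_iff _ _ _ _ _).1 (hq x h k).2) (by omega) (by omega) (by omega) (by omega) v

end Sufficiency

/-! ## The Fourier transform of a centralizer -/

section Translates

variable {H : Type u} [Group H] [Fintype H]

/-- The left translates of a Fourier basis. -/
noncomputable def FourierBasis.translate (B : FourierBasis H) (t : H) : FourierBasis H where
  vec a := leftTranslate t (B.vec a)
  orthonormal := B.orthonormal.comp_linearIsometry (leftTranslate t).toLinearIsometry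
  span_eq_top := by
    have h : Set.range (fun a => leftTranslate t (B.vec a)) =
        (leftTranslate t).toLinearEquiv.toLinearMap '' Set.range B.vec := by
      rw [← Set.range_comp]; rfl
    rw [h, ← Submodule.map_span, B.span_eq_top, Submodule.map_top, LinearEquiv.range]
  isotypic ρ j := by
    obtain ⟨ψ, h1, h2, h3⟩ := B.isotypic ρ j
    refine ⟨ψ, h1, ?_, h3⟩
    have h : Set.range (fun i => leftTranslate t (B.vec ⟨ρ, i, j⟩)) =
        (leftTranslate t).toLinearEquiv.toLinearMap '' Set.range fun i => B.vec ⟨ρ, i, j⟩ := by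
      rw [← Set.range_comp]; rfl
    rw [h, ← Submodule.map_span, ← h2]
    -- The span over `i` is the range of an equivariant map, so translation takes it onto itself and
    -- `ψ` can be kept.
    have hψ : ∀ w, leftTranslate t (ψ w) = ψ (ρ.rep t w) := fun w => by
      ext y
      rw [leftTranslate_apply]
      exact (h3 t w y).symm
    ext w
    constructor
    · rintro ⟨w, rfl⟩
      refine ⟨ψ (ρ.rep t⁻¹ w), ⟨_, rfl⟩, ?_⟩
      change leftTranslate t (ψ (ρ.rep t⁻¹ w)) = _
      rw [hψ, ← Module.End.mul_apply, ← map_mul, mul_inv_cancel, map_one]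
      rfl
    · rintro ⟨_, ⟨w, rfl⟩, rfl⟩
      exact ⟨ρ.rep t w, (hψ w).symm⟩

theorem FourierBasis.translate_one (B : FourierBasis H) : B.translate 1 = B := by
  cases B
  simp [FourierBasis.translate]

theorem l2norm_of_orthonormal {β E : Type*} [NormedAddCommGroup E] [InnerProductSpace ℂ E]
    {b : β → E} (hb : Orthonormal ℂ b) (c : β →₀ ℂ) :
    ‖Finsupp.linearCombination ℂ b c‖ = l2norm c := by
  rw [l2norm_eq, norm_eq_sqrt_re_inner (𝕜 := ℂ), hb.inner_finsupp_eq_sum_left]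
  rfl

end Translates

/-! ### Product states as superpositions of translates -/

section Tensors

open scoped symmDiff

variable {β : Type*}

/-- The superposition of the translates of a state. -/
noncomputable def translates (r : β → BasisState) (φ : QState) : (β →₀ ℂ) →ₗ[ℂ] QState :=
  Finsupp.linearCombination ℂ fun a => qtrans (r a) φ

theorem translates_add (r : β → BasisState) (φ φ' : QState) (c : β →₀ ℂ) :
    translates r (φ + φ') c = translates r φ c + translates r φ' c := by
  simp only [translates, Finsupp.linearCombination_apply, map_add, smul_add, Finsupp.sum_add]

/-- If `φ` lives on the wires below `M` and the patterns `r a` on the others, `translates r φ c` is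
the product of `φ` with `∑ c_a |r a⟩`, and a circuit on the wires below `M` acts on the first
factor. -/
theorem rapply_translates {C : List Raw} {M : ℕ} (hC : ∀ g ∈ C, g.On fun w => w < M)
    {r : β → BasisState} (hr : ∀ a w, w < M → r a w = false) (φ : QState) (c : β →₀ ℂ) :
    rapply C (translates r φ c) = translates r (rapply C φ) c := by
  rw [translates, translates, Finsupp.linearCombination_apply, Finsupp.linearCombination_apply,
    Finsupp.sum, Finsupp.sum, map_sum]
  refine Finset.sum_congr rfl fun a _ => ?_
  rw [map_smul, rapply_qtrans fun g hg => (hC g hg).mono (hr a)]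

theorem translates_single (r : β → BasisState) (s : BasisState) (c : β →₀ ℂ) :
    translates r (Finsupp.single s 1) c = Finsupp.mapDomain (fun a => s ∆ r a) c := by
  simp only [translates, Finsupp.linearCombination_apply, qtrans_single, Finsupp.smul_single,
    smul_eq_mul, mul_one]
  rfl

theorem rapply_mapDomain_classical {C : List Raw} (hC : ∀ g ∈ C, g.Cl) {f f' : β → BasisState}
    (h : ∀ a, ract C (f a) = f' a) (c : β →₀ ℂ) :
    rapply C (Finsupp.mapDomain f c) = Finsupp.mapDomain f' c := by
  rw [Finsupp.mapDomain, Finsupp.mapDomain, Finsupp.sum, Finsupp.sum, map_sum]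
  exact Finset.sum_congr rfl fun a _ => by rw [rapply_classical hC, h]

theorem rapply_translates_mapDomain {γ : Type*} {C : List Raw} (hC : ∀ g ∈ C, g.Cl)
    {r r' : β → BasisState} {f : γ → BasisState} (h : ∀ a b, ract C (f b ∆ r a) = f b ∆ r' a)
    (d : γ →₀ ℂ) (c : β →₀ ℂ) :
    rapply C (translates r (Finsupp.mapDomain f d) c) = translates r' (Finsupp.mapDomain f d) c := by
  rw [translates, translates, Finsupp.linearCombination_apply, Finsupp.linearCombination_apply,
    Finsupp.sum, Finsupp.sum, map_sum]
  refine Finset.sum_congr rfl fun a _ => ?_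
  rw [map_smul, qtrans, qtrans, Finsupp.lmapDomain_apply, Finsupp.lmapDomain_apply,
    ← Finsupp.mapDomain_comp, ← Finsupp.mapDomain_comp]
  congr 1
  exact rapply_mapDomain_classical hC (h a) d

/-- The norm of a product state is the product of the norms: the wires from `M` on determine `a`, so
the translates have disjoint supports. -/
theorem l2norm_translates {M : ℕ} {r : β → BasisState} (hr : ∀ a w, w < M → r a w = false)
    (hinj : Function.Injective r) {φ : QState} (hφ : φ ∈ lowStates M) (c : β →₀ ℂ) :
    l2norm (translates r φ c) = l2norm c * l2norm φ := by
  classical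
  have h : l2norm (translates r φ c) ^ 2 = (l2norm c * l2norm φ) ^ 2 := by
    rw [translates, Finsupp.linearCombination_apply, l2norm_sq_combination, mul_pow, l2norm_sq c,
      Finsupp.sum_mul]
    · exact Finsupp.sum_congr fun a _ => by rw [qtrans_l2norm]
    · intro a _ b _ hab
      rw [Finset.disjoint_left]
      intro s hs hs'
      obtain ⟨s1, h1, rfl⟩ := Finset.mem_image.1 (Finsupp.mapDomain_support hs)
      obtain ⟨s2, h2, h3⟩ := Finset.mem_image.1 (Finsupp.mapDomain_support hs')
      refine hab (hinj (funext fun w => ?_))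
      rcases Nat.lt_or_ge w M with hw | hw
      · rw [hr a w hw, hr b w hw]
      · have := congrFun h3 w
        rwa [symmDiff_apply_bool, symmDiff_apply_bool, mem_lowStates.1 hφ s1 h1 w hw,
          mem_lowStates.1 hφ s2 h2 w hw, Bool.false_xor, Bool.false_xor, eq_comm] at this
  exact (pow_left_inj₀ (l2norm_nonneg _) (mul_nonneg (l2norm_nonneg _) (l2norm_nonneg _))
    two_ne_zero).1 h

end Tensors

/-! ### Moving the result of the first use of `U` out of its way -/

section Shift

open scoped symmDiff

/-- The state with the first `M` wires moved to the next `M` wires. -/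
def shiftUp (M : ℕ) (s : BasisState) : BasisState := insertData M M ⊥ s

theorem shiftUp_of_lt {M w : ℕ} {s : BasisState} (h : w < M) : shiftUp M s w = false :=
  if_neg (by omega)

theorem shiftUp_symmDiff (M : ℕ) (s d : BasisState) :
    shiftUp M (s ∆ d) = shiftUp M s ∆ shiftUp M d := by
  funext w
  simp only [shiftUp, insertData, symmDiff_apply_bool]
  split_ifs <;> rfl

theorem shiftUp_blk {M o : ℕ} {l : List Bool} (h : o + l.length ≤ M) :
    shiftUp M (blk o l) = blk (M + o) l := by
  funext w
  simp only [shiftUp, insertData]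
  split_ifs with hw
  · obtain ⟨i, rfl⟩ := Nat.exists_eq_add_of_le hw.1
    rw [Nat.add_sub_cancel_left]
    by_cases hi : o ≤ i
    · obtain ⟨j, rfl⟩ := Nat.exists_eq_add_of_le hi
      rw [blk_add, ← Nat.add_assoc, blk_add]
    · rw [blk_of_lt (by omega), blk_of_lt (by omega)]
  · rcases (by omega : w < M ∨ M + M ≤ w) with h' | h'
    · rw [blk_of_lt (by omega)]; rfl
    · rw [blk_of_le (by omega)]; rfl

/-- Move the first `M` wires to the next `M` wires. -/
def moveUp (M : ℕ) : List Raw := addWires 0 M M ++ addWires M 0 M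

theorem moveUp_tidy (M : ℕ) : Tidy (fun _ => True) (moveUp M) :=
  ((addWires_tidy (by omega)).mono fun _ _ => trivial).append
    ((addWires_tidy (by omega)).mono fun _ _ => trivial)

theorem moveUp_spec {M : ℕ} {s : BasisState} (h : ∀ w, M ≤ w → s w = false) :
    ract (moveUp M) s = shiftUp M s := by
  obtain ⟨l, hl⟩ : ∃ l, l = (List.range M).map s := ⟨_, rfl⟩
  have hlen : l.length = M := by simp [hl]
  have hget : ∀ j < M, s j = l.getD j false := fun j hj => by simp [hl, hj]
  have hs : s = blk 0 l := by
    funext w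
    rcases Nat.lt_or_ge w M with hw | hw
    · have := blk_add 0 l w
      rw [Nat.zero_add] at this
      rw [this, hget w hw]
    · rw [h w hw, blk_of_le (by omega)]
  have hup : shiftUp M s = blk M l := by rw [hs, shiftUp_blk (by omega), Nat.add_zero]
  have e1 : ract (addWires 0 M M) s = s ∆ blk M l := addWires_spec (by omega) ⟨hlen, fun j hj => by
    rw [Nat.zero_add, hget j hj]⟩
  have e2 : ract (addWires M 0 M) (s ∆ blk M l) = s ∆ blk M l ∆ blk 0 l :=
    addWires_spec (by omega) ⟨hlen, fun j hj => by
      rw [symmDiff_apply_bool, h _ (by omega), blk_add, Bool.false_xor]⟩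
  rw [moveUp, ract_append, e1, e2, hup, ← hs, symmDiff_comm s, symmDiff_assoc, symmDiff_self,
    symmDiff_bot]

end Shift

/-! ### The circuit of the Fourier transform over a centralizer -/

section CentralizerTransform

open scoped symmDiff

/-- Add two copies of a string. -/
def setTwo (n : ℕ) (a : List Bool) : List Raw := setBits (0 * n) a ++ setBits (1 * n) a

/-- Remove the string `a` and move the registers to their final places. -/
def finishCirc (n : ℕ) (a : List Bool) : List Raw :=
  setBits (0 * n) a ++ (moveSlot n 1 0 ++ moveSlot n 4 1)

/-- The circuit of the Fourier transform of the centralizer of the element encoded by `a`. -/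
def centralizerCirc (U : List Raw) (n M : ℕ) (a : List Bool) : List Raw :=
  -- With `h` adjoined, `U` produces `h, ρ, j, t, i`. This is moved to the second block of `M`
  -- wires, and `U` is applied to `|h, h⟩` on the first block. The outcome is a superposition of
  -- labels that all contain the same `t` in slot `3`, so adding this slot to its counterpart erases
  -- `t` there. Then `|h, h⟩` is restored and removed, the result is moved back, and the known `h`
  -- is cleared.
  setBits (1 * n) a ++ (U ++ ((moveUp M ++ setTwo n a) ++ (U ++ (addWires (3 * n) (M + 3 * n) n ++
    (rinv U ++ (rinv (setTwo n a) ++ (rinv (moveUp M) ++ finishCirc n a)))))))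

theorem setBits_tidy' (o : ℕ) (l : List Bool) : Tidy (fun _ => True) (setBits o l) :=
  (setBits_tidy o l).mono fun _ _ => trivial

theorem setTwo_tidy (n : ℕ) (a : List Bool) : Tidy (fun _ => True) (setTwo n a) :=
  (setBits_tidy' _ _).append (setBits_tidy' _ _)

theorem setTwo_spec {n : ℕ} {a : List Bool} (ha : a.length = n) (s : BasisState) :
    ract (setTwo n a) s = slots n [a, a] ∆ s := by
  have h : slots n [a, a] = blk (0 * n) a ∆ blk (1 * n) a := by
    have h0 : slots n [[], []] = ⊥ := by
      rw [show ([[], []] : List (List Bool)) = [] ++ List.replicate 2 [] from rfl,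
        slots_append_replicate]
      funext w
      simp [slots]
    rw [← bot_symmDiff (blk (0 * n) a), ← h0, slots_put (by simp) ha.le rfl,
      slots_put (by simp) ha.le rfl]
    rfl
  rw [setTwo, ract_append, setBits_spec, setBits_spec, h, symmDiff_assoc, symmDiff_comm s]

theorem finishCirc_tidy (n : ℕ) (a : List Bool) : Tidy (fun _ => True) (finishCirc n a) :=
  (setBits_tidy' _ _).append ((moveSlot_tidy (by omega)).append (moveSlot_tidy (by omega)))

theorem finishCirc_spec {n : ℕ} {a i c r : List Bool} (ha : a.length = n) (hi : i.length = n)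
    (hr : r.length = n) : ract (finishCirc n a) (slots n [a, i, c, [], r]) =
      slots n [i, r, c, [], []] := by
  rw [finishCirc, ract_append, ract_append, setBits_spec, slots_erase (by simp) ha.le rfl]
  change ract _ (ract _ (slots n [[], i, c, [], r])) = _
  rw [moveSlot_spec i (by omega) (by simp) (by simp) hi rfl rfl,
    moveSlot_spec r (by omega) (by simp) (by simp) hr rfl rfl]
  rfl

theorem centralizerCirc_valid {U : List Raw} (hU : ∀ g ∈ U, g.Valid) {n M : ℕ} (hM : 5 * n ≤ M)
    (a : List Bool) : ∀ g ∈ centralizerCirc U n M a, g.Valid := by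
  intro g hg
  simp only [centralizerCirc, List.mem_append] at hg
  rcases hg with hg | hg | (hg | hg) | hg | hg | hg | hg | hg | hg
  · exact (setBits_tidy' _ _).valid g hg
  · exact hU g hg
  · exact (moveUp_tidy M).valid g hg
  · exact (setTwo_tidy n a).valid g hg
  · exact hU g hg
  · exact (addWires_tidy (by omega)).valid g hg
  · exact rinv_forall hU g hg
  · exact (setTwo_tidy n a).rinv.valid g hg
  · exact (moveUp_tidy M).rinv.valid g hg
  · exact (finishCirc_tidy n a).valid g hg

end CentralizerTransform

/-! ### Correctness of the circuit for a centralizer -/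

section CentralizerCorrectness

open scoped symmDiff

/-- The errors of the three uses of `U` add up. -/
theorem centralizerCirc_error {β : Type*} {U : List Raw} {n M : ℕ} {a t : List Bool}
    {irr row col : β → List Bool} {ε : ℝ} (hU : ∀ g ∈ U, g.Valid) (hon : ∀ g ∈ U, g.On fun w => w < M)
    (hM : 5 * n ≤ M) (ha : a.length = n) (ht : t.length = n) (hi : ∀ b, (irr b).length = n)
    (hr : ∀ b, (row b).length = n) (hc : ∀ b, (col b).length = n)
    (hinj : Function.Injective fun b => slots n [irr b, row b, col b]) {c c₀ : β →₀ ℂ} {ψ : QState}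
    (h : l2norm (rapply U ψ - Finsupp.mapDomain (fun b => slots n [a, irr b, col b, t, row b]) c) ≤
      ε * l2norm c)
    (h₀ : l2norm (rapply U (Finsupp.single (slots n [a, a]) 1) -
      Finsupp.mapDomain (fun b => slots n [a, irr b, col b, t, row b]) c₀) ≤ ε) :
    l2norm (rapply (U ++ ((moveUp M ++ setTwo n a) ++ (U ++ (addWires (3 * n) (M + 3 * n) n ++
      (rinv U ++ (rinv (setTwo n a) ++ (rinv (moveUp M) ++ finishCirc n a))))))) ψ -
      Finsupp.mapDomain (fun b => slots n [irr b, row b, col b]) c) ≤ 3 * ε * l2norm c := by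
  obtain ⟨f, hf⟩ : ∃ f : β → BasisState, ∀ b, f b = slots n [a, irr b, col b, t, row b] :=
    ⟨_, fun _ => rfl⟩
  obtain ⟨f', hf'⟩ : ∃ f : β → BasisState, ∀ b, f b = slots n [a, irr b, col b, [], row b] :=
    ⟨_, fun _ => rfl⟩
  obtain ⟨s, hs⟩ : ∃ s, s = slots n [a, a] := ⟨_, rfl⟩
  obtain ⟨r, hr0⟩ : ∃ r : β → BasisState, ∀ b, r b = shiftUp M (f b) := ⟨_, fun _ => rfl⟩
  obtain ⟨r', hr'⟩ : ∃ r : β → BasisState, ∀ b, r b = shiftUp M (f' b) := ⟨_, fun _ => rfl⟩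
  simp only [← hf, ← hs] at h h₀
  have hflow : ∀ b w, M ≤ w → f b w = false := fun b w hw => by
    rw [hf]
    exact slots_of_le (by simp [ha, ht, hi, hr, hc]) (by simp; omega)
  have hflow' : ∀ b w, M ≤ w → f' b w = false := fun b w hw => by
    rw [hf']
    exact slots_of_le (by simp [ha, hi, hr, hc]) (by simp; omega)
  have hslow : ∀ w, M ≤ w → s w = false := fun w hw => by
    rw [hs]
    exact slots_of_le (by simp [ha]) (by simp; omega)
  have hrl : ∀ b w, w < M → r b w = false := fun b w hw => by rw [hr0, shiftUp_of_lt hw]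
  have hrl' : ∀ b w, w < M → r' b w = false := fun b w hw => by rw [hr', shiftUp_of_lt hw]
  have hff : ∀ b, f b ∆ blk (3 * n) t = f' b := fun b => by
    rw [hf, hf', slots_erase (by simp) ht.le rfl]
    rfl
  have hrr : ∀ b, r b ∆ blk (M + 3 * n) t = r' b := fun b => by
    rw [hr0, hr', ← hff, shiftUp_symmDiff, shiftUp_blk (by omega)]
  have hfin : ∀ b, ract (rinv (setTwo n a) ++ (rinv (moveUp M) ++ finishCirc n a)) (s ∆ r' b) =
      slots n [irr b, row b, col b] := fun b => by
    rw [hs, ← setTwo_spec ha, ract_append, ract_append, (setTwo_tidy n a).ract_rinv, hr',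
      ← moveUp_spec (hflow' b), (moveUp_tidy M).ract_rinv, hf', finishCirc_spec ha (hi b) (hr b),
      slots_eq_replicate [irr b, row b, col b] 2]
    rfl
  have hinj' : Function.Injective r' := fun b b' e => hinj (by
    change slots n _ = slots n _
    rw [← hfin, ← hfin, e])
  have hinj0 : Function.Injective r := fun b b' e => hinj' (by rw [← hrr, ← hrr, e])
  obtain ⟨F, hF⟩ : ∃ F, F = rinv (setTwo n a) ++ (rinv (moveUp M) ++ finishCirc n a) := ⟨_, rfl⟩
  obtain ⟨A, hA⟩ : ∃ A, A = addWires (3 * n) (M + 3 * n) n := ⟨_, rfl⟩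
  obtain ⟨N, hN⟩ : ∃ N, N = moveUp M ++ setTwo n a := ⟨_, rfl⟩
  have hFt : Tidy (fun _ => True) F := by
    rw [hF]
    exact (setTwo_tidy n a).rinv.append ((moveUp_tidy M).rinv.append (finishCirc_tidy n a))
  have hAt : Tidy (fun _ => True) A := by
    rw [hA]
    exact (addWires_tidy (by omega)).mono fun _ _ => trivial
  have hNt : Tidy (fun _ => True) N := by
    rw [hN]
    exact (moveUp_tidy M).append (setTwo_tidy n a)
  rw [← hF] at hfin ⊢
  rw [← hA, ← hN]
  -- The errors of `U`: `d` on the given state, and `d₀` on the state with two copies of `a`.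
  obtain ⟨d, hd⟩ : ∃ d, d = rapply U ψ - Finsupp.mapDomain f c := ⟨_, rfl⟩
  obtain ⟨d₀, hd₀⟩ : ∃ d, d = rapply U (Finsupp.single s 1) - Finsupp.mapDomain f c₀ := ⟨_, rfl⟩
  have hfc : Finsupp.mapDomain f c₀ ∈ lowStates M := by
    rw [Finsupp.mapDomain]
    exact Submodule.sum_mem _ fun b _ => single_mem_lowStates (hflow b) _
  have hdlow : d₀ ∈ lowStates M := by
    rw [hd₀]
    exact Submodule.sub_mem _ (rapply_mem_lowStates hon (single_mem_lowStates hslow 1)) hfc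
  have eN : rapply N (Finsupp.mapDomain f c) = translates r (Finsupp.single s 1) c := by
    rw [translates_single]
    refine rapply_mapDomain_classical hNt.cl (fun b => ?_) c
    rw [hN, ract_append, moveUp_spec (hflow b), setTwo_spec ha, hs, hr0]
  have eA : rapply A (translates r (Finsupp.mapDomain f c₀) c) =
      translates r' (Finsupp.mapDomain f c₀) c := by
    refine rapply_translates_mapDomain hAt.cl (fun b b' => ?_) c₀ c
    rw [hA, addWires_spec (l := t) (by omega) ⟨ht, fun j hj => ?_⟩, symmDiff_assoc, hrr]
    rw [symmDiff_apply_bool, hrl _ _ (by omega), Bool.xor_false, hf]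
    exact (slots_reads (r := 3) (l := [a, irr b', col b', t, row b']) ht rfl).2 j hj
  have eU : rapply U (Finsupp.single s 1) = Finsupp.mapDomain f c₀ + d₀ := by
    rw [hd₀, add_sub_cancel]
  have eF : rapply F (translates r' (Finsupp.single s 1) c) =
      Finsupp.mapDomain (fun b => slots n [irr b, row b, col b]) c := by
    rw [translates_single]
    exact rapply_mapDomain_classical hFt.cl hfin c
  have eV : rapply (rinv U) (translates r' (Finsupp.mapDomain f c₀) c) =
      translates r' (Finsupp.single s 1) c - rapply (rinv U) (translates r' d₀ c) := by
    rw [eq_sub_iff_add_eq, ← map_add, ← translates_add, ← eU,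
      rapply_translates (rinv_forall hon) hrl', rapply_rinv hU]
  have hV := rinv_forall (Q := Raw.Valid) hU
  -- Without errors the result would be exact. The error `d` enters once. The error `d₀` enters
  -- twice: in the second use of `U`, and when the inverse is applied to the ideal superposition
  -- instead of the true image of `s`.
  have total : rapply (U ++ (N ++ (U ++ (A ++ (rinv U ++ F))))) ψ -
      Finsupp.mapDomain (fun b => slots n [irr b, row b, col b]) c =
      rapply (N ++ (U ++ (A ++ (rinv U ++ F)))) d +
        (rapply F (rapply (rinv U) (rapply A (translates r d₀ c))) -
          rapply F (rapply (rinv U) (translates r' d₀ c))) := by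
    rw [rapply_append, show rapply U ψ = Finsupp.mapDomain f c + d by rw [hd, add_sub_cancel], map_add]
    simp only [rapply_append]
    rw [eN, rapply_translates hon hrl, eU, translates_add, map_add, eA, map_add, eV, map_add, map_sub,
      eF]
    abel
  have n1 : l2norm (rapply (N ++ (U ++ (A ++ (rinv U ++ F)))) d) ≤ ε * l2norm c := by
    simp only [rapply_append]
    rw [rapply_l2norm hFt.valid, rapply_l2norm hV, rapply_l2norm hAt.valid, rapply_l2norm hU,
      rapply_l2norm hNt.valid, hd]
    exact h
  have hd₀' : l2norm c * l2norm d₀ ≤ ε * l2norm c := by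
    rw [mul_comm]
    exact mul_le_mul_of_nonneg_right (by rw [hd₀]; exact h₀) (l2norm_nonneg c)
  have n2 : l2norm (rapply F (rapply (rinv U) (rapply A (translates r d₀ c)))) ≤ ε * l2norm c := by
    rw [rapply_l2norm hFt.valid, rapply_l2norm hV, rapply_l2norm hAt.valid,
      l2norm_translates hrl hinj0 hdlow]
    exact hd₀'
  have n3 : l2norm (rapply F (rapply (rinv U) (translates r' d₀ c))) ≤ ε * l2norm c := by
    rw [rapply_l2norm hFt.valid, rapply_l2norm hV, l2norm_translates hrl' hinj' hdlow]
    exact hd₀'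
  rw [total]
  refine (l2norm_add_le _ _).trans ?_
  have n4 := l2norm_sub_le (rapply F (rapply (rinv U) (rapply A (translates r d₀ c)))) 0
    (rapply F (rapply (rinv U) (translates r' d₀ c)))
  rw [sub_zero, l2norm_sub_comm 0, sub_zero] at n4
  linarith

variable {G : Type u} [Group G] [Fintype G] {n : ℕ} {enc : G → List Bool}

theorem defect_mapDomain_block {T : G → Set G} (B : ∀ h : G, FourierBasis (Zc h))
    (L : ∀ h : G, FourierCode (Zc h) n) (henc : ∀ g, (enc g).length = n) (U : List Raw) (h : G) (t : T h)
    (c : FourierIndex (Zc h) →₀ ℂ) :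
    defect U (fun gh : G × G => BasisState.ofBits (enc gh.1 ++ enc gh.2)) (doubleBasis T B)
      (doubleOut enc L) (Finsupp.mapDomain (fun b => ⟨h, t, b⟩) c) =
      rapply U (∑ z : Zc h, Finsupp.single (slots n [enc (t * z : G), enc h])
        (Finsupp.linearCombination ℂ (B h).vec c z)) -
      Finsupp.mapDomain (fun b : FourierIndex (Zc h) => slots n [enc h, (L h).irr b.1,
        (L h).col b.1 b.2.2, enc t, (L h).row b.1 b.2.1]) c := by
  have hlin : Finsupp.linearCombination ℂ (doubleBasis T B) (Finsupp.mapDomain (fun b => ⟨h, t, b⟩) c) =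
      cosetMap h t (Finsupp.linearCombination ℂ (B h).vec c) := by
    rw [Finsupp.linearCombination_mapDomain, Finsupp.apply_linearCombination]
    rfl
  refine (defect_apply _ _ _ _ _).trans ?_
  rw [← Finsupp.mapDomain_comp]
  congr 2
  · refine (congrArg (loadState _) hlin).trans ((loadState_cosetMap _ _ _ _).trans ?_)
    refine Finset.sum_congr rfl fun z _ => ?_
    rw [← ofBits_flatten (by simp [henc])]
    simp
  · funext b
    rw [Function.comp_apply, doubleOut_eq henc]

/-- Translation by `t` moves the amplitude at `z` to `t z`. With `h` adjoined this is the vector of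
`D(G)` over the coset representative `t`, and it is why the basis has to be translated. -/
theorem rapply_setBits_translate (henc : ∀ g, (enc g).length = n) {h : G} (B : FourierBasis (Zc h))
    (t : Zc h) (c : FourierIndex (Zc h) →₀ ℂ) :
    rapply (setBits (1 * n) (enc h)) (loadState (fun z : Zc h => BasisState.ofBits (enc z))
      (Finsupp.linearCombination ℂ (B.translate t).vec c)) =
      ∑ z : Zc h, Finsupp.single (slots n [enc (t * z : G), enc h])
        (Finsupp.linearCombination ℂ B.vec c z) := by
  have hlin : Finsupp.linearCombination ℂ (B.translate t).vec c =
      leftTranslate t (Finsupp.linearCombination ℂ B.vec c) :=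
    (Finsupp.apply_linearCombination ℂ (leftTranslate t).toLinearEquiv.toLinearMap B.vec c).symm
  rw [hlin, loadState, map_sum]
  refine (Fintype.sum_equiv (Equiv.mulLeft t) _ _ fun z => ?_).symm
  rw [rapply_classical (setBits_tidy _ _).cl, setBits_spec, Equiv.coe_mulLeft, leftTranslate_apply,
    inv_mul_cancel_left]
  congr 1
  change slots n [enc (t * z : G), enc h] = BasisState.ofBits (enc (t * z : G)) ∆ _
  have e1 : BasisState.ofBits (enc (t * z : G)) = slots n [enc (t * z : G)] := by
    rw [← ofBits_flatten (l := [enc (t * z : G)]) (by simp [henc])]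
    simp
  rw [e1, slots_eq_replicate [enc (t * z : G)] 1]
  exact (slots_put (r := 1) (l := [enc (t * z : G), []]) (by simp) (henc h).le rfl).symm

theorem FourierBasis.exists_coordinates {H : Type u} [Group H] [Fintype H] (B : FourierBasis H)
    (u : EuclideanSpace ℂ H) : ∃ c, Finsupp.linearCombination ℂ B.vec c = u ∧ l2norm c = ‖u‖ := by
  have hu : u ∈ Submodule.span ℂ (Set.range B.vec) := by
    rw [B.span_eq_top]
    exact Submodule.mem_top
  obtain ⟨c, hc⟩ := (Finsupp.mem_span_range_iff_exists_finsupp (R := ℂ)).1 hu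
  refine ⟨c, hc, ?_⟩
  rw [← l2norm_of_orthonormal B.orthonormal, Finsupp.linearCombination_apply, hc]

/-- The input, once `h` is adjoined, and `|h, h⟩` both lie in the block of `(h, t)`, on which the
error of `U` is bounded by hypothesis. -/
theorem centralizerCirc_defect {T : G → Set G} (B : ∀ h : G, FourierBasis (Zc h))
    (L : ∀ h : G, FourierCode (Zc h) n) (henc : ∀ g, (enc g).length = n) {U : List Raw} {M : ℕ}
    (hU : ∀ g ∈ U, g.Valid) (hon : ∀ g ∈ U, g.On fun w => w < M) (hM : 5 * n ≤ M) {ε : ℝ}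
    (hd : ∀ c, l2norm (defect U (fun gh : G × G => BasisState.ofBits (enc gh.1 ++ enc gh.2))
      (doubleBasis T B) (doubleOut enc L) c) ≤ ε * l2norm c)
    (h : G) (t : Zc h) (ht : (t : G) ∈ T h) (c : FourierIndex (Zc h) →₀ ℂ) :
    l2norm (defect (centralizerCirc U n M (enc h)) (fun z : Zc h => BasisState.ofBits (enc z))
      ((B h).translate t).vec (L h).out c) ≤ 3 * ε * l2norm c := by
  classical
  have hblock : ∀ c : FourierIndex (Zc h) →₀ ℂ,
      l2norm (rapply U (∑ z : Zc h, Finsupp.single (slots n [enc (t * z : G), enc h])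
        (Finsupp.linearCombination ℂ (B h).vec c z)) -
      Finsupp.mapDomain (fun b : FourierIndex (Zc h) => slots n [enc h, (L h).irr b.1,
        (L h).col b.1 b.2.2, enc t, (L h).row b.1 b.2.1]) c) ≤ ε * l2norm c := fun c => by
    have h1 := hd (Finsupp.mapDomain (fun b => ⟨h, ⟨t, ht⟩, b⟩) c)
    rw [l2norm_mapDomain _ fun b b' hb => by simpa using hb] at h1
    exact (congrArg l2norm (defect_mapDomain_block B L henc U h ⟨t, ht⟩ c)).symm.trans_le h1
  -- For `z₀ = t⁻¹ h`, which lies in `Z(h)`, the ket `(t z₀) h^*` is `h h^*`; so the auxiliary state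
  -- is the image of the point mass at `z₀`, of norm 1.
  obtain ⟨z₀, hz₀⟩ : ∃ z : Zc h, z = t⁻¹ * ⟨h, Subgroup.mem_centralizer_singleton_iff.2 rfl⟩ := ⟨_, rfl⟩
  obtain ⟨c₀, hc₀, hc₀n⟩ := (B h).exists_coordinates (EuclideanSpace.single z₀ (1 : ℂ))
  have h₀ := hblock c₀
  rw [hc₀, hc₀n, PiLp.norm_single, norm_one, mul_one,
    Finset.sum_eq_single z₀ (fun z _ hz => by simp [hz]) (by simp)] at h₀
  have hz : enc (t * z₀ : G) = enc h := by rw [hz₀]; simp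
  rw [hz, PiLp.single_apply, if_pos rfl] at h₀
  have hout : (L h).out = fun b : FourierIndex (Zc h) => slots n [(L h).irr b.1, (L h).row b.1 b.2.1,
      (L h).col b.1 b.2.2] := funext (L h).out_eq
  have key := centralizerCirc_error (irr := fun b : FourierIndex (Zc h) => (L h).irr b.1)
    (row := fun b => (L h).row b.1 b.2.1) (col := fun b => (L h).col b.1 b.2.2) hU hon hM (henc h)
    (henc t) (fun b => (L h).length_irr b.1) (fun b => (L h).length_row b.1 b.2.1)
    (fun b => (L h).length_col b.1 b.2.2) (hout ▸ (L h).out_injective) (hblock c) h₀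
  rw [defect_apply, centralizerCirc, rapply_append, rapply_setBits_translate henc, hout]
  exact key

end CentralizerCorrectness

/-! ## Necessity -/

section Necessity

theorem PC.centralizerCirc {α : Type w} {X : Ctx α} {U : α → List Raw} {n M : α → ℕ}
    {s : α → List Bool} (hU : PC X U) (hn : PN X n) (hM : PN X M) (hs : PS X s) :
    PC X fun a => centralizerCirc (U a) (n a) (M a) (s a) := by
  have hr : ∀ r : ℕ, PN X fun a => r * n a := fun r => (PN.const X r).mul hn
  have h0 := PC.setBits (hr 0) hs
  have h1 := PC.setBits (hr 1) hs
  have hmove : PC X fun a => moveUp (M a) :=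
    (PC.addWires (PN.const X 0) hM hM).append (PC.addWires hM (PN.const X 0) hM)
  have htwo : PC X fun a => setTwo (n a) (s a) := h0.append h1
  have hfinish : PC X fun a => finishCirc (n a) (s a) :=
    h0.append ((PC.moveSlot hn 1 0).append (PC.moveSlot hn 4 1))
  exact h1.append (hU.append ((hmove.append htwo).append (hU.append
    ((PC.addWires (hr 3) (hM.add (hr 3)) hn).append (hU.rinv.append (htwo.rinv.append
      (hmove.rinv.append hfinish)))))))

/-- If `1 = t z` is the factorization of the identity, `t = z⁻¹` is in `Z(h)`. When `1` is in the
transversal, uniqueness of the factorization forces `t = 1`. -/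
theorem exists_mem_inter_centralizer {G : Type u} [Group G] {T : G → Set G} {h : G}
    (hT : Subgroup.IsComplement (T h) (Zc h : Set G)) :
    ∃ t : Zc h, (t : G) ∈ T h ∧ (1 ∈ T h → t = 1) := by
  obtain ⟨⟨t, z⟩, e⟩ := hT.2 1
  have e' : (t : G) * (z : G) = 1 := e
  obtain ⟨z, hz⟩ := z
  refine ⟨⟨z⁻¹, (Zc h).inv_mem hz⟩, ?_, fun h1 => ?_⟩
  · change z⁻¹ ∈ T h
    exact eq_inv_of_mul_eq_one_left e' ▸ t.2
  · have := hT.1 (a₁ := (⟨1, h1⟩, ⟨1, (Zc h).one_mem⟩)) (a₂ := (t, ⟨z, hz⟩)) (by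
      change (1 : G) * 1 = _
      rw [one_mul]
      exact e'.symm)
    have hz1 : (1 : G) = z := congrArg (fun p => (p.2 : G)) this
    exact Subtype.ext (by change z⁻¹ = 1; rw [← hz1, inv_one])

/-- Two more bits of precision pay for three uses of the circuit; in the exact case there is nothing
to pay. -/
theorem three_mul_precision_le {δ : ℕ → ℝ} (hδ : δ = (fun _ => 0) ∨ δ = fun k => (1 / 2) ^ k) (k : ℕ) :
    3 * δ (k + 2) ≤ δ k := by
  rcases hδ with rfl | rfl
  · simp
  · have : (0 : ℝ) < (1 / 2) ^ k := by positivity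
    simp only [pow_add]
    linarith

variable {ι : Type u} {G : ι → Type v} [∀ x, Group (G x)] [∀ x, Fintype (G x)]

theorem exists_efficientCentralizerQFT (E : GroupEncoding G) (T : ∀ x, G x → Set (G x))
    (hT : ∀ x h, Subgroup.IsComplement (T x h) (Zc h : Set (G x)))
    (B : ∀ x (h : G x), FourierBasis (Zc h)) (L : ∀ x (h : G x), FourierCode (Zc h) (E.len x))
    {δ : ℕ → ℝ} (hδ : δ = (fun _ => 0) ∨ δ = fun k => (1 / 2) ^ k)
    (hqft : EfficientDoubleQFT E T B L δ) :
    ∃ B' : ∀ x (h : G x), FourierBasis (Zc h),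
      (∀ x (h : G x), 1 ∈ T x h → B' x h = B x h) ∧ EfficientCentralizerQFT E B' L δ := by
  choose t ht ht1 using fun x (h : G x) => exists_mem_inter_centralizer (hT x h)
  refine ⟨fun x h => (B x h).translate (t x h), fun x h h1 => ?_, ?_⟩
  · change (B x h).translate (t x h) = _
    rw [ht1 x h h1, FourierBasis.translate_one]
  obtain ⟨C, q, c, hC⟩ := hqft
  obtain ⟨X, hX⟩ : ∃ X : Ctx ((x : ι) × G x × ℕ), X = ⟨3, fun a r =>
    [E.name a.1, E.enc a.1 a.2.1, unary a.2.2].getD r []⟩ := ⟨_, rfl⟩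
  have hname : PS X fun a => E.name a.1 :=
    (PS.read X (v := 0) (by rw [hX]; change 0 < 3; omega)).congr fun a => by rw [hX]; rfl
  have hs : PS X fun a => E.enc a.1 a.2.1 :=
    (PS.read X (v := 1) (by rw [hX]; change 1 < 3; omega)).congr fun a => by rw [hX]; rfl
  have hk : PN X fun a => a.2.2 :=
    (PS.read X (v := 2) (by rw [hX]; change 2 < 3; omega)).congr fun a => by rw [hX]; rfl
  -- The length of the encodings is not among the inputs here, but it is the length of the encoding
  -- of `h`.
  have hn : PN X fun a => E.len a.1 := hs.length.congr fun a => (E.length_enc a.1 a.2.1).symm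
  have hU : PC X fun a => (C a.1 (a.2.2 + 2)).map Gate.toRaw := by
    -- The base of the power comes from `E.len x + (k + 2) + 2`, where both `E.len x` and `k` are
    -- lengths of inputs and so at most `B`.
    refine PS.call hname hn (hk.add (PN.const X 2)) q _ (fun B => (2 * B + 4) ^ c)
      ((((PolyB.const 2).mul PolyB.id).add (PolyB.const 4)).pow c) fun a B hB => ?_
    have h := (hC a.1 (a.2.2 + 2)).1
    rw [Circuit.code_eq] at h
    refine h.mono ((E.polylog_le a.1 _ c).trans (Nat.pow_le_pow_left ?_ c))
    rw [hX] at hB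
    have h1 : (E.enc a.1 a.2.1).length ≤ B := hB 1 (by change 1 < 3; omega)
    have h2 : (unary a.2.2).length ≤ B := hB 2 (by change 2 < 3; omega)
    rw [E.length_enc] at h1
    rw [length_unary] at h2
    omega
  -- The length of the description exceeds the number of every wire of `U`; the summand `5 * E.len`
  -- makes room for the five slots of a label.
  have hM : PN X fun a => (rcode ((C a.1 (a.2.2 + 2)).map Gate.toRaw)).length + 5 * E.len a.1 :=
    (PS.length hU).add ((PN.const X 5).mul hn)
  obtain ⟨p, c', hp⟩ := PS.computes_polylog (PC.centralizerCirc hU hn hM hs) (by rw [hX]) E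
    (fun a => a.1) (fun a => a.2.2) (fun a => by rw [hX]; exact le_rfl)
    (fun a => by rw [hX]; exact (E.length_enc _ _).le) (fun a => by rw [hX]; exact (length_unary _).le)
  have hcirc : ∀ (x : ι) (h : G x) (k : ℕ), ∃ D : Circuit, D.map Gate.toRaw =
      centralizerCirc ((C x (k + 2)).map Gate.toRaw) (E.len x)
        ((rcode ((C x (k + 2)).map Gate.toRaw)).length + 5 * E.len x) (E.enc x h) :=
    fun x h k => exists_circuit _ (centralizerCirc_valid (Circuit.map_toRaw_valid _) (by omega) _)
  choose D hD using hcirc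
  refine ⟨D, p, c', fun x h k => ⟨?_, ?_⟩⟩
  · have := hp ⟨x, h, k⟩
    rw [hX] at this
    rw [Circuit.code_eq, hD]
    exact this
  · refine (carriesOut_iff _ _ _ _ _).2 fun v => ?_
    rw [hD]
    refine (centralizerCirc_defect (B x) (L x) (E.length_enc x) (Circuit.map_toRaw_valid _)
      (on_rcode (by omega)) (by omega) (fun v => (carriesOut_iff _ _ _ _ _).1 (hC x (k + 2)).2 v) h
      (t x h) (ht x h) v).trans ?_
    exact mul_le_mul_of_nonneg_right (three_mul_precision_le hδ k) (l2norm_nonneg v)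

end Necessity

theorem mainTheorem4 :
    (∀ (G : Type u) [Group G] [Fintype G],
      (∀ h : G, Nonempty (FourierBasis (Zc h))) ∧
      ∀ (T : G → Set G) (_ : ∀ h, Subgroup.IsComplement (T h) (Zc h : Set G))
        (B : ∀ h : G, FourierBasis (Zc h)),
        Orthonormal ℂ (doubleBasis T B) ∧
        Submodule.span ℂ (Set.range (doubleBasis T B)) = ⊤ ∧
        OrthogonalFamily ℂ
          (fun a : (h : G) × (ρ : IrrepClass (Zc h)) × Fin ρ.dim =>
            doubleBlock T B a.1 a.2.1 a.2.2)
          (fun a => (doubleBlock T B a.1 a.2.1 a.2.2).subtypeₗᵢ) ∧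
        (⨆ a : (h : G) × (ρ : IrrepClass (Zc h)) × Fin ρ.dim,
            doubleBlock T B a.1 a.2.1 a.2.2) = ⊤ ∧
        ∀ (h : G) (ρ : IrrepClass (Zc h)) (j : Fin ρ.dim),
          (∃ W : Submodule (QuantumDouble G) (QuantumDouble G),
            (W : Set (QuantumDouble G)) = doubleBlock T B h ρ j ∧
            IsSimpleModule (QuantumDouble G) W) ∧
          ∃ φ : Representation.IndV (Zc h).subtype ρ.rep ≃ₗ[ℂ] doubleBlock T B h ρ j,
            ∀ (g h' x : G) (w : Fin ρ.dim → ℂ),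
              (x⁻¹ * h' * x = h →
                QuantumDouble.ket g h' * (φ (indTensor ρ x w) : QuantumDouble G) =
                  φ (indTensor ρ (g * x) w)) ∧
              (x⁻¹ * h' * x ≠ h →
                QuantumDouble.ket g h' * (φ (indTensor ρ x w) : QuantumDouble G) = 0)) ∧
    (∀ (ι : Type u) (G : ι → Type v) [∀ x, Group (G x)] [∀ x, Fintype (G x)]
      (E : GroupEncoding G) (T : ∀ x, G x → Set (G x))
      (_ : ∀ x h, Subgroup.IsComplement (T x h) (Zc h : Set (G x)))
      (B : ∀ x (h : G x), FourierBasis (Zc h))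
      (L : ∀ x (h : G x), FourierCode (Zc h) (E.len x))
      (δ : ℕ → ℝ) (_ : δ = (fun _ => 0) ∨ δ = fun k => (1 / 2) ^ k),
      (EfficientMul E → EfficientCentralizerQFT E B L δ → EfficientFactorization E T →
        EfficientDoubleQFT E T B L δ) ∧
      (EfficientDoubleQFT E T B L δ →
        ∃ B' : ∀ x (h : G x), FourierBasis (Zc h),
          (∀ x (h : G x), 1 ∈ T x h → B' x h = B x h) ∧
          EfficientCentralizerQFT E B' L δ)) := by
  refine ⟨fun G _ _ => ⟨fun h => FourierBasis.nonempty _, fun T hT B => ⟨doubleBasis_orthonormal hT B,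
    doubleBasis_span hT B, doubleBlock_orthogonal hT B, iSup_doubleBlock hT B,
    doubleBlock_irreducible hT B⟩⟩, fun ι G _ _ E T hT B L δ hδ => ⟨fun hmul hqft hfac =>
    efficientDoubleQFT_of E T B L hδ hmul hqft hfac, exists_efficientCentralizerQFT E T hT B L hδ⟩⟩
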